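/- **Problems.** In the *3-SUM* problem one is given three lists $L_1,L_2,L_3$ of $n\ge 1$ integers each and asks whether one can choose $x_i\in L_i$ ($i=1,2,3$) with $x_1+x_2+x_3=0$. For a fixed graph $H$, in the *Exact-Weight-$H$* problem one is given a simple graph $G$ on $n\ge 1$ nodes with integer edge weights and a target $t\in\mathbb Z$, and asks whether $G$ has a (not necessarily induced) subgraph isomorphic to $H$ whose edge weights sum to $t$. The *3-star* is the star with 3 edges on 4 nodes, the *3-matching* consists of 3 pairwise disjoint edges on 6 nodes. **Size and time.** The size $s$ of a 3-SUM instance is $n$ (the number of integers per list) times the number of bits of $M$, where $M\ge 1$ is the least integer such that all given integers lie in $[-M,M]$; the size $s$ of an Exact-Weight-$H$ instance is $n$ (the number of nodes) times the number of bits of $M$, where $M\ge1$ is the least integer such that the edge weights and the target lie in $[-M,M]$. A problem *can be solved in time $O(s^{\gamma})$* if there is a randomized algorithm (a program of a random access machine with logarithmic cost, with arithmetic, indirect addressing and fair coins; graphs are given by adjacency and weight matrices) that always halts within time $O(s^\gamma)$ on instances of size $s$ and that answers correctly on each instance of size $s$ with probability $1-o(1)$ as $s\to\infty$. **Theorem.**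 The following three statements are equivalent (either all of them are true, or none of them is): 1. 3-SUM can be solved in time $O(s^{2-\varepsilon})$ for some $\varepsilon>0$. 2. Exact-Weight-3-star can be solved in time $O(s^{3-\varepsilon})$ for some $\varepsilon>0$. 3. Exact-Weight-3-matching can be solved in time $O(s^{4-\varepsilon})$ for some $\varepsilon>0$. -/

import Mathlib

open Filter Asymptotics
open scoped Topology ENNReal

/-! ### Randomized random access machines with logarithmic cost -/

namespace RAM

/-- Programs of a random access machine with integer registers `R 0, R 1, …` (a program mentions
only finitely many of them), an integer-valued memory that is addressed indirectly, and fair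
coins. Control flow is structured; this changes running times by at most a constant factor in
comparison with jumps. -/
inductive Prog : Type
  /-- do nothing -/
  | skip : Prog
  /-- `R r := c` -/
  | const (r : ℕ) (c : ℤ) : Prog
  /-- `R r := R a + R b` -/
  | add (r a b : ℕ) : Prog
  /-- `R r := R a - R b` -/
  | sub (r a b : ℕ) : Prog
  /-- `R r := R a * R b` -/
  | mul (r a b : ℕ) : Prog
  /-- `R r := R a / R b` (integer division with nonnegative remainder, `0` if `R b = 0`) -/
  | div (r a b : ℕ) : Prog
  /-- `R r := Mem[R a]` -/
  | load (r a : ℕ) : Prog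
  /-- `Mem[R a] := R b` -/
  | store (a b : ℕ) : Prog
  /-- `R r :=` a fresh uniformly random bit -/
  | coin (r : ℕ) : Prog
  /-- first `p`, then `q` -/
  | seq (p q : Prog) : Prog
  /-- `p` if `0 < R r`, otherwise `q` -/
  | ite (r : ℕ) (p q : Prog) : Prog
  /-- repeat `p` while `0 < R r` -/
  | loop (r : ℕ) (p : Prog) : Prog

/-- Contents of the registers and of the memory. -/
structure State : Type where
  reg : ℕ → ℤ
  mem : ℤ → ℤ

/-- Assign the value `v` to register `r`. -/
def State.setReg (σ : State) (r : ℕ) (v : ℤ) : State :=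
  { σ with reg := Function.update σ.reg r v }

/-- Assign the value `v` to the memory cell with address `a`. -/
def State.setMem (σ : State) (a v : ℤ) : State :=
  { σ with mem := Function.update σ.mem a v }

/-- The logarithmic cost of an integer: its length in binary, plus one. -/
def len (a : ℤ) : ℕ := Nat.size a.natAbs + 1

/-- A configuration: the statements still to be executed, the contents of registers and memory,
and the time spent so far. The machine has halted when nothing is left to be executed. -/
structure Config : Type where
  todo : List Prog
  state : State
  time : ℕ

/-- One step of the machine. A step costs the total length of the integers (operands, addresses,
memory contents) that it handles. A configuration that has halted does not change any more. -/
noncomputable def step : Config → PMF Config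
  | ⟨[], σ, t⟩ => PMF.pure ⟨[], σ, t⟩
  | ⟨.skip :: K, σ, t⟩ => PMF.pure ⟨K, σ, t + 1⟩
  | ⟨.const r c :: K, σ, t⟩ => PMF.pure ⟨K, σ.setReg r c, t + len c⟩
  | ⟨.add r a b :: K, σ, t⟩ =>
      PMF.pure ⟨K, σ.setReg r (σ.reg a + σ.reg b), t + len (σ.reg a) + len (σ.reg b)⟩
  | ⟨.sub r a b :: K, σ, t⟩ =>
      PMF.pure ⟨K, σ.setReg r (σ.reg a - σ.reg b), t + len (σ.reg a) + len (σ.reg b)⟩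
  | ⟨.mul r a b :: K, σ, t⟩ =>
      PMF.pure ⟨K, σ.setReg r (σ.reg a * σ.reg b), t + len (σ.reg a) + len (σ.reg b)⟩
  | ⟨.div r a b :: K, σ, t⟩ =>
      PMF.pure ⟨K, σ.setReg r (σ.reg a / σ.reg b), t + len (σ.reg a) + len (σ.reg b)⟩
  | ⟨.load r a :: K, σ, t⟩ =>
      PMF.pure ⟨K, σ.setReg r (σ.mem (σ.reg a)), t + len (σ.reg a) + len (σ.mem (σ.reg a))⟩
  | ⟨.store a b :: K, σ, t⟩ =>
      PMF.pure ⟨K, σ.setMem (σ.reg a) (σ.reg b), t + len (σ.reg a) + len (σ.reg b)⟩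
  | ⟨.coin r :: K, σ, t⟩ =>
      (PMF.uniformOfFintype Bool).map fun b => ⟨K, σ.setReg r (if b then 1 else 0), t + 1⟩
  | ⟨.seq p q :: K, σ, t⟩ => PMF.pure ⟨p :: q :: K, σ, t + 1⟩
  | ⟨.ite r p q :: K, σ, t⟩ =>
      PMF.pure ⟨(if 0 < σ.reg r then p else q) :: K, σ, t + len (σ.reg r)⟩
  | ⟨.loop r p :: K, σ, t⟩ =>
      PMF.pure ⟨if 0 < σ.reg r then p :: .loop r p :: K else K, σ, t + len (σ.reg r)⟩

/-- The distribution of the configuration after `N` steps from `c`. -/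
noncomputable def runFor : ℕ → Config → PMF Config
  | 0, c => PMF.pure c
  | N + 1, c => (runFor N c).bind step

/-- The memory that holds the list `l` in the cells `0, 1, …` and `0` everywhere else. -/
def memOfList (l : List ℤ) : ℤ → ℤ := fun a => if 0 ≤ a then l.getD a.toNat 0 else 0

/-- The initial configuration of program `p` on input `l`; all registers hold `0`. -/
def init (p : Prog) (l : List ℤ) : Config := ⟨[p], ⟨fun _ => 0, memOfList l⟩, 0⟩

/-- A halted machine accepts if register `0` holds a positive number. -/
def Config.Accepts (c : Config) : Prop := 0 < c.state.reg 0

/-- On input `l`, the program `p` halts within time `T` whatever the coins show, and it fails to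
decide correctly whether `b` holds with probability at most `δ`. -/
def DecidesWithin (p : Prog) (l : List ℤ) (b : Prop) (T : ℕ) (δ : ℝ≥0∞) : Prop :=
  ∃ N : ℕ, (∀ c ∈ (runFor N (init p l)).support, c.todo = [] ∧ c.time ≤ T) ∧
    (runFor N (init p l)).toOuterMeasure {c | ¬ (c.Accepts ↔ b)} ≤ δ

end RAM

/-! ### Decision problems and their complexity -/

/-- A decision problem: instances, their size (the parameter in which running times are
measured), their encoding as the input of a machine, and the yes-instances. -/
structure DecisionProblem : Type 1 where
  Inst : Type
  size : Inst → ℕ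
  encode : Inst → List ℤ
  yes : Inst → Prop

/-- `P` can be solved in time `O(f(n))` by a randomized algorithm that is correct on every instance
of size `n` with probability `1 - o(1)`. -/
def DecisionProblem.SolvableInTime (P : DecisionProblem) (f : ℕ → ℝ) : Prop :=
  ∃ (p : RAM.Prog) (T : ℕ → ℕ) (err : ℕ → ℝ≥0∞),
    (fun n => (T n : ℝ)) =O[atTop] f ∧ Tendsto err atTop (𝓝 0) ∧
    ∀ x : P.Inst, RAM.DecidesWithin p (P.encode x) (P.yes x) (T (P.size x)) (err (P.size x))

/-! ### `k`-SUM -/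

/-- `k` lists of `n ≥ 1` integers each; `x i j` is the `j`-th number of the `i`-th list. -/
structure KSumInst (k : ℕ) : Type where
  n : ℕ
  n_pos : 0 < n
  x : Fin k → Fin n → ℤ

namespace KSumInst

variable {k : ℕ} (I : KSumInst k)

/-- The smallest `M ≥ 1` such that all the integers lie in `[-M, M]`. -/
def maxAbs : ℕ := max 1 (Finset.univ.sup fun i => Finset.univ.sup fun j => (I.x i j).natAbs)

/-- The list length, followed by the lists one after the other. -/
def encode : List ℤ :=
  (I.n : ℤ) :: List.ofFn fun m : Fin (k * I.n) => I.x m.divNat m.modNat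

/-- One number can be chosen from each list such that the chosen numbers sum to `0`. -/
def HasZeroSum : Prop := ∃ a : Fin k → Fin I.n, ∑ i, I.x i (a i) = 0

end KSumInst

/-- The `k`-SUM problem. The size of an instance is the number of integers per list times the number
of bits of `M`, where the integers lie in `[-M, M]`. -/
def kSum (k : ℕ) : DecisionProblem where
  Inst := KSumInst k
  size I := I.n * Nat.size I.maxAbs
  encode := KSumInst.encode
  yes := KSumInst.HasZeroSum

/-! ### Exact-weight subgraph problems -/

/-- An edge-weighted graph on `n ≥ 1` nodes with a target weight. Only the weights `w s(u, v)` of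
edges `s(u, v)` of the graph matter. -/
structure WeightedGraphInst : Type where
  n : ℕ
  n_pos : 0 < n
  graph : SimpleGraph (Fin n)
  w : Sym2 (Fin n) → ℤ
  target : ℤ

namespace WeightedGraphInst

variable (I : WeightedGraphInst)

open Classical in
/-- The smallest `M ≥ 1` such that all edge weights and the target lie in `[-M, M]`. -/
noncomputable def maxAbs : ℕ :=
  max 1 (max I.target.natAbs (I.graph.edgeFinset.sup fun e => (I.w e).natAbs))

open Classical in
/-- The number of nodes, the target, the adjacency matrix row by row, and then the matrix of edge
weights (`0` for pairs that are not edges) row by row. -/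
noncomputable def encode : List ℤ :=
  (I.n : ℤ) :: I.target ::
    ((List.ofFn fun m : Fin (I.n * I.n) => if I.graph.Adj m.divNat m.modNat then 1 else 0) ++
      List.ofFn fun m : Fin (I.n * I.n) =>
        if I.graph.Adj m.divNat m.modNat then I.w s(m.divNat, m.modNat) else 0)

open Classical in
/-- The graph has a (not necessarily induced) subgraph isomorphic to `H`, given as the image of an
injective homomorphism, whose edge weights sum to the target. -/
def HasExactCopy {V : Type} [Fintype V] (H : SimpleGraph V) : Prop :=
  ∃ f : H.Copy I.graph, ∑ e ∈ H.edgeFinset, I.w (e.map f) = I.target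

end WeightedGraphInst

/-- The problem Exact-Weight-`H`. The size of an instance is the number of nodes times the number of
bits of `M`, where the weights and the target lie in `[-M, M]`. -/
noncomputable def exactWeight {V : Type} [Fintype V] (H : SimpleGraph V) : DecisionProblem where
  Inst := WeightedGraphInst
  size I := I.n * Nat.size I.maxAbs
  encode := WeightedGraphInst.encode
  yes I := I.HasExactCopy H

/-- The star with `k` edges on `k + 1` nodes. -/
def kStar (k : ℕ) : SimpleGraph (Fin (k + 1)) := SimpleGraph.starGraph (Fin.last k)

/-- The matching with `k` edges on `2k` nodes: the edges join `(i, false)` and `(i, true)`. -/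
def kMatching (k : ℕ) : SimpleGraph (Fin k × Bool) where
  Adj u v := u.1 = v.1 ∧ u.2 ≠ v.2
  symm := ⟨fun _ _ h => ⟨h.1.symm, h.2.symm⟩⟩
  loopless := ⟨fun _ h => h.2 rfl⟩

/-! The implications 1 → 2 → 3 → 1 are three reductions that keep track of exponents.

Stars by 3-SUM (`solvableInTime_star`). Once the center is fixed, one looks for three different
neighbours whose edge weights sum to the target. Apart from the requirement that the neighbours
differ, this is 3-SUM on lists of n numbers. Distinctness is enforced by residues: a few nodes are
always separated by some modulus of size O(log n) (`exists_mod_injOn`), so one tries all moduli and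
all patterns of distinct residues, and admits in each list only the nodes of one residue class. This
yields n^(1+o(1)) instances of 3-SUM, hence one more in the exponent.

Matchings by stars (`solvableInTime_matching`). Residues again make the end nodes distinct. Tags 0,
1, 3, multiplied by a large unit, are added to the weights of the candidates for the three edges, so
that the target can only be reached with one edge of each kind (`tag_perm`). The tagged weights,
together with 3n² small and 3n² large fillers, are sorted and cut into blocks of n entries. The
three entries sought lie in blocks 3n + i, i + d and i + e. For fixed d and e the three blocks move
up together as i grows, so only one i has to be considered: the first one for which the largest
entries reach the target (`exists_block_sum`). With d guessed, and e read as the center of a star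
whose leaves are the positions within the three blocks, one obtains n^(1+o(1)) star instances on 9n
nodes.

3-SUM by matchings (`KSumInst.solvableInTime`). The n numbers of a list become the edges of a
bipartite graph with about √n nodes on each side, tagged as before; edges of different lists are
disjoint automatically. A running time s^(4-ε) becomes n^(2-ε/2) times a power of the length of the
numbers. This power is harmless if the length is below a small power of n. Otherwise the numbers are
so long that a direct search with n² table look-ups is fast enough, because the cost of a look-up is
about linear in the length while the time limit is almost quadratic in it.

All this has to be carried out on the machine. A small deterministic language is compiled to it
(`Run.det_comp`). The given randomized program runs as a guest on its own registers and on the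
memory cells of one residue class (`halts_boxed`); every call gets a new class, so nothing ever has
to be erased. Each generated instance is decided by a majority vote of r calls, whose error 2^(-r)
comes from an exponential potential (`halts_trials`), and `halts_rounds` adds up these errors. Times
are bounded by `Dom` with separate exponents for n and for the bit length, and polylogarithmic
factors are absorbed into arbitrarily small powers. -/

namespace RAM

/-! ### Expected values and halting computations -/

/-- The expected value of `f` under `μ`. -/
noncomputable def expect {α : Type*} (μ : PMF α) (f : α → ℝ≥0∞) : ℝ≥0∞ := ∑' a, μ a * f a

theorem expect_pure {α : Type*} (a : α) (f : α → ℝ≥0∞) : expect (PMF.pure a) f = f a := by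
  unfold expect
  rw [tsum_eq_single a]
  · simp
  · intro b hb; simp [PMF.pure_apply, hb]

theorem expect_bind {α β : Type*} (μ : PMF α) (ν : α → PMF β) (f : β → ℝ≥0∞) :
    expect (μ.bind ν) f = expect μ fun a => expect (ν a) f := by
  unfold expect
  simp only [PMF.bind_apply, ← ENNReal.tsum_mul_right, ← ENNReal.tsum_mul_left]
  rw [ENNReal.tsum_comm]
  simp only [mul_assoc]

theorem expect_mono {α : Type*} (μ : PMF α) {f g : α → ℝ≥0∞} (h : ∀ a ∈ μ.support, f a ≤ g a) :
    expect μ f ≤ expect μ g := by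
  unfold expect
  refine ENNReal.tsum_le_tsum fun a => ?_
  by_cases ha : a ∈ μ.support
  · exact mul_le_mul_right (h a ha) _
  · rw [PMF.mem_support_iff, not_not] at ha; simp [ha]

theorem expect_bool_map {α : Type*} (h : Bool → α) (f : α → ℝ≥0∞) :
    expect ((PMF.uniformOfFintype Bool).map h) f = (f (h false) + f (h true)) / 2 := by
  rw [← PMF.bind_pure_comp, expect_bind]
  simp only [Function.comp, expect_pure]
  simp only [expect, tsum_bool, PMF.uniformOfFintype_apply, Fintype.card_bool]
  rw [← mul_add, ENNReal.div_eq_inv_mul]; norm_num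

/-- `runFor` appends steps at the end; inductions along the control flow need the first step
instead. -/
theorem runFor_succ' (N : ℕ) (c : Config) : runFor (N + 1) c = (step c).bind (runFor N) := by
  induction N generalizing c with
  | zero =>
    simp only [runFor, PMF.pure_bind]
    exact (PMF.bind_pure _).symm
  | succ N ih =>
    rw [runFor, ih, PMF.bind_bind]; rfl

theorem runFor_nil (N : ℕ) (σ : State) (t : ℕ) : runFor N ⟨[], σ, t⟩ = PMF.pure ⟨[], σ, t⟩ := by
  induction N with
  | zero => rfl
  | succ N ih => rw [runFor, ih, PMF.pure_bind]; rfl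

/-- From the given configuration the machine halts whatever the coins show, and the expected value
of `Φ` at the final state and time is at most the given number. -/
inductive Halts (Φ : State → ℕ → ℝ≥0∞) : Config → ℝ≥0∞ → Prop
  | done {σ : State} {t : ℕ} {v : ℝ≥0∞} : Φ σ t ≤ v → Halts Φ ⟨[], σ, t⟩ v
  | det {c c' : Config} {v : ℝ≥0∞} : step c = PMF.pure c' → Halts Φ c' v → Halts Φ c v
  | coin {r : ℕ} {K : List Prog} {σ : State} {t : ℕ} {v v₀ v₁ : ℝ≥0∞} :
      Halts Φ ⟨K, σ.setReg r 0, t + 1⟩ v₀ → Halts Φ ⟨K, σ.setReg r 1, t + 1⟩ v₁ →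
      (v₀ + v₁) / 2 ≤ v → Halts Φ ⟨.coin r :: K, σ, t⟩ v

theorem Halts.mono {Φ : State → ℕ → ℝ≥0∞} {c : Config} {v v' : ℝ≥0∞} (h : Halts Φ c v)
    (hv : v ≤ v') : Halts Φ c v' := by
  induction h generalizing v' with
  | done h => exact .done (h.trans hv)
  | det hs _ ih => exact .det hs (ih hv)
  | coin h0 h1 hle _ _ => exact .coin h0 h1 (hle.trans hv)

/-- Different coins may lead to different numbers of steps, but a halted configuration is
stationary, so the maximum over both branches works. This is why the conclusion is stated for all
larger step numbers. -/
theorem Halts.exists_runFor {Φ : State → ℕ → ℝ≥0∞} {c : Config} {v : ℝ≥0∞} (h : Halts Φ c v) :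
    ∃ N, ∀ N' ≥ N, (∀ c' ∈ (runFor N' c).support, c'.todo = []) ∧
      expect (runFor N' c) (fun c' => Φ c'.state c'.time) ≤ v := by
  induction h with
  | done h =>
    refine ⟨0, fun N' _ => ?_⟩
    rw [runFor_nil]
    refine ⟨fun c' hc' => ?_, ?_⟩
    · rw [PMF.mem_support_pure_iff] at hc'; rw [hc']
    · rw [expect_pure]; exact h
  | det hs _ ih =>
    obtain ⟨N, hN⟩ := ih
    refine ⟨N + 1, fun N' hN' => ?_⟩
    obtain ⟨M, rfl⟩ := Nat.exists_eq_add_of_le' (Nat.one_le_of_lt hN')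
    rw [runFor_succ', hs, PMF.pure_bind]
    exact hN M (by omega)
  | @coin r K σ t v v₀ v₁ h0 h1 hle ih0 ih1 =>
    obtain ⟨N, hN⟩ := ih0
    obtain ⟨N1, hN1⟩ := ih1
    refine ⟨max N N1 + 1, fun N' hN' => ?_⟩
    obtain ⟨M, rfl⟩ := Nat.exists_eq_add_of_le' (Nat.one_le_of_lt hN')
    have a0 := hN M (by omega)
    have a1 := hN1 M (by omega)
    rw [runFor_succ', step]
    refine ⟨fun c' hc' => ?_, ?_⟩
    · rw [PMF.mem_support_bind_iff] at hc'
      obtain ⟨d, hd, hc'⟩ := hc'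
      rw [PMF.mem_support_map_iff] at hd
      obtain ⟨b, -, rfl⟩ := hd
      cases b
      · exact a0.1 c' (by simpa using hc')
      · exact a1.1 c' (by simpa using hc')
    · rw [expect_bind, expect_bool_map]
      refine le_trans ?_ hle
      exact ENNReal.div_le_div_right (add_le_add (by simpa using a0.2) (by simpa using a1.2)) 2

/-- The loss of a final state: infinite if the time limit `T` is exceeded, and otherwise `1` for a
wrong answer and `0` for a correct one. -/
noncomputable def loss (b : Prop) (T : ℕ) (σ : State) (t : ℕ) : ℝ≥0∞ :=
  open Classical in if T < t then ⊤ else if (0 < σ.reg 0 ↔ b) then 0 else 1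

/-- A finite expected loss gives probability zero to exceeding the time limit, where the loss is
infinite. Within the limit the loss is the indicator of a wrong answer. -/
theorem decidesWithin_of_halts {p : Prog} {l : List ℤ} {b : Prop} {T : ℕ} {δ : ℝ≥0∞} (hδ : δ ≠ ⊤)
    (h : Halts (loss b T) (init p l) δ) : DecidesWithin p l b T δ := by
  obtain ⟨N, hN⟩ := h.exists_runFor
  obtain ⟨h1, h2⟩ := hN N le_rfl
  refine ⟨N, fun c hc => ⟨h1 c hc, ?_⟩, ?_⟩
  · by_contra hlt
    push Not at hlt
    apply hδ
    rw [← top_le_iff]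
    refine le_trans ?_ h2
    -- A single configuration of positive probability and infinite loss makes the whole sum
    -- infinite.
    refine le_trans ?_ (ENNReal.le_tsum c)
    have : loss b T c.state c.time = ⊤ := by unfold loss; rw [if_pos hlt]
    simp only [this]; rw [ENNReal.mul_top]
    exact (PMF.mem_support_iff _ _).1 hc
  · refine le_trans ?_ h2
    rw [PMF.toOuterMeasure_apply]
    refine ENNReal.tsum_le_tsum fun c => ?_
    by_cases hc : c ∈ {c : Config | ¬ (c.Accepts ↔ b)}
    · rw [Set.indicator_of_mem hc]
      have : 1 ≤ loss b T c.state c.time := by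
        unfold loss
        split_ifs with h3 h4
        · exact le_top
        · exact absurd h4 hc
        · exact le_rfl
      calc _ = runFor N (init p l) c * 1 := (mul_one _).symm
        _ ≤ _ := mul_le_mul_right this _
    · rw [Set.indicator_of_notMem hc]; exact zero_le

/-- Executed from `σ`, the program `p` tosses no coins and ends in `σ'` after time at most `τ`. -/
def Det (p : Prog) (σ : State) (τ : ℕ) (σ' : State) : Prop :=
  ∃ t ≤ τ, ∀ Φ v K t₀, Halts Φ ⟨K, σ', t₀ + t⟩ v → Halts Φ ⟨p :: K, σ, t₀⟩ v

theorem Det.mono {p : Prog} {σ σ' : State} {τ τ' : ℕ} (h : Det p σ τ σ') (hτ : τ ≤ τ') :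
    Det p σ τ' σ' := by
  obtain ⟨t, ht, h⟩ := h
  exact ⟨t, ht.trans hτ, h⟩

theorem Det.seq {p q : Prog} {σ σ₁ σ₂ : State} {τ₁ τ₂ τ : ℕ} (hp : Det p σ τ₁ σ₁)
    (hq : Det q σ₁ τ₂ σ₂) (hτ : τ₁ + τ₂ + 1 ≤ τ) : Det (.seq p q) σ τ σ₂ := by
  obtain ⟨t₁, h₁, hp⟩ := hp
  obtain ⟨t₂, h₂, hq⟩ := hq
  refine ⟨1 + t₁ + t₂, by omega, fun Φ v K t₀ h => .det rfl (hp _ _ _ _ (hq _ _ _ _ ?_))⟩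
  convert h using 2; omega

theorem Det.skip (σ : State) : Det .skip σ 1 σ := ⟨1, le_rfl, fun _ _ _ _ h => .det rfl h⟩

theorem Det.const (σ : State) (r : ℕ) (c : ℤ) : Det (.const r c) σ (len c) (σ.setReg r c) :=
  ⟨_, le_rfl, fun _ _ _ _ h => .det rfl h⟩

theorem Det.add (σ : State) (r a b : ℕ) :
    Det (.add r a b) σ (len (σ.reg a) + len (σ.reg b)) (σ.setReg r (σ.reg a + σ.reg b)) :=
  ⟨_, le_rfl, fun _ _ _ _ h => .det rfl (by rwa [add_assoc])⟩

theorem Det.sub (σ : State) (r a b : ℕ) :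
    Det (.sub r a b) σ (len (σ.reg a) + len (σ.reg b)) (σ.setReg r (σ.reg a - σ.reg b)) :=
  ⟨_, le_rfl, fun _ _ _ _ h => .det rfl (by rwa [add_assoc])⟩

theorem Det.mul (σ : State) (r a b : ℕ) :
    Det (.mul r a b) σ (len (σ.reg a) + len (σ.reg b)) (σ.setReg r (σ.reg a * σ.reg b)) :=
  ⟨_, le_rfl, fun _ _ _ _ h => .det rfl (by rwa [add_assoc])⟩

theorem Det.div (σ : State) (r a b : ℕ) :
    Det (.div r a b) σ (len (σ.reg a) + len (σ.reg b)) (σ.setReg r (σ.reg a / σ.reg b)) :=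
  ⟨_, le_rfl, fun _ _ _ _ h => .det rfl (by rwa [add_assoc])⟩

theorem Det.load (σ : State) (r a : ℕ) :
    Det (.load r a) σ (len (σ.reg a) + len (σ.mem (σ.reg a)))
      (σ.setReg r (σ.mem (σ.reg a))) :=
  ⟨_, le_rfl, fun _ _ _ _ h => .det rfl (by rwa [add_assoc])⟩

theorem Det.store (σ : State) (a b : ℕ) :
    Det (.store a b) σ (len (σ.reg a) + len (σ.reg b)) (σ.setMem (σ.reg a) (σ.reg b)) :=
  ⟨_, le_rfl, fun _ _ _ _ h => .det rfl (by rwa [add_assoc])⟩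

theorem Det.ite_pos {r : ℕ} {p q : Prog} {σ σ' : State} {τ τ' : ℕ} (hr : 0 < σ.reg r)
    (hp : Det p σ τ σ') (hτ : len (σ.reg r) + τ ≤ τ') : Det (.ite r p q) σ τ' σ' := by
  obtain ⟨t, ht, h⟩ := hp
  refine ⟨len (σ.reg r) + t, by omega, fun Φ v K t₀ hK => .det rfl ?_⟩
  rw [if_pos hr]; exact h _ _ _ _ (by rwa [add_assoc])

theorem Det.ite_neg {r : ℕ} {p q : Prog} {σ σ' : State} {τ τ' : ℕ} (hr : ¬ 0 < σ.reg r)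
    (hq : Det q σ τ σ') (hτ : len (σ.reg r) + τ ≤ τ') : Det (.ite r p q) σ τ' σ' := by
  obtain ⟨t, ht, h⟩ := hq
  refine ⟨len (σ.reg r) + t, by omega, fun Φ v K t₀ hK => .det rfl ?_⟩
  rw [if_neg hr]; exact h _ _ _ _ (by rwa [add_assoc])

theorem Det.loop_done {r : ℕ} {p : Prog} {σ : State} (hr : ¬ 0 < σ.reg r) :
    Det (.loop r p) σ (len (σ.reg r)) σ := by
  refine ⟨_, le_rfl, fun Φ v K t₀ hK => .det rfl ?_⟩
  rwa [if_neg hr]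

theorem Det.loop_step {r : ℕ} {p : Prog} {σ σ₁ σ₂ : State} {τ₁ τ₂ τ : ℕ} (hr : 0 < σ.reg r)
    (hp : Det p σ τ₁ σ₁) (hl : Det (.loop r p) σ₁ τ₂ σ₂) (hτ : len (σ.reg r) + τ₁ + τ₂ ≤ τ) :
    Det (.loop r p) σ τ σ₂ := by
  obtain ⟨t₁, h₁, hp⟩ := hp
  obtain ⟨t₂, h₂, hl⟩ := hl
  refine ⟨len (σ.reg r) + t₁ + t₂, by omega, fun Φ v K t₀ h => .det rfl ?_⟩
  rw [if_pos hr]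
  refine hp _ _ _ _ (hl _ _ _ _ ?_)
  convert h using 2; omega

theorem len_le_of_natAbs_lt {a : ℤ} {b : ℕ} (h : a.natAbs < 2 ^ b) : len a ≤ b + 1 :=
  Nat.succ_le_succ (Nat.size_le.2 h)

theorem one_le_len (a : ℤ) : 1 ≤ len a := Nat.le_add_left _ _

theorem len_mul_le (a b : ℤ) : len (a * b) ≤ len a + len b := by
  have : Nat.size (a * b).natAbs ≤ Nat.size a.natAbs + Nat.size b.natAbs := by
    rw [Nat.size_le, Int.natAbs_mul, pow_add]
    exact Nat.mul_lt_mul'' (Nat.lt_size_self _) (Nat.lt_size_self _)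
  unfold len; omega

theorem len_add_le (a b : ℤ) : len (a + b) ≤ len a + len b := by
  have : Nat.size (a + b).natAbs ≤ Nat.size a.natAbs + Nat.size b.natAbs + 1 := by
    rw [Nat.size_le]
    have h1 := Nat.lt_size_self a.natAbs
    have h2 := Nat.lt_size_self b.natAbs
    have h3 := Int.natAbs_add_le a b
    have h4 : 2 ^ a.natAbs.size ≤ 2 ^ (a.natAbs.size + b.natAbs.size) :=
      Nat.pow_le_pow_right (by norm_num) (by omega)
    have h5 : 2 ^ b.natAbs.size ≤ 2 ^ (a.natAbs.size + b.natAbs.size) :=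
      Nat.pow_le_pow_right (by norm_num) (by omega)
    rw [pow_succ]; omega
  unfold len; omega

@[simp] theorem State.setReg_reg (σ : State) (r : ℕ) (v : ℤ) (s : ℕ) :
    (σ.setReg r v).reg s = if s = r then v else σ.reg s := by
  simp [State.setReg, Function.update_apply]

@[simp] theorem State.setReg_mem (σ : State) (r : ℕ) (v : ℤ) : (σ.setReg r v).mem = σ.mem := rfl

@[simp] theorem State.setMem_reg (σ : State) (a v : ℤ) : (σ.setMem a v).reg = σ.reg := rfl

@[simp] theorem State.setMem_mem (σ : State) (a v b : ℤ) :
    (σ.setMem a v).mem b = if b = a then v else σ.mem b := by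
  simp [State.setMem, Function.update_apply]

end RAM

namespace RAM

/-! ### A deterministic language with expressions, an input, a working memory and an output -/

/-- Two kinds of reading are needed because the input occupies consecutive cells, whereas the
working memory is spread over a residue class of addresses. -/
inductive Expr : Type
  | lit (c : ℤ)
  | var (i : ℕ)
  | add (a b : Expr)
  | sub (a b : Expr)
  | mul (a b : Expr)
  | div (a b : Expr)
  /-- a cell of the input -/
  | inp (a : Expr)
  /-- a cell of the working memory -/
  | wrk (a : Expr)
  /-- `a` if `0 < c`, otherwise `b` -/
  | ite (c a b : Expr)

namespace Expr

/-- The value of an expression for the input `x`, the variables `v` and the working memory `W`. -/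
def ev (x : ℤ → ℤ) (v : ℕ → ℤ) (W : ℤ → ℤ) : Expr → ℤ
  | lit c => c
  | var i => v i
  | add a b => a.ev x v W + b.ev x v W
  | sub a b => a.ev x v W - b.ev x v W
  | mul a b => a.ev x v W * b.ev x v W
  | div a b => a.ev x v W / b.ev x v W
  | inp a => x (a.ev x v W)
  | wrk a => W (a.ev x v W)
  | ite c a b => if 0 < c.ev x v W then a.ev x v W else b.ev x v W

/-- The evaluation reads the input at addresses below `l` only. -/
def ok (l : ℤ) (x : ℤ → ℤ) (v : ℕ → ℤ) (W : ℤ → ℤ) : Expr → Prop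
  | lit _ => True
  | var _ => True
  | add a b => a.ok l x v W ∧ b.ok l x v W
  | sub a b => a.ok l x v W ∧ b.ok l x v W
  | mul a b => a.ok l x v W ∧ b.ok l x v W
  | div a b => a.ok l x v W ∧ b.ok l x v W
  | inp a => a.ok l x v W ∧ 0 ≤ a.ev x v W ∧ a.ev x v W < l
  | wrk a => a.ok l x v W
  | ite c a b => c.ok l x v W ∧ (0 < c.ev x v W → a.ok l x v W) ∧ (¬ 0 < c.ev x v W → b.ok l x v W)

/-- The working memory is not read. -/
def pureIn : Expr → Bool
  | lit _ => true
  | var _ => true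
  | add a b => a.pureIn && b.pureIn
  | sub a b => a.pureIn && b.pureIn
  | mul a b => a.pureIn && b.pureIn
  | div a b => a.pureIn && b.pureIn
  | inp a => a.pureIn
  | wrk _ => false
  | ite c a b => c.pureIn && a.pureIn && b.pureIn

/-- A bound for the length of the value, in multiples of a bound for the lengths of all the numbers
that are stored. -/
def width : Expr → ℕ
  | lit c => c.natAbs + 1
  | var _ => 1
  | add a b => a.width + b.width
  | sub a b => a.width + b.width
  | mul a b => a.width + b.width
  | div a _ => a.width
  | inp _ => 1
  | wrk _ => 1
  | ite _ a b => a.width + b.width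

/-- A bound for the time of the evaluation, in the same unit. -/
def cost : Expr → ℕ
  | lit c => 2 * (c.natAbs + 1)
  | var _ => 5
  | add a b => a.cost + b.cost + 2 * (a.width + b.width) + 2
  | sub a b => a.cost + b.cost + 2 * (a.width + b.width) + 2
  | mul a b => a.cost + b.cost + 2 * (a.width + b.width) + 2
  | div a b => a.cost + b.cost + 2 * (a.width + b.width) + 2
  | inp a => a.cost + 2 * a.width + 3
  | wrk a => a.cost + 6 * a.width + 15
  | ite c a b => c.cost + 2 * c.width + a.cost + b.cost + 1

/-- The program that puts the value into the temporary register `4 * d + 1`. -/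
def comp : Expr → ℕ → Prog
  | lit c, d => .const (4 * d + 1) c
  | var i, d => .seq (.const (4 * d + 1) 0) (.add (4 * d + 1) (4 * i) (4 * d + 1))
  | add a b, d => .seq (a.comp d) (.seq (b.comp (d + 1))
      (.add (4 * d + 1) (4 * d + 1) (4 * (d + 1) + 1)))
  | sub a b, d => .seq (a.comp d) (.seq (b.comp (d + 1))
      (.sub (4 * d + 1) (4 * d + 1) (4 * (d + 1) + 1)))
  | mul a b, d => .seq (a.comp d) (.seq (b.comp (d + 1))
      (.mul (4 * d + 1) (4 * d + 1) (4 * (d + 1) + 1)))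
  | div a b, d => .seq (a.comp d) (.seq (b.comp (d + 1))
      (.div (4 * d + 1) (4 * d + 1) (4 * (d + 1) + 1)))
  | inp a, d => .seq (a.comp d) (.load (4 * d + 1) (4 * d + 1))
  | wrk a, d => .seq (a.comp d) (.seq (.mul (4 * d + 1) (4 * d + 1) 3)
      (.seq (.add (4 * d + 1) (4 * d + 1) 7) (.load (4 * d + 1) (4 * d + 1))))
  | ite c a b, d => .seq (c.comp d) (.ite (4 * d + 1) (a.comp d) (b.comp d))

theorem width_pos (e : Expr) : 1 ≤ e.width := by
  induction e <;> simp only [width] <;> omega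

end Expr

/-- Variables, working memory and output. -/
structure St : Type where
  v : ℕ → ℤ
  W : ℤ → ℤ
  O : ℤ → ℤ

/-- Commands of the deterministic language. -/
inductive Cmd : Type
  | skip
  | set (i : ℕ) (e : Expr)
  | stW (a e : Expr)
  | stO (a e : Expr)
  | seq (c d : Cmd)
  | ite (e : Expr) (c d : Cmd)
  | while (e : Expr) (c : Cmd)

/-- The input, its length, and a bound for the lengths of the numbers that are stored. -/
structure Env : Type where
  x : ℤ → ℤ
  l : ℤ
  b : ℕ

/-- The value of an expression in a state. -/
abbrev St.ev (E : Env) (s : St) (e : Expr) : ℤ := e.ev E.x s.v s.W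

abbrev St.ok (E : Env) (s : St) (e : Expr) : Prop := e.ok E.l E.x s.v s.W

/-- The command can be executed and leads from the first state to the second one in so many
elementary operations. -/
inductive Run (E : Env) : Cmd → St → ℕ → St → Prop
  | skip (s : St) : Run E .skip s 1 s
  | set (s : St) (i : ℕ) (e : Expr) : s.ok E e → (s.ev E e).natAbs < 2 ^ E.b →
      Run E (.set i e) s 1 { s with v := Function.update s.v i (s.ev E e) }
  | stW (s : St) (a e : Expr) : s.ok E a → s.ok E e → (s.ev E e).natAbs < 2 ^ E.b →
      Run E (.stW a e) s 1 { s with W := Function.update s.W (s.ev E a) (s.ev E e) }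
  | stO (s : St) (a e : Expr) : s.ok E a → s.ok E e →
      Run E (.stO a e) s 1 { s with O := Function.update s.O (s.ev E a) (s.ev E e) }
  | seq {c d : Cmd} {s s₁ s₂ : St} {k₁ k₂ : ℕ} : Run E c s k₁ s₁ → Run E d s₁ k₂ s₂ →
      Run E (.seq c d) s (k₁ + k₂ + 1) s₂
  | ite_pos {e : Expr} {c d : Cmd} {s s' : St} {k : ℕ} : s.ok E e → 0 < s.ev E e →
      Run E c s k s' → Run E (.ite e c d) s (k + 1) s'
  | ite_neg {e : Expr} {c d : Cmd} {s s' : St} {k : ℕ} : s.ok E e → ¬ 0 < s.ev E e →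
      Run E d s k s' → Run E (.ite e c d) s (k + 1) s'
  | while_done {e : Expr} {c : Cmd} {s : St} : s.ok E e → ¬ 0 < s.ev E e →
      Run E (.while e c) s 1 s
  | while_step {e : Expr} {c : Cmd} {s s₁ s₂ : St} {k₁ k₂ : ℕ} : s.ok E e → 0 < s.ev E e →
      Run E c s k₁ s₁ → Run E (.while e c) s₁ k₂ s₂ → Run E (.while e c) s (k₁ + k₂ + 1) s₂

namespace Cmd

/-- Neither the working memory nor the output is used. -/
def pureIn : Cmd → Bool
  | skip => true
  | set _ e => e.pureIn
  | stW _ _ => false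
  | stO _ _ => false
  | seq c d => c.pureIn && d.pureIn
  | ite e c d => e.pureIn && c.pureIn && d.pureIn
  | .while e c => e.pureIn && c.pureIn

/-- A bound per elementary operation, in multiples of the bound for the lengths. The factor 2 for
loops pays for the test before the first pass, in addition to one test per pass. -/
def cost : Cmd → ℕ
  | skip => 1
  | set _ e => e.cost + 2 * e.width + 4
  | stW a e => a.cost + e.cost + 6 * a.width + 2 * e.width + 14
  | stO a e => a.cost + e.cost + 8 * a.width + 2 * e.width + 30
  | seq c d => c.cost + d.cost + 1
  | ite e c d => e.cost + 2 * e.width + c.cost + d.cost + 1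
  | .while e c => 2 * (e.cost + 2 * e.width + c.cost + 1)

/-- In a store, the value is computed at depth 1, so that the address in register 1 survives. `stO`
differs from `stW` only by the constant 1 that shifts the address to the next residue class. -/
def comp : Cmd → Prog
  | skip => .skip
  | set i e => .seq (e.comp 0) (.seq (.const 5 0) (.add (4 * i) 1 5))
  | stW a e => .seq (a.comp 0) (.seq (.mul 1 1 3) (.seq (.add 1 1 7) (.seq (e.comp 1)
      (.store 1 5))))
  | stO a e => .seq (a.comp 0) (.seq (.mul 1 1 3) (.seq (.add 1 1 7) (.seq (.const 5 1)
      (.seq (.add 1 1 5) (.seq (e.comp 1) (.store 1 5))))))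
  | seq c d => .seq c.comp d.comp
  | ite e c d => .seq (e.comp 0) (.ite 1 c.comp d.comp)
  | .while e c => .seq (e.comp 0) (.loop 1 (.seq c.comp (e.comp 0)))

end Cmd

/-- The registers and the memory represent the input and, if `m` holds, also the working memory and
the output, namely in the cells `a * K + J` and `a * K + J + 1`. -/
structure Sim (E : Env) (m : Prop) (K J : ℤ) (s : St) (σ : State) : Prop where
  vars : ∀ i, σ.reg (4 * i) = s.v i
  inp : ∀ a, 0 ≤ a → a < E.l → σ.mem a = E.x a
  regK : m → σ.reg 3 = K
  regJ : m → σ.reg 7 = J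
  wrk : m → ∀ a, σ.mem (a * K + J) = s.W a
  out : m → ∀ a, σ.mem (a * K + J + 1) = s.O a

theorem Sim.of_agree {E : Env} {m : Prop} {K J : ℤ} {s : St} {σ σ' : State}
    (h : Sim E m K J s σ) (hr : ∀ r, r % 4 ≠ 1 → σ'.reg r = σ.reg r) (hm : σ'.mem = σ.mem) :
    Sim E m K J s σ' where
  vars i := by rw [hr _ (by omega), h.vars]
  inp := by rw [hm]; exact h.inp
  regK := by rw [hr _ (by omega)]; exact h.regK
  regJ := by rw [hr _ (by omega)]; exact h.regJ
  wrk := by rw [hm]; exact h.wrk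
  out := by rw [hm]; exact h.out

/-- All the numbers that are stored are shorter than `E.b`. -/
structure Bdd (E : Env) (s : St) : Prop where
  vars : ∀ i, (s.v i).natAbs < 2 ^ E.b
  wrk : ∀ a, (s.W a).natAbs < 2 ^ E.b

/-- Conditions on the position of the memory areas. -/
structure Layout (E : Env) (m : Prop) (K J : ℤ) : Prop where
  b_pos : 1 ≤ E.b
  inp : ∀ a, 0 ≤ a → a < E.l → (E.x a).natAbs < 2 ^ E.b
  le_J : m → E.l ≤ J
  nonneg_J : m → 0 ≤ J
  J_lt : m → J + 1 < K
  K_lt : m → K.natAbs < 2 ^ E.b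

theorem Layout.J_lt_pow {E : Env} {m : Prop} {K J : ℤ} (h : Layout E m K J) (hm : m) :
    J.natAbs < 2 ^ E.b := by
  have := h.K_lt hm; have := h.J_lt hm; have := h.nonneg_J hm; omega

section
variable {E : Env} {m : Prop} {K J : ℤ} {s : St}

theorem Expr.natAbs_ev_lt (hL : Layout E m K J) (hB : Bdd E s) (e : Expr) (he : s.ok E e) :
    (s.ev E e).natAbs < 2 ^ (E.b * e.width) := by
  have two_le : ∀ e : Expr, 2 ≤ 2 ^ (E.b * e.width) := fun e =>
    Nat.le_self_pow (Nat.mul_ne_zero (by have := hL.b_pos; omega) (by have := e.width_pos; omega)) 2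
  -- Because both bounds are at least 2, sums obey the same bound as products, so widths simply add
  -- up in either case.
  have key : ∀ a b X Y : ℕ, a < X → b < Y → 2 ≤ X → 2 ≤ Y → a + b < X * Y := by
    intro a b X Y ha hb hX hY
    nlinarith
  induction e with
  | lit c =>
    simp only [St.ev, ev, width]
    calc c.natAbs < 2 ^ (c.natAbs + 1) := (Nat.lt_two_pow_self).trans (Nat.pow_lt_pow_right (by norm_num) (by omega))
      _ ≤ _ := Nat.pow_le_pow_right (by norm_num) (Nat.le_mul_of_pos_left _ hL.b_pos)
  | var i => simpa [St.ev, ev, width] using hB.vars i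
  | add a b iha ihb =>
    simp only [St.ev, ev, width, mul_add, pow_add]
    exact (Int.natAbs_add_le _ _).trans_lt (key _ _ _ _ (iha he.1) (ihb he.2) (two_le _) (two_le _))
  | sub a b iha ihb =>
    simp only [St.ev, ev, width, mul_add, pow_add]
    exact (Int.natAbs_sub_le _ _).trans_lt (key _ _ _ _ (iha he.1) (ihb he.2) (two_le _) (two_le _))
  | mul a b iha ihb =>
    simp only [St.ev, ev, width, mul_add, pow_add, Int.natAbs_mul]
    exact Nat.mul_lt_mul'' (iha he.1) (ihb he.2)
  | div a b iha ihb =>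
    simp only [St.ev, ev, width]
    exact (Int.natAbs_ediv_le_natAbs _ _).trans_lt (iha he.1)
  | inp a _ => simpa [St.ev, ev, width] using hL.inp _ he.2.1 he.2.2
  | wrk a _ => simpa [St.ev, ev, width] using hB.wrk _
  | ite c a b _ iha ihb =>
    simp only [St.ev, ev, width, mul_add, pow_add]
    split_ifs with h
    · exact (iha (he.2.1 h)).trans_le (Nat.le_mul_of_pos_right _ (by have := two_le b; omega))
    · exact (ihb (he.2.2 h)).trans_le (Nat.le_mul_of_pos_left _ (by have := two_le a; omega))

theorem Expr.len_ev_le (hL : Layout E m K J) (hB : Bdd E s) (e : Expr) (he : s.ok E e) :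
    len (s.ev E e) ≤ 2 * (E.b * e.width) := by
  have h1 := len_le_of_natAbs_lt (e.natAbs_ev_lt hL hB he)
  have h2 : 1 ≤ E.b * e.width := Nat.mul_pos hL.b_pos e.width_pos
  omega

/-- The registers and the memory after the evaluation of an expression. -/
structure Evaluated (d : ℕ) (val : ℤ) (σ σ' : State) : Prop where
  val : σ'.reg (4 * d + 1) = val
  reg : ∀ r, (∀ j, d ≤ j → r ≠ 4 * j + 1) → σ'.reg r = σ.reg r
  mem : σ'.mem = σ.mem

theorem Evaluated.sim {d : ℕ} {val : ℤ} {σ σ' : State} (h : Evaluated d val σ σ')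
    (hσ : Sim E m K J s σ) : Sim E m K J s σ' :=
  hσ.of_agree (fun r hr => h.reg r fun j _ => by omega) h.mem

theorem Expr.det_binary {e a b : Expr} {d : ℕ} {σ σ₁ σ₂ : State} {op : ℕ → ℕ → ℕ → Prog}
    {f : ℤ → ℤ → ℤ}
    (hL : Layout E m K J) (hB : Bdd E s) (ha : s.ok E a) (hb : s.ok E b)
    (hop : ∀ (σ : State) (r a b : ℕ), Det (op r a b) σ (len (σ.reg a) + len (σ.reg b))
      (σ.setReg r (f (σ.reg a) (σ.reg b))))
    (hev : s.ev E e = f (s.ev E a) (s.ev E b))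
    (hcost : e.cost = a.cost + b.cost + 2 * (a.width + b.width) + 2)
    (hcomp : e.comp d = .seq (a.comp d) (.seq (b.comp (d + 1))
      (op (4 * d + 1) (4 * d + 1) (4 * (d + 1) + 1))))
    (h1 : Det (a.comp d) σ (E.b * a.cost) σ₁) (hσ₁ : Evaluated d (s.ev E a) σ σ₁)
    (h2 : Det (b.comp (d + 1)) σ₁ (E.b * b.cost) σ₂)
    (hσ₂ : Evaluated (d + 1) (s.ev E b) σ₁ σ₂) :
    ∃ σ', Det (e.comp d) σ (E.b * e.cost) σ' ∧ Evaluated d (s.ev E e) σ σ' := by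
  have e1 : σ₂.reg (4 * d + 1) = s.ev E a := by
    rw [hσ₂.reg _ fun j hj => by omega, hσ₁.val]
  rw [hcomp, hcost, hev]
  refine ⟨_, h1.seq (h2.seq (hop _ _ _ _) le_rfl) ?_, ?_, ?_, ?_⟩
  · rw [e1, hσ₂.val]
    have := a.len_ev_le hL hB ha
    have := b.len_ev_le hL hB hb
    have := hL.b_pos
    simp only [mul_add]
    have h3 : E.b * (2 * a.width) = 2 * (E.b * a.width) := by ring
    have h4 : E.b * (2 * b.width) = 2 * (E.b * b.width) := by ring
    omega
  · simp [e1, hσ₂.val]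
  · intro r hr
    rw [State.setReg_reg, if_neg (hr d le_rfl), hσ₂.reg r fun j hj => hr j (by omega),
      hσ₁.reg r hr]
  · rw [State.setReg_mem, hσ₂.mem, hσ₁.mem]

/-- Evaluation at depth `d` writes only to temporary registers of depth at least `d`; so the left
operand survives the evaluation of the right one at depth `d + 1`. The alternative in `hm` covers
the first phase of a computation, in which the memory areas are not yet placed and only the input
may be read. -/
theorem Expr.det_comp (hL : Layout E m K J) (hB : Bdd E s) (e : Expr) (he : s.ok E e)
    (hm : m ∨ e.pureIn = true) (d : ℕ) (σ : State) (hσ : Sim E m K J s σ) :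
    ∃ σ', Det (e.comp d) σ (E.b * e.cost) σ' ∧ Evaluated d (s.ev E e) σ σ' := by
  have hb := hL.b_pos
  induction e generalizing d σ with
  | lit c =>
    refine ⟨_, (Det.const _ _ _).mono ?_, by simp [St.ev, ev], ?_, rfl⟩
    · have h1 := len_le_of_natAbs_lt (b := c.natAbs + 1) (a := c)
        ((Nat.lt_two_pow_self).trans (Nat.pow_lt_pow_right (by norm_num) (by omega)))
      simp only [cost]
      have : 2 * (c.natAbs + 1) ≤ E.b * (2 * (c.natAbs + 1)) := Nat.le_mul_of_pos_left _ hb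
      omega
    · intro r hr; rw [State.setReg_reg, if_neg (hr d le_rfl)]
  | var i =>
    refine ⟨_, (Det.const _ _ _).seq (Det.add _ _ _ _) ?_, ?_, ?_, rfl⟩
    · simp only [State.setReg_reg, cost, if_neg (show 4 * i ≠ 4 * d + 1 by omega), if_true,
        hσ.vars]
      have h1 := len_le_of_natAbs_lt (hB.vars i)
      have h2 : len 0 = 1 := by simp [len]
      omega
    · simp [if_neg (show 4 * i ≠ 4 * d + 1 by omega), hσ.vars, St.ev, ev]
    · intro r hr; simp [if_neg (hr d le_rfl)]
  | add a b iha ihb =>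
    simp only [pureIn, Bool.and_eq_true] at hm
    obtain ⟨σ₁, h1, h1'⟩ := iha he.1 (hm.imp_right And.left) d σ hσ
    obtain ⟨σ₂, h2, h2'⟩ := ihb he.2 (hm.imp_right And.right) (d + 1) σ₁ (h1'.sim hσ)
    exact det_binary hL hB he.1 he.2 Det.add rfl rfl rfl h1 h1' h2 h2'
  | sub a b iha ihb =>
    simp only [pureIn, Bool.and_eq_true] at hm
    obtain ⟨σ₁, h1, h1'⟩ := iha he.1 (hm.imp_right And.left) d σ hσ
    obtain ⟨σ₂, h2, h2'⟩ := ihb he.2 (hm.imp_right And.right) (d + 1) σ₁ (h1'.sim hσ)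
    exact det_binary hL hB he.1 he.2 Det.sub rfl rfl rfl h1 h1' h2 h2'
  | mul a b iha ihb =>
    simp only [pureIn, Bool.and_eq_true] at hm
    obtain ⟨σ₁, h1, h1'⟩ := iha he.1 (hm.imp_right And.left) d σ hσ
    obtain ⟨σ₂, h2, h2'⟩ := ihb he.2 (hm.imp_right And.right) (d + 1) σ₁ (h1'.sim hσ)
    exact det_binary hL hB he.1 he.2 Det.mul rfl rfl rfl h1 h1' h2 h2'
  | div a b iha ihb =>
    simp only [pureIn, Bool.and_eq_true] at hm
    obtain ⟨σ₁, h1, h1'⟩ := iha he.1 (hm.imp_right And.left) d σ hσ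
    obtain ⟨σ₂, h2, h2'⟩ := ihb he.2 (hm.imp_right And.right) (d + 1) σ₁ (h1'.sim hσ)
    exact det_binary hL hB he.1 he.2 Det.div rfl rfl rfl h1 h1' h2 h2'
  | inp a iha =>
    obtain ⟨σ₁, h1, h1'⟩ := iha he.1 (by simpa [pureIn] using hm) d σ hσ
    have hx := (h1'.sim hσ).inp _ he.2.1 he.2.2
    refine ⟨_, h1.seq (Det.load _ _ _) ?_, ?_, ?_, ?_⟩
    · rw [h1'.val, hx, cost]
      have := a.len_ev_le hL hB he.1
      have h2 := len_le_of_natAbs_lt (hL.inp _ he.2.1 he.2.2)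
      have h3 : E.b * (a.cost + 2 * a.width + 3) =
        E.b * a.cost + 2 * (E.b * a.width) + 3 * E.b := by ring
      simp only [St.ev] at *
      omega
    · simp only [State.setReg_reg, if_true, h1'.val, hx]; rfl
    · intro r hr; rw [State.setReg_reg, if_neg (hr d le_rfl), h1'.reg r hr]
    · rw [State.setReg_mem, h1'.mem]
  | wrk a iha =>
    have hm' : m := hm.resolve_right (by simp [pureIn])
    obtain ⟨σ₁, h1, h1'⟩ := iha he (.inl hm') d σ hσ
    have hK := (h1'.sim hσ).regK hm'
    have hJ := (h1'.sim hσ).regJ hm'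
    have hx := (h1'.sim hσ).wrk hm' (s.ev E a)
    refine ⟨_, h1.seq ((Det.mul _ _ _ _).seq ((Det.add _ _ _ _).seq (Det.load _ _ _) le_rfl)
      le_rfl) ?_, ?_, ?_, ?_⟩
    · have e1 : (3 = 4 * d + 1) = False := by simp; omega
      have e2 : (7 = 4 * d + 1) = False := by simp; omega
      simp only [State.setReg_reg, if_true, State.setReg_mem, e2, if_false, h1'.val, hK, hJ, hx]
      have g0 := a.len_ev_le hL hB he
      have g1 := len_le_of_natAbs_lt (hL.K_lt hm')
      have g2 := len_le_of_natAbs_lt (hL.J_lt_pow hm')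
      have g3 := len_mul_le (s.ev E a) K
      have g4 := len_add_le (s.ev E a * K) J
      have g5 := len_le_of_natAbs_lt (hB.wrk (s.ev E a))
      have h3 : E.b * cost (.wrk a) = E.b * a.cost + 6 * (E.b * a.width) + 15 * E.b := by
        simp only [cost]; ring
      omega
    · have e1 : (3 = 4 * d + 1) = False := by simp; omega
      have e2 : (7 = 4 * d + 1) = False := by simp; omega
      simp only [State.setReg_reg, if_true, State.setReg_mem, e2, if_false, h1'.val, hK, hJ, hx]
      rfl
    · intro r hr; simp only [State.setReg_reg, if_neg (hr d le_rfl), h1'.reg r hr]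
    · simp only [State.setReg_mem, h1'.mem]
  | ite c a b ihc iha ihb =>
    simp only [pureIn, Bool.and_eq_true] at hm
    obtain ⟨σ₁, h1, h1'⟩ := ihc he.1 (hm.imp_right fun h => h.1.1) d σ hσ
    have h3 : E.b * cost (.ite c a b) =
      E.b * c.cost + 2 * (E.b * c.width) + E.b * a.cost + E.b * b.cost + E.b := by
      simp only [cost]; ring
    have g0 := c.len_ev_le hL hB he.1
    by_cases h : 0 < s.ev E c
    · obtain ⟨σ₂, h2, h2'⟩ := iha (he.2.1 h) (hm.imp_right fun h => h.1.2) d σ₁ (h1'.sim hσ)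
      refine ⟨σ₂, h1.seq (Det.ite_pos (by rwa [h1'.val]) h2 le_rfl) ?_, ?_, ?_, ?_⟩
      · rw [h1'.val]; omega
      · rw [h2'.val]; simp only [St.ev, ev]; rw [if_pos h]
      · intro r hr; rw [h2'.reg r hr, h1'.reg r hr]
      · rw [h2'.mem, h1'.mem]
    · obtain ⟨σ₂, h2, h2'⟩ := ihb (he.2.2 h) (hm.imp_right fun h => h.2) d σ₁ (h1'.sim hσ)
      refine ⟨σ₂, h1.seq (Det.ite_neg (by rwa [h1'.val]) h2 le_rfl) ?_, ?_, ?_, ?_⟩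
      · rw [h1'.val]; omega
      · rw [h2'.val]; simp only [St.ev, ev]; rw [if_neg h]
      · intro r hr; rw [h2'.reg r hr, h1'.reg r hr]
      · rw [h2'.mem, h1'.mem]

end

end RAM

/-! ### Correctness of the compiled commands -/

namespace RAM

/-- What a compiled command leaves alone. -/
structure Frame (m : Prop) (K J : ℤ) (σ σ' : State) : Prop where
  reg : ∀ r, r % 4 = 2 ∨ r % 4 = 3 → σ'.reg r = σ.reg r
  mem : ∀ a, (m → ∀ x, a ≠ x * K + J ∧ a ≠ x * K + J + 1) → σ'.mem a = σ.mem a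

theorem Frame.refl (m : Prop) (K J : ℤ) (σ : State) : Frame m K J σ σ :=
  ⟨fun _ _ => rfl, fun _ _ => rfl⟩

theorem Frame.trans {m : Prop} {K J : ℤ} {σ σ₁ σ₂ : State} (h : Frame m K J σ σ₁)
    (h' : Frame m K J σ₁ σ₂) : Frame m K J σ σ₂ :=
  ⟨fun r hr => (h'.reg r hr).trans (h.reg r hr), fun a ha => (h'.mem a ha).trans (h.mem a ha)⟩

theorem Evaluated.frame {m : Prop} {K J : ℤ} {d : ℕ} {val : ℤ} {σ σ' : State}
    (h : Evaluated d val σ σ') : Frame m K J σ σ' :=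
  ⟨fun r hr => h.reg r fun j _ => by omega, fun a _ => by rw [h.mem]⟩

theorem mul_add_inj {K J x y : ℤ} (hK : 0 < K) (h : x * K + J = y * K + J) : x = y := by
  have : x * K = y * K := by linarith
  exact mul_right_cancel₀ hK.ne' this

theorem mul_add_ne {K J x y : ℤ} (hK : 1 < K) : x * K + J ≠ y * K + J + 1 := by
  intro h
  have : (x - y) * K = 1 := by linarith
  have := Int.eq_one_or_neg_one_of_mul_eq_one' this
  omega

/-- For `x < 0` the cells of the classes of `J` and `J + 1` are negative, and for `x ≥ 0` they are
at least `J`, while the input lies between `0` and `J`. Hence no store damages the input. -/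
theorem Layout.not_inp {E : Env} {m : Prop} {K J : ℤ} (hL : Layout E m K J) (hm : m) {a : ℤ}
    (h0 : 0 ≤ a) (h1 : a < E.l) (x : ℤ) : a ≠ x * K + J ∧ a ≠ x * K + J + 1 := by
  have := hL.le_J hm
  have := hL.J_lt hm
  have := hL.nonneg_J hm
  rcases lt_or_ge x 0 with hx | hx
  · have : x * K ≤ -1 * K := mul_le_mul_of_nonneg_right (by omega) (by omega)
    omega
  · have : 0 ≤ x * K := mul_nonneg hx (by omega)
    omega

section
variable {E : Env} {m : Prop} {K J : ℤ}

theorem det_set (hL : Layout E m K J) {s : St} (hB : Bdd E s) {i : ℕ} {e : Expr} (he : s.ok E e)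
    (hm : m ∨ (Cmd.set i e).pureIn = true) {σ : State} (hσ : Sim E m K J s σ) :
    ∃ σ', Det (Cmd.set i e).comp σ (E.b * (Cmd.set i e).cost) σ' ∧
      Sim E m K J { s with v := Function.update s.v i (s.ev E e) } σ' ∧ Frame m K J σ σ' := by
  obtain ⟨σ₁, h1, h1'⟩ := e.det_comp hL hB he hm 0 σ hσ
  have h1s := h1'.sim hσ
  have hv : σ₁.reg 1 = s.ev E e := by simpa using h1'.val
  refine ⟨_, h1.seq ((Det.const _ _ _).seq (Det.add _ _ _ _) le_rfl) ?_, ⟨?_, ?_, ?_, ?_, ?_, ?_⟩,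
    ⟨?_, ?_⟩⟩
  · have g0 := e.len_ev_le hL hB he
    have g1 := hL.b_pos
    have g2 : len 0 = 1 := by simp [len]
    have : E.b * (Cmd.set i e).cost = E.b * e.cost + 2 * (E.b * e.width) + 4 * E.b := by
      simp only [Cmd.cost]; ring
    simp [hv]
    omega
  · intro j
    simp only [State.setReg_reg, hv, if_true, if_neg (show (1 : ℕ) ≠ 5 by norm_num)]
    by_cases h : j = i
    · subst h; simp
    · rw [if_neg (by omega), if_neg (by omega), h1s.vars]; simp [Function.update_of_ne h]
  · exact h1s.inp
  · intro h; simp only [State.setReg_reg]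
    rw [if_neg (by omega), if_neg (by omega), h1s.regK h]
  · intro h; simp only [State.setReg_reg]
    rw [if_neg (by omega), if_neg (by omega), h1s.regJ h]
  · exact h1s.wrk
  · exact h1s.out
  · intro r hr
    simp only [State.setReg_reg]
    rw [if_neg (by omega), if_neg (by omega), h1'.frame (m := m) (K := K) (J := J) |>.reg r hr]
  · intro a _; simp [h1'.mem]

theorem det_stW (hL : Layout E m K J) {s : St} (hB : Bdd E s) {a e : Expr} (ha : s.ok E a)
    (he : s.ok E e) (hm : m) {σ : State} (hσ : Sim E m K J s σ) :
    ∃ σ', Det (Cmd.stW a e).comp σ (E.b * (Cmd.stW a e).cost) σ' ∧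
      Sim E m K J { s with W := Function.update s.W (s.ev E a) (s.ev E e) } σ' ∧
      Frame m K J σ σ' := by
  obtain ⟨σ₁, h1, h1'⟩ := a.det_comp hL hB ha (.inl hm) 0 σ hσ
  have h1s := h1'.sim hσ
  have hv : σ₁.reg 1 = s.ev E a := by simpa using h1'.val
  obtain ⟨σ₂, hσ₂⟩ : ∃ σ₂, σ₂ = (σ₁.setReg 1 (s.ev E a * K)).setReg 1 (s.ev E a * K + J) := ⟨_, rfl⟩
  have h2s : Sim E m K J s σ₂ := h1s.of_agree (fun r hr => by
    rw [hσ₂]; simp only [State.setReg_reg]; rw [if_neg (by omega), if_neg (by omega)])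
    (by rw [hσ₂]; rfl)
  obtain ⟨σ₃, h3, h3'⟩ := e.det_comp hL hB he (.inl hm) 1 σ₂ h2s
  have h3s := h3'.sim h2s
  have hv3 : σ₃.reg 5 = s.ev E e := by simpa using h3'.val
  have hv1 : σ₃.reg 1 = s.ev E a * K + J := by
    rw [h3'.reg 1 fun j hj => by omega, hσ₂]; simp
  have hK := h1s.regK hm
  have hJ := h1s.regJ hm
  have hd1 : Det (.mul 1 1 3) σ₁ (len (s.ev E a) + len K) (σ₁.setReg 1 (s.ev E a * K)) := by
    have := Det.mul σ₁ 1 1 3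
    rwa [hv, hK] at this
  have hd2 : Det (.add 1 1 7) (σ₁.setReg 1 (s.ev E a * K)) (len (s.ev E a * K) + len J) σ₂ := by
    have := Det.add (σ₁.setReg 1 (s.ev E a * K)) 1 1 7
    simp only [State.setReg_reg, if_true, if_neg (show (7 : ℕ) ≠ 1 by norm_num), hJ] at this
    rwa [hσ₂]
  have hd4 : Det (.store 1 5) σ₃ (len (s.ev E a * K + J) + len (s.ev E e))
      (σ₃.setMem (s.ev E a * K + J) (s.ev E e)) := by
    have := Det.store σ₃ 1 5
    rwa [hv1, hv3] at this
  have hKlt := hL.J_lt hm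
  have hJ0 := hL.nonneg_J hm
  refine ⟨_, h1.seq (hd1.seq (hd2.seq (h3.seq hd4 le_rfl) le_rfl) le_rfl) ?_,
    ⟨h3s.vars, ?_, h3s.regK, h3s.regJ, ?_, ?_⟩, ⟨?_, ?_⟩⟩
  · have g0 := a.len_ev_le hL hB ha
    have g0' := e.len_ev_le hL hB he
    have g1 := len_le_of_natAbs_lt (hL.K_lt hm)
    have g2 := len_le_of_natAbs_lt (hL.J_lt_pow hm)
    have g3 := len_mul_le (s.ev E a) K
    have g4 := len_add_le (s.ev E a * K) J
    have g5 := hL.b_pos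
    have : E.b * (Cmd.stW a e).cost = E.b * a.cost + E.b * e.cost + 6 * (E.b * a.width) +
      2 * (E.b * e.width) + 14 * E.b := by
      simp only [Cmd.cost]; ring
    omega
  · intro x h0 h1
    rw [State.setMem_mem, if_neg (hL.not_inp hm h0 h1 _).1, h3s.inp x h0 h1]
  · intro _ x
    rw [State.setMem_mem, h3s.wrk hm]
    by_cases h : x = s.ev E a
    · subst h; simp
    · rw [if_neg fun h' => h (mul_add_inj (by omega) h')]
      exact (Function.update_of_ne h _ _).symm
  · intro _ x
    rw [State.setMem_mem, h3s.out hm, if_neg fun h' => mul_add_ne (by omega) h'.symm]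
  · intro r hr
    rw [State.setMem_reg, h3'.frame (m := m) (K := K) (J := J) |>.reg r hr, hσ₂]
    simp only [State.setReg_reg]
    rw [if_neg (by omega), if_neg (by omega), h1'.frame (m := m) (K := K) (J := J) |>.reg r hr]
  · intro x hx
    rw [State.setMem_mem, if_neg (hx hm _).1, h3'.mem, hσ₂]
    exact congrFun h1'.mem x

theorem det_stO (hL : Layout E m K J) {s : St} (hB : Bdd E s) {a e : Expr} (ha : s.ok E a)
    (he : s.ok E e) (hm : m) {σ : State} (hσ : Sim E m K J s σ) :
    ∃ σ', Det (Cmd.stO a e).comp σ (E.b * (Cmd.stO a e).cost) σ' ∧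
      Sim E m K J { s with O := Function.update s.O (s.ev E a) (s.ev E e) } σ' ∧
      Frame m K J σ σ' := by
  obtain ⟨σ₁, h1, h1'⟩ := a.det_comp hL hB ha (.inl hm) 0 σ hσ
  have h1s := h1'.sim hσ
  have hv : σ₁.reg 1 = s.ev E a := by simpa using h1'.val
  obtain ⟨σ₂, hσ₂⟩ : ∃ σ₂, σ₂ = (((σ₁.setReg 1 (s.ev E a * K)).setReg 1 (s.ev E a * K + J)).setReg
    5 1).setReg 1 (s.ev E a * K + J + 1) := ⟨_, rfl⟩
  have h2s : Sim E m K J s σ₂ := h1s.of_agree (fun r hr => by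
    rw [hσ₂]; simp only [State.setReg_reg]
    rw [if_neg (by omega), if_neg (by omega), if_neg (by omega), if_neg (by omega)])
    (by rw [hσ₂]; rfl)
  obtain ⟨σ₃, h3, h3'⟩ := e.det_comp hL hB he (.inl hm) 1 σ₂ h2s
  have h3s := h3'.sim h2s
  have hv3 : σ₃.reg 5 = s.ev E e := by simpa using h3'.val
  have hv1 : σ₃.reg 1 = s.ev E a * K + J + 1 := by
    rw [h3'.reg 1 fun j hj => by omega, hσ₂]; simp
  have hK := h1s.regK hm
  have hJ := h1s.regJ hm
  have hd1 : Det (.mul 1 1 3) σ₁ (len (s.ev E a) + len K) (σ₁.setReg 1 (s.ev E a * K)) := by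
    have := Det.mul σ₁ 1 1 3
    rwa [hv, hK] at this
  have hd2 : Det (.add 1 1 7) (σ₁.setReg 1 (s.ev E a * K)) (len (s.ev E a * K) + len J)
      ((σ₁.setReg 1 (s.ev E a * K)).setReg 1 (s.ev E a * K + J)) := by
    have := Det.add (σ₁.setReg 1 (s.ev E a * K)) 1 1 7
    simpa only [State.setReg_reg, if_true, if_neg (show (7 : ℕ) ≠ 1 by norm_num), hJ] using this
  have hd2' := Det.const ((σ₁.setReg 1 (s.ev E a * K)).setReg 1 (s.ev E a * K + J)) 5 1
  have hd2'' : Det (.add 1 1 5) (((σ₁.setReg 1 (s.ev E a * K)).setReg 1 (s.ev E a * K + J)).setReg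
      5 1) (len (s.ev E a * K + J) + len 1) σ₂ := by
    have := Det.add (((σ₁.setReg 1 (s.ev E a * K)).setReg 1 (s.ev E a * K + J)).setReg
      5 1) 1 1 5
    simp only [State.setReg_reg, if_true, if_neg (show (1 : ℕ) ≠ 5 by norm_num)] at this
    rwa [hσ₂]
  have hd4 : Det (.store 1 5) σ₃ (len (s.ev E a * K + J + 1) + len (s.ev E e))
      (σ₃.setMem (s.ev E a * K + J + 1) (s.ev E e)) := by
    have := Det.store σ₃ 1 5
    rwa [hv1, hv3] at this
  have hKlt := hL.J_lt hm
  have hJ0 := hL.nonneg_J hm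
  refine ⟨_, h1.seq (hd1.seq (hd2.seq (hd2'.seq (hd2''.seq (h3.seq hd4 le_rfl) le_rfl) le_rfl)
    le_rfl) le_rfl) ?_, ⟨h3s.vars, ?_, h3s.regK, h3s.regJ, ?_, ?_⟩, ⟨?_, ?_⟩⟩
  · have g0 := a.len_ev_le hL hB ha
    have g0' := e.len_ev_le hL hB he
    have g1 := len_le_of_natAbs_lt (hL.K_lt hm)
    have g2 := len_le_of_natAbs_lt (hL.J_lt_pow hm)
    have g3 := len_mul_le (s.ev E a) K
    have g4 := len_add_le (s.ev E a * K) J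
    have g4' := len_add_le (s.ev E a * K + J) 1
    have g5 := hL.b_pos
    have g6 : len 1 = 2 := by simp [len]
    have : E.b * (Cmd.stO a e).cost = E.b * a.cost + E.b * e.cost + 8 * (E.b * a.width) +
      2 * (E.b * e.width) + 30 * E.b := by
      simp only [Cmd.cost]; ring
    omega
  · intro x h0 h1
    rw [State.setMem_mem, if_neg (hL.not_inp hm h0 h1 _).2, h3s.inp x h0 h1]
  · intro _ x
    rw [State.setMem_mem, h3s.wrk hm, if_neg fun h' => mul_add_ne (by omega) h']
  · intro _ x
    rw [State.setMem_mem, h3s.out hm]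
    by_cases h : x = s.ev E a
    · subst h; simp
    · rw [if_neg fun h' => h (mul_add_inj (K := K) (J := J) (by omega) (by linarith))]
      exact (Function.update_of_ne h _ _).symm
  · intro r hr
    rw [State.setMem_reg, h3'.frame (m := m) (K := K) (J := J) |>.reg r hr, hσ₂]
    simp only [State.setReg_reg]
    rw [if_neg (by omega), if_neg (by omega), if_neg (by omega), if_neg (by omega),
      h1'.frame (m := m) (K := K) (J := J) |>.reg r hr]
  · intro x hx
    rw [State.setMem_mem, if_neg (hx hm _).2, h3'.mem, hσ₂]
    exact congrFun h1'.mem x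

theorem Bdd.update_v {s : St} (hB : Bdd E s) {i : ℕ} {a : ℤ} (ha : a.natAbs < 2 ^ E.b) :
    Bdd E { s with v := Function.update s.v i a } :=
  ⟨fun j => by
    by_cases h : j = i
    · subst h; simpa using ha
    · simpa [Function.update_of_ne h] using hB.vars j, hB.wrk⟩

theorem Bdd.update_W {s : St} (hB : Bdd E s) {i : ℤ} {a : ℤ} (ha : a.natAbs < 2 ^ E.b) :
    Bdd E { s with W := Function.update s.W i a } :=
  ⟨hB.vars, fun j => by
    by_cases h : j = i
    · subst h; simpa using ha
    · simpa [Function.update_of_ne h] using hB.wrk j⟩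

/-- The output is never read back by a command, so `stO` needs no bound and `Bdd` ignores it. -/
theorem Run.bdd {c : Cmd} {s s' : St} {k : ℕ} (h : Run E c s k s') (hB : Bdd E s) : Bdd E s' := by
  induction h with
  | skip => exact hB
  | set s i e _ h => exact hB.update_v h
  | stW s a e _ _ h => exact hB.update_W h
  | stO s a e _ _ => exact ⟨hB.vars, hB.wrk⟩
  | seq _ _ h1 h2 => exact h2 (h1 hB)
  | ite_pos _ _ _ h => exact h hB
  | ite_neg _ _ _ h => exact h hB
  | while_done => exact hB
  | while_step _ _ _ _ h1 h2 => exact h2 (h1 hB)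

/-- Induction on the run. The second part starts at the machine's loop after the condition has been
evaluated into register 1. The remaining passes of a `while` begin exactly there, so the induction
hypothesis has to cover this state, too. -/
theorem Run.det_comp (hL : Layout E m K J) {c : Cmd} {s s' : St} {k : ℕ} (h : Run E c s k s')
    (hB : Bdd E s) (hm : m ∨ c.pureIn = true) {σ : State} (hσ : Sim E m K J s σ) :
    (∃ σ', Det c.comp σ (k * (E.b * c.cost)) σ' ∧ Sim E m K J s' σ' ∧ Frame m K J σ σ') ∧
    ∀ e c₀, c = .while e c₀ → σ.reg 1 = s.ev E e → ∃ σ',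
      Det (.loop 1 (.seq c₀.comp (e.comp 0))) σ
        (k * (E.b * (e.cost + 2 * e.width + c₀.cost + 1))) σ' ∧
      Sim E m K J s' σ' ∧ Frame m K J σ σ' := by
  have hb := hL.b_pos
  induction h generalizing σ with
  | skip s =>
    exact ⟨⟨σ, (Det.skip σ).mono (by simp only [Cmd.cost]; omega), hσ, .refl _ _ _ _⟩, nofun⟩
  | set s i e he h =>
    refine ⟨?_, nofun⟩
    rw [one_mul]; exact det_set hL hB he hm hσ
  | stW s a e ha he h =>
    refine ⟨?_, nofun⟩
    rw [one_mul]; exact det_stW hL hB ha he (hm.resolve_right (by simp [Cmd.pureIn])) hσ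
  | stO s a e ha he =>
    refine ⟨?_, nofun⟩
    rw [one_mul]; exact det_stO hL hB ha he (hm.resolve_right (by simp [Cmd.pureIn])) hσ
  | @seq c d s s₁ s₂ k₁ k₂ h1 h2 ih1 ih2 =>
    refine ⟨?_, nofun⟩
    simp only [Cmd.pureIn, Bool.and_eq_true] at hm
    obtain ⟨σ₁, d1, s1, f1⟩ := (ih1 hB (hm.imp_right And.left) hσ).1
    obtain ⟨σ₂, d2, s2, f2⟩ := (ih2 (h1.bdd hB) (hm.imp_right And.right) s1).1
    refine ⟨σ₂, d1.seq d2 ?_, s2, f1.trans f2⟩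
    simp only [Cmd.cost]
    calc _ ≤ k₁ * (E.b * (c.cost + d.cost + 1)) + k₂ * (E.b * (c.cost + d.cost + 1)) +
          1 * (E.b * (c.cost + d.cost + 1)) := by
          gcongr
          · omega
          · omega
          · rw [one_mul]; exact Nat.mul_pos hb (by omega)
      _ = _ := by ring
  | @ite_pos e c d s s' k he hpos h1 ih =>
    refine ⟨?_, nofun⟩
    simp only [Cmd.pureIn, Bool.and_eq_true] at hm
    obtain ⟨σ₁, d0, e0⟩ := e.det_comp hL hB he (hm.imp_right fun h => h.1.1) 0 σ hσ
    obtain ⟨σ₂, d1, s1, f1⟩ := (ih hB (hm.imp_right fun h => h.1.2) (e0.sim hσ)).1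
    have hv : σ₁.reg 1 = s.ev E e := by simpa using e0.val
    refine ⟨σ₂, d0.seq (Det.ite_pos (by rwa [hv]) d1 le_rfl) ?_, s1, e0.frame.trans f1⟩
    rw [hv]
    have g := e.len_ev_le hL hB he
    have e1 : (k + 1) * (E.b * (Cmd.ite e c d).cost) = k * (E.b * c.cost) +
      k * (E.b * (e.cost + 2 * e.width + d.cost + 1)) + (E.b * e.cost + 2 * (E.b * e.width) +
        E.b * c.cost + E.b * d.cost + E.b) := by
      simp only [Cmd.cost]; ring
    omega
  | @ite_neg e c d s s' k he hpos h1 ih =>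
    refine ⟨?_, nofun⟩
    simp only [Cmd.pureIn, Bool.and_eq_true] at hm
    obtain ⟨σ₁, d0, e0⟩ := e.det_comp hL hB he (hm.imp_right fun h => h.1.1) 0 σ hσ
    obtain ⟨σ₂, d1, s1, f1⟩ := (ih hB (hm.imp_right fun h => h.2) (e0.sim hσ)).1
    have hv : σ₁.reg 1 = s.ev E e := by simpa using e0.val
    refine ⟨σ₂, d0.seq (Det.ite_neg (by rwa [hv]) d1 le_rfl) ?_, s1, e0.frame.trans f1⟩
    rw [hv]
    have g := e.len_ev_le hL hB he
    have e1 : (k + 1) * (E.b * (Cmd.ite e c d).cost) = k * (E.b * d.cost) +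
      k * (E.b * (e.cost + 2 * e.width + c.cost + 1)) + (E.b * e.cost + 2 * (E.b * e.width) +
        E.b * c.cost + E.b * d.cost + E.b) := by
      simp only [Cmd.cost]; ring
    omega
  | @while_done e c s he hneg =>
    simp only [Cmd.pureIn, Bool.and_eq_true] at hm
    have g := e.len_ev_le hL hB he
    have e1 : E.b * (e.cost + 2 * e.width + c.cost + 1) = E.b * e.cost + 2 * (E.b * e.width) +
        E.b * c.cost + E.b := by ring
    constructor
    · obtain ⟨σ₁, d0, e0⟩ := e.det_comp hL hB he (hm.imp_right And.left) 0 σ hσ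
      have hv : σ₁.reg 1 = s.ev E e := by simpa using e0.val
      refine ⟨σ₁, d0.seq (Det.loop_done (by rwa [hv])) ?_, e0.sim hσ, e0.frame⟩
      rw [hv]
      have e2 : E.b * (Cmd.while e c).cost = 2 * (E.b * (e.cost + 2 * e.width + c.cost + 1)) := by
        simp only [Cmd.cost]; ring
      omega
    · intro e' c' hec hv
      cases hec
      refine ⟨σ, (Det.loop_done (by rwa [hv])).mono ?_, hσ, .refl _ _ _ _⟩
      rw [hv]; omega
  | @while_step e c s s₁ s₂ k₁ k₂ he hpos h1 h2 ih1 ih2 =>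
    simp only [Cmd.pureIn, Bool.and_eq_true] at hm ih2
    have g := e.len_ev_le hL hB he
    have e1 : E.b * (e.cost + 2 * e.width + c.cost + 1) = E.b * e.cost + 2 * (E.b * e.width) +
        E.b * c.cost + E.b := by ring
    have key : ∀ σ, Sim E m K J s σ → σ.reg 1 = s.ev E e → ∃ σ',
        Det (.loop 1 (.seq c.comp (e.comp 0))) σ
          ((k₁ + k₂ + 1) * (E.b * (e.cost + 2 * e.width + c.cost + 1))) σ' ∧
        Sim E m K J s₂ σ' ∧ Frame m K J σ σ' := by
      intro σ hσ hv
      obtain ⟨σ₁, d1, s1, f1⟩ := (ih1 hB (hm.imp_right And.right) hσ).1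
      have hB1 := h1.bdd hB
      -- The remaining run begins with a test of `e`, whichever of the two rules it uses.
      have he1 : s₁.ok E e := by cases h2 <;> assumption
      obtain ⟨σ₂, d2, e2⟩ := e.det_comp hL hB1 he1 (hm.imp_right And.left) 0 σ₁ s1
      obtain ⟨σ₃, d3, s3, f3⟩ := (ih2 hB1 hm (e2.sim s1)).2 e c rfl (by simpa using e2.val)
      refine ⟨σ₃, Det.loop_step (by rwa [hv]) (d1.seq d2 le_rfl) d3 ?_, s3,
        f1.trans (e2.frame.trans f3)⟩
      rw [hv]
      have : k₁ * (E.b * c.cost) ≤ k₁ * (E.b * (e.cost + 2 * e.width + c.cost + 1)) := by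
        gcongr; omega
      have e3 : (k₁ + k₂ + 1) * (E.b * (e.cost + 2 * e.width + c.cost + 1)) =
        k₁ * (E.b * (e.cost + 2 * e.width + c.cost + 1)) +
        k₂ * (E.b * (e.cost + 2 * e.width + c.cost + 1)) +
        E.b * (e.cost + 2 * e.width + c.cost + 1) := by ring
      omega
    constructor
    · obtain ⟨σ₁, d0, e0⟩ := e.det_comp hL hB he (hm.imp_right And.left) 0 σ hσ
      obtain ⟨σ₂, d1, s1, f1⟩ := key σ₁ (e0.sim hσ) (by simpa using e0.val)
      refine ⟨σ₂, d0.seq d1 ?_, s1, e0.frame.trans f1⟩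
      have e2 : (k₁ + k₂ + 1) * (E.b * (Cmd.while e c).cost) =
          (k₁ + k₂ + 1) * (E.b * (e.cost + 2 * e.width + c.cost + 1)) +
          (k₁ + k₂) * (E.b * (e.cost + 2 * e.width + c.cost + 1)) +
          E.b * (e.cost + 2 * e.width + c.cost + 1) := by
        simp only [Cmd.cost]; ring
      omega
    · intro e' c' hec hv
      cases hec
      exact key σ hσ hv

end

end RAM

namespace RAM

/-! ### Running a program inside another one -/

/-- A bound for the registers that a program mentions. -/
def Prog.regs : Prog → ℕ
  | skip => 0
  | const r _ => r + 1
  | add r a b => max (r + 1) (max (a + 1) (b + 1))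
  | sub r a b => max (r + 1) (max (a + 1) (b + 1))
  | mul r a b => max (r + 1) (max (a + 1) (b + 1))
  | div r a b => max (r + 1) (max (a + 1) (b + 1))
  | load r a => max (r + 1) (a + 1)
  | store a b => max (a + 1) (b + 1)
  | coin r => r + 1
  | seq p q => max p.regs q.regs
  | ite r p q => max (r + 1) (max p.regs q.regs)
  | loop r p => max (r + 1) p.regs

/-- The program that works like `p` on the registers `4 * r + 2` and the memory cells
`a * K + J`, where `K` and `J` are the contents of the registers `3` and `7`. -/
def Prog.boxed : Prog → Prog
  | skip => skip
  | const r c => const (4 * r + 2) c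
  | add r a b => add (4 * r + 2) (4 * a + 2) (4 * b + 2)
  | sub r a b => sub (4 * r + 2) (4 * a + 2) (4 * b + 2)
  | mul r a b => mul (4 * r + 2) (4 * a + 2) (4 * b + 2)
  | div r a b => div (4 * r + 2) (4 * a + 2) (4 * b + 2)
  | load r a => seq (mul 1 (4 * a + 2) 3) (seq (add 1 1 7) (load (4 * r + 2) 1))
  | store a b => seq (mul 1 (4 * a + 2) 3) (seq (add 1 1 7) (store 1 (4 * b + 2)))
  | coin r => coin (4 * r + 2)
  | seq p q => seq p.boxed q.boxed
  | ite r p q => ite (4 * r + 2) p.boxed q.boxed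
  | loop r p => loop (4 * r + 2) p.boxed

/-- The state `σ` represents the state `τ` of a boxed program with registers below `m`, and agrees
with `σ₀` elsewhere. -/
structure Box (K J : ℤ) (m : ℕ) (σ₀ τ σ : State) : Prop where
  reg : ∀ r < m, σ.reg (4 * r + 2) = τ.reg r
  mem : ∀ a, σ.mem (a * K + J) = τ.mem a
  regs : ∀ r, r % 4 ≠ 2 → r ≠ 1 → σ.reg r = σ₀.reg r
  rest : ∀ a, (∀ x, a ≠ x * K + J) → σ.mem a = σ₀.mem a

section
variable {K J : ℤ} {m : ℕ} {σ₀ τ σ : State}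

theorem Box.setReg (h : Box K J m σ₀ τ σ) (r : ℕ) (v : ℤ) :
    Box K J m σ₀ (τ.setReg r v) (σ.setReg (4 * r + 2) v) where
  reg s hs := by
    simp only [State.setReg_reg]
    by_cases hsr : s = r
    · subst hsr; simp
    · rw [if_neg (by omega), if_neg hsr, h.reg s hs]
  mem := h.mem
  regs s hs hs1 := by
    simp only [State.setReg_reg]; rw [if_neg (by omega), h.regs s hs hs1]
  rest := h.rest

theorem Box.setReg_one (h : Box K J m σ₀ τ σ) (v : ℤ) :
    Box K J m σ₀ τ (σ.setReg 1 v) where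
  reg s hs := by
    simp only [State.setReg_reg]; rw [if_neg (by omega), h.reg s hs]
  mem := h.mem
  regs s hs hs1 := by
    simp only [State.setReg_reg]; rw [if_neg hs1, h.regs s hs hs1]
  rest := h.rest

theorem Box.setMem (hK : 0 < K) (h : Box K J m σ₀ τ σ) (a v : ℤ) :
    Box K J m σ₀ (τ.setMem a v) (σ.setMem (a * K + J) v) where
  reg := h.reg
  mem x := by
    simp only [State.setMem_mem]
    by_cases hx : x = a
    · subst hx; simp
    · rw [if_neg hx, if_neg fun h' => hx (mul_add_inj hK h'), h.mem]
  regs := h.regs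
  rest x hx := by
    simp only [State.setMem_mem]; rw [if_neg (hx a), h.rest x hx]

/-- The factor by which boxing slows a program down. -/
def boxFactor (b : ℕ) : ℕ := 5 * b + 10

/-- The address computation costs a multiple of `b` more than the access itself. This is the only
source of the slowdown by a factor of order `b`. -/
theorem Box.det_addr (h : Box K J m σ₀ τ σ) {b a : ℕ} (hK : len K ≤ b + 1) (hJ : len J ≤ b + 1)
    (h3 : σ₀.reg 3 = K) (h7 : σ₀.reg 7 = J) (ha : a < m) {q : Prog} {σ' : State} {c : ℕ}
    (hq : Det q ((σ.setReg 1 (τ.reg a * K)).setReg 1 (τ.reg a * K + J))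
      (len (τ.reg a * K + J) + c) σ') :
    Det (.seq (.mul 1 (4 * a + 2) 3) (.seq (.add 1 1 7) q)) σ
      (boxFactor b * (len (τ.reg a) + c)) σ' := by
  have e3 : σ.reg 3 = K := by rw [h.regs 3 (by norm_num) (by norm_num), h3]
  have e7 : σ.reg 7 = J := by rw [h.regs 7 (by norm_num) (by norm_num), h7]
  have d1 := Det.mul σ 1 (4 * a + 2) 3
  rw [e3, h.reg a ha] at d1
  have d2 := Det.add (σ.setReg 1 (τ.reg a * K)) 1 1 7
  simp only [State.setReg_reg, if_true, if_neg (show (7 : ℕ) ≠ 1 by norm_num), e7] at d2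
  refine d1.seq (d2.seq hq le_rfl) ?_
  have g1 := len_mul_le (τ.reg a) K
  have g2 := len_add_le (τ.reg a * K) J
  have g3 := one_le_len (τ.reg a)
  unfold boxFactor
  have g4 : (5 * b + 10) * 1 ≤ (5 * b + 10) * len (τ.reg a) := Nat.mul_le_mul_left _ g3
  have g5 : 1 * c ≤ (5 * b + 10) * c := Nat.mul_le_mul_right _ (by omega)
  have g6 : (5 * b + 10) * len (τ.reg a) = (5 * b + 7) * len (τ.reg a) + 3 * len (τ.reg a) := by
    ring
  have g7 : (5 * b + 7) * 1 ≤ (5 * b + 7) * len (τ.reg a) := Nat.mul_le_mul_left _ g3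
  rw [mul_add]
  omega

theorem le_boxFactor_mul (b c : ℕ) : c ≤ boxFactor b * c :=
  Nat.le_mul_of_pos_left _ (by unfold boxFactor; omega)

/-- Induction on the number of steps of the guest. Whatever its final configurations are worth for
the continuation `K₀` is averaged with the guest's own probabilities. The condition on the times
says that the host's time minus `boxFactor b` times the guest's time has not increased. -/
theorem halts_boxed {b : ℕ} (hK0 : 0 < K) (hK : len K ≤ b + 1) (hJ : len J ≤ b + 1)
    (h3 : σ₀.reg 3 = K) (h7 : σ₀.reg 7 = J) {Φ : State → ℕ → ℝ≥0∞} {K₀ : List Prog} (N : ℕ) :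
    ∀ (c : Config) (σ : State) (t : ℕ) (g : Config → ℝ≥0∞), (∀ p ∈ c.todo, p.regs ≤ m) →
    (∀ c' ∈ (runFor N c).support, c'.todo = []) → Box K J m σ₀ c.state σ →
    (∀ c' ∈ (runFor N c).support, ∀ σ' t', Box K J m σ₀ c'.state σ' →
      t' + boxFactor b * c.time ≤ t + boxFactor b * c'.time → Halts Φ ⟨K₀, σ', t'⟩ (g c')) →
    Halts Φ ⟨c.todo.map Prog.boxed ++ K₀, σ, t⟩ (expect (runFor N c) g) := by
  induction N with
  | zero =>
    intro c σ t g _ hend hbox hg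
    have hc : c ∈ (runFor 0 c).support := by simp [runFor]
    rw [hend c hc, runFor, expect_pure]
    exact hg c hc σ t hbox le_rfl
  | succ N ih =>
    rintro ⟨todo, τ, tp⟩ σ t g hm hend hbox hg
    rw [runFor_succ'] at hend hg ⊢
    rcases todo with _ | ⟨p, Q⟩
    · have : step ⟨[], τ, tp⟩ = PMF.pure ⟨[], τ, tp⟩ := rfl
      rw [this, PMF.pure_bind] at hend hg ⊢
      exact ih _ σ t g hm hend hbox hg
    have hmp : p.regs ≤ m := hm p (by simp)
    have hmK : ∀ q ∈ Q, q.regs ≤ m := fun q hq => hm q (by simp [hq])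
    -- Instructions that change the state, each simulated by code without coins.
    have simple : ∀ (τ' σ' : State) (cost : ℕ),
        step ⟨p :: Q, τ, tp⟩ = PMF.pure ⟨Q, τ', tp + cost⟩ →
        Det p.boxed σ (boxFactor b * cost) σ' → Box K J m σ₀ τ' σ' →
        Halts Φ ⟨(p :: Q).map Prog.boxed ++ K₀, σ, t⟩
          (expect ((step ⟨p :: Q, τ, tp⟩).bind (runFor N)) g) := by
      intro τ' σ' cost hs hd hb
      rw [hs, PMF.pure_bind] at hend hg ⊢
      obtain ⟨t₁, ht₁, hd⟩ := hd
      refine hd _ _ _ _ (ih ⟨Q, τ', tp + cost⟩ σ' (t + t₁) g hmK hend hb ?_)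
      intro c' hc' σ' t' hb' ht'
      refine hg c' hc' σ' t' hb' ?_
      simp only [mul_add] at ht' ⊢
      omega
    -- Instructions that only change what is to be executed: one step of the host for one step of
    -- the guest.
    have control : ∀ (Q' : List Prog) (cost : ℕ),
        step ⟨p :: Q, τ, tp⟩ = PMF.pure ⟨Q', τ, tp + cost⟩ →
        step ⟨(p :: Q).map Prog.boxed ++ K₀, σ, t⟩ =
          PMF.pure ⟨Q'.map Prog.boxed ++ K₀, σ, t + cost⟩ →
        (∀ q ∈ Q', q.regs ≤ m) →
        Halts Φ ⟨(p :: Q).map Prog.boxed ++ K₀, σ, t⟩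
          (expect ((step ⟨p :: Q, τ, tp⟩).bind (runFor N)) g) := by
      intro Q' cost hs hd hm'
      rw [hs, PMF.pure_bind] at hend hg ⊢
      refine .det hd (ih ⟨Q', τ, tp + cost⟩ σ (t + cost) g hm' hend hbox ?_)
      intro c' hc' σ' t' hb' ht'
      refine hg c' hc' σ' t' hb' ?_
      have := le_boxFactor_mul b cost
      simp only [mul_add] at ht' ⊢
      omega
    cases p with
    | skip => exact control Q 1 rfl rfl hmK
    | const r c =>
      exact simple _ _ (len c) rfl ((Det.const _ _ _).mono (le_boxFactor_mul _ _)) (hbox.setReg _ _)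
    | add r x y =>
      simp only [Prog.regs] at hmp
      have d := Det.add σ (4 * r + 2) (4 * x + 2) (4 * y + 2)
      rw [hbox.reg x (by omega), hbox.reg y (by omega)] at d
      exact simple _ _ _ (by simp only [step, add_assoc]) (d.mono (le_boxFactor_mul _ _))
        (hbox.setReg _ _)
    | sub r x y =>
      simp only [Prog.regs] at hmp
      have d := Det.sub σ (4 * r + 2) (4 * x + 2) (4 * y + 2)
      rw [hbox.reg x (by omega), hbox.reg y (by omega)] at d
      exact simple _ _ _ (by simp only [step, add_assoc]) (d.mono (le_boxFactor_mul _ _))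
        (hbox.setReg _ _)
    | mul r x y =>
      simp only [Prog.regs] at hmp
      have d := Det.mul σ (4 * r + 2) (4 * x + 2) (4 * y + 2)
      rw [hbox.reg x (by omega), hbox.reg y (by omega)] at d
      exact simple _ _ _ (by simp only [step, add_assoc]) (d.mono (le_boxFactor_mul _ _))
        (hbox.setReg _ _)
    | div r x y =>
      simp only [Prog.regs] at hmp
      have d := Det.div σ (4 * r + 2) (4 * x + 2) (4 * y + 2)
      rw [hbox.reg x (by omega), hbox.reg y (by omega)] at d
      exact simple _ _ _ (by simp only [step, add_assoc]) (d.mono (le_boxFactor_mul _ _))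
        (hbox.setReg _ _)
    | load r x =>
      simp only [Prog.regs] at hmp
      have d := Det.load ((σ.setReg 1 (τ.reg x * K)).setReg 1 (τ.reg x * K + J)) (4 * r + 2) 1
      simp only [State.setReg_reg, if_true, State.setReg_mem, hbox.mem] at d
      exact simple _ _ (len (τ.reg x) + len (τ.mem (τ.reg x))) (by simp only [step, add_assoc])
        (hbox.det_addr hK hJ h3 h7 (by omega) d) (((hbox.setReg_one _).setReg_one _).setReg _ _)
    | store x y =>
      simp only [Prog.regs] at hmp
      have d := Det.store ((σ.setReg 1 (τ.reg x * K)).setReg 1 (τ.reg x * K + J)) 1 (4 * y + 2)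
      simp only [State.setReg_reg, if_true, if_neg (show 4 * y + 2 ≠ 1 by omega)] at d
      rw [hbox.reg y (by omega)] at d
      exact simple (τ.setMem (τ.reg x) (τ.reg y)) _ (len (τ.reg x) + len (τ.reg y))
        (by simp only [step, add_assoc]) (hbox.det_addr hK hJ h3 h7 (by omega) d)
        (((hbox.setReg_one _).setReg_one _).setMem hK0 _ _)
    | coin r =>
      simp only [step] at hend hg ⊢
      rw [expect_bind, expect_bool_map]
      have hsub : ∀ (bt : Bool) (c' : Config), c' ∈ (runFor N
          ⟨Q, τ.setReg r (if bt then 1 else 0), tp + 1⟩).support →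
          c' ∈ (((PMF.uniformOfFintype Bool).map fun bt =>
            (⟨Q, τ.setReg r (if bt then 1 else 0), tp + 1⟩ : Config)).bind (runFor N)).support := by
        intro bt c' hc'
        rw [PMF.mem_support_bind_iff]
        exact ⟨_, (PMF.mem_support_map_iff _ _ _).2 ⟨bt, by simp, rfl⟩, hc'⟩
      have hbr : ∀ bt : Bool, Halts Φ
          ⟨Q.map Prog.boxed ++ K₀, σ.setReg (4 * r + 2) (if bt then 1 else 0), t + 1⟩
          (expect (runFor N ⟨Q, τ.setReg r (if bt then 1 else 0), tp + 1⟩) g) := by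
        intro bt
        refine ih ⟨Q, τ.setReg r (if bt then 1 else 0), tp + 1⟩ _ (t + 1) g hmK
          (fun c' hc' => hend c' (hsub bt c' hc')) (hbox.setReg _ _) ?_
        intro c' hc' σ' t' hb' ht'
        refine hg c' (hsub bt c' hc') σ' t' hb' ?_
        have := le_boxFactor_mul b 1
        simp only [mul_add] at ht' ⊢
        omega
      exact .coin (hbr false) (hbr true) le_rfl
    | seq p q =>
      simp only [Prog.regs] at hmp
      refine control (p :: q :: Q) 1 rfl rfl ?_
      intro x hx
      rcases List.mem_cons.1 hx with rfl | hx
      · omega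
      rcases List.mem_cons.1 hx with rfl | hx
      · omega
      exact hmK x hx
    | ite r p q =>
      simp only [Prog.regs] at hmp
      refine control ((if 0 < τ.reg r then p else q) :: Q) (len (τ.reg r)) rfl ?_ ?_
      · simp only [List.map_cons, List.cons_append, Prog.boxed, step, hbox.reg r (by omega)]
        split_ifs <;> rfl
      · intro x hx
        rcases List.mem_cons.1 hx with rfl | hx
        · split_ifs <;> omega
        exact hmK x hx
    | loop r p =>
      have hmp' := hmp
      simp only [Prog.regs] at hmp
      refine control (if 0 < τ.reg r then p :: .loop r p :: Q else Q) (len (τ.reg r)) rfl ?_ ?_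
      · simp only [List.map_cons, List.cons_append, Prog.boxed, step, hbox.reg r (by omega)]
        split_ifs <;> rfl
      · intro x hx
        split_ifs at hx
        · rcases List.mem_cons.1 hx with rfl | hx
          · omega
          rcases List.mem_cons.1 hx with rfl | hx
          · exact hmp'
          exact hmK x hx
        · exact hmK x hx

end

end RAM

namespace RAM

/-! ### Repeated randomized calls with a majority vote -/

theorem expect_add {α : Type*} (μ : PMF α) (f g : α → ℝ≥0∞) :
    expect μ (fun a => f a + g a) = expect μ f + expect μ g := by
  simp only [expect, mul_add, ENNReal.tsum_add]

theorem expect_const {α : Type*} (μ : PMF α) (w : ℝ≥0∞) : expect μ (fun _ => w) = w := by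
  simp only [expect, ENNReal.tsum_mul_right, PMF.tsum_coe, one_mul]

open Classical in
-- The integrand is at most `w + f` plus `16 * f` times the indicator of `S`; for `δ ≤ 1/16` the
-- last summand has mean at most `f`.
theorem expect_two_values_le {α : Type*} (μ : PMF α) (S : Set α) {δ w f : ℝ≥0∞}
    (hS : μ.toOuterMeasure S ≤ δ) :
    expect μ (fun a => if a ∈ S then w + 16 * f else w + f) ≤ w + (f + δ * (16 * f)) := by
  have h1 : ∀ a, (if a ∈ S then w + 16 * f else w + f) ≤
      w + (f + S.indicator (fun _ => 16 * f) a) := by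
    intro a
    by_cases ha : a ∈ S
    · rw [if_pos ha, Set.indicator_of_mem ha]
      gcongr; exact le_add_self
    · rw [if_neg ha]; gcongr; exact le_self_add
  refine (expect_mono μ fun a _ => h1 a).trans ?_
  rw [expect_add, expect_const, expect_add, expect_const]
  gcongr
  have : expect μ (S.indicator fun _ => 16 * f) = μ.toOuterMeasure S * (16 * f) := by
    rw [PMF.toOuterMeasure_apply, ← ENNReal.tsum_mul_right, expect]
    refine tsum_congr fun a => ?_
    by_cases ha : a ∈ S <;> simp [ha]
  rw [this]
  gcongr

theorem Det.halts {p : Prog} {σ σ' : State} {τ : ℕ} (h : Det p σ τ σ')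
    {Φ : State → ℕ → ℝ≥0∞} {v : ℝ≥0∞} {K : List Prog} {t : ℕ}
    (hK : ∀ t' ≤ t + τ, Halts Φ ⟨K, σ', t'⟩ v) : Halts Φ ⟨p :: K, σ, t⟩ v := by
  obtain ⟨t₁, h1, h⟩ := h
  exact h _ _ _ _ (hK _ (by omega))

theorem Det.halts_seq {p q : Prog} {σ σ' : State} {τ : ℕ} (h : Det p σ τ σ')
    {Φ : State → ℕ → ℝ≥0∞} {v : ℝ≥0∞} {K : List Prog} {t : ℕ}
    (hK : ∀ t' ≤ t + τ + 1, Halts Φ ⟨q :: K, σ', t'⟩ v) : Halts Φ ⟨.seq p q :: K, σ, t⟩ v :=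
  .det rfl (h.halts fun t' ht' => hK t' (by omega))

namespace Prog

/-- Clear the registers of a boxed program. -/
def clear : ℕ → Prog
  | 0 => skip
  | m + 1 => seq (clear m) (const (4 * m + 2) 0)

/-- `R b := R a` -/
def copy (a b : ℕ) : Prog := seq (const 1 0) (add b a 1)

/-- `R a := R a + c` -/
def incr (a : ℕ) (c : ℤ) : Prog := seq (const 1 c) (add a a 1)

end Prog

theorem det_clear (m : ℕ) (σ : State) : ∃ σ', Det (.clear m) σ (2 * m + 1) σ' ∧
    (∀ r < m, σ'.reg (4 * r + 2) = 0) ∧ (∀ r, r % 4 ≠ 2 → σ'.reg r = σ.reg r) ∧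
    σ'.mem = σ.mem := by
  induction m with
  | zero => exact ⟨σ, Det.skip σ, by simp, by simp, rfl⟩
  | succ m ih =>
    obtain ⟨σ₁, h1, h2, h3, h4⟩ := ih
    refine ⟨_, h1.seq (Det.const _ _ _) (by simp [len]; omega), ?_, ?_, h4⟩
    · intro r hr
      by_cases h : r = m
      · simp [h]
      · simp [h, h2 r (by omega)]
    · intro r hr
      simp only [State.setReg_reg]; rw [if_neg (by omega), h3 r hr]

theorem det_copy {a b : ℕ} (ha : a ≠ 1) (σ : State) {B : ℕ} (hB : (σ.reg a).natAbs < 2 ^ B) :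
    Det (.copy a b) σ (B + 4) ((σ.setReg 1 0).setReg b (σ.reg a)) := by
  have h := Det.add (σ.setReg 1 0) b a 1
  simp only [State.setReg_reg, if_true, if_neg ha, add_zero] at h
  refine (Det.const σ 1 0).seq h ?_
  have := len_le_of_natAbs_lt hB
  have : len 0 = 1 := by simp [len]
  omega

theorem det_incr {a : ℕ} {c : ℤ} (ha : a ≠ 1) (hc : len c = 2) (σ : State) {B : ℕ}
    (hB : (σ.reg a).natAbs < 2 ^ B) :
    Det (.incr a c) σ (B + 6) ((σ.setReg 1 c).setReg a (σ.reg a + c)) := by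
  have h := Det.add (σ.setReg 1 c) a a 1
  simp only [State.setReg_reg, if_true, if_neg ha] at h
  refine (Det.const σ 1 c).seq h ?_
  have := len_le_of_natAbs_lt hB
  omega

/-- The variables of the deterministic language as they are stored in the registers. -/
def State.vars (σ : State) (i : ℕ) : ℤ := σ.reg (4 * i)

/-- The state of the machine between two calls: the memory areas from `J` on are clean. -/
structure Ready (E : Env) (Pre : (ℕ → ℤ) → Prop) (K J : ℤ) (σ : State) : Prop where
  pre : Pre σ.vars
  bdd : ∀ i, (σ.vars i).natAbs < 2 ^ E.b
  inp : ∀ a, 0 ≤ a → a < E.l → σ.mem a = E.x a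
  regK : σ.reg 3 = K
  regJ : σ.reg 7 = J
  fresh : ∀ j, J ≤ j → j < K → ∀ a, σ.mem (a * K + j) = 0

theorem Ready.of_agree {E : Env} {Pre : (ℕ → ℤ) → Prop} {K J : ℤ} {σ σ' : State}
    (h : Ready E Pre K J σ) (hr : ∀ r, r % 4 = 0 ∨ r = 3 ∨ r = 7 → σ'.reg r = σ.reg r)
    (hm : σ'.mem = σ.mem) : Ready E Pre K J σ' := by
  have hv : σ'.vars = σ.vars := funext fun i => hr _ (by omega)
  exact ⟨hv ▸ h.pre, hv ▸ h.bdd, hm ▸ h.inp, by rw [hr 3 (by omega), h.regK],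
    by rw [hr 7 (by omega), h.regJ], hm ▸ h.fresh⟩

theorem class_inj {K a a' j j' : ℤ} (hj : 0 ≤ j) (hjK : j < K) (hj' : 0 ≤ j') (hjK' : j' < K)
    (h : a * K + j = a' * K + j') : a = a' ∧ j = j' := by
  have e1 : (a * K + j) / K = a := by
    rw [add_comm, Int.add_mul_ediv_right _ _ (by omega), Int.ediv_eq_zero_of_lt hj hjK, zero_add]
  have e2 : (a' * K + j') / K = a' := by
    rw [add_comm, Int.add_mul_ediv_right _ _ (by omega), Int.ediv_eq_zero_of_lt hj' hjK', zero_add]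
  have : a = a' := by rw [← e1, ← e2, h]
  subst this
  exact ⟨rfl, by linarith⟩

/-- Every instruction pays for the lengths of its operands, and its result is no longer than they
are together. The extra 1 is the length of the initial zeros. -/
theorem len_step_le {c c' : Config} (h : ∀ r, len (c.state.reg r) ≤ c.time + 1)
    (hc' : c' ∈ (step c).support) (r : ℕ) : len (c'.state.reg r) ≤ c'.time + 1 := by
  obtain ⟨todo, σ, t⟩ := c
  have upd : ∀ (x : ℕ) (v : ℤ) (t' : ℕ), t ≤ t' → len v ≤ t' + 1 →
      len ((σ.setReg x v).reg r) ≤ t' + 1 := by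
    intro x v t' ht hv
    rw [State.setReg_reg]
    split_ifs
    · exact hv
    · exact (h r).trans (by simpa using ht)
  have same : ∀ t', t ≤ t' → len (σ.reg r) ≤ t' + 1 := fun t' ht => (h r).trans (by simpa using ht)
  have sub_eq : ∀ a b : ℤ, len (a - b) ≤ len a + len b := fun a b => by
    rw [sub_eq_add_neg]; simpa [len] using len_add_le a (-b)
  have div_le : ∀ a b : ℤ, len (a / b) ≤ len a := fun a b =>
    Nat.succ_le_succ (Nat.size_le_size (Int.natAbs_ediv_le_natAbs a b))
  rcases todo with _ | ⟨p, K⟩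
  · simp only [step, PMF.mem_support_pure_iff] at hc'; subst hc'; exact h r
  cases p <;> simp only [step, PMF.mem_support_pure_iff, PMF.mem_support_map_iff] at hc'
  case coin x =>
    obtain ⟨b, -, rfl⟩ := hc'
    refine upd _ _ _ (Nat.le_succ t) ?_
    cases b <;> simp [len]
  all_goals (subst hc'; dsimp only)
  case const x v => exact upd _ _ _ (by omega) (by omega)
  case add x a b => exact upd _ _ _ (by omega) (by have := len_add_le (σ.reg a) (σ.reg b); omega)
  case sub x a b => exact upd _ _ _ (by omega) (by have := sub_eq (σ.reg a) (σ.reg b); omega)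
  case mul x a b => exact upd _ _ _ (by omega) (by have := len_mul_le (σ.reg a) (σ.reg b); omega)
  case div x a b => exact upd _ _ _ (by omega) (by have := div_le (σ.reg a) (σ.reg b); omega)
  case load x a => exact upd _ _ _ (by omega) (by omega)
  all_goals exact same _ (by omega)

theorem len_reg_le_time {c : Config} (h : ∀ r, len (c.state.reg r) ≤ c.time + 1) (N : ℕ) :
    ∀ c' ∈ (runFor N c).support, ∀ r, len (c'.state.reg r) ≤ c'.time + 1 := by
  induction N with
  | zero =>
    intro c' hc'
    simp only [runFor, PMF.mem_support_pure_iff] at hc'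
    subst hc'; exact h
  | succ N ih =>
    intro c' hc'
    simp only [runFor, PMF.mem_support_bind_iff] at hc'
    obtain ⟨d, hd, hc'⟩ := hc'
    exact len_step_le (ih d hd) hc'

/-- Compute an instance, let `p` decide it, and count the answer in register `15`. -/
def trial (gen : Cmd) (p : Prog) : Prog :=
  .seq (.incr 23 (-1)) (.seq gen.comp (.seq (.incr 7 1) (.seq (.clear (p.regs + 1))
    (.seq p.boxed (.seq (.ite 2 (.incr 15 1) (.incr 15 (-1))) (.incr 7 1))))))

/-- A bound for the time of a trial. -/
def trialTime (gen : Cmd) (p : Prog) (b k T : ℕ) : ℕ :=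
  k * (b * gen.cost) + boxFactor b * T + T + 2 * p.regs + 5 * b + 50

section
variable {E : Env} {Pre : (ℕ → ℤ) → Prop} {K : ℤ}

open Classical in
-- A wrong answer has probability at most 1/16, so it may multiply the term `f` by 16 while the mean
-- grows by a factor of at most 2. The trial uses up the classes of `J` and `J + 1`, for the
-- computation of the instance and for the guest; the next one starts at `J + 2` with clean memory.
theorem halts_trial {gen : Cmd} {p : Prog} {l : List ℤ} {Y : Prop} {T k : ℕ} {δ : ℝ≥0∞}
    (hp : DecidesWithin p l Y T δ) (hδ : δ ≤ 16⁻¹) {J : ℤ} (hL : Layout E True K J)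
    (hb : 1 ≤ E.b) {σ : State} (hσ : Ready E Pre K J σ)
    (hgen : ∃ k' ≤ k, ∃ s', Run E gen ⟨σ.vars, 0, 0⟩ k' s' ∧ Pre s'.v ∧
      (∀ i ≤ 5, s'.v i = σ.vars i) ∧ s'.O = memOfList l)
    (h23 : (σ.reg 23).natAbs < 2 ^ E.b) (h15 : (σ.reg 15).natAbs < 2 ^ E.b)
    {Φ : State → ℕ → ℝ≥0∞} {K₀ : List Prog} {t : ℕ} {w f : ℝ≥0∞}
    (hK : ∀ σ' t' (ok : Prop), Ready E Pre K (J + 2) σ' → (∀ i ≤ 5, σ'.vars i = σ.vars i) →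
      σ'.reg 19 = σ.reg 19 → σ'.reg 23 = σ.reg 23 - 1 →
      σ'.reg 15 = σ.reg 15 + (if (Y ↔ ok) then 1 else -1) →
      t' ≤ t + trialTime gen p E.b k T →
      Halts Φ ⟨K₀, σ', t'⟩ (if ok then w + f else w + 16 * f)) :
    Halts Φ ⟨trial gen p :: K₀, σ, t⟩ (w + 2 * f) := by
  have l1 : len 1 = 2 := by simp [len]
  have l2 : len (-1) = 2 := by simp [len]
  have hJ0 := hL.nonneg_J trivial
  have hJK := hL.J_lt trivial
  have hKb := hL.K_lt trivial
  obtain ⟨k', hk', s', hrun, hpre', hv', hO'⟩ := hgen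
  refine (det_incr (a := 23) (by norm_num) l2 σ h23).halts_seq fun t₁ ht₁ => ?_
  set σ₁ := (σ.setReg 1 (-1)).setReg 23 (σ.reg 23 + -1) with hσ₁
  have r1 : ∀ r, r ≠ 1 → r ≠ 23 → σ₁.reg r = σ.reg r := by
    intro r h h'; simp [hσ₁, h, h']
  have e1 : σ₁.reg 23 = σ.reg 23 - 1 := by simp [hσ₁]; ring
  have R1 : Ready E Pre K J σ₁ := hσ.of_agree (fun r hr => r1 r (by omega) (by omega)) rfl
  have hsim : Sim E True K J ⟨σ.vars, 0, 0⟩ σ₁ :=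
    ⟨fun i => r1 _ (by omega) (by omega), R1.inp, fun _ => R1.regK, fun _ => R1.regJ,
      fun _ a => R1.fresh J le_rfl (by omega) a, fun _ a => by
        rw [add_assoc]; exact R1.fresh (J + 1) (by omega) hJK a⟩
  have hBd : Bdd E ⟨σ.vars, 0, 0⟩ := ⟨hσ.bdd, fun a => by simp⟩
  obtain ⟨⟨σ₂, d2, S2, F2⟩, -⟩ := hrun.det_comp hL hBd (.inl trivial) hsim
  have hBd2 := hrun.bdd hBd
  refine d2.halts_seq fun t₂ ht₂ => ?_
  have e27 : σ₂.reg 7 = J := S2.regJ trivial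
  refine (det_incr (a := 7) (by norm_num) l1 σ₂ (B := E.b) (by rw [e27]; omega)).halts_seq
    fun t₃ ht₃ => ?_
  set σ₃ := (σ₂.setReg 1 1).setReg 7 (σ₂.reg 7 + 1) with hσ₃
  have r3 : ∀ r, r ≠ 1 → r ≠ 7 → σ₃.reg r = σ₂.reg r := by
    intro r h h'; simp [hσ₃, h, h']
  have e3 : σ₃.reg 7 = J + 1 := by simp [hσ₃, e27]
  obtain ⟨σ₄, d4, c4, r4, m4⟩ := det_clear (p.regs + 1) σ₃
  refine d4.halts_seq fun t₄ ht₄ => ?_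
  refine .det rfl ?_
  have m4' : σ₄.mem = σ₂.mem := by rw [m4]; rfl
  -- The output area now holds the encoded instance and becomes the entire memory of the guest.
  have hbox : Box K (J + 1) (p.regs + 1) σ₄ ⟨fun _ => 0, memOfList l⟩ σ₄ := by
    refine ⟨fun r hr => c4 r hr, fun a => ?_, fun _ _ _ => rfl, fun _ _ => rfl⟩
    rw [m4', ← add_assoc, S2.out trivial, hO']
  obtain ⟨N, hN1, hN2⟩ := hp
  have h43 : σ₄.reg 3 = K := by
    rw [r4 3 (by norm_num), r3 3 (by norm_num) (by norm_num)]; exact S2.regK trivial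
  have h47 : σ₄.reg 7 = J + 1 := by rw [r4 7 (by norm_num), e3]
  obtain ⟨S, hS⟩ : ∃ S : Set Config, S = {c | ¬ (c.Accepts ↔ Y)} := ⟨_, rfl⟩
  rw [← hS] at hN2
  have hval : expect (runFor N (init p l)) (fun c => if c ∈ S then w + 16 * f else w + f) ≤
      w + 2 * f := by
    refine (expect_two_values_le _ S hN2).trans ?_
    gcongr
    have : δ * (16 * f) ≤ f := by
      calc δ * (16 * f) ≤ 16⁻¹ * (16 * f) := by gcongr
        _ = f := by rw [← mul_assoc, ENNReal.inv_mul_cancel (by norm_num) (by norm_num), one_mul]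
    rw [two_mul]
    gcongr
  refine Halts.mono ?_ hval
  have main := halts_boxed (K := K) (J := J + 1) (m := p.regs + 1) (σ₀ := σ₄) (b := E.b)
    (by omega) (len_le_of_natAbs_lt hKb) (len_le_of_natAbs_lt (by omega)) h43 h47 (Φ := Φ)
    (K₀ := .seq (.ite 2 (.incr 15 1) (.incr 15 (-1))) (.incr 7 1) :: K₀) N (init p l) σ₄ (t₄ + 1)
    (fun c => if c ∈ S then w + 16 * f else w + f) (by simp [init])
    (fun c hc => (hN1 c hc).1) hbox
  refine main fun c hc σ₅ t₅ B5 ht₅ => ?_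
  have hcT := (hN1 c hc).2
  have hcT' : boxFactor E.b * c.time ≤ boxFactor E.b * T := Nat.mul_le_mul_left _ hcT
  have ht₅' : t₅ ≤ t₄ + 1 + boxFactor E.b * T := by
    have : t₅ + boxFactor E.b * (init p l).time ≤ t₄ + 1 + boxFactor E.b * c.time := ht₅
    simp only [init, mul_zero] at this
    omega
  have r5 : ∀ r, r % 4 = 0 ∨ (r % 4 = 3 ∧ r ≠ 7) → σ₅.reg r = σ₂.reg r := by
    intro r hr
    rw [B5.regs r (by omega) (by omega), r4 r (by omega), r3 r (by omega) (by omega)]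
  have r53 : ∀ r, r % 4 = 3 → r ≠ 7 → r ≠ 23 → σ₅.reg r = σ.reg r := by
    intro r hr h7 h23
    rw [r5 r (by omega), F2.reg r (by omega), r1 r (by omega) h23]
  have e57 : σ₅.reg 7 = J + 1 := by rw [B5.regs 7 (by norm_num) (by norm_num), h47]
  have e523 : σ₅.reg 23 = σ.reg 23 - 1 := by
    rw [r5 23 (by omega), F2.reg 23 (by omega), e1]
  have v5 : σ₅.vars = s'.v := funext fun i => by
    rw [State.vars, r5 _ (by omega), S2.vars]
  have R5 : ∀ σ₇ : State, σ₇.mem = σ₅.mem → σ₇.reg 7 = J + 2 →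
      (∀ r, r % 4 = 0 ∨ r = 3 → σ₇.reg r = σ₅.reg r) → Ready E Pre K (J + 2) σ₇ := by
    intro σ₇ hm7 h77 hr7
    have v7 : σ₇.vars = s'.v := by
      rw [← v5]; exact funext fun i => hr7 _ (by omega)
    refine ⟨v7 ▸ hpre', v7 ▸ hBd2.vars, ?_, ?_, h77, ?_⟩
    · intro a h0 h1
      rw [hm7, B5.rest a fun x => by
        rw [← add_assoc]; exact (hL.not_inp trivial h0 h1 x).2, m4']
      exact S2.inp a h0 h1
    · rw [hr7 3 (by omega), r5 3 (by omega)]; exact S2.regK trivial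
    · intro j hj hjK a
      have n1 : ∀ x, a * K + j ≠ x * K + (J + 1) := fun x h => by
        have := (class_inj (by omega) hjK (by omega) (by omega) h).2; omega
      have n2 : ∀ x, a * K + j ≠ x * K + J := fun x h => by
        have := (class_inj (by omega) hjK (by omega) (by omega) h).2; omega
      rw [hm7, B5.rest _ n1, m4', F2.mem _ fun _ x => ⟨n2 x, by rw [add_assoc]; exact n1 x⟩]
      exact R1.fresh j (by omega) hjK a
  have vv : ∀ σ₇ : State, (∀ r, r % 4 = 0 ∨ r = 3 → σ₇.reg r = σ₅.reg r) →
      ∀ i ≤ 5, σ₇.vars i = σ.vars i := by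
    intro σ₇ hr7 i hi
    rw [State.vars, hr7 _ (by omega), r5 _ (by omega), S2.vars, hv' i hi]
  have e52 : σ₅.reg 2 = c.state.reg 0 := B5.reg 0 (by omega)
  have e515 : σ₅.reg 15 = σ.reg 15 := r53 15 (by norm_num) (by norm_num) (by norm_num)
  set d : ℤ := if 0 < σ₅.reg 2 then 1 else -1 with hd
  have ld : len d = 2 := by rw [hd]; split_ifs <;> assumption
  -- The guest's answer register is tested outside of the box; its length is controlled by the time
  -- the guest has spent.
  have hlen : len (σ₅.reg 2) ≤ T + 1 := by
    rw [e52]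
    exact (len_reg_le_time (c := init p l) (fun r => by simp [init, len]) N c hc 0).trans
      (by omega)
  have d5 : Det (.ite 2 (.incr 15 1) (.incr 15 (-1))) σ₅ (len (σ₅.reg 2) + (E.b + 6))
      ((σ₅.setReg 1 d).setReg 15 (σ₅.reg 15 + d)) := by
    have := det_incr (a := 15) (by norm_num) ld σ₅ (B := E.b) (by rwa [e515])
    by_cases h : 0 < σ₅.reg 2
    · rw [hd, if_pos h] at this ⊢
      exact Det.ite_pos h this le_rfl
    · rw [hd, if_neg h] at this ⊢
      exact Det.ite_neg h this le_rfl
  refine d5.halts_seq fun t₆ ht₆ => ?_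
  set σ₆ := (σ₅.setReg 1 d).setReg 15 (σ₅.reg 15 + d) with hσ₆
  have r6 : ∀ r, r ≠ 1 → r ≠ 15 → σ₆.reg r = σ₅.reg r := by
    intro r h h'; simp [hσ₆, h, h']
  have e615 : σ₆.reg 15 = σ.reg 15 + d := by simp [hσ₆, e515]
  have e67 : σ₆.reg 7 = J + 1 := by rw [r6 7 (by norm_num) (by norm_num), e57]
  refine (det_incr (a := 7) (by norm_num) l1 σ₆ (B := E.b) (by rw [e67]; omega)).halts
    fun t₇ ht₇ => ?_
  set σ₇ := (σ₆.setReg 1 1).setReg 7 (σ₆.reg 7 + 1) with hσ₇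
  have r7 : ∀ r, r ≠ 1 → r ≠ 7 → σ₇.reg r = σ₆.reg r := by
    intro r h h'; simp [hσ₇, h, h']
  have r75 : ∀ r, r % 4 = 0 ∨ r = 3 → σ₇.reg r = σ₅.reg r := by
    intro r hr; rw [r7 r (by omega) (by omega), r6 r (by omega) (by omega)]
  have hfin := hK σ₇ t₇ (c ∉ S) (R5 σ₇ rfl (by simp [hσ₇, e67]; ring) r75) (vv σ₇ r75)
    (by rw [r7 19 (by norm_num) (by norm_num), r6 19 (by norm_num) (by norm_num),
      r53 19 (by norm_num) (by norm_num) (by norm_num)])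
    (by rw [r7 23 (by norm_num) (by norm_num), r6 23 (by norm_num) (by norm_num), e523])
    (by
      rw [r7 15 (by norm_num) (by norm_num), e615, hd, e52, hS]
      have : (Y ↔ c ∉ {c : Config | ¬ (c.Accepts ↔ Y)}) ↔ 0 < c.state.reg 0 := by
        simp only [Set.mem_ofPred_eq, not_not, Config.Accepts]; tauto
      simp only [this])
    (by
      have g1 : k' * (E.b * gen.cost) ≤ k * (E.b * gen.cost) := Nat.mul_le_mul_right _ hk'
      have g2 : T ≤ boxFactor E.b * T := le_boxFactor_mul _ _
      unfold trialTime at *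
      have g3 : boxFactor E.b * T ≤ boxFactor E.b * T := le_rfl
      omega)
  by_cases hcS : c ∈ S
  · simpa [hcS] using hfin
  · simpa [hcS] using hfin

end

end RAM

/-! ### Many instances: error of a vote, sum of the errors, and the complete driver -/

namespace RAM

/-- Decide the instance with the number `z` by majority vote, and record a positive answer. -/
def round (gen : Cmd) (p : Prog) : Prog :=
  .seq (.incr 19 (-1)) (.seq (.copy 19 20) (.seq (.const 15 0) (.seq (.copy 8 23)
    (.seq (.loop 23 (trial gen p)) (.ite 15 (.const 0 1) .skip)))))

def roundTime (r τ b : ℕ) : ℕ := r * (τ + b + 1) + 7 * b + 60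

/-- After a deterministic preparation, generate instances and decide them by the program `p`; the
answer is positive if one of the instances is. -/
def driver (pre ini gen : Cmd) (p : Prog) : Prog :=
  .seq pre.comp (.seq (.copy 12 3) (.seq (.copy 16 7) (.seq ini.comp (.seq (.incr 7 1)
    (.seq (.incr 7 1) (.seq (.copy 4 19) (.loop 19 (round gen p))))))))

theorem vars_setReg (σ : State) (i : ℕ) (a : ℤ) :
    (σ.setReg (4 * i) a).vars = Function.update σ.vars i a := by
  funext j
  simp only [State.vars, State.setReg_reg, Function.update_apply]
  exact if_congr (by omega) rfl rfl

section
variable {E : Env} {Pre : (ℕ → ℤ) → Prop} {K : ℤ}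

/-- The specification of a command that writes the instance number `z`, encoded by the list `l`. -/
def Generates (E : Env) (Pre : (ℕ → ℤ) → Prop) (gen : Cmd) (z : ℕ) (l : List ℤ) (k : ℕ) : Prop :=
  ∀ v : ℕ → ℤ, Pre v → v 5 = z → (∀ i, (v i).natAbs < 2 ^ E.b) →
    ∃ k' ≤ k, ∃ s', Run E gen ⟨v, 0, 0⟩ k' s' ∧ Pre s'.v ∧ (∀ i ≤ 5, s'.v i = v i) ∧
      s'.O = memOfList l

open Classical in
-- A Chernoff bound by a potential: `u` counts the wrong answers so far, and `f * 16 ^ u * 2 ^ R`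
-- with `R` trials to go does not increase in the mean, by `halts_trial`. Register 15 holds the
-- number of positive minus that of negative answers, which is `done - 2 * u` up to the sign given
-- by `Y`.
theorem halts_trials {gen : Cmd} {p : Prog} {l : List ℤ} {Y : Prop} {T k z : ℕ} {δ : ℝ≥0∞}
    (hp : DecidesWithin p l Y T δ) (hδ : δ ≤ 16⁻¹) (hb : 1 ≤ E.b)
    (hinp : ∀ a, 0 ≤ a → a < E.l → (E.x a).natAbs < 2 ^ E.b) (hKb : K.natAbs < 2 ^ E.b)
    (hgen : Generates E Pre gen z l k) {Φ : State → ℕ → ℝ≥0∞} {K₀ : List Prog} {w f : ℝ≥0∞}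
    (R : ℕ) : ∀ (J : ℤ) (σ : State) (t u done : ℕ), E.l ≤ J → 0 ≤ J → J + 2 * R < K →
    Ready E Pre K J σ → σ.vars 5 = z → σ.reg 23 = R → u ≤ done → done + R < 2 ^ E.b →
    σ.reg 15 = (if Y then 1 else -1) * (done - 2 * u) →
    (∀ (σ' : State) (t' u' : ℕ), Ready E Pre K (J + 2 * R) σ' → (∀ i ≤ 5, σ'.vars i = σ.vars i) →
      σ'.reg 19 = σ.reg 19 → σ'.reg 15 = (if Y then 1 else -1) * ((done + R : ℕ) - 2 * u') →
      u' ≤ done + R → t' ≤ t + R * (trialTime gen p E.b k T + E.b + 1) + E.b + 1 →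
      Halts Φ ⟨K₀, σ', t'⟩ (w + f * 16 ^ u')) →
    Halts Φ ⟨.loop 23 (trial gen p) :: K₀, σ, t⟩ (w + f * 16 ^ u * 2 ^ R) := by
  induction R with
  | zero =>
    intro J σ t u done _ _ _ hσ _ h23 hu _ h15 hK
    refine (Det.loop_done (by rw [h23]; simp)).halts fun t' ht' => ?_
    rw [pow_zero, mul_one]
    have l0 : len (σ.reg 23) = 1 := by rw [h23]; simp [len]
    exact hK σ t' u (by simpa using hσ) (fun _ _ => rfl) rfl (by simpa using h15) hu (by omega)
  | succ R ih =>
    intro J σ t u done hlJ hJ0 hJK hσ hz h23 hu hdone h15 hK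
    push_cast at hJK h23
    have l0 : len (σ.reg 23) ≤ E.b + 1 := len_le_of_natAbs_lt (by rw [h23]; omega)
    refine .det (c' := ⟨trial gen p :: .loop 23 (trial gen p) :: K₀, σ, t + len (σ.reg 23)⟩) ?_ ?_
    · simp only [step]; rw [if_pos (by rw [h23]; omega)]
    have hL : Layout E True K J := ⟨hb, hinp, fun _ => hlJ, fun _ => hJ0, fun _ => by omega,
      fun _ => hKb⟩
    have h15b : (σ.reg 15).natAbs < 2 ^ E.b := by
      rw [h15]; split_ifs <;> omega
    have e : w + f * 16 ^ u * 2 ^ (R + 1) = w + 2 * (f * 16 ^ u * 2 ^ R) := by ring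
    rw [e]
    refine halts_trial hp hδ hL hb hσ (hgen _ hσ.pre hz hσ.bdd) (by rw [h23]; omega) h15b ?_
    intro σ' t' ok R' hv' h19' h23' h15' ht'
    have e2 : (if ok then w + f * 16 ^ u * 2 ^ R else w + 16 * (f * 16 ^ u * 2 ^ R)) =
        w + f * 16 ^ (if ok then u else u + 1) * 2 ^ R := by
      split_ifs
      · rfl
      · ring
    rw [e2]
    refine ih (J + 2) σ' t' _ (done + 1) (by omega) (by omega) (by omega) R'
      (by rw [hv' 5 le_rfl, hz]) (by rw [h23', h23]; ring) (by split_ifs <;> omega) (by omega) ?_ ?_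
    · rw [h15', h15]
      by_cases hY : Y <;> by_cases hok : ok <;> simp [hY, hok] <;> ring
    · intro σ₁ t₁ u₁ R₁ hv₁ h19₁ h15₁ hu₁ ht₁
      refine hK σ₁ t₁ u₁ ?_ (fun i hi => (hv₁ i hi).trans (hv' i hi)) (h19₁.trans h19') ?_ ?_ ?_
      · convert R₁ using 1; push_cast; ring
      · rw [h15₁]; congr 2; push_cast; ring
      · omega
      · have : (R + 1) * (trialTime gen p E.b k T + E.b + 1) =
          R * (trialTime gen p E.b k T + E.b + 1) + (trialTime gen p E.b k T + E.b + 1) := by ring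
        omega

/-- The failure probability of a majority vote among `r` trials. -/
noncomputable def voteError (r : ℕ) : ℝ≥0∞ := (4⁻¹ : ℝ≥0∞) ^ r * 2 ^ r

/-- If at least half of the answers are wrong, then `16 ^ u ≥ 4 ^ r`. Together with the factor `2 ^
r` gained in the mean, this bounds the probability of a wrong vote by `2 ^ r / 4 ^ r`. -/
theorem one_le_of_vote_wrong {r u : ℕ} (h : r ≤ 2 * u) : 1 ≤ (4⁻¹ : ℝ≥0∞) ^ r * 16 ^ u := by
  calc (1 : ℝ≥0∞) = 4⁻¹ ^ r * 4 ^ r := by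
        rw [← mul_pow, ENNReal.inv_mul_cancel (by norm_num) (by norm_num), one_pow]
    _ ≤ 4⁻¹ ^ r * 4 ^ (2 * u) := by gcongr; norm_num
    _ = _ := by rw [pow_mul]; norm_num

open Classical in
-- A union bound as an induction on the remaining instances, which are processed from the last to
-- the first. If the recorded answer is right about the instances from `rem` on, the expected loss
-- is at most `rem * voteError r`; otherwise the trivial bound 1 is carried along.
theorem halts_rounds {gen : Cmd} {p : Prog} {l : ℕ → List ℤ} {Y : ℕ → Prop} {a₀ : Prop}
    {T k r Z : ℕ} {δ : ℝ≥0∞} (hp : ∀ z < Z, DecidesWithin p (l z) (Y z) T δ) (hδ : δ ≤ 16⁻¹)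
    (hb : 1 ≤ E.b)
    (hinp : ∀ a, 0 ≤ a → a < E.l → (E.x a).natAbs < 2 ^ E.b) (hKb : K.natAbs < 2 ^ E.b)
    (hgen : ∀ z < Z, Generates E Pre gen z (l z) k)
    (hPre : ∀ v, Pre v → v 2 = r) (hPre' : ∀ v i a, i = 0 ∨ i = 5 → Pre v →
      Pre (Function.update v i a))
    (hZr : Z * voteError r ≤ 1)
    {Φ : State → ℕ → ℝ≥0∞} {Tmax : ℕ}
    (hΦ : ∀ σ t, t ≤ Tmax → Φ σ t ≤ if (0 < σ.reg 0 ↔ (a₀ ∨ ∃ z < Z, Y z)) then 0 else 1)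
    (rem : ℕ) : ∀ (J : ℤ) (σ : State) (t : ℕ), rem ≤ Z → E.l ≤ J → 0 ≤ J →
    J + 2 * (rem * r) < K → Ready E Pre K J σ → σ.reg 19 = rem → rem < 2 ^ E.b →
    t + rem * (roundTime r (trialTime gen p E.b k T) E.b) + 1 ≤ Tmax →
    Halts Φ ⟨[.loop 19 (round gen p)], σ, t⟩
      (if (0 < σ.vars 0 ↔ (a₀ ∨ ∃ z < Z, rem ≤ z ∧ Y z)) then rem * voteError r else 1) := by
  induction rem with
  | zero =>
    intro J σ t _ _ _ _ hσ h19 _ ht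
    refine (Det.loop_done (by rw [h19]; simp)).halts fun t' ht' => .done ?_
    have l0 : len (σ.reg 19) = 1 := by rw [h19]; simp [len]
    simpa [State.vars] using hΦ σ t' (by omega)
  | succ z ih =>
    intro J σ t hzZ hlJ hJ0 hJK hσ h19 hzb ht
    push_cast at hJK h19
    have hzZ' : z < Z := hzZ
    have hr2 : σ.vars 2 = r := hPre _ hσ.pre
    have hrb : r < 2 ^ E.b := by have := hσ.bdd 2; rw [hr2] at this; simpa using this
    have l0 : len (σ.reg 19) ≤ E.b + 1 := len_le_of_natAbs_lt (by rw [h19]; omega)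
    have lm : len (-1) = 2 := by simp [len]
    have hrt : roundTime r (trialTime gen p E.b k T) E.b =
      r * (trialTime gen p E.b k T + E.b + 1) + 7 * E.b + 60 := rfl
    have ht2 : (z + 1) * roundTime r (trialTime gen p E.b k T) E.b =
      z * roundTime r (trialTime gen p E.b k T) E.b +
        (r * (trialTime gen p E.b k T + E.b + 1) + 7 * E.b + 60) := by rw [← hrt]; ring
    refine .det (c' := ⟨[round gen p, .loop 19 (round gen p)], σ, t + len (σ.reg 19)⟩) ?_ ?_
    · simp only [step]; rw [if_pos (by rw [h19]; omega)]
    refine (det_incr (a := 19) (by norm_num) lm σ (B := E.b) (by rw [h19]; omega)).halts_seq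
      fun t₁ ht₁ => ?_
    set σ₁ := (σ.setReg 1 (-1)).setReg 19 (σ.reg 19 + -1) with hσ₁
    have e19 : σ₁.reg 19 = z := by simp [hσ₁, h19]
    have R1 : Ready E Pre K J σ₁ := hσ.of_agree (fun r hr => by
      simp only [hσ₁, State.setReg_reg]; rw [if_neg (by omega), if_neg (by omega)]) rfl
    have v1 : σ₁.vars = σ.vars := funext fun i => by
      simp only [State.vars, hσ₁, State.setReg_reg]; rw [if_neg (by omega), if_neg (by omega)]
    refine (det_copy (a := 19) (by norm_num) σ₁ (B := E.b) (by rw [e19]; omega)).halts_seq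
      fun t₂ ht₂ => ?_
    rw [e19]
    refine (Det.const _ 15 0).halts_seq fun t₃ ht₃ => ?_
    have lz : len 0 = 1 := by simp [len]
    rw [lz] at ht₃
    set σ₃ := ((σ₁.setReg 1 0).setReg (4 * 5) z).setReg 15 0 with hσ₃
    change Halts Φ ⟨_ :: _, σ₃, t₃⟩ _
    have v3 : σ₃.vars = Function.update σ.vars 5 z := by
      have : σ₃.vars = ((σ₁.setReg 1 0).setReg (4 * 5) z).vars := funext fun i => by
        simp only [State.vars, hσ₃, State.setReg_reg]; rw [if_neg (by omega)]
      rw [this, vars_setReg]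
      congr 1
      rw [← v1]
      exact funext fun i => by simp only [State.vars, State.setReg_reg]; rw [if_neg (by omega)]
    have R3 : Ready E Pre K J σ₃ := by
      refine ⟨v3 ▸ hPre' _ _ _ (.inr rfl) hσ.pre, ?_, hσ.inp, ?_, ?_, hσ.fresh⟩
      · intro i
        rw [v3, Function.update_apply]
        split_ifs
        · simp only [Int.natAbs_natCast]; omega
        · exact hσ.bdd i
      · simp [hσ₃, R1.regK]
      · simp [hσ₃, R1.regJ]
    have e32 : σ₃.reg 8 = r := by
      have := congrFun v3 2
      simpa [State.vars, Function.update_apply] using this.trans (by simp [hr2])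
    refine (det_copy (a := 8) (by norm_num) σ₃ (B := E.b) (by rw [e32]; simpa using hrb)).halts_seq
      fun t₄ ht₄ => ?_
    rw [e32]
    set σ₄ := (σ₃.setReg 1 0).setReg 23 r with hσ₄
    have v4 : σ₄.vars = Function.update σ.vars 5 z := by
      rw [← v3]
      exact funext fun i => by
        simp only [State.vars, hσ₄, State.setReg_reg]; rw [if_neg (by omega), if_neg (by omega)]
    have R4 : Ready E Pre K J σ₄ := R3.of_agree (fun r hr => by
      simp only [hσ₄, State.setReg_reg]; rw [if_neg (by omega), if_neg (by omega)]) rfl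
    have e419 : σ₄.reg 19 = z := by simp [hσ₄, hσ₃, e19]
    have e415 : σ₄.reg 15 = 0 := by simp [hσ₄, hσ₃]
    refine .det rfl ?_
    have hJK' : J + 2 * r < K := by
      have : (0 : ℤ) ≤ z * r := by positivity
      nlinarith
    -- what follows the vote
    have final : ∀ (σ' : State) (t' u' : ℕ) (val : ℝ≥0∞), Ready E Pre K (J + 2 * r) σ' →
        (∀ i ≤ 5, σ'.vars i = σ₄.vars i) → σ'.reg 19 = σ₄.reg 19 →
        σ'.reg 15 = (if Y z then 1 else -1) * ((r : ℕ) - 2 * u') → u' ≤ r →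
        t' ≤ t₄ + 1 + r * (trialTime gen p E.b k T + E.b + 1) + E.b + 1 →
        (∀ a : ℤ, a = (if 0 < σ'.reg 15 then 1 else σ.vars 0) →
          (if (0 < a ↔ (a₀ ∨ ∃ z' < Z, z ≤ z' ∧ Y z')) then z * voteError r else 1) ≤ val) →
        Halts Φ ⟨[.ite 15 (.const 0 1) .skip, .loop 19 (round gen p)], σ', t'⟩ val := by
      intro σ' t' u' val R' hv' h19' h15' hu' ht' hval
      have hv0 : σ'.vars 0 = σ.vars 0 := by rw [hv' 0 (by norm_num), v4]; simp
      have l15 : len (σ'.reg 15) ≤ E.b + 1 := len_le_of_natAbs_lt (by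
        rw [h15']; split_ifs <;> omega)
      have l1 : len 1 = 2 := by simp [len]
      have hJ2 : J + 2 * r + 2 * (z * r) < K := by
        rw [add_mul, one_mul] at hJK; linarith
      by_cases h : 0 < σ'.reg 15
      · refine (Det.ite_pos h (Det.const _ 0 1) le_rfl).halts fun t₅ ht₅ => ?_
        have v5 : (σ'.setReg 0 1).vars = Function.update σ'.vars 0 1 := vars_setReg σ' 0 1
        refine (ih (J + 2 * r) (σ'.setReg 0 1) t₅ (by omega) (by omega) (by omega)
          hJ2 ⟨?_, ?_, R'.inp, ?_, ?_, R'.fresh⟩ ?_ (by omega) (by omega)).mono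
          (hval _ (by rw [v5, if_pos h]; simp))
        · rw [v5]; exact hPre' _ _ _ (.inl rfl) R'.pre
        · intro i
          rw [v5, Function.update_apply]
          split_ifs
          · exact Nat.one_lt_two_pow (by omega)
          · exact R'.bdd i
        · simp [R'.regK]
        · simp [R'.regJ]
        · simp [h19', e419]
      · refine (Det.ite_neg h (Det.skip _) le_rfl).halts fun t₅ ht₅ => ?_
        exact (ih (J + 2 * r) σ' t₅ (by omega) (by omega) (by omega)
          hJ2 R' (by rw [h19', e419]) (by omega) (by omega)).mono
          (hval _ (by rw [if_neg h, hv0]))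
    have vote : ∀ w f : ℝ≥0∞, (∀ (σ' : State) (t' u' : ℕ), Ready E Pre K (J + 2 * r) σ' →
        (∀ i ≤ 5, σ'.vars i = σ₄.vars i) → σ'.reg 19 = σ₄.reg 19 →
        σ'.reg 15 = (if Y z then 1 else -1) * ((0 + r : ℕ) - 2 * u') →
        u' ≤ 0 + r → t' ≤ t₄ + 1 + r * (trialTime gen p E.b k T + E.b + 1) + E.b + 1 →
        Halts Φ ⟨[.ite 15 (.const 0 1) .skip, .loop 19 (round gen p)], σ', t'⟩ (w + f * 16 ^ u')) →
        Halts Φ ⟨[.loop 23 (trial gen p), .ite 15 (.const 0 1) .skip, .loop 19 (round gen p)],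
          σ₄, t₄ + 1⟩ (w + f * 2 ^ r) := by
      intro w f h
      have := halts_trials (hp z hzZ') hδ hb hinp hKb (hgen z hzZ') (K₀ := [.ite 15 (.const 0 1)
        .skip, .loop 19 (round gen p)]) (Φ := Φ) (w := w) (f := f) r J σ₄ (t₄ + 1) 0 0 hlJ hJ0 hJK'
        R4 (by rw [v4]; simp) (by simp [hσ₄]) le_rfl (by omega) (by rw [e415]; simp) h
      simpa using this
    have hzη : (z : ℝ≥0∞) * voteError r ≤ 1 := by
      refine le_trans ?_ hZr
      gcongr
    have hsplit : (∃ z' < Z, z ≤ z' ∧ Y z') ↔ (Y z ∨ ∃ z' < Z, z + 1 ≤ z' ∧ Y z') := by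
      constructor
      · rintro ⟨z', h1, h2, h3⟩
        rcases h2.eq_or_lt with rfl | h2
        · exact .inl h3
        · exact .inr ⟨z', h1, h2, h3⟩
      · rintro (h | ⟨z', h1, h2, h3⟩)
        · exact ⟨z, hzZ', le_rfl, h⟩
        · exact ⟨z', h1, by omega, h3⟩
    split_ifs with hgood
    -- The expected loss splits into the share of the later rounds, kept in `w`, and the potential
    -- of the present vote with `f = 4⁻¹ ^ r`.
    · have e : ((z + 1 : ℕ) : ℝ≥0∞) * voteError r = z * voteError r + 4⁻¹ ^ r * 2 ^ r := by
        push_cast; rw [add_mul, one_mul]; rfl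
      rw [e]
      refine vote _ _ fun σ' t' u' R' hv' h19' h15' hu' ht' => final σ' t' u' _ R' hv' h19'
        (by simpa using h15') (by simpa using hu') ht' fun a ha => ?_
      by_cases hbad : r ≤ 2 * u'
      · refine le_trans ?_ ((one_le_of_vote_wrong hbad).trans le_add_self)
        split_ifs
        · exact hzη
        · exact le_rfl
      · rw [if_pos]
        · exact le_self_add
        · rw [ha, hsplit]
          by_cases hY : Y z
          · have : 0 < σ'.reg 15 := by rw [h15', if_pos hY]; omega
            rw [if_pos this]; simp [hY]
          · have : ¬ 0 < σ'.reg 15 := by rw [h15', if_neg hY]; omega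
            rw [if_neg this, hgood]; simp [hY]
    -- The recorded answer is already wrong, and no potential is needed.
    · have h1 := vote 1 0 fun σ' t' u' R' hv' h19' h15' hu' ht' => final σ' t' u' _ R' hv' h19'
        (by simpa using h15') (by simpa using hu') ht' fun a ha => by
        rw [zero_mul, add_zero]
        split_ifs
        · exact hzη
        · exact le_rfl
      simpa using h1

end

/-- The data of a reduction of one instance, encoded by the list `x`, to a sequence of instances
that are encoded by the lists `l z`. -/
structure Plan (pre ini gen : Cmd) (x : List ℤ) (l : ℕ → List ℤ) (a₀ : Prop) (Z r b k₀ k₁ k₂ : ℕ) :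
    Type where
  Pre : (ℕ → ℤ) → Prop
  K : ℤ
  J : ℤ
  b_pos : 1 ≤ b
  inp : ∀ a ∈ x, a.natAbs < 2 ^ b
  pureIn : pre.pureIn = true
  le_J : x.length ≤ J
  J_lt : J + 2 + 2 * (Z * r) < K
  K_lt : K.natAbs < 2 ^ b
  Z_lt : Z < 2 ^ b
  pre_spec : ∀ v, Pre v → v 1 = Z ∧ v 2 = r ∧ v 3 = K ∧ v 4 = J
  pre_update : ∀ v i a, i = 0 ∨ i = 5 → Pre v → Pre (Function.update v i a)
  pre_run : ∃ k ≤ k₀, ∃ s', Run ⟨memOfList x, x.length, b⟩ pre ⟨0, 0, 0⟩ k s' ∧ Pre s'.v ∧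
    s'.v 0 = 0
  ini_run : ∀ v : ℕ → ℤ, Pre v → v 0 = 0 → (∀ i, (v i).natAbs < 2 ^ b) → ∃ k ≤ k₁, ∃ s',
    Run ⟨memOfList x, x.length, b⟩ ini ⟨v, 0, 0⟩ k s' ∧ Pre s'.v ∧ (0 < s'.v 0 ↔ a₀)
  gen_run : ∀ z < Z, Generates ⟨memOfList x, x.length, b⟩ Pre gen z (l z) k₂

/-- The time of the driver. -/
def driverTime (pre ini gen : Cmd) (p : Prog) (Z r b k₀ k₁ k₂ T : ℕ) : ℕ :=
  k₀ * (b * pre.cost) + k₁ * (b * ini.cost) + Z * roundTime r (trialTime gen p b k₂ T) b +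
    10 * b + 100

theorem memOfList_natAbs_lt {x : List ℤ} {b : ℕ} (h : ∀ a ∈ x, a.natAbs < 2 ^ b) (a : ℤ) :
    (memOfList x a).natAbs < 2 ^ b := by
  unfold memOfList
  split_ifs
  · rw [List.getD_eq_getElem?_getD]
    rcases h' : x[a.toNat]? with _ | y
    · simp
    · exact h y (List.mem_of_getElem? h')
  · simp

/-- The preparation reads only the input, since it is what computes `K` and `J`. Then `ini` uses the
classes of `J` and `J + 1`, and the trials use new classes from `J + 2` on. -/
theorem Plan.decidesWithin {pre ini gen : Cmd} {x : List ℤ} {l : ℕ → List ℤ} {a₀ : Prop}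
    {Y : ℕ → Prop} {Z r b k₀ k₁ k₂ T : ℕ} (P : Plan pre ini gen x l a₀ Z r b k₀ k₁ k₂) {p : Prog}
    {δ : ℝ≥0∞} (hδ : δ ≤ 16⁻¹) (hp : ∀ z < Z, DecidesWithin p (l z) (Y z) T δ)
    (hZr : Z * voteError r ≤ 1) :
    DecidesWithin (driver pre ini gen p) x (a₀ ∨ ∃ z < Z, Y z)
      (driverTime pre ini gen p Z r b k₀ k₁ k₂ T) (Z * voteError r) := by
  classical
  refine decidesWithin_of_halts (ne_top_of_le_ne_top ENNReal.one_ne_top hZr) ?_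
  set Tm := driverTime pre ini gen p Z r b k₀ k₁ k₂ T with hTm
  have hTm' : Tm = k₀ * (b * pre.cost) + k₁ * (b * ini.cost) +
    Z * roundTime r (trialTime gen p b k₂ T) b + 10 * b + 100 := rfl
  set E : Env := ⟨memOfList x, x.length, b⟩ with hE
  have l1 : len 1 = 2 := by simp [len]
  have hJl := P.le_J
  have hJK := P.J_lt
  have hKb := P.K_lt
  have hZr0 : (0 : ℤ) ≤ Z * r := by positivity
  have hinp : ∀ a, 0 ≤ a → a < E.l → (E.x a).natAbs < 2 ^ E.b := fun a _ _ =>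
    memOfList_natAbs_lt P.inp a
  -- No memory area is available in the first phase.
  have hL0 : Layout E False P.K P.J := ⟨P.b_pos, hinp, nofun, nofun, nofun, nofun⟩
  have hL : Layout E True P.K P.J := ⟨P.b_pos, hinp, fun _ => hJl, fun _ => by omega,
    fun _ => by omega, fun _ => hKb⟩
  obtain ⟨k, hk, s₁, run1, pre1, z1⟩ := P.pre_run
  have B0 : Bdd E ⟨0, 0, 0⟩ := ⟨fun _ => by simp, fun _ => by simp⟩
  obtain ⟨⟨σ₁, d1, S1, F1⟩, -⟩ := run1.det_comp hL0 B0 (.inr P.pureIn)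
    (σ := ⟨fun _ => 0, memOfList x⟩) ⟨fun _ => rfl, fun _ _ _ => rfl, nofun, nofun, nofun, nofun⟩
  have B1 := run1.bdd B0
  obtain ⟨p1, p2, p3, p4⟩ := P.pre_spec _ pre1
  refine d1.halts_seq fun t₁ ht₁ => ?_
  have e12 : σ₁.reg 12 = P.K := (S1.vars 3).trans p3
  have e16 : σ₁.reg 16 = P.J := (S1.vars 4).trans p4
  refine (det_copy (a := 12) (by norm_num) σ₁ (B := b) (by rw [e12]; exact hKb)).halts_seq
    fun t₂ ht₂ => ?_
  rw [e12]
  refine (det_copy (a := 16) (by norm_num) _ (B := b) (by simp [e16]; omega)).halts_seq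
    fun t₃ ht₃ => ?_
  set σ₃ := (((σ₁.setReg 1 0).setReg 3 P.K).setReg 1 0).setReg 7
    (((σ₁.setReg 1 0).setReg 3 P.K).reg 16) with hσ₃
  have m3 : σ₃.mem = memOfList x := funext fun a => F1.mem a nofun
  have v3 : σ₃.vars = s₁.v := funext fun i => by
    simp only [State.vars, hσ₃, State.setReg_reg]
    rw [if_neg (by omega), if_neg (by omega), if_neg (by omega), if_neg (by omega), S1.vars]
  -- All classes from `J` on are initially zero, as the input ends before cell `J` and negative
  -- cells hold zero.
  have out : ∀ j, P.J ≤ j → j < P.K → ∀ a, memOfList x (a * P.K + j) = 0 := by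
    intro j hj hjK a
    unfold memOfList
    split_ifs with h
    · rw [List.getD_eq_default]
      have : 0 ≤ a := by
        by_contra ha
        have : a * P.K ≤ -1 * P.K := mul_le_mul_of_nonneg_right (by omega) (by omega)
        omega
      have : 0 ≤ a * P.K := mul_nonneg this (by omega)
      omega
    · rfl
  have r37 : σ₃.reg 7 = P.J := by simp [hσ₃, e16]
  have r33 : σ₃.reg 3 = P.K := by simp [hσ₃]
  have S3 : Sim E True P.K P.J ⟨s₁.v, 0, 0⟩ σ₃ :=
    ⟨fun i => congrFun v3 i, fun a _ _ => by rw [m3], fun _ => r33, fun _ => r37,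
      fun _ a => by rw [m3]; exact out _ le_rfl (by omega) a,
      fun _ a => by rw [m3, add_assoc]; exact out _ (by omega) (by omega) a⟩
  obtain ⟨k', hk', s₄, run4, pre4, a4⟩ := P.ini_run s₁.v pre1 z1 B1.vars
  have B1' : Bdd E ⟨s₁.v, 0, 0⟩ := ⟨B1.vars, fun _ => by simp⟩
  obtain ⟨⟨σ₄, d4, S4, F4⟩, -⟩ := run4.det_comp hL B1' (.inl trivial) S3
  have B4 := run4.bdd B1'
  refine d4.halts_seq fun t₄ ht₄ => ?_
  have r47 : σ₄.reg 7 = P.J := S4.regJ trivial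
  refine (det_incr (a := 7) (by norm_num) l1 σ₄ (B := b) (by rw [r47]; omega)).halts_seq
    fun t₅ ht₅ => ?_
  rw [r47]
  refine (det_incr (a := 7) (by norm_num) l1 _ (B := b) (by simp; omega)).halts_seq
    fun t₆ ht₆ => ?_
  set σ₆ := (((σ₄.setReg 1 1).setReg 7 (P.J + 1)).setReg 1 1).setReg 7
    (((σ₄.setReg 1 1).setReg 7 (P.J + 1)).reg 7 + 1) with hσ₆
  obtain ⟨q1, q2, q3, q4⟩ := P.pre_spec _ pre4
  have v6 : σ₆.vars = s₄.v := funext fun i => by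
    simp only [State.vars, hσ₆, State.setReg_reg]
    rw [if_neg (by omega), if_neg (by omega), if_neg (by omega), if_neg (by omega), S4.vars]
  have e64 : σ₆.reg 4 = Z := (congrFun v6 1).trans q1
  refine (det_copy (a := 4) (by norm_num) σ₆ (B := b)
    (by rw [e64]; simpa using P.Z_lt)).halts_seq fun t₇ ht₇ => ?_
  rw [e64]
  set σ₇ := (σ₆.setReg 1 0).setReg 19 Z with hσ₇
  have v7 : σ₇.vars = s₄.v := by
    rw [← v6]
    exact funext fun i => by
      simp only [State.vars, hσ₇, State.setReg_reg]; rw [if_neg (by omega), if_neg (by omega)]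
  have R7 : Ready E P.Pre P.K (P.J + 2) σ₇ := by
    refine ⟨v7 ▸ pre4, v7 ▸ B4.vars, fun a h0 h1 => S4.inp a h0 h1, ?_, ?_, ?_⟩
    · simpa [hσ₇, hσ₆] using S4.regK trivial
    · simp [hσ₇, hσ₆]; ring
    · intro j hj hjK a
      have n1 : ∀ x, a * P.K + j ≠ x * P.K + (P.J + 1) := fun x h => by
        have := (class_inj (by omega) hjK (by omega) (by omega) h).2; omega
      have n2 : ∀ x, a * P.K + j ≠ x * P.K + P.J := fun x h => by
        have := (class_inj (by omega) hjK (by omega) (by omega) h).2; omega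
      have : σ₇.mem (a * P.K + j) = σ₄.mem (a * P.K + j) := rfl
      rw [this, F4.mem _ fun _ x => ⟨n2 x, by rw [add_assoc]; exact n1 x⟩, m3]
      exact out j (by omega) hjK a
  have main := halts_rounds (E := E) (a₀ := a₀) hp hδ P.b_pos hinp hKb P.gen_run
    (fun v hv => (P.pre_spec v hv).2.1) P.pre_update hZr (Φ := loss (a₀ ∨ ∃ z < Z, Y z) Tm)
    (Tmax := Tm) (fun σ t ht => by
      unfold loss; rw [if_neg (by omega)]; exact le_of_eq (by congr))
    Z (P.J + 2) σ₇ t₇ le_rfl (by change (x.length : ℤ) ≤ _; omega) (by omega) hJK R7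
    (by simp [hσ₇]) P.Z_lt (by
      have g1 : k * (b * pre.cost) ≤ k₀ * (b * pre.cost) := Nat.mul_le_mul_right _ hk
      have g2 : k' * (b * ini.cost) ≤ k₁ * (b * ini.cost) := Nat.mul_le_mul_right _ hk'
      have e1 : E.b = b := rfl
      rw [e1] at ht₁ ht₄ ⊢
      omega)
  rwa [if_pos] at main
  rw [v7, a4]
  constructor
  · exact .inl
  · rintro (h | ⟨z, h1, h2, -⟩)
    · exact h
    · omega

end RAM

namespace RAM

/-! ### Reasoning about commands -/

namespace Expr

instance : Add Expr := ⟨add⟩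
instance : Sub Expr := ⟨sub⟩
instance : Mul Expr := ⟨mul⟩
instance : Div Expr := ⟨div⟩
instance (n : ℕ) : OfNat Expr n := ⟨lit n⟩

/-- The remainder of a division. -/
def mod (a b : Expr) : Expr := a - b * (a / b)

/-- `1` if the values are equal, otherwise `0`. -/
def eqb (a b : Expr) : Expr := ite (a - b) 0 (ite (b - a) 0 1)

/-- `1` if the first value is smaller, otherwise `0`. -/
def ltb (a b : Expr) : Expr := ite (b - a) 1 0

section
variable (x : ℤ → ℤ) (v : ℕ → ℤ) (W : ℤ → ℤ) (l : ℤ) (a b c : Expr)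

@[simp] theorem ev_lit (n : ℤ) : (lit n).ev x v W = n := Eq.trans rfl rfl
@[simp] theorem ev_zero : (0 : Expr).ev x v W = 0 := Eq.trans rfl rfl
@[simp] theorem ev_one : (1 : Expr).ev x v W = 1 := Eq.trans rfl rfl
@[simp] theorem ev_ofNat (n : ℕ) [n.AtLeastTwo] :
    (no_index (OfNat.ofNat n) : Expr).ev x v W = OfNat.ofNat n := Eq.trans rfl rfl
@[simp] theorem ev_var (i : ℕ) : (var i).ev x v W = v i := Eq.trans rfl rfl
@[simp] theorem ev_add : (a + b).ev x v W = a.ev x v W + b.ev x v W := Eq.trans rfl rfl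
@[simp] theorem ev_sub : (a - b).ev x v W = a.ev x v W - b.ev x v W := Eq.trans rfl rfl
@[simp] theorem ev_mul : (a * b).ev x v W = a.ev x v W * b.ev x v W := Eq.trans rfl rfl
@[simp] theorem ev_div : (a / b).ev x v W = a.ev x v W / b.ev x v W := Eq.trans rfl rfl
@[simp] theorem ev_inp : (inp a).ev x v W = x (a.ev x v W) := Eq.trans rfl rfl
@[simp] theorem ev_wrk : (wrk a).ev x v W = W (a.ev x v W) := Eq.trans rfl rfl
@[simp] theorem ev_ite : (ite c a b).ev x v W =
    if 0 < c.ev x v W then a.ev x v W else b.ev x v W := Eq.trans rfl rfl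
@[simp] theorem ev_mod : (mod a b).ev x v W = a.ev x v W % b.ev x v W := by
  simp [mod, Int.emod_def]
@[simp] theorem ev_eqb : (eqb a b).ev x v W = if a.ev x v W = b.ev x v W then 1 else 0 := by
  simp only [eqb, ev_ite, ev_sub, ev_zero, ev_one]
  rcases lt_trichotomy (a.ev x v W) (b.ev x v W) with h | h | h
  · rw [if_neg (by omega), if_pos (by omega), if_neg h.ne]
  · rw [if_neg (by omega), if_neg (by omega), if_pos h]
  · rw [if_pos (by omega), if_neg h.ne']
@[simp] theorem ev_ltb : (ltb a b).ev x v W = if a.ev x v W < b.ev x v W then 1 else 0 := by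
  simp [ltb]

@[simp] theorem ok_lit (n : ℤ) : (lit n).ok l x v W ↔ True := Iff.rfl
@[simp] theorem ok_zero : (0 : Expr).ok l x v W ↔ True := Iff.rfl
@[simp] theorem ok_one : (1 : Expr).ok l x v W ↔ True := Iff.rfl
@[simp] theorem ok_ofNat (n : ℕ) [n.AtLeastTwo] :
    (no_index (OfNat.ofNat n) : Expr).ok l x v W ↔ True := Iff.rfl
@[simp] theorem ok_var (i : ℕ) : (var i).ok l x v W ↔ True := Iff.rfl
@[simp] theorem ok_add : (a + b).ok l x v W ↔ a.ok l x v W ∧ b.ok l x v W := Iff.rfl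
@[simp] theorem ok_sub : (a - b).ok l x v W ↔ a.ok l x v W ∧ b.ok l x v W := Iff.rfl
@[simp] theorem ok_mul : (a * b).ok l x v W ↔ a.ok l x v W ∧ b.ok l x v W := Iff.rfl
@[simp] theorem ok_div : (a / b).ok l x v W ↔ a.ok l x v W ∧ b.ok l x v W := Iff.rfl
@[simp] theorem ok_inp : (inp a).ok l x v W ↔
    a.ok l x v W ∧ 0 ≤ a.ev x v W ∧ a.ev x v W < l := Iff.rfl
@[simp] theorem ok_wrk : (wrk a).ok l x v W ↔ a.ok l x v W := Iff.rfl
@[simp] theorem ok_ite : (ite c a b).ok l x v W ↔ c.ok l x v W ∧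
    (0 < c.ev x v W → a.ok l x v W) ∧ (¬ 0 < c.ev x v W → b.ok l x v W) := Iff.rfl
@[simp] theorem ok_mod : (mod a b).ok l x v W ↔ a.ok l x v W ∧ b.ok l x v W := by
  simp [mod]; tauto
@[simp] theorem ok_eqb : (eqb a b).ok l x v W ↔ a.ok l x v W ∧ b.ok l x v W := by
  simp [eqb]; tauto
@[simp] theorem ok_ltb : (ltb a b).ok l x v W ↔ a.ok l x v W ∧ b.ok l x v W := by
  simp [ltb]; tauto
end

end Expr

namespace Cmd

/-- The variables that a command may change. -/
def mods : Cmd → List ℕ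
  | skip => []
  | set i _ => [i]
  | stW _ _ => []
  | stO _ _ => []
  | seq c d => c.mods ++ d.mods
  | ite _ c d => c.mods ++ d.mods
  | .while _ c => c.mods

/-- The working memory is not changed. -/
def noW : Cmd → Bool
  | skip => true
  | set _ _ => true
  | stW _ _ => false
  | stO _ _ => true
  | seq c d => c.noW && d.noW
  | ite _ c d => c.noW && d.noW
  | .while _ c => c.noW

/-- The output is not changed. -/
def noO : Cmd → Bool
  | skip => true
  | set _ _ => true
  | stW _ _ => true
  | stO _ _ => false
  | seq c d => c.noO && d.noO
  | ite _ c d => c.noO && d.noO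
  | .while _ c => c.noO

/-- `for i = 0, …, e - 1` -/
def loop (i : ℕ) (e : Expr) (c : Cmd) : Cmd :=
  seq (set i 0) (.while (e - .var i) (seq c (set i (.var i + 1))))

end Cmd

/-- What a command leaves alone. -/
structure Same (c : Cmd) (s s' : St) : Prop where
  v : ∀ j, j ∉ c.mods → s'.v j = s.v j
  W : c.noW = true → s'.W = s.W
  O : c.noO = true → s'.O = s.O

theorem Run.same {E : Env} {c : Cmd} {s s' : St} {k : ℕ} (h : Run E c s k s') : Same c s s' := by
  induction h with
  | skip => exact ⟨fun _ _ => rfl, fun _ => rfl, fun _ => rfl⟩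
  | set s i e _ _ =>
    exact ⟨fun j hj => Function.update_of_ne (by simpa [Cmd.mods] using hj) _ _, fun _ => rfl,
      fun _ => rfl⟩
  | stW => exact ⟨fun _ _ => rfl, nofun, fun _ => rfl⟩
  | stO => exact ⟨fun _ _ => rfl, fun _ => rfl, nofun⟩
  | seq _ _ h1 h2 =>
    refine ⟨fun j hj => ?_, fun h => ?_, fun h => ?_⟩
    · simp only [Cmd.mods, List.mem_append, not_or] at hj
      rw [h2.v j hj.2, h1.v j hj.1]
    · simp only [Cmd.noW, Bool.and_eq_true] at h
      rw [h2.W h.2, h1.W h.1]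
    · simp only [Cmd.noO, Bool.and_eq_true] at h
      rw [h2.O h.2, h1.O h.1]
  | ite_pos _ _ _ h1 =>
    refine ⟨fun j hj => h1.v j ?_, fun h => h1.W ?_, fun h => h1.O ?_⟩
    · simp only [Cmd.mods, List.mem_append, not_or] at hj; exact hj.1
    · simp only [Cmd.noW, Bool.and_eq_true] at h; exact h.1
    · simp only [Cmd.noO, Bool.and_eq_true] at h; exact h.1
  | ite_neg _ _ _ h1 =>
    refine ⟨fun j hj => h1.v j ?_, fun h => h1.W ?_, fun h => h1.O ?_⟩
    · simp only [Cmd.mods, List.mem_append, not_or] at hj; exact hj.2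
    · simp only [Cmd.noW, Bool.and_eq_true] at h; exact h.2
    · simp only [Cmd.noO, Bool.and_eq_true] at h; exact h.2
  | while_done => exact ⟨fun _ _ => rfl, fun _ => rfl, fun _ => rfl⟩
  | while_step _ _ _ _ h1 h2 =>
    exact ⟨fun j hj => (h2.v j hj).trans (h1.v j hj), fun h => (h2.W h).trans (h1.W h),
      fun h => (h2.O h).trans (h1.O h)⟩

/-- From `s` the command leads to a state with the property `Q` in at most `τ` operations. -/
def Tri (E : Env) (c : Cmd) (s : St) (τ : ℕ) (Q : St → Prop) : Prop :=
  ∃ k ≤ τ, ∃ s', Run E c s k s' ∧ Q s'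

section
variable {E : Env} {s : St} {c d : Cmd} {τ τ₁ τ₂ : ℕ} {Q Q' : St → Prop}

theorem Tri.mono (h : Tri E c s τ₁ Q') (hτ : τ₁ ≤ τ) (hQ : ∀ s', Same c s s' → Q' s' → Q s') :
    Tri E c s τ Q := by
  obtain ⟨k, hk, s', hr, hq⟩ := h
  exact ⟨k, hk.trans hτ, s', hr, hQ s' hr.same hq⟩

theorem Tri.skip (h : Q s) : Tri E .skip s 1 Q := ⟨1, le_rfl, s, .skip s, h⟩

theorem Tri.set {i : ℕ} {e : Expr} (he : e.ok E.l E.x s.v s.W) {a : ℤ}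
    (ha : e.ev E.x s.v s.W = a) (hb : a.natAbs < 2 ^ E.b)
    (h : Q { s with v := Function.update s.v i a }) : Tri E (.set i e) s 1 Q := by
  subst ha; exact ⟨1, le_rfl, _, .set s i e he hb, h⟩

theorem Tri.stW {a e : Expr} (ha : a.ok E.l E.x s.v s.W) (he : e.ok E.l E.x s.v s.W)
    (hb : (e.ev E.x s.v s.W).natAbs < 2 ^ E.b)
    (h : Q { s with W := Function.update s.W (a.ev E.x s.v s.W) (e.ev E.x s.v s.W) }) :
    Tri E (.stW a e) s 1 Q := ⟨1, le_rfl, _, .stW s a e ha he hb, h⟩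

theorem Tri.stO {a e : Expr} (ha : a.ok E.l E.x s.v s.W) (he : e.ok E.l E.x s.v s.W)
    (h : Q { s with O := Function.update s.O (a.ev E.x s.v s.W) (e.ev E.x s.v s.W) }) :
    Tri E (.stO a e) s 1 Q := ⟨1, le_rfl, _, .stO s a e ha he, h⟩

theorem Tri.seq (h : Tri E c s τ₁ Q') (h' : ∀ s', Same c s s' → Q' s' → Tri E d s' τ₂ Q) :
    Tri E (.seq c d) s (τ₁ + τ₂ + 1) Q := by
  obtain ⟨k, hk, s', hr, hq⟩ := h
  obtain ⟨k', hk', s₂, hr', hq'⟩ := h' s' hr.same hq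
  exact ⟨_, by omega, s₂, hr.seq hr', hq'⟩

theorem Tri.ite {e : Expr} (he : e.ok E.l E.x s.v s.W)
    (h : 0 < e.ev E.x s.v s.W → Tri E c s τ Q) (h' : ¬ 0 < e.ev E.x s.v s.W → Tri E d s τ Q) :
    Tri E (.ite e c d) s (τ + 1) Q := by
  by_cases hpos : 0 < e.ev E.x s.v s.W
  · obtain ⟨k, hk, s', hr, hq⟩ := h hpos
    exact ⟨_, by omega, s', .ite_pos he hpos hr, hq⟩
  · obtain ⟨k, hk, s', hr, hq⟩ := h' hpos
    exact ⟨_, by omega, s', .ite_neg he hpos hr, hq⟩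

/-- A loop that is executed `N` times, with an invariant. -/
theorem Tri.while {e : Expr} (I : ℕ → St → Prop) (N : ℕ) (h0 : I 0 s)
    (hok : ∀ k ≤ N, ∀ s', Same c s s' → I k s' → e.ok E.l E.x s'.v s'.W)
    (hev : ∀ k ≤ N, ∀ s', Same c s s' → I k s' → (0 < e.ev E.x s'.v s'.W ↔ k < N))
    (hc : ∀ k < N, ∀ s', Same c s s' → I k s' → Tri E c s' τ (I (k + 1))) :
    Tri E (.while e c) s (N * (τ + 1) + 1) (I N) := by
  have key : ∀ j k, k + j = N → ∀ s', Same c s s' → I k s' →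
      Tri E (.while e c) s' (j * (τ + 1) + 1) (I N) := by
    intro j
    induction j with
    | zero =>
      intro k hk s' hs hI
      obtain rfl : k = N := hk
      exact ⟨1, by omega, s', .while_done (hok k le_rfl s' hs hI)
        (by rw [hev k le_rfl s' hs hI]; omega), hI⟩
    | succ j ih =>
      intro k hk s' hs hI
      obtain ⟨k₁, h1, s₁, hr, hq⟩ := hc k (by omega) s' hs hI
      have hs' : Same c s s₁ := ⟨fun i hi => (hr.same.v i hi).trans (hs.v i hi),
        fun h => (hr.same.W h).trans (hs.W h), fun h => (hr.same.O h).trans (hs.O h)⟩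
      obtain ⟨k₂, h2, s₂, hr', hq'⟩ := ih (k + 1) (by omega) s₁ hs' hq
      refine ⟨_, ?_, s₂, .while_step (hok k (by omega) s' hs hI)
        ((hev k (by omega) s' hs hI).2 (by omega)) hr hr', hq'⟩
      rw [add_mul]; omega
  exact key N 0 (by omega) s ⟨fun _ _ => rfl, fun _ => rfl, fun _ => rfl⟩ h0

/-- The body leaves the counter alone, so its postcondition can be stated for the state after the
increment that follows; the invariant may thus mention the counter. -/
theorem Tri.loop {i : ℕ} {e : Expr} (I : ℕ → St → Prop) (N : ℕ) (hN : N < 2 ^ E.b)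
    (h0 : I 0 { s with v := Function.update s.v i 0 })
    (hi : i ∉ c.mods)
    (he : ∀ k ≤ N, ∀ s', Same (.loop i e c) s s' → I k s' → s'.v i = k →
      e.ok E.l E.x s'.v s'.W ∧ e.ev E.x s'.v s'.W = N)
    (hc : ∀ k < N, ∀ s', Same (.loop i e c) s s' → I k s' → s'.v i = k →
      Tri E c s' τ fun s' => I (k + 1) { s' with v := Function.update s'.v i (k + 1 : ℕ) }) :
    Tri E (.loop i e c) s (N * (τ + 3) + 3) fun s' => I N s' ∧ s'.v i = N := by
  have hsame : ∀ s', Same (.seq c (.set i (.var i + 1))) { s with v := Function.update s.v i 0 } s' →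
      Same (.loop i e c) s s' := by
    intro s' h
    refine ⟨fun j hj => ?_, fun hw => h.W ?_, fun hw => h.O ?_⟩
    · simp only [Cmd.loop, Cmd.mods, List.mem_append, List.mem_singleton, not_or] at hj
      rw [h.v j (by simp [Cmd.mods, hj])]
      exact Function.update_of_ne hj.1 _ _
    · simpa [Cmd.loop, Cmd.noW] using hw
    · simpa [Cmd.loop, Cmd.noO] using hw
  have hb : (0 : ℤ).natAbs < 2 ^ E.b := by simp
  refine Tri.mono (Tri.seq (Q' := fun s' => s' = { s with v := Function.update s.v i 0 })
    (Tri.set (a := 0) (by simp) (by simp) hb rfl) fun s' _ hs' => ?_)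
    (by rw [show 1 + (N * (τ + 1 + 1 + 1) + 1) + 1 = N * (τ + 3) + 3 by ring])
    (fun s' _ h => h) (τ₁ := 1 + (N * (τ + 1 + 1 + 1) + 1) + 1)
  subst hs'
  refine Tri.while (fun k s' => I k s' ∧ s'.v i = k) N ⟨h0, by simp⟩ ?_ ?_ ?_
  · intro k hk s' hs hI
    have := (he k hk s' (hsame s' hs) hI.1 hI.2).1
    simp [this]
  · intro k hk s' hs hI
    have := (he k hk s' (hsame s' hs) hI.1 hI.2).2
    simp only [Expr.ev_sub, this, Expr.ev_var, hI.2]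
    omega
  · intro k hk s' hs hI
    refine (Tri.seq (hc k hk s' (hsame s' hs) hI.1 hI.2) (τ₂ := 1) fun s₁ hs₁ hI₁ => ?_).mono
      (by omega) (fun _ _ h => h)
    have : s₁.v i = k := by rw [hs₁.v i hi, hI.2]
    refine Tri.set (a := (k + 1 : ℕ)) (by simp) (by simp [this])
      (by simp only [Int.natAbs_natCast]; omega) ⟨hI₁, by simp⟩

end

/-- The function that takes the values `f 0, …, f (N - 1)` from the argument `base` on and agrees
with `O` elsewhere. -/
def tab (base : ℤ) (N : ℕ) (f : ℕ → ℤ) (O : ℤ → ℤ) : ℤ → ℤ := fun a =>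
  if base ≤ a ∧ a < base + N then f (a - base).toNat else O a

theorem tab_zero (base : ℤ) (f : ℕ → ℤ) (O : ℤ → ℤ) : tab base 0 f O = O := by
  funext a; unfold tab; rw [if_neg]; push_cast; omega

theorem tab_succ (base : ℤ) (N : ℕ) (f : ℕ → ℤ) (O : ℤ → ℤ) :
    Function.update (tab base N f O) (base + N) (f N) = tab base (N + 1) f O := by
  funext a
  unfold tab
  rw [Function.update_apply]
  split_ifs with h1 h2 h3 h4 h5
  · subst h1; simp
  · subst h1; push_cast at h2; omega
  · rfl
  · push_cast at h4; omega
  · push_cast at h5; omega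
  · rfl

theorem tab_apply {base : ℤ} {N : ℕ} {f : ℕ → ℤ} {O : ℤ → ℤ} {k : ℕ} (hk : k < N) :
    tab base N f O (base + k) = f k := by
  unfold tab; rw [if_pos (by omega)]; simp

section
variable {E : Env} {s : St}

/-- Expressions cannot read the output. So they are evaluated as in the initial state with only the
counter changed, and no invariant has to be supplied. -/
theorem Tri.tabO {i : ℕ} {e addr val : Expr} (base : ℤ) (N : ℕ) (f : ℕ → ℤ) (hN : N < 2 ^ E.b)
    (he : ∀ k : ℕ, k ≤ N → e.ok E.l E.x (Function.update s.v i k) s.W ∧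
      e.ev E.x (Function.update s.v i k) s.W = N)
    (ha : ∀ k : ℕ, k < N → addr.ok E.l E.x (Function.update s.v i k) s.W ∧
      addr.ev E.x (Function.update s.v i k) s.W = base + k)
    (hv : ∀ k : ℕ, k < N → val.ok E.l E.x (Function.update s.v i k) s.W ∧
      val.ev E.x (Function.update s.v i k) s.W = f k) :
    Tri E (.loop i e (.stO addr val)) s (N * 4 + 3) fun s' => s'.O = tab base N f s.O := by
  have hv' : ∀ (k : ℕ) (s' : St), Same (.loop i e (.stO addr val)) s s' → s'.v i = k →
      s'.v = Function.update s.v i k := by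
    intro k s' hs hk
    funext j
    by_cases h : j = i
    · subst h; simp [hk]
    · rw [Function.update_of_ne h, hs.v j (by simp [Cmd.loop, Cmd.mods, h])]
  have hW : ∀ s' : St, Same (.loop i e (.stO addr val)) s s' → s'.W = s.W := fun s' hs =>
    hs.W (by simp [Cmd.loop, Cmd.noW])
  refine (Tri.loop (τ := 1) (fun k s' => s'.O = tab base k f s.O) N hN ?_ (by simp [Cmd.mods])
    ?_ ?_).mono le_rfl fun s' _ h => h.1
  · exact (tab_zero _ _ _).symm
  · intro k hk s' hs _ hk'
    rw [hv' k s' hs hk', hW s' hs]; exact he k hk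
  · intro k hk s' hs hO hk'
    have h1 := ha k hk
    have h2 := hv k hk
    rw [← hv' k s' hs hk', ← hW s' hs] at h1 h2
    refine Tri.stO h1.1 h2.1 ?_
    simp only [h1.2, h2.2, hO, tab_succ]

/-- The working memory changes during the loop: the conditions on the number of passes and on the
addresses are therefore required for every `W`, and those on the values for the partially filled
table. -/
theorem Tri.tabW {i : ℕ} {e addr val : Expr} (base : ℤ) (N : ℕ) (f : ℕ → ℤ) (hN : N < 2 ^ E.b)
    (he : ∀ (k : ℕ) (W : ℤ → ℤ), k ≤ N → e.ok E.l E.x (Function.update s.v i k) W ∧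
      e.ev E.x (Function.update s.v i k) W = N)
    (ha : ∀ (k : ℕ) (W : ℤ → ℤ), k < N → addr.ok E.l E.x (Function.update s.v i k) W ∧
      addr.ev E.x (Function.update s.v i k) W = base + k)
    (hv : ∀ k : ℕ, k < N → val.ok E.l E.x (Function.update s.v i k) (tab base k f s.W) ∧
      val.ev E.x (Function.update s.v i k) (tab base k f s.W) = f k)
    (hf : ∀ k < N, (f k).natAbs < 2 ^ E.b) :
    Tri E (.loop i e (.stW addr val)) s (N * 4 + 3) fun s' => s'.W = tab base N f s.W := by
  have hv' : ∀ (k : ℕ) (s' : St), Same (.loop i e (.stW addr val)) s s' → s'.v i = k →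
      s'.v = Function.update s.v i k := by
    intro k s' hs hk
    funext j
    by_cases h : j = i
    · subst h; simp [hk]
    · rw [Function.update_of_ne h, hs.v j (by simp [Cmd.loop, Cmd.mods, h])]
  refine (Tri.loop (τ := 1) (fun k s' => s'.W = tab base k f s.W) N hN ?_ (by simp [Cmd.mods])
    ?_ ?_).mono le_rfl fun s' _ h => h.1
  · exact (tab_zero _ _ _).symm
  · intro k hk s' hs _ hk'
    rw [hv' k s' hs hk']; exact he k _ hk
  · intro k hk s' hs hW hk'
    have h1 := ha k s'.W hk
    have h2 := hv k hk
    rw [← hv' k s' hs hk'] at h1 h2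
    rw [← hW] at h2
    refine Tri.stW h1.1 h2.1 (by rw [h2.2]; exact hf k hk) ?_
    simp only [h1.2, h2.2]
    rw [hW, tab_succ]

/-- A loop that iterates a function on a variable. -/
theorem Tri.accum {i y : ℕ} {e val : Expr} (hiy : i ≠ y) (N : ℕ) (f : ℕ → ℤ) (hN : N < 2 ^ E.b)
    (h0 : f 0 = s.v y)
    (he : ∀ k : ℕ, k ≤ N → e.ok E.l E.x (Function.update (Function.update s.v y (f k)) i k) s.W ∧
      e.ev E.x (Function.update (Function.update s.v y (f k)) i k) s.W = N)
    (hv : ∀ k : ℕ, k < N →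
      val.ok E.l E.x (Function.update (Function.update s.v y (f k)) i k) s.W ∧
      val.ev E.x (Function.update (Function.update s.v y (f k)) i k) s.W = f (k + 1))
    (hf : ∀ k < N, (f (k + 1)).natAbs < 2 ^ E.b) :
    Tri E (.loop i e (.set y val)) s (N * 4 + 3) fun s' => s'.v y = f N := by
  have hv' : ∀ (k : ℕ) (s' : St), Same (.loop i e (.set y val)) s s' → s'.v y = f k → s'.v i = k →
      s'.v = Function.update (Function.update s.v y (f k)) i k := by
    intro k s' hs hy hk
    funext j
    by_cases h : j = i
    · subst h; simp [hk]
    · rw [Function.update_of_ne h]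
      by_cases h' : j = y
      · subst h'; simp [hy]
      · rw [Function.update_of_ne h', hs.v j (by simp [Cmd.loop, Cmd.mods, h, h'])]
  have hW : ∀ s' : St, Same (.loop i e (.set y val)) s s' → s'.W = s.W := fun s' hs =>
    hs.W (by simp [Cmd.loop, Cmd.noW])
  refine (Tri.loop (τ := 1) (fun k s' => s'.v y = f k) N hN ?_ (by simpa [Cmd.mods] using hiy)
    ?_ ?_).mono le_rfl fun s' _ h => h.1
  · simp [h0, Function.update_of_ne hiy.symm]
  · intro k hk s' hs hy hk'
    rw [hv' k s' hs hy hk', hW s' hs]; exact he k hk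
  · intro k hk s' hs hy hk'
    have h2 := hv k hk
    rw [← hv' k s' hs hy hk', ← hW s' hs] at h2
    refine Tri.set h2.1 h2.2 (hf k hk) ?_
    simp [Function.update_of_ne hiy.symm]

end

/-! ### Lists in memory -/

theorem memOfList_nil : memOfList [] = 0 := by
  funext a; simp [memOfList]

theorem memOfList_append_ofFn (l : List ℤ) (N : ℕ) (f : ℕ → ℤ) :
    memOfList (l ++ List.ofFn fun m : Fin N => f m) = tab l.length N f (memOfList l) := by
  funext a
  unfold memOfList tab
  by_cases h0 : 0 ≤ a
  · obtain ⟨n, rfl⟩ := Int.eq_ofNat_of_zero_le h0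
    simp only [h0, if_true, Int.toNat_natCast, List.getD_eq_getElem?_getD]
    by_cases h1 : n < l.length
    · rw [List.getElem?_append_left h1, if_neg (by omega)]
    · rw [List.getElem?_append_right (by omega)]
      by_cases h2 : n < l.length + N
      · rw [if_pos (by omega), List.getElem?_eq_getElem (by simp; omega)]
        simp only [List.getElem_ofFn, Option.getD_some]
        congr 1; omega
      · rw [if_neg (by omega), List.getElem?_eq_none (by simp; omega),
          List.getElem?_eq_none (by omega)]
  · rw [if_neg h0, if_neg (by omega)]
    exact (if_neg h0).symm

theorem memOfList_concat (l : List ℤ) (c : ℤ) :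
    memOfList (l ++ [c]) = Function.update (memOfList l) l.length c := by
  have := memOfList_append_ofFn l 1 fun _ => c
  simp only [List.ofFn_succ, List.ofFn_zero] at this
  rw [this, ← tab_succ, tab_zero]; simp

end RAM

/-! ### Instances as functions of natural numbers -/

theorem RAM.tab_congr {base : ℤ} {N : ℕ} {f g : ℕ → ℤ} (O : ℤ → ℤ) (h : ∀ k < N, f k = g k) :
    RAM.tab base N f O = RAM.tab base N g O := by
  funext a
  unfold RAM.tab
  split_ifs with ha
  · exact h _ (by omega)
  · rfl

namespace KSumInst

/-- The `j`-th number of the `i`-th list. -/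
def get (I : KSumInst 3) (i j : ℕ) : ℤ :=
  if h : i < 3 ∧ j < I.n then I.x ⟨i, h.1⟩ ⟨j, h.2⟩ else 0

theorem memOfList_encode (I : KSumInst 3) : RAM.memOfList I.encode =
    RAM.tab 1 (3 * I.n) (fun m => I.get (m / I.n) (m % I.n)) (Function.update 0 0 (I.n : ℤ)) := by
  have h1 : I.encode = ([(I.n : ℤ)] ++ List.ofFn fun m : Fin (3 * I.n) =>
      I.get (m / I.n) (m % I.n)) := by
    unfold encode
    rw [List.singleton_append]
    congr 2
    funext m
    have hn := I.n_pos
    have hm := m.2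
    have h0 : (m : ℕ) / I.n < 3 := Nat.div_lt_of_lt_mul (hm.trans_eq (Nat.mul_comm _ _))
    unfold get
    rw [dif_pos ⟨h0, Nat.mod_lt _ hn⟩]
    rfl
  rw [h1, RAM.memOfList_append_ofFn _ _ fun m => I.get (m / I.n) (m % I.n)]
  congr 1
  have := RAM.memOfList_concat [] (I.n : ℤ)
  rw [List.nil_append] at this
  rw [this, RAM.memOfList_nil]; rfl

theorem length_encode (I : KSumInst 3) : I.encode.length = 3 * I.n + 1 := by
  simp [encode]

theorem natAbs_get_le (I : KSumInst 3) (i j : ℕ) : (I.get i j).natAbs ≤ I.maxAbs := by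
  unfold get
  split_ifs with h
  · refine le_trans ?_ (le_max_right _ _)
    exact (Finset.le_sup (f := fun j => (I.x ⟨i, h.1⟩ j).natAbs)
      (Finset.mem_univ (⟨j, h.2⟩ : Fin I.n))).trans
      (Finset.le_sup (f := fun i => Finset.univ.sup fun j => (I.x i j).natAbs)
        (Finset.mem_univ (⟨i, h.1⟩ : Fin 3)))
  · simp

theorem maxAbs_le (I : KSumInst 3) {B : ℕ} (hB : 1 ≤ B)
    (h : ∀ i j, i < 3 → j < I.n → (I.get i j).natAbs ≤ B) : I.maxAbs ≤ B := by
  refine max_le hB (Finset.sup_le fun i _ => Finset.sup_le fun j _ => ?_)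
  have := h i j i.2 j.2
  unfold get at this
  rwa [dif_pos ⟨i.2, j.2⟩] at this

theorem hasZeroSum_iff (I : KSumInst 3) : I.HasZeroSum ↔
    ∃ a < I.n, ∃ b < I.n, ∃ c < I.n, I.get 0 a + I.get 1 b + I.get 2 c = 0 := by
  unfold HasZeroSum
  constructor
  · rintro ⟨a, ha⟩
    refine ⟨a 0, (a 0).2, a 1, (a 1).2, a 2, (a 2).2, ?_⟩
    rw [Fin.sum_univ_three] at ha
    simpa [get] using ha
  · rintro ⟨a, ha, b, hb, c, hc, h⟩
    refine ⟨![⟨a, ha⟩, ⟨b, hb⟩, ⟨c, hc⟩], ?_⟩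
    rw [Fin.sum_univ_three]
    simpa [get, ha, hb, hc] using h

/-- The instance with the given numbers. -/
def ofFun (n : ℕ) (hn : 0 < n) (f : ℕ → ℕ → ℤ) : KSumInst 3 := ⟨n, hn, fun i j => f i j⟩

theorem get_ofFun {n : ℕ} (hn : 0 < n) (f : ℕ → ℕ → ℤ) {i j : ℕ} (hi : i < 3) (hj : j < n) :
    (ofFun n hn f).get i j = f i j := by
  unfold get; rw [dif_pos ⟨hi, hj⟩]; rfl

end KSumInst

namespace WeightedGraphInst

variable (I : WeightedGraphInst)

/-- The nodes with the numbers `u` and `v` are adjacent. -/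
def adj (u v : ℕ) : Prop := ∃ (hu : u < I.n) (hv : v < I.n), I.graph.Adj ⟨u, hu⟩ ⟨v, hv⟩

open Classical in
/-- The weight of an edge, `0` for pairs that are not edges. -/
noncomputable def wt (u v : ℕ) : ℤ :=
  if h : I.adj u v then I.w s(⟨u, h.1⟩, ⟨v, h.2.1⟩) else 0

theorem adj_comm (u v : ℕ) : I.adj u v ↔ I.adj v u :=
  ⟨fun ⟨a, b, h⟩ => ⟨b, a, h.symm⟩, fun ⟨a, b, h⟩ => ⟨b, a, h.symm⟩⟩

theorem adj_ne {u v : ℕ} (h : I.adj u v) : u ≠ v := by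
  rintro rfl
  obtain ⟨_, _, h⟩ := h
  exact I.graph.loopless.irrefl _ h

theorem wt_comm (u v : ℕ) : I.wt u v = I.wt v u := by
  unfold wt
  by_cases h : I.adj u v
  · rw [dif_pos h, dif_pos ((I.adj_comm u v).1 h), Sym2.eq_swap]
  · rw [dif_neg h, dif_neg fun h' => h ((I.adj_comm u v).2 h')]

open Classical in
theorem memOfList_encode : RAM.memOfList I.encode =
    RAM.tab (2 + I.n * I.n) (I.n * I.n) (fun m => I.wt (m / I.n) (m % I.n))
      (RAM.tab 2 (I.n * I.n) (fun m => if I.adj (m / I.n) (m % I.n) then 1 else 0)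
        (Function.update (Function.update 0 0 (I.n : ℤ)) 1 I.target)) := by
  have hn := I.n_pos
  have h1 : I.encode = ((([] ++ [(I.n : ℤ)]) ++ [I.target]) ++
      List.ofFn fun m : Fin (I.n * I.n) => if I.adj (m / I.n) (m % I.n) then (1 : ℤ) else 0) ++
      List.ofFn fun m : Fin (I.n * I.n) => I.wt (m / I.n) (m % I.n) := by
    unfold encode
    have h2 : ∀ m : Fin (I.n * I.n), I.graph.Adj m.divNat m.modNat ↔ I.adj (m / I.n) (m % I.n) :=
      fun m => ⟨fun h => ⟨_, _, h⟩, fun ⟨_, _, h⟩ => h⟩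
    simp only [List.nil_append, List.cons_append]
    congr 3
    · congr 1; funext m; exact if_congr (h2 m) rfl rfl
    · congr 1
      funext m
      unfold wt
      by_cases h : I.adj (m / I.n) (m % I.n)
      · rw [if_pos ((h2 m).2 h), dif_pos h]; rfl
      · rw [if_neg fun h' => h ((h2 m).1 h'), dif_neg h]
  rw [h1, RAM.memOfList_append_ofFn _ _ fun m => I.wt (m / I.n) (m % I.n),
    RAM.memOfList_append_ofFn _ _ fun m => if I.adj (m / I.n) (m % I.n) then (1 : ℤ) else 0,
    RAM.memOfList_concat, RAM.memOfList_concat, RAM.memOfList_nil]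
  congr 1
  simp; ring

theorem length_encode : I.encode.length = 2 * (I.n * I.n) + 2 := by
  simp [encode]; ring

theorem natAbs_wt_le (u v : ℕ) : (I.wt u v).natAbs ≤ I.maxAbs := by
  classical
  unfold wt
  split_ifs with h
  · unfold maxAbs
    refine le_trans ?_ (le_max_right _ _)
    refine le_trans ?_ (le_max_right _ _)
    exact Finset.le_sup (f := fun e => (I.w e).natAbs)
      (SimpleGraph.mem_edgeFinset.2 ((SimpleGraph.mem_edgeSet _).2 h.2.2))
  · simp

theorem natAbs_target_le : I.target.natAbs ≤ I.maxAbs :=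
  (le_max_left _ _).trans (le_max_right _ _)

theorem one_le_maxAbs : 1 ≤ I.maxAbs := le_max_left _ _

theorem maxAbs_le {B : ℕ} (hB : 1 ≤ B) (ht : I.target.natAbs ≤ B)
    (h : ∀ u v, I.adj u v → (I.wt u v).natAbs ≤ B) : I.maxAbs ≤ B := by
  classical
  refine max_le hB (max_le ht (Finset.sup_le fun e he => ?_))
  induction e with
  | _ u v =>
    have hadj : I.adj u v := ⟨u.2, v.2, (SimpleGraph.mem_edgeSet _).1 (SimpleGraph.mem_edgeFinset.1 he)⟩
    have := h u v hadj
    unfold wt at this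
    rwa [dif_pos hadj] at this

theorem wt_eq {u v : Fin I.n} (h : I.graph.Adj u v) : I.wt u v = I.w s(u, v) := by
  unfold wt; rw [dif_pos ⟨u.2, v.2, h⟩]

theorem hasExactCopy_star_iff : I.HasExactCopy (kStar 3) ↔ ∃ c u₀ u₁ u₂ : ℕ,
    (u₀ ≠ u₁ ∧ u₀ ≠ u₂ ∧ u₁ ≠ u₂) ∧ I.adj c u₀ ∧ I.adj c u₁ ∧ I.adj c u₂ ∧
    I.wt c u₀ + I.wt c u₁ + I.wt c u₂ = I.target := by
  classical
  have hE : (kStar 3).edgeFinset = {s(3, 0), s(3, 1), s(3, 2)} := by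
    ext e
    induction e with
    | _ u v =>
      rw [SimpleGraph.mem_edgeFinset, SimpleGraph.mem_edgeSet]
      simp only [kStar, SimpleGraph.starGraph_adj]
      revert u v; decide
  unfold HasExactCopy
  rw [show (∃ f : (kStar 3).Copy I.graph, ∑ e ∈ (kStar 3).edgeFinset, I.w (e.map f) = I.target) ↔
    ∃ f : (kStar 3).Copy I.graph, ∑ e ∈ {s(3, 0), s(3, 1), s(3, 2)}, I.w (e.map f) = I.target by
    rw [← hE]]
  have hsum : ∀ g : Sym2 (Fin 4) → ℤ, ∑ e ∈ {s(3, 0), s(3, 1), s(3, 2)}, g e =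
      g s(3, 0) + g s(3, 1) + g s(3, 2) := by
    intro g
    rw [Finset.sum_insert (by decide), Finset.sum_insert (by decide), Finset.sum_singleton,
      add_assoc]
  simp only [hsum, Sym2.map_mk]
  constructor
  · rintro ⟨f, hf⟩
    have ha : ∀ i : Fin 4, i ≠ 3 → I.graph.Adj (f 3) (f i) := fun i hi =>
      f.toHom.map_adj (by simp only [kStar, SimpleGraph.starGraph_adj]; revert i; decide)
    have hne : ∀ i j : Fin 4, i ≠ j → (f i : ℕ) ≠ f j := fun i j hij h =>
      hij (f.injective (Fin.ext h))
    refine ⟨f 3, f 0, f 1, f 2, ⟨hne _ _ (by decide), hne _ _ (by decide), hne _ _ (by decide)⟩,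
      ⟨_, _, ha 0 (by decide)⟩, ⟨_, _, ha 1 (by decide)⟩, ⟨_, _, ha 2 (by decide)⟩, ?_⟩
    rw [I.wt_eq (ha 0 (by decide)), I.wt_eq (ha 1 (by decide)), I.wt_eq (ha 2 (by decide))]
    exact hf
  · rintro ⟨c, u₀, u₁, u₂, ⟨n1, n2, n3⟩, h0, h1, h2, hs⟩
    have m0 := I.adj_ne h0
    have m1 := I.adj_ne h1
    have m2 := I.adj_ne h2
    obtain ⟨hc, hu0, a0⟩ := id h0
    obtain ⟨_, hu1, a1⟩ := id h1
    obtain ⟨_, hu2, a2⟩ := id h2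
    let f : Fin 4 → Fin I.n := ![⟨u₀, hu0⟩, ⟨u₁, hu1⟩, ⟨u₂, hu2⟩, ⟨c, hc⟩]
    have hom : ∀ {i j : Fin 4}, (kStar 3).Adj i j → I.graph.Adj (f i) (f j) := by
      intro i j hij
      simp only [kStar, SimpleGraph.starGraph_adj] at hij
      fin_cases i <;> fin_cases j <;> first | exact a0 | exact a1 | exact a2 | exact a0.symm | exact a1.symm | exact a2.symm | (exfalso; revert hij; decide)
    have hinj : Function.Injective f := by
      intro i j hij
      fin_cases i <;> fin_cases j <;> first | rfl | (exfalso; simp [f] at hij; omega)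
    refine ⟨⟨⟨f, hom⟩, hinj⟩, ?_⟩
    rw [← hs]
    unfold wt
    rw [dif_pos h0, dif_pos h1, dif_pos h2]
    rfl

theorem hasExactCopy_matching_iff : I.HasExactCopy (kMatching 3) ↔ ∃ u₀ v₀ u₁ v₁ u₂ v₂ : ℕ,
    [u₀, v₀, u₁, v₁, u₂, v₂].Nodup ∧ I.adj u₀ v₀ ∧ I.adj u₁ v₁ ∧ I.adj u₂ v₂ ∧
    I.wt u₀ v₀ + I.wt u₁ v₁ + I.wt u₂ v₂ = I.target := by
  classical
  have hE : (kMatching 3).edgeFinset = {s((0, false), (0, true)), s((1, false), (1, true)),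
      s((2, false), (2, true))} := by
    ext e
    induction e with
    | _ u v =>
      rw [SimpleGraph.mem_edgeFinset, SimpleGraph.mem_edgeSet]
      change u.1 = v.1 ∧ u.2 ≠ v.2 ↔ _
      revert u v; decide
  unfold HasExactCopy
  rw [show (∃ f : (kMatching 3).Copy I.graph, ∑ e ∈ (kMatching 3).edgeFinset,
      I.w (e.map f) = I.target) ↔
    ∃ f : (kMatching 3).Copy I.graph, ∑ e ∈ {s((0, false), (0, true)), s((1, false), (1, true)),
      s((2, false), (2, true))}, I.w (e.map f) = I.target by
    rw [← hE]]
  have hsum : ∀ g : Sym2 (Fin 3 × Bool) → ℤ, ∑ e ∈ {s((0, false), (0, true)),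
      s((1, false), (1, true)), s((2, false), (2, true))}, g e =
      g s((0, false), (0, true)) + g s((1, false), (1, true)) + g s((2, false), (2, true)) := by
    intro g
    rw [Finset.sum_insert (by decide), Finset.sum_insert (by decide), Finset.sum_singleton,
      add_assoc]
  simp only [hsum, Sym2.map_mk]
  constructor
  · rintro ⟨f, hf⟩
    have ha : ∀ i : Fin 3, I.graph.Adj (f (i, false)) (f (i, true)) := fun i =>
      f.toHom.map_adj ⟨rfl, by simp⟩
    have hne : ∀ i j : Fin 3 × Bool, i ≠ j → (f i : ℕ) ≠ f j := fun i j hij h =>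
      hij (f.injective (Fin.ext h))
    refine ⟨f (0, false), f (0, true), f (1, false), f (1, true), f (2, false), f (2, true), ?_,
      ⟨_, _, ha 0⟩, ⟨_, _, ha 1⟩, ⟨_, _, ha 2⟩, ?_⟩
    · have : ([(0, false), (0, true), (1, false), (1, true), (2, false), (2, true)] :
          List (Fin 3 × Bool)).Nodup := by decide
      exact this.map fun i j h => f.injective (Fin.ext h)
    rw [I.wt_eq (ha 0), I.wt_eq (ha 1), I.wt_eq (ha 2)]
    exact hf
  · rintro ⟨u₀, v₀, u₁, v₁, u₂, v₂, hnd, h0, h1, h2, hs⟩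
    obtain ⟨hu0, hv0, a0⟩ := id h0
    obtain ⟨hu1, hv1, a1⟩ := id h1
    obtain ⟨hu2, hv2, a2⟩ := id h2
    let f : Fin 3 × Bool → Fin I.n := fun i => ![![⟨u₀, hu0⟩, ⟨v₀, hv0⟩], ![⟨u₁, hu1⟩, ⟨v₁, hv1⟩],
      ![⟨u₂, hu2⟩, ⟨v₂, hv2⟩]] i.1 (if i.2 then 1 else 0)
    have hom : ∀ {i j : Fin 3 × Bool}, (kMatching 3).Adj i j → I.graph.Adj (f i) (f j) := by
      rintro ⟨i, b⟩ ⟨j, c⟩ ⟨hij, hbc⟩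
      obtain rfl : i = j := hij
      cases b <;> cases c <;> simp at hbc <;> fin_cases i <;>
        first | exact a0 | exact a1 | exact a2 | exact a0.symm | exact a1.symm | exact a2.symm
    have hinj : Function.Injective f := by
      simp only [List.nodup_cons, List.mem_cons, List.not_mem_nil, or_false, not_or] at hnd
      rintro ⟨i, b⟩ ⟨j, c⟩ hij
      cases b <;> cases c <;> fin_cases i <;> fin_cases j <;>
        first | rfl | (exfalso; simp [f] at hij; omega)
    refine ⟨⟨⟨f, hom⟩, hinj⟩, ?_⟩
    rw [← hs]
    unfold wt
    rw [dif_pos h0, dif_pos h1, dif_pos h2]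
    rfl

open Classical in
/-- The weighted graph that consists of the given arcs, which must not come in pairs of opposite
ones. -/
noncomputable def ofArcs (n : ℕ) (hn : 0 < n) (arc : ℕ → ℕ → Prop) (val : ℕ → ℕ → ℤ) (t : ℤ)
    (h : ∀ u v, arc u v → ¬ arc v u) : WeightedGraphInst where
  n := n
  n_pos := hn
  graph := ⟨fun u v => arc u v ∨ arc v u, ⟨fun _ _ h => h.symm⟩,
    ⟨fun u hu => hu.elim (fun h' => h u u h' h') fun h' => h u u h' h'⟩⟩
  w := Sym2.lift ⟨fun u v => if arc u v then val u v else if arc v u then val v u else 0, by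
    intro u v
    by_cases h1 : arc u v
    · simp [h1, h _ _ h1]
    · simp [h1]⟩
  target := t

section
variable {n : ℕ} {hn : 0 < n} {arc : ℕ → ℕ → Prop} {val : ℕ → ℕ → ℤ} {t : ℤ}
  {h : ∀ u v, arc u v → ¬ arc v u}

theorem adj_ofArcs {u v : ℕ} : (ofArcs n hn arc val t h).adj u v ↔
    u < n ∧ v < n ∧ (arc u v ∨ arc v u) :=
  ⟨fun ⟨a, b, c⟩ => ⟨a, b, c⟩, fun ⟨a, b, c⟩ => ⟨a, b, c⟩⟩

open Classical in
theorem wt_ofArcs {u v : ℕ} (hu : u < n) (hv : v < n) : (ofArcs n hn arc val t h).wt u v =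
    if arc u v then val u v else if arc v u then val v u else 0 := by
  unfold wt
  split_ifs with h1 h2 h3 h4 h5
  · change (ofArcs n hn arc val t h).w s(⟨u, hu⟩, ⟨v, hv⟩) = _
    simp [ofArcs, h2]
  · change (ofArcs n hn arc val t h).w s(⟨u, hu⟩, ⟨v, hv⟩) = _
    simp [ofArcs, h2, h3]
  · rw [adj_ofArcs] at h1; tauto
  · rw [adj_ofArcs] at h1; tauto
  · rw [adj_ofArcs] at h1; tauto
  · rfl

end

end WeightedGraphInst

/-! ### Separation by residues -/

/-- If all positive numbers up to `2 * k` divided `D`, so would the central binomial coefficient,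
because the prime powers that divide it are at most `2 * k`. But it exceeds `4 ^ k / k`, hence `2 ^
k`. -/
theorem Nat.exists_not_dvd_of_lt_two_pow {D k : ℕ} (hD : 0 < D) (hk : 4 ≤ k) (h : D < 2 ^ k) :
    ∃ q, 0 < q ∧ q ≤ 2 * k ∧ ¬ q ∣ D := by
  by_contra! hall
  have h1 : Nat.centralBinom k ∣ D := by
    rw [Nat.dvd_iff_prime_pow_dvd_dvd]
    intro p j hp hj
    refine hall _ (pow_pos hp.pos _) ?_
    have h2 := (hp.pow_dvd_iff_le_factorization (Nat.centralBinom_ne_zero k)).1 hj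
    exact (Nat.pow_le_pow_right hp.pos h2).trans
      (by simpa [Nat.centralBinom] using Nat.pow_factorization_choose_le (by omega))
  have h2 := Nat.le_of_dvd hD h1
  have h3 := Nat.four_pow_lt_mul_centralBinom k hk
  have h4 : k < 2 ^ k := Nat.lt_two_pow_self
  have h5 : (4 : ℕ) ^ k = 2 ^ k * 2 ^ k := by rw [← mul_pow]; norm_num
  nlinarith

/-- A number that does not divide the product of all differences of elements of `S` divides none of
the differences, so it separates the elements. -/
theorem exists_mod_injOn {S : Finset ℕ} (hS : S.card ≤ 6) {n : ℕ} (hn : ∀ u ∈ S, u < n) :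
    ∃ q, 0 < q ∧ q ≤ 72 * n.size + 8 ∧ Set.InjOn (· % q) (S : Set ℕ) := by
  have hpos : ∀ u ∈ S.offDiag, 0 < ((u.1 : ℤ) - u.2).natAbs := by
    intro u hu
    rw [Finset.mem_offDiag] at hu
    omega
  -- There are at most `6 * 6 = 36` ordered pairs, each with a difference below `2 ^ n.size`. The
  -- additional 4 makes the inequality strict and provides `4 ≤ k`; twice this exponent is the bound
  -- for `q`.
  have hlt : ∏ u ∈ S.offDiag, ((u.1 : ℤ) - u.2).natAbs < 2 ^ (36 * n.size + 4) := by
    refine (Finset.prod_le_pow_card _ _ (2 ^ n.size) fun u hu => ?_).trans_lt ?_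
    · rw [Finset.mem_offDiag] at hu
      have h1 := hn _ hu.1
      have h2 := hn _ hu.2.1
      have h3 := Nat.lt_size_self n
      omega
    · rw [← pow_mul]
      refine Nat.pow_lt_pow_right (by norm_num) ?_
      have h1 : S.offDiag.card ≤ 36 := by
        rw [Finset.offDiag_card]
        exact (Nat.sub_le _ _).trans (Nat.mul_le_mul hS hS)
      have := Nat.mul_le_mul_left n.size h1
      linarith
  obtain ⟨q, h1, h2, h3⟩ := Nat.exists_not_dvd_of_lt_two_pow (Finset.prod_pos hpos)
    (by omega) hlt
  refine ⟨q, h1, by omega, fun u hu v hv huv => ?_⟩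
  by_contra hne
  refine h3 (dvd_trans ?_ (Finset.dvd_prod_of_mem (fun u : ℕ × ℕ => ((u.1 : ℤ) - u.2).natAbs)
    (Finset.mem_offDiag.2 ⟨hu, hv, hne⟩ : (u, v) ∈ S.offDiag)))
  rw [← Int.natCast_dvd]
  exact (Nat.modEq_iff_dvd.1 (show v ≡ u [MOD q] from huv.symm))

/-! ### Domination by powers of two parameters -/

/-- `f` is at most a constant multiple of `n ^ α * L ^ β`. -/
def Dom {ι : Type*} (n L : ι → ℕ) (α β : ℝ) (f : ι → ℕ) : Prop :=
  ∃ C : ℝ, 0 ≤ C ∧ ∀ i, (f i : ℝ) ≤ C * ((n i : ℝ) ^ α * (L i : ℝ) ^ β)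

namespace Dom

variable {ι : Type*} {n L : ι → ℕ} {α β α' β' : ℝ} {f g : ι → ℕ}

theorem of_le (h : Dom n L α β g) (hfg : ∀ i, f i ≤ g i) : Dom n L α β f := by
  obtain ⟨C, h0, h⟩ := h
  exact ⟨C, h0, fun i => (Nat.cast_le.2 (hfg i)).trans (h i)⟩

theorem mono (hn : ∀ i, 1 ≤ n i) (hL : ∀ i, 1 ≤ L i) (h : Dom n L α β f) (hα : α ≤ α')
    (hβ : β ≤ β') : Dom n L α' β' f := by
  obtain ⟨C, h0, h⟩ := h
  refine ⟨C, h0, fun i => (h i).trans ?_⟩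
  have h1 : (1 : ℝ) ≤ n i := by exact_mod_cast hn i
  have h2 : (1 : ℝ) ≤ L i := by exact_mod_cast hL i
  gcongr

theorem add (h : Dom n L α β f) (h' : Dom n L α β g) : Dom n L α β fun i => f i + g i := by
  obtain ⟨C, h0, h⟩ := h
  obtain ⟨C', h0', h'⟩ := h'
  refine ⟨C + C', by positivity, fun i => ?_⟩
  have := h i
  have := h' i
  push_cast
  linarith

theorem mul (hn : ∀ i, 1 ≤ n i) (hL : ∀ i, 1 ≤ L i) (h : Dom n L α β f) (h' : Dom n L α' β' g) :
    Dom n L (α + α') (β + β') fun i => f i * g i := by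
  obtain ⟨C, h0, h⟩ := h
  obtain ⟨C', h0', h'⟩ := h'
  refine ⟨C * C', by positivity, fun i => ?_⟩
  have h1 : (0 : ℝ) < n i := by exact_mod_cast hn i
  have h2 : (0 : ℝ) < L i := by exact_mod_cast hL i
  rw [Real.rpow_add h1, Real.rpow_add h2]
  push_cast
  calc (f i : ℝ) * g i ≤ C * ((n i : ℝ) ^ α * (L i : ℝ) ^ β) *
      (C' * ((n i : ℝ) ^ α' * (L i : ℝ) ^ β')) := by
        have := h i
        have := h' i
        gcongr
    _ = _ := by ring

theorem const (c : ℕ) : Dom n L 0 0 fun _ => c := ⟨c, by positivity, fun i => by simp⟩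

theorem smul (c : ℕ) (h : Dom n L α β f) : Dom n L α β fun i => c * f i := by
  obtain ⟨C, h0, h⟩ := h
  refine ⟨c * C, by positivity, fun i => ?_⟩
  push_cast
  rw [mul_assoc]
  exact mul_le_mul_of_nonneg_left (h i) (by positivity)

theorem fst : Dom n L 1 0 n := ⟨1, by norm_num, fun i => by simp⟩

theorem snd : Dom n L 0 1 L := ⟨1, by norm_num, fun i => by simp⟩

theorem rpow (hn : ∀ i, 1 ≤ n i) (hL : ∀ i, 1 ≤ L i) (h : Dom n L α β f) (hα : 0 ≤ α) (hβ : 0 ≤ β)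
    {c γ : ℝ} (hc : 0 ≤ c) (hγ : 0 ≤ γ) :
    Dom n L (α * γ) (β * γ) fun i => ⌈c * (f i : ℝ) ^ γ⌉₊ := by
  obtain ⟨C, h0, h⟩ := h
  refine ⟨c * C ^ γ + 1, by positivity, fun i => ?_⟩
  have h1 : (1 : ℝ) ≤ n i := by exact_mod_cast hn i
  have h2 : (1 : ℝ) ≤ L i := by exact_mod_cast hL i
  have h3 : (f i : ℝ) ^ γ ≤ C ^ γ * ((n i : ℝ) ^ (α * γ) * (L i : ℝ) ^ (β * γ)) := by
    refine (Real.rpow_le_rpow (by positivity) (h i) hγ).trans_eq ?_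
    rw [Real.mul_rpow h0 (by positivity), Real.mul_rpow (by positivity) (by positivity),
      Real.rpow_mul (by positivity), Real.rpow_mul (by positivity)]
  have h4 : (1 : ℝ) ≤ (n i : ℝ) ^ (α * γ) * (L i : ℝ) ^ (β * γ) :=
    one_le_mul_of_one_le_of_one_le (Real.one_le_rpow h1 (by positivity))
      (Real.one_le_rpow h2 (by positivity))
  refine (Nat.ceil_lt_add_one (by positivity)).le.trans ?_
  have := mul_le_mul_of_nonneg_left h3 hc
  linarith

/-- The binary length is at most `log₂ m + 1`, and logarithms grow more slowly than any power. -/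
theorem _root_.Nat.size_le_rpow {η : ℝ} (hη : 0 < η) :
    ∃ c : ℝ, 0 ≤ c ∧ ∀ m : ℕ, (m.size : ℝ) ≤ c * (m : ℝ) ^ η := by
  refine ⟨1 + 1 / (Real.log 2 * η), by positivity, fun m => ?_⟩
  rcases Nat.eq_zero_or_pos m with rfl | hm
  · simp [Nat.size_zero, Real.zero_rpow hη.ne']
  have hm1 : (1 : ℝ) ≤ m := by exact_mod_cast hm
  have h1 : 2 ^ (m.size - 1) ≤ m := by
    rw [← Nat.lt_size]
    have := Nat.size_pos.2 hm
    omega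
  have h2 : ((m.size - 1 : ℕ) : ℝ) * Real.log 2 ≤ Real.log m := by
    rw [← Real.log_pow]
    exact Real.log_le_log (by positivity) (by exact_mod_cast h1)
  have h3 : Real.log m ≤ (m : ℝ) ^ η / η := Real.log_le_rpow_div (by positivity) hη
  have h4 : (m.size : ℝ) ≤ ((m.size - 1 : ℕ) : ℝ) + 1 := by
    exact_mod_cast (by omega : m.size ≤ m.size - 1 + 1)
  have h5 : (1 : ℝ) ≤ (m : ℝ) ^ η := Real.one_le_rpow hm1 hη.le
  have hl : 0 < Real.log 2 := Real.log_pos (by norm_num)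
  have h6 : ((m.size - 1 : ℕ) : ℝ) ≤ (m : ℝ) ^ η / η / Real.log 2 := by
    rw [le_div_iff₀ hl]; linarith
  calc (m.size : ℝ) ≤ (m : ℝ) ^ η / η / Real.log 2 + (m : ℝ) ^ η := by linarith
    _ = _ := by field_simp; ring

theorem size (hn : ∀ i, 1 ≤ n i) (hL : ∀ i, 1 ≤ L i) (h : Dom n L α β f) {η : ℝ} (hη : 0 < η) :
    Dom n L η η fun i => (f i).size := by
  -- Both exponents are raised to a common `A ≥ 1`, so that the exponent `η / A` for the logarithm
  -- turns `n ^ A * L ^ A` into `n ^ η * L ^ η`.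
  set A := max 1 (max α β) with hA
  have hA1 : 1 ≤ A := le_max_left _ _
  have hA0 : (0 : ℝ) < A := by linarith
  obtain ⟨c, hc, h1⟩ := Nat.size_le_rpow (div_pos hη hA0)
  have h2 := rpow hn hL (mono hn hL h ((le_max_left α β).trans (le_max_right _ _))
    ((le_max_right α β).trans (le_max_right _ _))) hA0.le hA0.le hc (div_pos hη hA0).le
  rw [← hA, mul_div_cancel₀ _ hA0.ne'] at h2
  exact h2.of_le fun i => by exact_mod_cast (h1 (f i)).trans (Nat.le_ceil _)

end Dom

/-! ### Solvability -/

theorem RAM.DecidesWithin.mono {p : RAM.Prog} {l : List ℤ} {b b' : Prop} {T T' : ℕ} {δ δ' : ℝ≥0∞}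
    (h : RAM.DecidesWithin p l b T δ) (hb : b ↔ b') (hT : T ≤ T') (hδ : δ ≤ δ') :
    RAM.DecidesWithin p l b' T' δ' := by
  obtain ⟨N, h1, h2⟩ := h
  obtain rfl : b = b' := propext hb
  exact ⟨N, fun c hc => ⟨(h1 c hc).1, (h1 c hc).2.trans hT⟩, h2.trans hδ⟩

/-- An error of `o(1)` is below 1/16 only from some size `s₀` on, so reductions have to produce
instances at least that large. The time is expressed by an upper bound `s` for the size, which is
all that a reduction controls. -/
theorem DecisionProblem.SolvableInTime.exists_program {P : DecisionProblem} {γ : ℝ}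
    (h : P.SolvableInTime fun n => (n : ℝ) ^ γ) (hγ : 0 ≤ γ) :
    ∃ (p : RAM.Prog) (c : ℝ) (s₀ : ℕ), 0 ≤ c ∧ ∀ (x : P.Inst) (s : ℕ), s₀ ≤ P.size x →
      P.size x ≤ s → RAM.DecidesWithin p (P.encode x) (P.yes x) ⌈c * (s : ℝ) ^ γ⌉₊ 16⁻¹ := by
  obtain ⟨p, T, err, hT, herr, hp⟩ := h
  obtain ⟨c, hc, hT⟩ := hT.exists_nonneg
  rw [isBigOWith_iff] at hT
  have h16 : ∀ᶠ s in atTop, err s ≤ 16⁻¹ := herr.eventually (ge_mem_nhds (by simp))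
  obtain ⟨s₀, hs⟩ := eventually_atTop.1 (hT.and h16)
  refine ⟨p, c, s₀, hc, fun x s h0 h1 => (hp x).mono Iff.rfl ?_ (hs _ h0).2⟩
  have h2 := (hs _ h0).1
  rw [Real.norm_of_nonneg (by positivity), Real.norm_of_nonneg (by positivity)] at h2
  have h3 : ((P.size x : ℝ)) ^ γ ≤ (s : ℝ) ^ γ :=
    Real.rpow_le_rpow (by positivity) (by exact_mod_cast h1) hγ
  exact_mod_cast (h2.trans (mul_le_mul_of_nonneg_left h3 hc)).trans (Nat.le_ceil _)

/-- Equal exponents of `n` and `L` combine to a power of the size `n * L`; the error `1 / s` tends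
to `0`. -/
theorem DecisionProblem.solvableInTime_of_dom {P : DecisionProblem} {γ : ℝ} (hγ : 0 ≤ γ)
    {p : RAM.Prog} {n L T : P.Inst → ℕ} (hsize : ∀ x, P.size x = n x * L x)
    (hT : Dom n L γ γ T)
    (hp : ∀ x, RAM.DecidesWithin p (P.encode x) (P.yes x) (T x) ((P.size x : ℝ≥0∞)⁻¹)) :
    P.SolvableInTime fun n => (n : ℝ) ^ γ := by
  obtain ⟨C, h0, hC⟩ := hT
  refine ⟨p, fun s => ⌈C * (s : ℝ) ^ γ⌉₊, fun s => (s : ℝ≥0∞)⁻¹, ?_,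
    ENNReal.tendsto_inv_nat_nhds_zero, fun x => (hp x).mono Iff.rfl ?_ le_rfl⟩
  · refine IsBigO.of_bound (C + 1) ?_
    filter_upwards [eventually_ge_atTop 1] with s hs
    have h1 : (1 : ℝ) ≤ (s : ℝ) ^ γ := Real.one_le_rpow (by exact_mod_cast hs) hγ
    rw [Real.norm_of_nonneg (by positivity), Real.norm_of_nonneg (by positivity)]
    refine (Nat.ceil_lt_add_one (by positivity)).le.trans ?_
    linarith
  · have := hC x
    rw [← Real.mul_rpow (by positivity) (by positivity), ← Nat.cast_mul, ← hsize] at this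
    exact_mod_cast this.trans (Nat.le_ceil _)

/-! ### Time and error of the driver -/

namespace RAM

/-- The time of the driver up to a constant. -/
theorem driverTime_le (pre ini gen : Cmd) (p : Prog) : ∃ c, ∀ Z r b k₀ k₁ k₂ T : ℕ, 1 ≤ b →
    driverTime pre ini gen p Z r b k₀ k₁ k₂ T ≤
      c * (k₀ * b + k₁ * b + Z * (r + 1) * b * (k₂ + T + 1) + b) := by
  refine ⟨pre.cost + ini.cost + (gen.cost + 2 * p.regs + 1000), fun Z r b k₀ k₁ k₂ T hb => ?_⟩
  unfold driverTime roundTime trialTime boxFactor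
  have h1 : k₂ * (b * gen.cost) + (5 * b + 10) * T + T + 2 * p.regs + 5 * b + 50 + b + 1 ≤
      (gen.cost + 2 * p.regs + 900) * (b * (k₂ + T + 1)) := by
    obtain ⟨b, rfl⟩ := Nat.exists_eq_add_of_le hb
    ring_nf
    omega
  set G := gen.cost + 2 * p.regs + 900 with hG
  set X := b * (k₂ + T + 1) with hX
  have hX1 : b ≤ X := Nat.le_mul_of_pos_right _ (by omega)
  have h2 : r * (k₂ * (b * gen.cost) + (5 * b + 10) * T + T + 2 * p.regs + 5 * b + 50 + b + 1) +
      7 * b + 60 ≤ (r + 1) * (G * X) := by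
    have h3 := Nat.mul_le_mul_left r h1
    have h4 : 900 * X ≤ G * X := Nat.mul_le_mul_right _ (by omega)
    have h6 : (r + 1) * (G * X) = r * (G * X) + G * X := by ring
    omega
  have h5 := Nat.mul_le_mul_left Z h2
  have h6 : Z * ((r + 1) * (G * X)) = G * (Z * (r + 1) * b * (k₂ + T + 1)) := by rw [hX]; ring
  have h7 : k₀ * (b * pre.cost) = pre.cost * (k₀ * b) := by ring
  have h8 : k₁ * (b * ini.cost) = ini.cost * (k₁ * b) := by ring
  have h9 : gen.cost + 2 * p.regs + 1000 = G + 100 := by omega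
  rw [h7, h8, h9]
  rw [h6] at h5
  generalize Z * (r * (k₂ * (b * gen.cost) + (5 * b + 10) * T + T + 2 * p.regs + 5 * b + 50 + b +
    1) + 7 * b + 60) = Y at h5 ⊢
  generalize k₀ * b = A
  generalize k₁ * b = B
  generalize Z * (r + 1) * b * (k₂ + T + 1) = D at h5 ⊢
  generalize pre.cost = a
  generalize ini.cost = d
  have h10 : 110 * b ≤ (G + 100) * b + a * b + d * b := by
    have : 110 * b ≤ (G + 100) * b := Nat.mul_le_mul_right _ (by omega)
    omega
  ring_nf at h10 ⊢
  omega

/-- The error of a vote is `2⁻¹ ^ r`, so logarithmically many repetitions reduce the sum over all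
instances to `1 / s`. -/
theorem voteError_mul_le {Z r s : ℕ} (hs : 1 ≤ s) (h : Z * s ≤ 2 ^ r) :
    Z * voteError r ≤ (s : ℝ≥0∞)⁻¹ := by
  have h4 : voteError r = (2 ^ r)⁻¹ := by
    unfold voteError
    rw [← mul_pow, show (4 : ℝ≥0∞)⁻¹ * 2 = 2⁻¹ from ?_, ENNReal.inv_pow]
    rw [show (4 : ℝ≥0∞) = 2 * 2 by norm_num, ENNReal.mul_inv (by simp) (by simp), mul_assoc,
      ENNReal.inv_mul_cancel (by simp) (by simp), mul_one]
  have hs0 : (s : ℝ≥0∞) ≠ 0 := by simp; omega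
  rw [h4, ← div_eq_mul_inv, ENNReal.div_le_iff (by simp) (by simp), mul_comm, ← div_eq_mul_inv]
  rw [ENNReal.le_div_iff_mul_le (.inl hs0) (.inl (by simp))]
  exact_mod_cast h

end RAM

theorem Nat.size_mul_le (a b : ℕ) : (a * b).size ≤ a.size + b.size := by
  rw [Nat.size_le, pow_add]
  exact Nat.mul_lt_mul'' (Nat.lt_size_self a) (Nat.lt_size_self b)

theorem Nat.size_add_le (a b : ℕ) : (a + b).size ≤ a.size + b.size + 1 := by
  rw [Nat.size_le, pow_succ, pow_add]
  have h1 := Nat.lt_size_self a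
  have h2 := Nat.lt_size_self b
  have h3 : 2 ^ a.size ≤ 2 ^ a.size * 2 ^ b.size := Nat.le_mul_of_pos_right _ (by positivity)
  have h4 : 2 ^ b.size ≤ 2 ^ a.size * 2 ^ b.size := Nat.le_mul_of_pos_left _ (by positivity)
  omega

theorem Nat.two_pow_size_le {m : ℕ} (hm : 0 < m) : 2 ^ m.size ≤ 2 * m := by
  have h1 : m.size - 1 < m.size := Nat.sub_lt (Nat.size_pos.2 hm) one_pos
  have h2 := Nat.lt_size.1 h1
  obtain ⟨k, hk⟩ : ∃ k, m.size = k + 1 := ⟨m.size - 1, by omega⟩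
  rw [hk, pow_succ]
  rw [hk] at h2
  simp only [Nat.add_sub_cancel] at h2
  omega

/-! ### Programs for binary lengths and for maxima -/

namespace RAM

section
variable {E : Env} {s : St} {c d : Cmd} {τ : ℕ} {Q : St → Prop}

theorem Tri.set_seq {i : ℕ} {e : Expr} (a : ℤ) (he : e.ok E.l E.x s.v s.W)
    (ha : e.ev E.x s.v s.W = a) (hb : a.natAbs < 2 ^ E.b)
    (h : Tri E d { s with v := Function.update s.v i a } τ Q) :
    Tri E (.seq (.set i e) d) s (τ + 2) Q :=
  (Tri.seq (Q' := fun s' => s' = { s with v := Function.update s.v i a })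
    (Tri.set he ha hb rfl) fun s' _ hs' => hs' ▸ h).mono (by omega) fun _ _ h => h

/-- `out` becomes the binary length of `y`. -/
def Cmd.size (y out tmp : ℕ) : Cmd :=
  .seq (.set tmp 1) (.seq (.set out 0) (.while (.var y + 1 - .var tmp)
    (.seq (.set tmp (.var tmp + .var tmp)) (.set out (.var out + 1)))))

/-- After `k` passes, `out` is `k` and `tmp` is `2 ^ k`; the loop goes on as long as `2 ^ k ≤ m`. -/
theorem Tri.size {y out tmp m : ℕ} (h1 : y ≠ out) (h2 : y ≠ tmp) (h3 : out ≠ tmp)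
    (hy : s.v y = m) (hm : m.size < E.b) :
    Tri E (Cmd.size y out tmp) s (4 * m.size + 5) fun s' => s'.v out = m.size := by
  have hlt : ∀ k ≤ m.size, 2 ^ k < 2 ^ E.b := fun k hk => Nat.pow_lt_pow_right (by norm_num) (by omega)
  have hm' : m.size < 2 ^ E.b := hm.trans Nat.lt_two_pow_self
  refine (Tri.set_seq 1 (by simp) (by simp) (by simpa using hlt 0 (Nat.zero_le _))
    (Tri.set_seq 0 (by simp) (by simp) (by simp)
    ((Tri.while (τ := 3) (fun k s' => s'.v tmp = (2 ^ k : ℕ) ∧ s'.v out = k) m.size ?_ ?_ ?_ ?_).mono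
      le_rfl fun _ _ h => h.2))).mono (by omega) fun _ _ h => h
  · simp [Function.update_of_ne h3.symm]
  · intro k _ s' _ _; simp
  · intro k hk s' hs h
    have : s'.v y = m := by
      rw [hs.v y (by simp [Cmd.mods, h1, h2])]; simp [Function.update_of_ne h1, Function.update_of_ne h2, hy]
    simp only [Expr.ev_sub, Expr.ev_add, Expr.ev_var, Expr.ev_one, this, h.1]
    rw [Nat.lt_size]
    omega
  · intro k hk s' hs h
    refine (Tri.set_seq (2 ^ (k + 1) : ℕ) (by simp) ?_ (by simpa using hlt (k + 1) hk)
      (Tri.set (a := (k + 1 : ℕ)) (by simp) ?_ ?_ ?_)).mono le_rfl fun _ _ h => h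
    · simp [h.1, pow_succ]; ring
    · simp [Function.update_of_ne h3, h.2]
    · simp only [Int.natAbs_natCast]; omega
    · simp [Function.update_of_ne h3.symm]

/-- The maximum of `m` and of the absolute values of the first `N` values of `g`. -/
def maxAbs (m : ℕ) (g : ℕ → ℤ) : ℕ → ℕ
  | 0 => m
  | N + 1 => max (maxAbs m g N) (g N).natAbs

theorem le_maxAbs {m : ℕ} {g : ℕ → ℤ} {N : ℕ} : m ≤ maxAbs m g N := by
  induction N with
  | zero => exact le_rfl
  | succ N ih => exact ih.trans (le_max_left _ _)

theorem natAbs_le_maxAbs {m : ℕ} {g : ℕ → ℤ} {N k : ℕ} (hk : k < N) :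
    (g k).natAbs ≤ maxAbs m g N := by
  induction N with
  | zero => omega
  | succ N ih =>
    rcases Nat.lt_succ_iff_lt_or_eq.1 hk with h | rfl
    · exact (ih h).trans (le_max_left _ _)
    · exact le_max_right _ _

theorem maxAbs_le {m : ℕ} {g : ℕ → ℤ} {N B : ℕ} (hm : m ≤ B) (h : ∀ k < N, (g k).natAbs ≤ B) :
    maxAbs m g N ≤ B := by
  induction N with
  | zero => exact hm
  | succ N ih => exact max_le (ih fun k hk => h k (by omega)) (h N (by omega))

/-- The larger one of `a` and the absolute value of `e`. -/
def Expr.maxAbs (a e : Expr) : Expr := .ite (e - a) e (.ite (0 - e - a) (0 - e) a)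

theorem Expr.ev_maxAbs {x v W} {a e : Expr} {m : ℕ} (h : a.ev x v W = m) :
    (Expr.maxAbs a e).ev x v W = (max m (e.ev x v W).natAbs : ℕ) := by
  simp only [Expr.maxAbs, Expr.ev_ite, Expr.ev_sub, Expr.ev_zero, h]
  split_ifs <;> omega

theorem Expr.ok_maxAbs {l x v W} {a e : Expr} (h : a.ok l x v W) (h' : e.ok l x v W) :
    (Expr.maxAbs a e).ok l x v W := by
  simp [Expr.maxAbs, h, h']

theorem Tri.maxAbs {i y : ℕ} {e val : Expr} (hiy : i ≠ y) (N m : ℕ) (g : ℕ → ℤ) (hN : N < 2 ^ E.b)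
    (hy : s.v y = m)
    (he : ∀ (k : ℕ) (a : ℤ), k ≤ N →
      e.ok E.l E.x (Function.update (Function.update s.v y a) i k) s.W ∧
      e.ev E.x (Function.update (Function.update s.v y a) i k) s.W = N)
    (hv : ∀ (k : ℕ) (a : ℤ), k < N →
      val.ok E.l E.x (Function.update (Function.update s.v y a) i k) s.W ∧
      val.ev E.x (Function.update (Function.update s.v y a) i k) s.W = g k)
    (hb : RAM.maxAbs m g N < 2 ^ E.b) :
    Tri E (.loop i e (.set y (Expr.maxAbs (.var y) val))) s (N * 4 + 3)
      fun s' => s'.v y = RAM.maxAbs m g N := by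
  refine Tri.accum hiy N (fun k => RAM.maxAbs m g k) hN hy.symm (fun k hk => he k _ hk)
    (fun k hk => ⟨Expr.ok_maxAbs (by simp) (hv k _ hk).1, ?_⟩) fun k hk => ?_
  · rw [Expr.ev_maxAbs (m := RAM.maxAbs m g k) (by simp [Function.update_of_ne hiy.symm]),
      (hv k _ hk).2]
    rfl
  · refine lt_of_le_of_lt ?_ hb
    simp only [Int.natAbs_natCast]
    exact RAM.maxAbs_le le_maxAbs fun j hj => natAbs_le_maxAbs (by omega)

end

end RAM

/-! ### Weighted graphs as they are found in memory -/

namespace WeightedGraphInst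

variable (I : WeightedGraphInst)

/-- Non-edges are stored with weight `0`, so the maximum over the whole matrix is the one over the
edges. -/
theorem maxAbs_eq : I.maxAbs = RAM.maxAbs (max 1 I.target.natAbs)
    (fun m => I.wt (m / I.n) (m % I.n)) (I.n * I.n) := by
  refine le_antisymm (I.maxAbs_le ((le_max_left _ _).trans RAM.le_maxAbs)
    ((le_max_right _ _).trans RAM.le_maxAbs) fun u v huv => ?_)
    (RAM.maxAbs_le (max_le I.one_le_maxAbs I.natAbs_target_le) fun k _ => I.natAbs_wt_le _ _)
  obtain ⟨hu, hv, _⟩ := huv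
  have h := RAM.natAbs_le_maxAbs (m := max 1 I.target.natAbs)
    (g := fun m => I.wt (m / I.n) (m % I.n)) (show u * I.n + v < I.n * I.n by nlinarith)
  have e1 : (u * I.n + v) / I.n = u := by
    rw [mul_comm, Nat.mul_add_div I.n_pos, Nat.div_eq_of_lt hv, add_zero]
  have e2 : (u * I.n + v) % I.n = v := by
    rw [mul_comm, Nat.mul_add_mod, Nat.mod_eq_of_lt hv]
  simpa only [e1, e2] using h

theorem memOfList_encode_zero : RAM.memOfList I.encode 0 = I.n := by
  have : (0 : ℤ) ≤ I.n * I.n := by positivity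
  rw [memOfList_encode]
  unfold RAM.tab
  rw [if_neg (by omega), if_neg (by omega)]
  simp

theorem memOfList_encode_one : RAM.memOfList I.encode 1 = I.target := by
  have : (0 : ℤ) ≤ I.n * I.n := by positivity
  rw [memOfList_encode]
  unfold RAM.tab
  rw [if_neg (by omega), if_neg (by omega)]
  simp

open Classical in
theorem memOfList_encode_adj {u v : ℕ} (hu : u < I.n) (hv : v < I.n) :
    RAM.memOfList I.encode (2 + (u * I.n + v)) = if I.adj u v then 1 else 0 := by
  have h : u * I.n + v < I.n * I.n := by nlinarith
  have e1 : (u * I.n + v) / I.n = u := by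
    rw [mul_comm, Nat.mul_add_div I.n_pos, Nat.div_eq_of_lt hv, add_zero]
  have e2 : (u * I.n + v) % I.n = v := by
    rw [mul_comm, Nat.mul_add_mod, Nat.mod_eq_of_lt hv]
  have h' : ((u * I.n + v : ℕ) : ℤ) < (I.n * I.n : ℕ) := by exact_mod_cast h
  push_cast at h'
  rw [memOfList_encode, RAM.tab, if_neg (by omega)]
  have := RAM.tab_apply (base := 2) (f := fun m => if I.adj (m / I.n) (m % I.n) then (1 : ℤ) else 0)
    (O := Function.update (Function.update 0 0 (I.n : ℤ)) 1 I.target) h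
  push_cast at this
  rw [this, e1, e2]

theorem memOfList_encode_wt' {m : ℕ} (hm : m < I.n * I.n) :
    RAM.memOfList I.encode (2 + I.n * I.n + m) = I.wt (m / I.n) (m % I.n) := by
  rw [memOfList_encode]
  exact RAM.tab_apply hm

theorem memOfList_encode_wt {u v : ℕ} (hu : u < I.n) (hv : v < I.n) :
    RAM.memOfList I.encode (2 + I.n * I.n + (u * I.n + v)) = I.wt u v := by
  have h : u * I.n + v < I.n * I.n := by nlinarith
  have := I.memOfList_encode_wt' h
  push_cast at this
  rw [this, mul_comm, Nat.mul_add_div I.n_pos, Nat.div_eq_of_lt hv, add_zero, Nat.mul_add_mod,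
    Nat.mod_eq_of_lt hv]

end WeightedGraphInst

namespace RAM.Expr

@[simp] theorem pureIn_add (a b : Expr) : (a + b).pureIn = (a.pureIn && b.pureIn) := rfl
@[simp] theorem pureIn_sub (a b : Expr) : (a - b).pureIn = (a.pureIn && b.pureIn) := rfl
@[simp] theorem pureIn_mul (a b : Expr) : (a * b).pureIn = (a.pureIn && b.pureIn) := rfl
@[simp] theorem pureIn_div (a b : Expr) : (a / b).pureIn = (a.pureIn && b.pureIn) := rfl
@[simp] theorem pureIn_zero : (0 : Expr).pureIn = true := rfl
@[simp] theorem pureIn_one : (1 : Expr).pureIn = true := rfl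
@[simp] theorem pureIn_ofNat (n : ℕ) [n.AtLeastTwo] :
    (no_index (OfNat.ofNat n) : Expr).pureIn = true := rfl

end RAM.Expr

open RAM RAM.Expr

/-! ### The preparation that is common to the reductions of graph problems -/

namespace WeightedGraphInst

/-- A preparation for the input of a weighted graph; `e` is the number of instances that are to be
generated. -/
def pre (e : Expr) (c : ℕ) : Cmd :=
  .seq (.set 6 (inp 0)) <| .seq (.set 7 (Expr.maxAbs 1 (inp 1))) <|
  .seq (.loop 11 (var 6 * var 6)
    (.set 7 (Expr.maxAbs (var 7) (inp (2 + var 6 * var 6 + var 11))))) <|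
  .seq (Cmd.size 7 8 12) <| .seq (Cmd.size 6 9 12) <| .seq (.set 10 (72 * var 9 + 8)) <|
  .seq (.set 1 e) <| .seq (.set 13 (var 1 * var 6 * var 8)) <| .seq (Cmd.size 13 2 12) <|
  .seq (.set 4 (2 * (var 6 * var 6) + 2)) <| .seq (.set 3 (var 4 + 2 * (var 1 * var 2) + 3)) <|
  .set 7 (lit c * var 7)

section
variable (Z : ℕ → ℕ → ℕ) (c : ℕ) (I : WeightedGraphInst)

/-- A bound for the moduli that are tried. -/
def q : ℕ := 72 * I.n.size + 8

/-- The binary length of the weights. -/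
noncomputable def len : ℕ := I.maxAbs.size

/-- The number of generated instances. -/
def num : ℕ := Z I.n I.q

/-- The least `r` with `num * n * len < 2 ^ r`, which makes the total error of all votes at most the
reciprocal of the size. -/
noncomputable def reps : ℕ := (I.num Z * I.n * I.len).size

/-- Room for the input of length `2 * (n * n) + 2`, for the two classes of the initial phase and for
two classes per trial; one more makes the inequality in `Plan.J_lt` strict. -/
noncomputable def modulus : ℕ := 2 * (I.n * I.n) + 2 + 2 * (I.num Z * I.reps Z) + 3

/-- A multiple of the bound of the weights. -/
noncomputable def unit : ℕ := c * I.maxAbs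

/-- The factor is generous, so that all the constant multiples that occur later, such as `1024 *
unit` or `81 * (n * n)`, stay below this bound. -/
noncomputable def big : ℕ :=
  100000 * (I.modulus Z + I.num Z * I.n * I.len + I.unit c + I.maxAbs + I.q)

noncomputable def bits : ℕ := (I.big Z c).size

/-- The variables after the preparation. -/
def Vars (v : ℕ → ℤ) : Prop := v 1 = I.num Z ∧ v 2 = I.reps Z ∧ v 3 = I.modulus Z ∧
  v 4 = (2 * (I.n * I.n) + 2 : ℕ) ∧ v 6 = I.n ∧ v 7 = I.unit c ∧ v 10 = I.q

noncomputable abbrev env : Env := ⟨memOfList I.encode, I.encode.length, I.bits Z c⟩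

variable {Z c}

theorem lt_two_pow_bits {m : ℕ} (h : m ≤ I.big Z c) : m < 2 ^ I.bits Z c :=
  h.trans_lt (Nat.lt_size_self _)

theorem size_lt_bits {m : ℕ} (h0 : 0 < m) (h : 2 * m ≤ I.big Z c) : m.size < I.bits Z c :=
  Nat.lt_size.2 ((Nat.two_pow_size_le h0).trans h)

theorem len_pos : 0 < I.len := Nat.size_pos.2 I.one_le_maxAbs

theorem natAbs_inp_lt : ∀ a ∈ I.encode, a.natAbs < 2 ^ I.bits Z c := by
  have h1 := I.one_le_maxAbs
  have h2 : I.n ≤ I.n * I.n := Nat.le_mul_of_pos_left _ I.n_pos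
  intro a ha
  refine I.lt_two_pow_bits ?_
  unfold big modulus
  simp only [encode, List.mem_cons, List.mem_append, List.mem_ofFn] at ha
  rcases ha with rfl | rfl | ⟨m, rfl⟩ | ⟨m, rfl⟩
  · rw [Int.natAbs_natCast]; omega
  · have := I.natAbs_target_le; omega
  · split_ifs <;> (simp; try omega)
  · split_ifs with h
    · have := I.natAbs_wt_le m.divNat m.modNat
      rw [I.wt_eq h] at this; omega
    · simp

theorem tri_pre (hZ : ∀ n q, 0 < n → 0 < q → 0 < Z n q) {e : Expr}
    (he : ∀ l x v W (n q : ℕ), v 6 = (n : ℤ) → v 10 = (q : ℤ) → e.ok l x v W ∧ e.ev x v W = Z n q) :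
    Tri (I.env Z c) (pre e c) ⟨0, 0, 0⟩
      (4 * (I.n * I.n) + 4 * (I.len + I.n.size + I.reps Z) + 60)
      fun s' => I.Vars Z c s'.v ∧ s'.v 0 = 0 := by
  have hn := I.n_pos
  have h1 := I.one_le_maxAbs
  have h2 : I.n ≤ I.n * I.n := Nat.le_mul_of_pos_left _ hn
  have hq : 0 < I.q := by unfold q; omega
  have hZ0 : 0 < I.num Z := hZ _ _ hn hq
  have hL := I.len_pos
  have hbig : I.big Z c = 100000 * (2 * (I.n * I.n) + 2 + 2 * (I.num Z * I.reps Z) + 3 +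
    I.num Z * I.n * I.len + c * I.maxAbs + I.maxAbs + I.q) := rfl
  have hZn : I.num Z ≤ I.num Z * I.n * I.len := by
    rw [mul_assoc]; exact Nat.le_mul_of_pos_right _ (by positivity)
  have hx0 := I.memOfList_encode_zero
  have hx1 := I.memOfList_encode_one
  have hlen := I.length_encode
  set b := I.bits Z c with hb
  have lt : ∀ m : ℕ, m ≤ I.big Z c → (m : ℤ).natAbs < 2 ^ b := fun m hm => by
    rw [Int.natAbs_natCast]; exact I.lt_two_pow_bits hm
  have hM0 : max 1 I.target.natAbs ≤ I.maxAbs := max_le h1 I.natAbs_target_le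
  refine Tri.mono (τ₁ := ((I.n * I.n) * 4 + 3) + ((4 * I.maxAbs.size + 5) +
    ((4 * I.n.size + 5) + (((((4 * (I.num Z * I.n * I.len).size + 5) + 5 + 1) + 2) +
      2) + 2) + 1) + 1) + 1 + 2 + 2)
    (Q' := fun s' => I.Vars Z c s'.v ∧ s'.v 0 = 0) ?_ ?_ fun _ _ h => h
  · refine Tri.set_seq I.n ?_ ?_ (lt _ (by omega)) ?_
    · simp [hlen]; positivity
    · simp [hx0]
    refine Tri.set_seq (max 1 I.target.natAbs : ℕ) ?_ ?_ (lt _ (by omega)) ?_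
    · exact ok_maxAbs (by simp) (by
        have : (0 : ℤ) ≤ I.n * I.n := by positivity
        simp [hlen]; omega)
    · rw [ev_maxAbs (m := 1) (by simp)]; simp [hx1]
    refine Tri.seq (Tri.maxAbs (by norm_num) (I.n * I.n) (max 1 I.target.natAbs)
      (fun m => I.wt (m / I.n) (m % I.n)) ?_ ?_ ?_ ?_ ?_) fun s₁ hs₁ h7 => ?_
    · exact I.lt_two_pow_bits (by omega)
    · simp
    · intro k a _; simp
    · intro k a hk
      have := I.memOfList_encode_wt' hk
      constructor
      · simp [hlen]; constructor
        · positivity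
        · have : (k : ℤ) < (I.n * I.n : ℕ) := by exact_mod_cast hk
          push_cast at this; linarith
      · simp [this]
    · rw [← I.maxAbs_eq]; exact I.lt_two_pow_bits (by omega)
    rw [← I.maxAbs_eq] at h7
    have h6 : s₁.v 6 = I.n := by rw [hs₁.v 6 (by simp [Cmd.loop, Cmd.mods])]; simp
    have h0 : s₁.v 0 = 0 := by rw [hs₁.v 0 (by simp [Cmd.loop, Cmd.mods])]; simp
    refine Tri.seq (Tri.size (by norm_num) (by norm_num) (by norm_num) h7
      (I.size_lt_bits h1 (by omega))) fun s₂ hs₂ h8 => ?_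
    replace h7 : s₂.v 7 = I.maxAbs := by rw [hs₂.v 7 (by simp [Cmd.size, Cmd.mods]), h7]
    replace h6 : s₂.v 6 = I.n := by rw [hs₂.v 6 (by simp [Cmd.size, Cmd.mods]), h6]
    replace h0 : s₂.v 0 = 0 := by rw [hs₂.v 0 (by simp [Cmd.size, Cmd.mods]), h0]
    refine Tri.seq (Tri.size (by norm_num) (by norm_num) (by norm_num) h6
      (I.size_lt_bits hn (by omega))) fun s₃ hs₃ h9 => ?_
    replace h8 : s₃.v 8 = I.len := by rw [hs₃.v 8 (by simp [Cmd.size, Cmd.mods]), h8]; rfl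
    replace h7 : s₃.v 7 = I.maxAbs := by rw [hs₃.v 7 (by simp [Cmd.size, Cmd.mods]), h7]
    replace h6 : s₃.v 6 = I.n := by rw [hs₃.v 6 (by simp [Cmd.size, Cmd.mods]), h6]
    replace h0 : s₃.v 0 = 0 := by rw [hs₃.v 0 (by simp [Cmd.size, Cmd.mods]), h0]
    refine Tri.set_seq I.q (by simp) (by simp [h9, q]) (lt _ (by omega)) ?_
    refine Tri.set_seq (I.num Z) (he _ _ _ _ I.n I.q (by simp [h6]) (by simp)).1
      (he 0 _ _ _ I.n I.q (by simp [h6]) (by simp)).2 (lt _ (by omega)) ?_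
    refine Tri.set_seq (I.num Z * I.n * I.len : ℕ) (by simp) (by simp [h6, h8])
      (lt _ (by omega)) ?_
    refine Tri.seq (τ₂ := 5) (Tri.size (m := I.num Z * I.n * I.len) (by norm_num) (by norm_num) (by norm_num)
      (by simp) (I.size_lt_bits (by positivity) (by omega))) fun s₄ hs₄ h2' => ?_
    have m4 : ∀ j, j ≠ 2 → j ≠ 12 → j ≠ 13 → j ≠ 1 → j ≠ 10 → s₄.v j = s₃.v j := by
      intro j a1 a2 a3 a4 a5
      rw [hs₄.v j (by simp [Cmd.size, Cmd.mods, a1, a2])]; simp [a3, a4, a5]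
    have h1' : s₄.v 1 = I.num Z := by
      rw [hs₄.v 1 (by simp [Cmd.size, Cmd.mods])]; simp
    have h10 : s₄.v 10 = I.q := by
      rw [hs₄.v 10 (by simp [Cmd.size, Cmd.mods])]; simp
    rw [← m4 7 (by norm_num) (by norm_num) (by norm_num) (by norm_num) (by norm_num)] at h7
    rw [← m4 6 (by norm_num) (by norm_num) (by norm_num) (by norm_num) (by norm_num)] at h6
    rw [← m4 0 (by norm_num) (by norm_num) (by norm_num) (by norm_num) (by norm_num)] at h0
    have h2'' : s₄.v 2 = I.reps Z := h2'
    refine Tri.set_seq (2 * (I.n * I.n) + 2 : ℕ) (by simp) (by simp [h6]) (lt _ (by omega)) ?_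
    refine Tri.set_seq (I.modulus Z) (by simp) ?_ (lt _ ?_) ?_
    · simp [h1', h2'', modulus]
    · unfold modulus; omega
    refine Tri.set (a := I.unit c) (by simp) ?_ (lt _ ?_) ?_
    · simp [h7, unit]
    · unfold unit; omega
    clear h2'
    refine ⟨⟨?_, ?_, ?_, ?_, ?_, ?_, ?_⟩, ?_⟩ <;> simp [h0, h6, h1', h10, h2'']
  · change _ ≤ 4 * (I.n * I.n) + 4 * (I.maxAbs.size + I.n.size + (I.num Z * I.n * I.len).size) + 60
    omega

theorem pureIn_pre {e : Expr} (he : e.pureIn = true) : (pre e c).pureIn = true := by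
  simp [pre, Cmd.pureIn, Cmd.size, Cmd.loop, Expr.maxAbs, Expr.pureIn, he]

end

end WeightedGraphInst

/-! ### Time of a reduction of a graph problem -/

namespace WeightedGraphInst

section
variable (Z : ℕ → ℕ → ℕ) (c : ℕ)

theorem dom_q {η : ℝ} (hη : 0 < η) : Dom n len η η q := by
  have hn : ∀ I : WeightedGraphInst, 1 ≤ I.n := n_pos
  have hL : ∀ I : WeightedGraphInst, 1 ≤ I.len := len_pos
  exact ((Dom.size hn hL Dom.fst hη).smul 72).add ((Dom.const 8).mono hn hL hη.le hη.le)

variable {Z}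

theorem dom_reps (hZ : Dom n len 2 2 (num Z)) {η : ℝ} (hη : 0 < η) : Dom n len η η (reps Z) := by
  have hn : ∀ I : WeightedGraphInst, 1 ≤ I.n := n_pos
  have hL : ∀ I : WeightedGraphInst, 1 ≤ I.len := len_pos
  exact ((hZ.mul hn hL Dom.fst).mul hn hL Dom.snd).size hn hL hη

/-- Apart from `unit` and `maxAbs`, all summands of `big` are polynomial in `n` and `len`, so that
their lengths are below any power. The length of the two exceptions is `len` up to a constant,
whence the exponent `1 + η`. -/
theorem dom_bits (hZ : Dom n len 2 2 (num Z)) {η : ℝ} (hη : 0 < η) :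
    Dom n len η (1 + η) (bits Z c) := by
  have hn : ∀ I : WeightedGraphInst, 1 ≤ I.n := n_pos
  have hL : ∀ I : WeightedGraphInst, 1 ≤ I.len := len_pos
  have hc : ∀ k, Dom n len η (1 + η) fun _ => k := fun k =>
    (Dom.const k).mono hn hL hη.le (by linarith)
  have h1 : Dom n len 4 4 (modulus Z) := by
    have h2 : Dom n len 4 4 fun I => I.n * I.n := (Dom.fst.mul hn hL Dom.fst).mono hn hL
      (by norm_num) (by norm_num)
    have h3 : Dom n len 4 4 fun I => I.num Z * I.reps Z :=
      (hZ.mul hn hL (dom_reps hZ one_pos)).mono hn hL (by norm_num) (by norm_num)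
    have hc : ∀ k, Dom n len 4 4 fun _ => k := fun k =>
      (Dom.const k).mono hn hL (by norm_num) (by norm_num)
    exact ((((h2.smul 2).add (hc 2)).add (h3.smul 2)).add (hc 3)).of_le fun I => by
      unfold modulus; omega
  have h2 : Dom n len 4 4 fun I => I.num Z * I.n * I.len :=
    ((hZ.mul hn hL Dom.fst).mul hn hL Dom.snd).mono hn hL (by norm_num) (by norm_num)
  have h3 : Dom n len 4 4 q := (dom_q one_pos).mono hn hL (by norm_num) (by norm_num)
  have h4 := ((h1.add h2).add h3).size hn hL hη
  have h5 : Dom n len η (1 + η) fun I => (I.modulus Z + I.num Z * I.n * I.len + I.q).size :=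
    h4.mono hn hL le_rfl (by linarith)
  have h6 : Dom n len η (1 + η) len := Dom.snd.mono hn hL hη.le (by linarith)
  refine (((hc (Nat.size 100000)).add h5).add (((hc ((c + 1).size)).add h6).add (hc 1))).of_le
    fun I => ?_
  have e : I.big Z c = 100000 * ((I.modulus Z + I.num Z * I.n * I.len + I.q) +
      (c + 1) * I.maxAbs) := by unfold big unit; ring
  unfold bits
  rw [e]
  refine (Nat.size_mul_le _ _).trans ?_
  have h7 := Nat.size_add_le (I.modulus Z + I.num Z * I.n * I.len + I.q) ((c + 1) * I.maxAbs)
  have h8 := Nat.size_mul_le (c + 1) I.maxAbs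
  change _ ≤ _ + _ + (_ + I.maxAbs.size + 1)
  omega

end

/-- The exponents of `n` and `len` add up: `1 + η`, `η` for the number of instances, `η`, `η` for
the repetitions, `η`, `1 + η` for the lengths of the stored numbers, that is, for the cost of an
operation and the slowdown of the guest, and `β`, `β` for one instance. Both sums are `β + 1 + 3 *
η`. The missing power of `n` in the cost of an operation is provided by the number of instances, so
the two parameters balance. -/
theorem solvableInTime_of_reduction {V : Type} [Fintype V] {H : SimpleGraph V}
    {P : DecisionProblem} {β δ : ℝ} (hβ : 1 ≤ β) (hδ : 0 < δ)
    (hP : P.SolvableInTime fun s => (s : ℝ) ^ β) {Z : ℕ → ℕ → ℕ}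
    (hZ : ∀ n q, 0 < n → 0 < q → 0 < Z n q) (hZd : ∀ η : ℝ, 0 < η → Dom n len (1 + η) η (num Z))
    {e : Expr} (he' : e.pureIn = true)
    (he : ∀ l x v W (n q : ℕ), v 6 = (n : ℤ) → v 10 = (q : ℤ) →
      e.ok l x v W ∧ e.ev x v W = Z n q)
    {gen : Cmd} (F : ℕ → WeightedGraphInst → ℕ → P.Inst) {S k : ℕ → WeightedGraphInst → ℕ}
    (hlow : ∀ c ≥ 100, ∀ (I : WeightedGraphInst), ∀ z < I.num Z,
      (I.unit c).size ≤ P.size (F c I z))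
    (hupp : ∀ c ≥ 100, ∀ (I : WeightedGraphInst), ∀ z < I.num Z, P.size (F c I z) ≤ S c I)
    (hS : ∀ c, Dom n len 1 1 (S c)) (hk : ∀ c, Dom n len β β (k c))
    (hgen : ∀ c ≥ 100, ∀ (I : WeightedGraphInst), ∀ z < I.num Z,
      Generates (I.env Z c) (I.Vars Z c) gen z (P.encode (F c I z)) (k c I))
    (hyes : ∀ c ≥ 100, ∀ (I : WeightedGraphInst),
      I.HasExactCopy H ↔ ∃ z < I.num Z, P.yes (F c I z)) :
    (exactWeight H).SolvableInTime fun s => (s : ℝ) ^ (β + 1 + δ) := by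
  have hn : ∀ I : WeightedGraphInst, 1 ≤ I.n := n_pos
  have hL : ∀ I : WeightedGraphInst, 1 ≤ I.len := len_pos
  obtain ⟨p, cT, s₀, hcT, hp⟩ := hP.exists_program (by linarith)
  -- The power of two makes each generated instance at least as large as `s₀`, through the length of
  -- `unit`; the factor 100 separates multiples of `unit` from sums of weights.
  set c := 100 * 2 ^ s₀ with hc
  have hc100 : 100 ≤ c := Nat.le_mul_of_pos_right _ (by positivity)
  set T : WeightedGraphInst → ℕ := fun I => ⌈cT * (S c I : ℝ) ^ β⌉₊ with hT
  set k₀ : WeightedGraphInst → ℕ := fun I =>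
    4 * (I.n * I.n) + 4 * (I.len + I.n.size + I.reps Z) + 60 with hk₀
  refine DecisionProblem.solvableInTime_of_dom (p := driver (pre e c) .skip gen p) (n := n)
    (L := len) (T := fun I => driverTime (pre e c) .skip gen p (I.num Z) (I.reps Z) (I.bits Z c)
      (k₀ I) 1 (k c I) (T I)) (by linarith) (fun _ => rfl) ?_ fun I => ?_
  -- Three factors of the running time contribute one `η` each.
  · obtain ⟨η, hη, hηδ⟩ : ∃ η : ℝ, 0 < η ∧ 4 * η ≤ δ := ⟨δ / 4, by linarith, by linarith⟩
    obtain ⟨C, hC⟩ := driverTime_le (pre e c) .skip gen p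
    have hZ2 : Dom n len 2 2 (num Z) := (hZd 1 one_pos).mono hn hL (by norm_num) (by norm_num)
    have hb := dom_bits c hZ2 hη
    have hr := dom_reps hZ2 hη
    have hTd : Dom n len β β T := by
      have := (hS c).rpow hn hL zero_le_one zero_le_one hcT (γ := β) (by linarith)
      simpa using this
    have hk0 : Dom n len 2 1 k₀ := by
      have h1 : Dom n len 2 1 fun I => I.n * I.n := (Dom.fst.mul hn hL Dom.fst).mono hn hL
        (by norm_num) (by norm_num)
      have h2 : Dom n len 2 1 fun I => I.n.size :=
        (Dom.fst.size hn hL one_pos).mono hn hL (by norm_num) le_rfl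
      have h3 : Dom n len 2 1 (reps Z) := (dom_reps hZ2 one_pos).mono hn hL (by norm_num) le_rfl
      have h4 : Dom n len 2 1 len := Dom.snd.mono hn hL (by norm_num) le_rfl
      exact ((h1.smul 4).add (((h4.add h2).add h3).smul 4)).add
        ((Dom.const 60).mono hn hL (by norm_num) (by norm_num))
    have h1 : Dom n len (β + 1 + δ) (β + 1 + δ) fun I => k₀ I * I.bits Z c :=
      (hk0.mul hn hL hb).mono hn hL (by linarith) (by linarith)
    have h2 : Dom n len (β + 1 + δ) (β + 1 + δ) fun I => I.bits Z c :=
      hb.mono hn hL (by linarith) (by linarith)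
    have h3 : Dom n len (β + 1 + δ) (β + 1 + δ) fun I =>
        I.num Z * (I.reps Z + 1) * I.bits Z c * (k c I + T I + 1) := by
      have h4 : Dom n len η η fun I => I.reps Z + 1 :=
        hr.add ((Dom.const 1).mono hn hL hη.le hη.le)
      have h5 : Dom n len β β fun I => k c I + T I + 1 :=
        ((hk c).add hTd).add ((Dom.const 1).mono hn hL (by linarith) (by linarith))
      exact ((((hZd η hη).mul hn hL h4).mul hn hL hb).mul hn hL h5).mono hn hL (by linarith)
        (by linarith)
    refine (((h1.add (h2.smul 1)).add h3).add h2).smul C |>.of_le fun I => ?_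
    refine hC _ _ _ _ _ _ _ ?_
    exact Nat.size_pos.2 (by unfold big modulus; omega)
  · set b := I.bits Z c with hb
    have hK : I.modulus Z = 2 * (I.n * I.n) + 2 + 2 * (I.num Z * I.reps Z) + 3 := rfl
    have hbig : I.big Z c = 100000 * (I.modulus Z + I.num Z * I.n * I.len + I.unit c + I.maxAbs +
      I.q) := rfl
    have hzero := I.tri_pre (c := c) hZ he
    obtain ⟨k', hk', s', hrun, hV, h0⟩ := hzero
    have P' : Plan (pre e c) .skip gen I.encode (fun z => P.encode (F c I z)) False (I.num Z)
        (I.reps Z) b (k₀ I) 1 (k c I) :=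
      { Pre := I.Vars Z c
        K := I.modulus Z
        J := (2 * (I.n * I.n) + 2 : ℕ)
        b_pos := Nat.size_pos.2 (by omega)
        inp := I.natAbs_inp_lt
        pureIn := pureIn_pre he'
        le_J := by rw [I.length_encode]
        J_lt := by rw [hK]; push_cast; omega
        K_lt := by rw [Int.natAbs_natCast]; exact I.lt_two_pow_bits (by omega)
        Z_lt := by
          refine I.lt_two_pow_bits ?_
          have : I.num Z ≤ I.num Z * I.n * I.len := by
            rw [mul_assoc]; exact Nat.le_mul_of_pos_right _ (Nat.mul_pos (hn I) (hL I))
          omega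
        pre_spec := fun v hv => ⟨hv.1, hv.2.1, hv.2.2.1, hv.2.2.2.1⟩
        pre_update := by
          rintro v i a (rfl | rfl) hv <;> simpa [Vars] using hv
        pre_run := ⟨k', hk', s', hrun, hV, h0⟩
        ini_run := fun v hv h0 _ => ⟨1, le_rfl, _, .skip _, hv, by simp [h0]⟩
        gen_run := fun z hz => hgen c hc100 I z hz }
    have hs : 1 ≤ I.n * I.len := Nat.mul_pos (hn I) (hL I)
    have herr : I.num Z * voteError (I.reps Z) ≤ ((I.n * I.len : ℕ) : ℝ≥0∞)⁻¹ :=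
      voteError_mul_le hs (by rw [← mul_assoc]; exact (Nat.lt_size_self _).le)
    refine (P'.decidesWithin (T := T I) (p := p) (Y := fun z => P.yes (F c I z)) (δ := 16⁻¹) le_rfl
      (fun z hz => hp _ _ ?_ (hupp c hc100 I z hz)) (herr.trans ?_)).mono ?_ le_rfl herr
    · refine le_trans ?_ (hlow c hc100 I z hz)
      refine (Nat.lt_size.2 ?_).le
      unfold unit
      exact (Nat.le_mul_of_pos_left _ (by norm_num)).trans
        (Nat.le_mul_of_pos_right c I.one_le_maxAbs)
    · rw [ENNReal.inv_le_one]; exact_mod_cast hs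
    · rw [false_or]; exact (hyes c hc100 I).symm

end WeightedGraphInst

theorem Nat.digit_div {a b Q : ℕ} (h : b < Q) : (a * Q + b) / Q = a := by
  rw [mul_comm, Nat.mul_add_div (by omega), Nat.div_eq_of_lt h, add_zero]

theorem Nat.digit_mod {a b Q : ℕ} (h : b < Q) : (a * Q + b) % Q = b := by
  rw [mul_comm, Nat.mul_add_mod, Nat.mod_eq_of_lt h]

theorem Nat.digit_lt {a b A Q : ℕ} (ha : a < A) (h : b < Q) : a * Q + b < A * Q := by
  calc a * Q + b < a * Q + Q := by omega
    _ = (a + 1) * Q := by ring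
    _ ≤ A * Q := Nat.mul_le_mul_right _ ha

namespace WeightedGraphInst

/-! ### Stars by `3`-SUM -/

section
variable (I : WeightedGraphInst)

open Classical in
/-- The `u`-th number of the `i`-th list: the weight of the edge from `m` to `u`, provided that the
remainder of `u` modulo `p` is the `i`-th one of three distinct numbers. -/
noncomputable def starEntry (c m p a₀ a₁ a₂ i u : ℕ) : ℤ :=
  if (a₀ ≠ a₁ ∧ a₀ ≠ a₂ ∧ a₁ ≠ a₂) ∧ I.adj m u ∧ u % p = (if i = 0 then a₀ else if i = 1 then a₁
    else a₂) then I.wt m u - (if i = 2 then I.target else 0) else (8 * I.unit c : ℕ)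

/-- The instance of `3`-SUM with the number `z`. -/
noncomputable def starSum (c z : ℕ) : KSumInst 3 :=
  KSumInst.ofFun I.n I.n_pos (I.starEntry c (z / I.q / I.q / I.q / I.q) (z / I.q / I.q / I.q % I.q + 1)
    (z / I.q / I.q % I.q) (z / I.q % I.q) (z % I.q))

/-- The number of these instances. -/
def starNum (n q : ℕ) : ℕ := n * q * q * q * q

/-- The computation of the parameters of an instance. -/
def starDigits : Cmd :=
  .seq (.set 11 (mod (var 5) (var 10))) <| .seq (.set 12 (mod (var 5 / var 10) (var 10))) <|
  .seq (.set 13 (mod (var 5 / var 10 / var 10) (var 10))) <|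
  .seq (.set 14 (mod (var 5 / var 10 / var 10 / var 10) (var 10) + 1)) <|
  .set 15 (var 5 / var 10 / var 10 / var 10 / var 10)

/-- The entry with the number in variable 17. -/
def starVal : Expr :=
  .ite (inp (2 + (var 15 * var 6 + mod (var 17) (var 6))) *
      eqb (mod (mod (var 17) (var 6)) (var 14)) (.ite (eqb (var 17 / var 6) 0) (var 13)
        (.ite (eqb (var 17 / var 6) 1) (var 12) (var 11))) *
      (.ite (eqb (var 13) (var 12)) 0 (.ite (eqb (var 13) (var 11)) 0
        (.ite (eqb (var 12) (var 11)) 0 1))))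
    (inp (2 + var 6 * var 6 + (var 15 * var 6 + mod (var 17) (var 6))) -
      .ite (eqb (var 17 / var 6) 2) (inp 1) 0) (8 * var 7)

/-- The program that writes the instance. -/
def starGen : Cmd :=
  .seq starDigits <| .seq (.stO 0 (var 6)) <| .loop 17 (3 * var 6) (.stO (1 + var 17) starVal)

theorem ev_starVal {c m p a₀ a₁ a₂ k : ℕ} {v : ℕ → ℤ} {W : ℤ → ℤ} (hm : m < I.n)
    (h6 : v 6 = I.n) (h7 : v 7 = I.unit c) (h11 : v 11 = a₂) (h12 : v 12 = a₁) (h13 : v 13 = a₀)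
    (h14 : v 14 = p) (h15 : v 15 = m) (h17 : v 17 = k) :
    starVal.ok I.encode.length (memOfList I.encode) v W ∧
      starVal.ev (memOfList I.encode) v W = I.starEntry c m p a₀ a₁ a₂ (k / I.n) (k % I.n) := by
  have hu : k % I.n < I.n := Nat.mod_lt _ I.n_pos
  have hi' : (k : ℤ) / I.n = (k / I.n : ℕ) := by simp
  have hu' : (k : ℤ) % I.n = (k % I.n : ℕ) := by simp
  have hA := I.memOfList_encode_adj hm hu
  have hW := I.memOfList_encode_wt hm hu
  have b1 : ((m * I.n + k % I.n : ℕ) : ℤ) < (I.n * I.n : ℕ) := by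
    exact_mod_cast Nat.digit_lt hm hu
  have b2 : (0 : ℤ) ≤ (m * I.n + k % I.n : ℕ) := by positivity
  have b3 : (0 : ℤ) ≤ (I.n * I.n : ℕ) := by positivity
  rw [Nat.cast_add, Nat.cast_mul] at b1 b2
  rw [Nat.cast_mul] at b1 b3
  have hl : (I.encode.length : ℤ) = 2 * (I.n * I.n) + 2 := by rw [I.length_encode]; push_cast; rfl
  generalize k / I.n = i at *
  generalize k % I.n = u at *
  constructor
  · simp only [starVal, ok_ite, ok_mul, ok_var, ok_inp, ok_add, ok_ofNat, ok_mod, ok_eqb, ok_div,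
      ok_zero, ok_one, ok_sub, ev_add, ev_mul, ev_ofNat, ev_var, ev_mod, h6, h15, h17, hu', hl,
      ev_one, true_and, and_true, implies_true]
    refine ⟨by constructor <;> linarith, fun _ => ⟨by constructor <;> linarith, fun _ => ?_⟩⟩
    constructor <;> linarith
  · have hup : (u : ℤ) % p = (u % p : ℕ) := by simp
    simp only [starVal, ev_ite, ev_eqb, ev_inp, ev_sub, ev_div, ev_zero, ev_one, ev_add, ev_mul,
      ev_ofNat, ev_var, ev_mod, h6, h7, h11, h12, h13, h14, h15, h17, hi', hu', hA, hW, hup,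
      I.memOfList_encode_one]
    unfold starEntry
    have c0 : ((i : ℤ) = 0) = (i = 0) := by norm_cast
    have c1 : ((i : ℤ) = 1) = (i = 1) := by norm_cast
    have c2 : ((i : ℤ) = 2) = (i = 2) := by norm_cast
    have cc : (((u % p : ℕ) : ℤ) = if 0 < (if i = 0 then (1 : ℤ) else 0) then (a₀ : ℤ) else
        if 0 < (if i = 1 then (1 : ℤ) else 0) then (a₁ : ℤ) else a₂) =
        (u % p = if i = 0 then a₀ else if i = 1 then a₁ else a₂) := by
      by_cases g0 : i = 0
      · simp only [g0, if_true, one_pos, Nat.cast_inj]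
      · by_cases g1 : i = 1
        · simp only [g1, if_true, one_pos, Nat.cast_inj, one_ne_zero, if_false, lt_irrefl]
        · simp only [g0, g1, Nat.cast_inj, if_false, lt_irrefl]
    have ct : (if 0 < (if i = 2 then (1 : ℤ) else 0) then I.target else 0) =
        if i = 2 then I.target else 0 := by
      by_cases g : i = 2 <;> simp [g]
    simp only [c0, c1, c2, cc, ct, Nat.cast_inj]
    generalize (if i = 0 then a₀ else if i = 1 then a₁ else a₂) = a
    by_cases g1 : I.adj m u <;> by_cases g2 : u % p = a <;> by_cases g3 : a₀ = a₁ <;>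
      by_cases g4 : a₀ = a₂ <;> by_cases g5 : a₁ = a₂ <;> simp [g1, g2, g3, g4, g5]

theorem starNum_div_lt {z : ℕ} (hz : z < I.num starNum) : z / I.q / I.q / I.q / I.q < I.n := by
  have : z < I.n * I.q * I.q * I.q * I.q := hz
  rw [Nat.div_div_eq_div_mul, Nat.div_div_eq_div_mul, Nat.div_div_eq_div_mul]
  exact Nat.div_lt_of_lt_mul (this.trans_eq (by ring))

theorem big_starNum (c : ℕ) : 100000 * (I.n * I.n) ≤ I.big starNum c ∧
    100000 * I.num starNum ≤ I.big starNum c ∧ 100000 * I.q + 500000 ≤ I.big starNum c := by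
  have hbig : I.big starNum c = 100000 * (2 * (I.n * I.n) + 2 + 2 * (I.num starNum *
    I.reps starNum) + 3 + I.num starNum * I.n * I.len + c * I.maxAbs + I.maxAbs + I.q) := rfl
  have hZn : I.num starNum ≤ I.num starNum * I.n * I.len := by
    rw [mul_assoc]; exact Nat.le_mul_of_pos_right _ (Nat.mul_pos I.n_pos I.len_pos)
  refine ⟨?_, ?_, ?_⟩ <;> omega

theorem tri_starDigits {c z : ℕ} (hz : z < I.num starNum) {s : St} (h5 : s.v 5 = z)
    (h10 : s.v 10 = I.q) : Tri (I.env starNum c) starDigits s 9 fun s' =>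
      s'.v 15 = (z / I.q / I.q / I.q / I.q : ℕ) ∧ s'.v 14 = (z / I.q / I.q / I.q % I.q + 1 : ℕ) ∧
      s'.v 13 = (z / I.q / I.q % I.q : ℕ) ∧ s'.v 12 = (z / I.q % I.q : ℕ) ∧
      s'.v 11 = (z % I.q : ℕ) := by
  have hq : 0 < I.q := by unfold q; omega
  obtain ⟨-, hb2, hb3⟩ := I.big_starNum c
  have lt : ∀ m : ℕ, m ≤ I.big starNum c → (m : ℤ).natAbs < 2 ^ I.bits starNum c := fun m hm => by
    rw [Int.natAbs_natCast]; exact I.lt_two_pow_bits hm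
  have lm : ∀ a, a % I.q ≤ I.big starNum c := fun a => by have := Nat.mod_lt a hq; omega
  refine Tri.set_seq (z % I.q : ℕ) (by simp) (by simp [h5, h10]) (lt _ (lm _)) ?_
  refine Tri.set_seq (z / I.q % I.q : ℕ) (by simp) (by simp [h5, h10]) (lt _ (lm _)) ?_
  refine Tri.set_seq (z / I.q / I.q % I.q : ℕ) (by simp) (by simp [h5, h10]) (lt _ (lm _)) ?_
  refine Tri.set_seq (z / I.q / I.q / I.q % I.q + 1 : ℕ) (by simp) (by simp [h5, h10]) (lt _ ?_) ?_
  · have := Nat.mod_lt (z / I.q / I.q / I.q) hq; omega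
  refine Tri.set (a := (z / I.q / I.q / I.q / I.q : ℕ)) (by simp) (by simp [h5, h10]) (lt _ ?_) ?_
  · have := I.starNum_div_lt hz
    have : I.n ≤ I.n * I.n := Nat.le_mul_of_pos_left _ I.n_pos
    have := I.big_starNum c
    omega
  simp

theorem generates_starSum {c z : ℕ} (hz : z < I.num starNum) :
    Generates (I.env starNum c) (I.Vars starNum c) starGen z (I.starSum c z).encode
      (12 * I.n + 30) := by
  intro v hv h5 _
  obtain ⟨h1, h2, h3, h4, h6, h7, h10⟩ := id hv
  have hn := I.n_pos
  have hm := I.starNum_div_lt hz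
  obtain ⟨T, hT⟩ : ∃ T, T = 3 * I.n * 4 + 3 := ⟨_, rfl⟩
  refine Tri.mono (τ₁ := 9 + (1 + T + 1) + 1)
    (Q' := fun s' => s'.O = memOfList (I.starSum c z).encode) ?_ (by omega) fun s' hs hO =>
      ⟨?_, ?_, hO⟩
  · refine Tri.seq (I.tri_starDigits hz h5 h10) fun s hs ⟨e15, e14, e13, e12, e11⟩ => ?_
    have e6 : s.v 6 = I.n := by rw [hs.v 6 (by simp [starDigits, Cmd.mods])]; exact h6
    have e7 : s.v 7 = I.unit c := by rw [hs.v 7 (by simp [starDigits, Cmd.mods])]; exact h7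
    have eO : s.O = 0 := hs.O rfl
    refine Tri.seq (Q' := fun s₁ => s₁.O = Function.update (0 : ℤ → ℤ) 0 (I.n : ℤ))
      (Tri.stO (by simp) (by simp) (by simp [e6, eO])) fun s₁ hs₁ hO₁ => ?_
    have hv₁ : s₁.v = s.v := funext fun j => hs₁.v j (by simp [Cmd.mods])
    refine (Tri.tabO 1 (3 * I.n) (fun k => (I.starSum c z).get (k / I.n) (k % I.n)) ?_ ?_ ?_
      ?_).mono hT.ge fun s₂ _ hO₂ => ?_
    · have : I.n ≤ I.n * I.n := Nat.le_mul_of_pos_left _ I.n_pos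
      have := I.big_starNum c
      exact I.lt_two_pow_bits (by omega)
    · intro k _; simp [hv₁, e6]
    · intro k _; simp
    · intro k hk
      rw [starSum, KSumInst.get_ofFun I.n_pos _
        (Nat.div_lt_of_lt_mul (by rw [mul_comm]; exact hk)) (Nat.mod_lt _ hn)]
      rw [hv₁]
      apply I.ev_starVal hm <;> simp [*]
    · rw [hO₂, hO₁, KSumInst.memOfList_encode]; rfl
  · have hj : ∀ j, j ≤ 10 → s'.v j = v j := fun j hj =>
      hs.v j (by simp [starGen, starDigits, Cmd.mods, Cmd.loop]; omega)
    unfold Vars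
    simp only [hj 1 (by norm_num), hj 2 (by norm_num), hj 3 (by norm_num), hj 4 (by norm_num),
      hj 6 (by norm_num), hj 7 (by norm_num), hj 10 le_rfl]
    exact hv
  · exact fun j hj => hs.v j (by simp [starGen, starDigits, Cmd.mods, Cmd.loop]; omega)

end

end WeightedGraphInst

/-! ### Size and correctness of the `3`-SUM instances -/

namespace WeightedGraphInst

section
variable (I : WeightedGraphInst)

theorem natAbs_starEntry_le {c : ℕ} (hc : 100 ≤ c) (m p a₀ a₁ a₂ i u : ℕ) :
    (I.starEntry c m p a₀ a₁ a₂ i u).natAbs ≤ 8 * I.unit c := by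
  have h1 := I.natAbs_wt_le m u
  have h2 := I.natAbs_target_le
  have h3 : 100 * I.maxAbs ≤ I.unit c := Nat.mul_le_mul_right _ hc
  unfold starEntry
  split_ifs <;> omega

open Classical in
theorem starEntry_zero (c m p a₀ a₁ a₂ u : ℕ) : I.starEntry c m p a₀ a₁ a₂ 0 u =
    if (a₀ ≠ a₁ ∧ a₀ ≠ a₂ ∧ a₁ ≠ a₂) ∧ I.adj m u ∧ u % p = a₀ then I.wt m u
    else (8 * I.unit c : ℕ) := by
  simp [starEntry]

open Classical in
theorem starEntry_one (c m p a₀ a₁ a₂ u : ℕ) : I.starEntry c m p a₀ a₁ a₂ 1 u =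
    if (a₀ ≠ a₁ ∧ a₀ ≠ a₂ ∧ a₁ ≠ a₂) ∧ I.adj m u ∧ u % p = a₁ then I.wt m u
    else (8 * I.unit c : ℕ) := by
  simp [starEntry]

open Classical in
theorem starEntry_two (c m p a₀ a₁ a₂ u : ℕ) : I.starEntry c m p a₀ a₁ a₂ 2 u =
    if (a₀ ≠ a₁ ∧ a₀ ≠ a₂ ∧ a₁ ≠ a₂) ∧ I.adj m u ∧ u % p = a₂ then I.wt m u - I.target
    else (8 * I.unit c : ℕ) := by
  simp [starEntry]

theorem starSum_size {c z : ℕ} (hc : 100 ≤ c) (hz : z < I.num starNum) :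
    (I.unit c).size ≤ (kSum 3).size (I.starSum c z) ∧
      (kSum 3).size (I.starSum c z) ≤ I.n * ((8 * c).size + I.len) := by
  have hn := I.n_pos
  have hm := I.starNum_div_lt hz
  constructor
  · have h1 : (8 * I.unit c) ≤ (I.starSum c z).maxAbs := by
      -- The center is not adjacent to itself, so its own entry is the filler `8 * unit`, which
      -- forces the lower bound.
      have h2 := (I.starSum c z).natAbs_get_le 0 (z / I.q / I.q / I.q / I.q)
      rw [starSum, KSumInst.get_ofFun I.n_pos _ (by norm_num) hm, starEntry, if_neg] at h2
      · rwa [Int.natAbs_natCast] at h2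
      · intro h; exact I.adj_ne h.2.1 rfl
    change _ ≤ I.n * _
    exact (Nat.size_le_size (by omega)).trans (Nat.le_mul_of_pos_left _ hn)
  · refine Nat.mul_le_mul_left _ ((Nat.size_le_size (n := 8 * c * I.maxAbs) ?_).trans
      (Nat.size_mul_le _ _))
    have h0 := I.one_le_maxAbs
    refine KSumInst.maxAbs_le _ (by nlinarith) fun i j hi hj => ?_
    change j < I.n at hj
    rw [starSum, KSumInst.get_ofFun I.n_pos _ hi hj]
    refine (I.natAbs_starEntry_le hc _ _ _ _ _ _ _).trans_eq ?_
    unfold unit; ring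

/-- A zero sum cannot contain a filler `8 * unit`, because the other entries are at least `-2 *
maxAbs`. The remaining entries belong to neighbours of the center in three different residue
classes, which are therefore distinct. -/
theorem hasExactCopy_star_iff_starSum {c : ℕ} (hc : 100 ≤ c) :
    I.HasExactCopy (kStar 3) ↔ ∃ z < I.num starNum, (I.starSum c z).HasZeroSum := by
  have hn := I.n_pos
  have hq : 0 < I.q := by unfold q; omega
  have hM := I.one_le_maxAbs
  have hU : 100 * I.maxAbs ≤ I.unit c := Nat.mul_le_mul_right _ hc
  rw [hasExactCopy_star_iff]
  constructor
  · rintro ⟨m, u₀, u₁, u₂, ⟨n1, n2, n3⟩, h0, h1, h2, hs⟩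
    obtain ⟨hm, hu0, -⟩ := id h0
    obtain ⟨-, hu1, -⟩ := id h1
    obtain ⟨-, hu2, -⟩ := id h2
    obtain ⟨p, hp, hpq, hinj⟩ := exists_mod_injOn (S := {u₀, u₁, u₂})
      (Finset.card_le_three.trans (by norm_num)) (n := I.n) (by simp [hu0, hu1, hu2])
    change p ≤ I.q at hpq
    have d0 := Nat.mod_lt u₀ hp
    have d1 := Nat.mod_lt u₁ hp
    have d2 := Nat.mod_lt u₂ hp
    -- The digits of the instance number are the center, the modulus minus one, which is below `q`,
    -- and the three residues.
    refine ⟨(((m * I.q + (p - 1)) * I.q + u₀ % p) * I.q + u₁ % p) * I.q + u₂ % p,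
      Nat.digit_lt (Nat.digit_lt (Nat.digit_lt (Nat.digit_lt hm ?_) ?_) ?_) ?_, ?_⟩
    iterate 4 omega
    rw [KSumInst.hasZeroSum_iff]
    refine ⟨u₀, hu0, u₁, hu1, u₂, hu2, ?_⟩
    rw [starSum, KSumInst.get_ofFun _ _ (by norm_num) hu0, KSumInst.get_ofFun _ _ (by norm_num) hu1,
      KSumInst.get_ofFun _ _ (by norm_num) hu2]
    rw [Nat.digit_mod (by omega), Nat.digit_div (by omega), Nat.digit_mod (by omega),
      Nat.digit_div (by omega), Nat.digit_mod (by omega), Nat.digit_div (by omega),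
      Nat.digit_mod (by omega), Nat.digit_div (by omega), Nat.sub_add_cancel hp]
    have r1 : u₀ % p ≠ u₁ % p := fun h => n1 (hinj (by simp) (by simp) h)
    have r2 : u₀ % p ≠ u₂ % p := fun h => n2 (hinj (by simp) (by simp) h)
    have r3 : u₁ % p ≠ u₂ % p := fun h => n3 (hinj (by simp) (by simp) h)
    rw [starEntry_zero, starEntry_one, starEntry_two, if_pos ⟨⟨r1, r2, r3⟩, h0, rfl⟩,
      if_pos ⟨⟨r1, r2, r3⟩, h1, rfl⟩, if_pos ⟨⟨r1, r2, r3⟩, h2, rfl⟩]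
    linarith
  · rintro ⟨z, hz, h⟩
    rw [KSumInst.hasZeroSum_iff] at h
    obtain ⟨u₀, hu0, u₁, hu1, u₂, hu2, h⟩ := h
    change u₀ < I.n at hu0
    change u₁ < I.n at hu1
    change u₂ < I.n at hu2
    rw [starSum, KSumInst.get_ofFun _ _ (by norm_num) hu0, KSumInst.get_ofFun _ _ (by norm_num) hu1,
      KSumInst.get_ofFun _ _ (by norm_num) hu2] at h
    generalize z / I.q / I.q / I.q / I.q = m at *
    generalize z / I.q / I.q / I.q % I.q + 1 = p at *
    generalize z / I.q / I.q % I.q = a₀ at *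
    generalize z / I.q % I.q = a₁ at *
    generalize z % I.q = a₂ at *
    have hw := fun u => I.natAbs_wt_le m u
    have ht := I.natAbs_target_le
    have w0 := hw u₀
    have w1 := hw u₁
    have w2 := hw u₂
    rw [starEntry_zero, starEntry_one, starEntry_two] at h
    split_ifs at h with g0 g1 g2
    · obtain ⟨⟨r1, r2, r3⟩, h0, c0⟩ := g0
      obtain ⟨-, h1, c1⟩ := g1
      obtain ⟨-, h2, c2⟩ := g2
      refine ⟨m, u₀, u₁, u₂, ⟨?_, ?_, ?_⟩, h0, h1, h2, by linarith⟩
      · rintro rfl; exact r1 (c0.symm.trans c1)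
      · rintro rfl; exact r2 (c0.symm.trans c2)
      · rintro rfl; exact r3 (c1.symm.trans c2)
    all_goals omega

end

/-- There are `n * q ^ 4` instances, and `q` is only logarithmic. Each has lists of length `n` and
numbers that are longer than the weights by a constant. -/
theorem solvableInTime_star {β δ : ℝ} (hβ : 1 ≤ β) (hδ : 0 < δ)
    (h : (kSum 3).SolvableInTime fun s => (s : ℝ) ^ β) :
    (exactWeight (kStar 3)).SolvableInTime fun s => (s : ℝ) ^ (β + 1 + δ) := by
  have hn : ∀ I : WeightedGraphInst, 1 ≤ I.n := n_pos
  have hL : ∀ I : WeightedGraphInst, 1 ≤ I.len := len_pos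
  have hc : ∀ k, Dom n len 1 1 fun _ => k := fun k =>
    (Dom.const k).mono hn hL (by norm_num) (by norm_num)
  refine solvableInTime_of_reduction (Z := starNum) (e := var 6 * var 10 * var 10 * var 10 * var 10)
    (gen := starGen) (S := fun c I => I.n * ((8 * c).size + I.len)) (k := fun _ I => 12 * I.n + 30)
    hβ hδ h (fun n q hn hq => by unfold starNum; positivity) (fun η hη => ?_)
    (by simp [Expr.pureIn]) ?_
    (fun c I z => I.starSum c z) (fun c hc I z hz => (I.starSum_size hc hz).1)
    (fun c hc I z hz => (I.starSum_size hc hz).2) (fun c => ?_) (fun c => ?_)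
    (fun c _ I z hz => I.generates_starSum hz) fun c hc I => I.hasExactCopy_star_iff_starSum hc
  · have hq := dom_q (η := η / 4) (by linarith)
    exact ((((Dom.fst.mul hn hL hq).mul hn hL hq).mul hn hL hq).mul hn hL hq).mono hn hL
      (by linarith) (by linarith)
  · intro l x v W n q h6 h10
    simp [h6, h10, starNum]
  · have h1 : Dom n len 0 1 fun I => (8 * c).size + I.len :=
      ((Dom.const _).mono hn hL le_rfl zero_le_one).add Dom.snd
    exact (Dom.fst.mul hn hL h1).mono hn hL (by norm_num) (by norm_num)
  · exact ((Dom.fst.smul 12).mono hn hL hβ (by linarith)).add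
      ((Dom.const 30).mono hn hL (by linarith) (by linarith))

end WeightedGraphInst

/-! ### Radix sort -/

/-- Sort by the binary digit with number `k`. -/
def radixStep (k : ℕ) (l : List ℤ) : List ℤ :=
  l.filter (fun x => decide (x / 2 ^ k % 2 = 0)) ++ l.filter fun x => !decide (x / 2 ^ k % 2 = 0)

/-- Sort by the last `k` binary digits. -/
def radix (l : List ℤ) : ℕ → List ℤ
  | 0 => l
  | k + 1 => radixStep k (radix l k)

theorem radix_perm (l : List ℤ) (k : ℕ) : (radix l k).Perm l := by
  induction k with
  | zero => exact .refl _
  | succ k ih => exact (List.filter_append_perm _ _).trans ih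

theorem Int.emod_two_mul (x P : ℤ) (hP : 0 < P) : x % (P * 2) = P * (x / P % 2) + x % P := by
  have h1 := Int.emod_add_mul_ediv x P
  have h2 := Int.emod_add_mul_ediv (x / P) 2
  have h3 := Int.emod_nonneg x hP.ne'
  have h4 := Int.emod_lt_of_pos x hP
  have h5 : x = (P * (x / P % 2) + x % P) + P * 2 * (x / P / 2) := by
    linear_combination -h1 - P * h2
  conv_lhs => rw [h5]
  rw [Int.add_mul_emod_self_left, Int.emod_eq_of_lt]
  · have := Int.emod_nonneg (x / P) (two_ne_zero)
    positivity
  · have := Int.emod_lt_of_pos (x / P) two_pos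
    nlinarith

/-- A sorting step by one digit is stable, so entries with equal digits remain ordered by the lower
digits. -/
theorem radix_pairwise (l : List ℤ) (k : ℕ) :
    (radix l k).Pairwise fun x y => x % 2 ^ k ≤ y % 2 ^ k := by
  induction k with
  | zero => simp [List.pairwise_iff_forall_sublist]
  | succ k ih =>
    have hP : (0 : ℤ) < 2 ^ k := by positivity
    have e : ∀ x : ℤ, x % 2 ^ (k + 1) = 2 ^ k * (x / 2 ^ k % 2) + x % 2 ^ k := fun x => by
      rw [pow_succ]; exact Int.emod_two_mul x _ hP
    have hb : ∀ x : ℤ, x / 2 ^ k % 2 = 0 ∨ x / 2 ^ k % 2 = 1 := fun x => by omega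
    change (radixStep k (radix l k)).Pairwise _
    unfold radixStep
    rw [List.pairwise_append]
    refine ⟨(ih.filter _).imp_of_mem ?_, (ih.filter _).imp_of_mem ?_, ?_⟩
    · intro x y hx hy h
      simp only [List.mem_filter, decide_eq_true_eq] at hx hy
      rw [e, e, hx.2, hy.2]; linarith
    · intro x y hx hy h
      simp only [List.mem_filter, Bool.not_eq_true', decide_eq_false_iff_not] at hx hy
      rw [e, e, (hb x).resolve_left hx.2, (hb y).resolve_left hy.2]; linarith
    · intro x hx y hy
      simp only [List.mem_filter, decide_eq_true_eq, Bool.not_eq_true',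
        decide_eq_false_iff_not] at hx hy
      rw [e, e, hx.2, (hb y).resolve_left hy.2]
      have := Int.emod_lt_of_pos x hP
      have := Int.emod_nonneg y hP.ne'
      linarith

theorem radix_sorted {l : List ℤ} {k : ℕ} (h : ∀ x ∈ l, 0 ≤ x ∧ x < 2 ^ k) :
    (radix l k).Pairwise (· ≤ ·) := by
  refine (radix_pairwise l k).imp_of_mem fun hx hy hxy => ?_
  have h1 := h _ ((radix_perm l k).mem_iff.1 hx)
  have h2 := h _ ((radix_perm l k).mem_iff.1 hy)
  rwa [Int.emod_eq_of_lt h1.1 h1.2, Int.emod_eq_of_lt h2.1 h2.2] at hxy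

/-! ### Radix sort as a program -/

namespace RAM

/-- A memory that holds a list from the given address on. -/
def put (base : ℤ) (l : List ℤ) (O : ℤ → ℤ) : ℤ → ℤ := tab base l.length (fun i => l.getD i 0) O

theorem put_nil (base : ℤ) (O : ℤ → ℤ) : put base [] O = O := tab_zero _ _ _

theorem put_concat (base : ℤ) (l : List ℤ) (a : ℤ) (O : ℤ → ℤ) :
    Function.update (put base l O) (base + l.length) a = put base (l ++ [a]) O := by
  unfold put
  rw [List.length_append, List.length_singleton, ← tab_succ,
    tab_congr O (g := fun i => (l ++ [a]).getD i 0) fun i hi => ?_]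
  · simp
  · simp [List.getD_eq_getElem?_getD, List.getElem?_append_left hi]

theorem put_apply {base : ℤ} {l : List ℤ} {O : ℤ → ℤ} {i : ℕ} (hi : i < l.length) :
    put base l O (base + i) = l.getD i 0 := tab_apply hi

theorem put_apply_of_lt {base : ℤ} {l : List ℤ} {O : ℤ → ℤ} {a : ℤ} (h : a < base) :
    put base l O a = O a := by
  unfold put tab; rw [if_neg (by omega)]

/-- The number of cells of a list that is sorted. -/
def cells : Expr := 9 * (var 6 * var 6)

/-- The current entry in the stage that is numbered by variable 24. -/
def radixCell : Expr := wrk (var 24 * cells + var 25)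

/-- Append the entries that satisfy a condition to the list of the next stage. -/
def pass (cond : Expr) : Cmd :=
  .loop 25 cells (.ite cond (.seq (.stW ((var 24 + 1) * cells + var 26) radixCell)
    (.set 26 (var 26 + 1))) .skip)

section
variable {E : Env} {s : St} {n : ℕ}

theorem ev_cells {x : ℤ → ℤ} {v : ℕ → ℤ} {W : ℤ → ℤ} (h6 : v 6 = n) :
    cells.ev x v W = (9 * (n * n) : ℕ) := by simp [cells, h6]

/-- Each stage has its own region of the working memory, so the list of the next stage grows without
disturbing the one that is read. The invariant says that the filtered prefix has been appended to
`l'`. -/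
theorem tri_pass {cond : Expr} {P : ℤ → Bool} {k : ℕ} {l l' : List ℤ} {W₀ : ℤ → ℤ}
    (hcond : ∀ v W, v 28 = 2 ^ k → cond.ok E.l E.x v W ∧
      (0 < cond.ev E.x v W ↔ P (radixCell.ev E.x v W) = true))
    (hl : l.length = 9 * (n * n)) (hb : l'.length + 9 * (n * n) < 2 ^ E.b)
    (hlb : ∀ a ∈ l, a.natAbs < 2 ^ E.b)
    (h6 : s.v 6 = n) (h24 : s.v 24 = k) (h26 : s.v 26 = l'.length) (h28 : s.v 28 = 2 ^ k)
    (hW : s.W = put ((k + 1) * (9 * (n * n) : ℕ)) l' (put (k * (9 * (n * n) : ℕ)) l W₀)) :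
    Tri E (pass cond) s (9 * (n * n) * 7 + 3) fun s' =>
      s'.v 26 = (l' ++ l.filter P).length ∧
      s'.W = put ((k + 1) * (9 * (n * n) : ℕ)) (l' ++ l.filter P)
        (put (k * (9 * (n * n) : ℕ)) l W₀) := by
  have hmods : ∀ j, j ≠ 25 → j ≠ 26 → ∀ s', Same (pass cond) s s' → s'.v j = s.v j := by
    intro j h1 h2 s' hs
    exact hs.v j (by simp [pass, Cmd.loop, Cmd.mods, h1, h2])
  set N := 9 * (n * n) with hN
  refine (Tri.loop (τ := 4) (fun j s' => s'.v 26 = (l' ++ (l.take j).filter P).length ∧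
    s'.W = put ((k + 1) * (N : ℤ)) (l' ++ (l.take j).filter P) (put (k * (N : ℤ)) l W₀)) N
    (by omega) ?_ (by simp [Cmd.mods]) ?_ ?_).mono le_rfl fun s' _ h => ?_
  · simp [h26, hW]
  · intro j _ s' hs _ _
    refine ⟨by simp [cells], ?_⟩
    rw [ev_cells (by rw [hmods 6 (by norm_num) (by norm_num) s' hs, h6])]
  · intro j hj s' hs ⟨hp, hW'⟩ h25
    have e6 := hmods 6 (by norm_num) (by norm_num) s' hs
    have e24 := hmods 24 (by norm_num) (by norm_num) s' hs
    have e28 := hmods 28 (by norm_num) (by norm_num) s' hs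
    rw [h6] at e6
    rw [h24] at e24
    rw [h28] at e28
    have hjl : j < l.length := by omega
    have hcell : radixCell.ev E.x s'.v s'.W = l[j] := by
      simp only [radixCell, ev_wrk, ev_add, ev_mul, ev_var, ev_cells e6, e24, h25, hW']
      rw [put_apply_of_lt, ← hN, put_apply hjl, List.getD_eq_getElem _ _ hjl]
      have : (j : ℤ) < N := by exact_mod_cast hj
      rw [add_mul]; linarith
    have htake : l.take (j + 1) = l.take j ++ [l[j]] := by
      rw [List.take_succ_eq_append_getElem hjl]
    obtain ⟨hok, hpos⟩ := hcond s'.v s'.W e28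
    rw [hcell] at hpos
    have hlen : (l' ++ (l.take j).filter P).length ≤ l'.length + j := by
      rw [List.length_append]
      have := List.length_filter_le P (l.take j)
      rw [List.length_take] at this
      omega
    refine Tri.ite hok (fun h => ?_) fun h => ?_
    · have hP := hpos.1 h
      refine (Tri.seq (Q' := fun s₁ => s₁.W = put ((k + 1) * (N : ℤ))
        ((l' ++ (l.take j).filter P) ++ [l[j]]) (put (k * (N : ℤ)) l W₀)) (τ₂ := 1)
        (Tri.stW (by simp [cells]) (by simp [radixCell, cells]) ?_ ?_) fun s₁ hs₁ hW₁ => ?_).mono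
        (by norm_num) fun _ _ h => h
      · rw [hcell]; exact hlb _ (List.getElem_mem hjl)
      · simp only [hcell, ev_add, ev_mul, ev_var, ev_one, ev_cells e6, e24, hp]
        rw [hW', ← hN, put_concat]
      · have e26 : s₁.v 26 = s'.v 26 := hs₁.v 26 (by simp [Cmd.mods])
        refine Tri.set (a := ((l' ++ (l.take j).filter P).length + 1 : ℕ)) (by simp)
          (by simp [e26, hp]) (by rw [Int.natAbs_natCast]; omega) ?_
        rw [htake, List.filter_append, List.filter_cons_of_pos hP, List.filter_nil,
          ← List.append_assoc]
        refine ⟨?_, hW₁⟩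
        simp [add_assoc]
    · have hP : ¬ P l[j] = true := fun h' => h (hpos.2 h')
      refine (Tri.skip ?_).mono (by norm_num) fun _ _ h => h
      rw [htake, List.filter_append, List.filter_cons_of_neg hP, List.filter_nil, List.append_nil]
      exact ⟨by simpa using hp, hW'⟩
  · have h' := h.1
    rw [List.take_of_length_le hl.le] at h'
    exact h'

/-- Sort by the binary digits, whose number is in variable 21. -/
def radixSort : Cmd :=
  .seq (.set 28 1) (.loop 24 (var 21) (.seq (.set 26 0)
    (.seq (pass (1 - mod (radixCell / var 28) 2)) (.seq (pass (mod (radixCell / var 28) 2))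
      (.set 28 (var 28 + var 28))))))

/-- Two passes per digit, the first for the entries with digit 0. Nothing is copied back; the final
list is found in the region of stage `B`, above the remains `W₁` of the earlier stages. -/
theorem tri_radixSort {l : List ℤ} {B : ℕ} {W₀ : ℤ → ℤ} (hl : l.length = 9 * (n * n))
    (hb : 2 * (9 * (n * n)) < 2 ^ E.b) (hB : B < E.b) (hlb : ∀ a ∈ l, a.natAbs < 2 ^ E.b)
    (h6 : s.v 6 = n) (h21 : s.v 21 = B) (hW : s.W = put 0 l W₀) :
    Tri E radixSort s (B * (2 * (9 * (n * n) * 7) + 20) + 10) fun s' =>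
      ∃ W₁, s'.W = put (B * (9 * (n * n) : ℕ)) (radix l B) W₁ := by
  set N := 9 * (n * n) with hN
  have h2 : ∀ k ≤ B, 2 ^ k < 2 ^ E.b := fun k hk => Nat.pow_lt_pow_right (by norm_num) (by omega)
  refine (Tri.set_seq 1 (by simp) (by simp) (by simpa using h2 0 (Nat.zero_le _))
    ((Tri.loop (τ := 2 * (N * 7) + 13) (fun k s' => s'.v 28 = 2 ^ k ∧
      ∃ W₁, s'.W = put (k * (N : ℤ)) (radix l k) W₁) B ?_ ?_ ?_ ?_ ?_).mono le_rfl fun s' _ h =>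
      h.1.2)).mono ?_ fun _ _ h => h
  · exact hB.trans Nat.lt_two_pow_self
  · exact ⟨by simp, W₀, by simpa [radix] using hW⟩
  · simp [pass, Cmd.mods, Cmd.loop]
  · intro k _ s' hs _ _
    have e21 : s'.v 21 = B := by
      rw [hs.v 21 (by simp [pass, Cmd.mods, Cmd.loop])]; simp [h21]
    exact ⟨by simp, by simp [e21]⟩
  · intro k hk s' hs ⟨h28, W₁, hW₁⟩ h24
    have e6 : s'.v 6 = n := by
      rw [hs.v 6 (by simp [pass, Cmd.mods, Cmd.loop])]; simp [h6]
    have hperm := radix_perm l k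
    have hl' : (radix l k).length = N := hperm.length_eq.trans hl
    have hlb' : ∀ a ∈ radix l k, a.natAbs < 2 ^ E.b := fun a ha => hlb a (hperm.mem_iff.1 ha)
    refine Tri.mono (τ₁ := ((N * 7 + 3) + ((N * 7 + 3) + 1 + 1) + 1) + 2) (Q' := fun s' =>
      s'.v 28 = 2 ^ (k + 1) ∧
      ∃ W₁, s'.W = put ((k + 1) * (N : ℤ)) (radix l (k + 1)) W₁) ?_ (by omega) ?_
    · refine Tri.set_seq 0 (by simp) (by simp) (by simp) ?_
      refine Tri.seq (tri_pass (l' := []) (P := fun x => decide (x / 2 ^ k % 2 = 0)) (k := k)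
        (W₀ := W₁) ?_ hl' (by simp; omega) hlb' (by simp [e6]) (by simp [h24]) (by simp)
        (by simp [h28]) (by rw [put_nil]; exact hW₁)) fun s₁ hs₁ hQ₁ => ?_
      · intro v W hv
        refine ⟨by simp [radixCell, cells], ?_⟩
        simp only [ev_sub, ev_one, ev_mod, ev_div, ev_var, ev_ofNat, hv, decide_eq_true_eq]
        omega
      have g6 : s₁.v 6 = n := by
        rw [hs₁.v 6 (by simp [pass, Cmd.mods, Cmd.loop])]; simp [e6]
      have g24 : s₁.v 24 = k := by
        rw [hs₁.v 24 (by simp [pass, Cmd.mods, Cmd.loop])]; simp [h24]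
      have g28 : s₁.v 28 = 2 ^ k := by
        rw [hs₁.v 28 (by simp [pass, Cmd.mods, Cmd.loop])]; simp [h28]
      refine Tri.seq (τ₁ := N * 7 + 3) (τ₂ := 1) (tri_pass (P := fun x => !decide (x / 2 ^ k % 2 = 0)) (k := k)
        (W₀ := W₁) ?_ hl' ?_ hlb' g6 g24 hQ₁.1 g28 hQ₁.2) fun s₂ hs₂ hQ₂ => ?_
      · intro v W hv
        refine ⟨by simp [radixCell, cells], ?_⟩
        simp only [ev_mod, ev_div, ev_var, ev_ofNat, hv, Bool.not_eq_true',
          decide_eq_false_iff_not]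
        omega
      · have := List.length_filter_le (fun x => decide (x / 2 ^ k % 2 = 0)) (radix l k)
        rw [List.nil_append]
        omega
      have k28 : s₂.v 28 = 2 ^ k := by
        rw [hs₂.v 28 (by simp [pass, Cmd.mods, Cmd.loop])]; simp [g28]
      refine Tri.set (a := 2 ^ (k + 1)) (by simp) (by simp [k28]; ring) ?_ ⟨by simp,
        put (k * (N : ℤ)) (radix l k) W₁, hQ₂.2⟩
      · rw [Int.natAbs_pow]; exact h2 (k + 1) hk
    · intro s₁ hs₁ ⟨h1, W₁, h3⟩
      exact ⟨by simpa using h1, W₁, by push_cast; exact h3⟩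
  · have : B * (2 * (N * 7) + 13 + 3) ≤ B * (2 * (N * 7) + 20) := Nat.mul_le_mul_left _ (by omega)
    omega

end

end RAM

/-! ### Expressions for distinctness and for powers -/

namespace RAM.Expr

/-- `e` if variable `a` differs from the listed ones, otherwise `0`. -/
def neAll (a : ℕ) : List ℕ → Expr → Expr
  | [], e => e
  | b :: l, e => ite (eqb (var a) (var b)) 0 (neAll a l e)

/-- `1` if the values of the listed variables are distinct, otherwise `0`. -/
def nodup : List ℕ → Expr
  | [] => 1
  | a :: l => neAll a l (nodup l)

section
variable {x : ℤ → ℤ} {v : ℕ → ℤ} {W : ℤ → ℤ} {l : ℤ}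

theorem ok_neAll {a : ℕ} {L : List ℕ} {e : Expr} (he : e.ok l x v W) : (neAll a L e).ok l x v W := by
  induction L with
  | nil => exact he
  | cons b L ih => simp [neAll, ih]

theorem ev_neAll {a : ℕ} {L : List ℕ} {e : Expr} :
    (neAll a L e).ev x v W = if v a ∈ L.map v then 0 else e.ev x v W := by
  induction L with
  | nil => simp [neAll]
  | cons b L ih =>
    by_cases h : v a = v b
    · simp [neAll, h]
    · simp [neAll, h, ih]

theorem ok_nodup {L : List ℕ} : (nodup L).ok l x v W := by
  induction L with
  | nil => simp [nodup]
  | cons b L ih => exact ok_neAll ih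

theorem ev_nodup {L : List ℕ} : (nodup L).ev x v W = if (L.map v).Nodup then 1 else 0 := by
  induction L with
  | nil => simp [nodup]
  | cons b L ih =>
    rw [nodup, ev_neAll, ih]
    by_cases h : v b ∈ L.map v
    · rw [if_pos h]
      exact (if_neg fun h' => (List.nodup_cons.1 h').1 h).symm
    · rw [if_neg h]
      exact if_congr (by rw [List.map_cons, List.nodup_cons]; tauto) rfl rfl

end

/-- A power of an expression. -/
def npow (e : Expr) : ℕ → Expr
  | 0 => 1
  | i + 1 => npow e i * e

theorem ok_npow {x v W l} {e : Expr} (h : e.ok l x v W) (i : ℕ) : (npow e i).ok l x v W := by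
  induction i with
  | zero => simp [npow]
  | succ i ih => simp [npow, ih, h]

theorem ev_npow {x v W} {e : Expr} {q : ℕ} (h : e.ev x v W = q) (i : ℕ) :
    (npow e i).ev x v W = (q ^ i : ℕ) := by
  induction i with
  | zero => simp [npow]
  | succ i ih => simp [npow, ih, h, pow_succ]

theorem pureIn_npow {e : Expr} (h : e.pureIn = true) (i : ℕ) : (npow e i).pureIn = true := by
  induction i with
  | zero => simp [npow]
  | succ i ih => simp [npow, ih, h]

/-- A power of variable 10. -/
def qpow : ℕ → Expr := npow (var 10)

theorem ok_qpow {x v W l} (i : ℕ) : (qpow i).ok l x v W :=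
  ok_npow (e := var 10) (by simp) i

theorem ev_qpow {x v W} {q : ℕ} (h : v 10 = (q : ℤ)) (i : ℕ) : (qpow i).ev x v W = (q ^ i : ℕ) :=
  ev_npow (e := var 10) (by simpa using h) i

end RAM.Expr

namespace WeightedGraphInst

/-! ### Matchings by stars -/

section
variable (I : WeightedGraphInst)

/-- The tag of the edges with the number `g`. -/
def tag (g : ℕ) : ℕ := if g = 0 then 0 else if g = 1 then 1 else 3

open Classical in
/-- The modified weight of the pair `(u, v)` as the edge with the number `g`. -/
noncomputable def matchEntry (c p : ℕ) (a : ℕ → ℕ) (g u v : ℕ) : ℤ :=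
  if [a 0, a 1, a 2, a 3, a 4, a 5].Nodup ∧ I.adj u v ∧ u % p = a (2 * g) ∧
      v % p = a (2 * g + 1) then
    (32 + tag g : ℕ) * (I.unit c : ℕ) + I.wt u v else (1000 * I.unit c : ℕ)

/-- Three lists of modified weights between small and large numbers. -/
noncomputable def matchRaw (c p : ℕ) (a : ℕ → ℕ) (k : ℕ) : ℤ :=
  if k < 3 * (I.n * I.n) then 0 else if k < 6 * (I.n * I.n) then
    I.matchEntry c p a (k / (I.n * I.n) - 3) (k % (I.n * I.n) / I.n) (k % (I.n * I.n) % I.n)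
  else (1000 * I.unit c : ℕ)

/-- The sorted list of modified weights. -/
noncomputable def matchList (c p : ℕ) (a : ℕ → ℕ) : List ℤ :=
  radix (List.ofFn fun k : Fin (9 * (I.n * I.n)) => I.matchRaw c p a k) (1024 * I.unit c).size

/-- The target of the modified weights. -/
noncomputable def matchTarget (c : ℕ) : ℤ := 100 * I.unit c + I.target

end

section
variable (n d e : ℕ) (t : ℤ) (f : ℕ → ℤ)

/-- The sum of the largest entries of three blocks. -/
def topSum (i : ℕ) : ℤ :=
  f ((3 * n + i) * n + (n - 1)) + f ((i + d) * n + (n - 1)) + f ((i + e) * n + (n - 1))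

/-- The first position with a large sum. -/
def cut : ℕ → ℕ
  | 0 => 0
  | i + 1 => if topSum n d e f i < t then i + 1 else cut i

theorem cut_le (i : ℕ) : cut n d e t f i ≤ i := by
  induction i with
  | zero => exact le_rfl
  | succ i ih => unfold cut; split_ifs <;> omega

/-- The number of the block of the leaf group `g`. -/
def block (g : ℕ) : ℕ :=
  if g = 6 then 3 * n + cut n d e t f (3 * n) else
    if g = 7 then cut n d e t f (3 * n) + d else cut n d e t f (3 * n) + e

/-- The weight of the edge between the center `u` and the leaf `v`. -/
def starWeight (u v : ℕ) : ℤ := f (block n d u t f (v / n) * n + v % n)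

/-- The graph all whose edges join one of `6 n` centers and one of `3 n` leaves. -/
noncomputable def centers (hn : 0 < n) : WeightedGraphInst :=
  ofArcs (9 * n) (by omega) (fun u v => u < 6 * n ∧ 6 * n ≤ v) (starWeight n d t f) t
    fun u v h h' => by omega

end

section
variable (I : WeightedGraphInst)

/-- The instance of the star problem with the number `z`. -/
noncomputable def matchStar (c z : ℕ) : WeightedGraphInst :=
  centers I.n (z / I.q ^ 7) (I.matchTarget c)
    (fun i => (I.matchList c (z / I.q ^ 6 % I.q + 1) fun i => z / I.q ^ i % I.q).getD i 0) I.n_pos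

/-- The number of these instances. -/
def matchNum (n q : ℕ) : ℕ := 6 * n * q ^ 7

/-- The number of the group of the entry with the number in variable 23 selects one of three. -/
def select (e₀ e₁ e₂ : Expr) : Expr :=
  .ite (eqb (var 23 / (var 6 * var 6)) 3) e₀ (.ite (eqb (var 23 / (var 6 * var 6)) 4) e₁ e₂)

/-- The entry with the number in variable 23. -/
def matchVal : Expr :=
  .ite (ltb (var 23) (3 * (var 6 * var 6))) 0 (.ite (ltb (var 23) (6 * (var 6 * var 6)))
    (.ite (var 19 * inp (2 + mod (var 23) (var 6 * var 6)) *
        eqb (mod (mod (var 23) (var 6 * var 6) / var 6) (var 17)) (select (var 11) (var 13) (var 15)) *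
        eqb (mod (mod (mod (var 23) (var 6 * var 6)) (var 6)) (var 17))
          (select (var 12) (var 14) (var 16)))
      ((32 + select 0 1 3) * var 7 + inp (2 + var 6 * var 6 + mod (var 23) (var 6 * var 6)))
      (1000 * var 7)) (1000 * var 7))

theorem ev_select {x v W} {k g n : ℕ} {e₀ e₁ e₂ : Expr} {a : ℕ → ℤ} (h6 : v 6 = (n : ℤ))
    (h23 : v 23 = (k : ℤ)) (hg : k / (n * n) = g + 3) (hg' : g < 3) (h0 : e₀.ev x v W = a 0)
    (h1 : e₁.ev x v W = a 1) (h2 : e₂.ev x v W = a 2) : (select e₀ e₁ e₂).ev x v W = a g := by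
  have hk : (k : ℤ) / ((n : ℤ) * n) = (g + 3 : ℕ) := by rw [← hg]; push_cast; rfl
  simp only [select, ev_ite, ev_eqb, ev_div, ev_mul, ev_var, ev_ofNat, h6, h23, hk]
  interval_cases g <;> simp [h0, h1, h2]

theorem ok_select {x v W l} {e₀ e₁ e₂ : Expr} (h0 : e₀.ok l x v W) (h1 : e₁.ok l x v W)
    (h2 : e₂.ok l x v W) : (select e₀ e₁ e₂).ok l x v W := by
  simp [select, h0, h1, h2]

theorem ev_matchVal {c p k : ℕ} {a : ℕ → ℕ} {v : ℕ → ℤ} {W : ℤ → ℤ} (h6 : v 6 = I.n) (h7 : v 7 = I.unit c) (ha : ∀ i < 6, v (11 + i) = a i) (h17 : v 17 = p)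
    (h19 : v 19 = if [a 0, a 1, a 2, a 3, a 4, a 5].Nodup then 1 else 0) (h23 : v 23 = k) :
    matchVal.ok I.encode.length (memOfList I.encode) v W ∧
      matchVal.ev (memOfList I.encode) v W = I.matchRaw c p a k := by
  have hN : 0 < I.n * I.n := Nat.mul_pos I.n_pos I.n_pos
  have hlt : k % (I.n * I.n) < I.n * I.n := Nat.mod_lt _ hN
  have hl : (I.encode.length : ℤ) = 2 * (I.n * I.n) + 2 := by rw [I.length_encode]; push_cast; rfl
  have hu : k % (I.n * I.n) / I.n < I.n := Nat.div_lt_of_lt_mul hlt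
  have hv : k % (I.n * I.n) % I.n < I.n := Nat.mod_lt _ I.n_pos
  have hA := I.memOfList_encode_adj hu hv
  have hW := I.memOfList_encode_wt hu hv
  have huv : ((k % (I.n * I.n) / I.n : ℕ) : ℤ) * I.n + (k % (I.n * I.n) % I.n : ℕ) =
      (k % (I.n * I.n) : ℕ) := by
    exact_mod_cast Nat.div_add_mod' _ _
  rw [huv] at hA hW
  have km : (k : ℤ) % ((I.n : ℤ) * I.n) = (k % (I.n * I.n) : ℕ) := by push_cast; rfl
  have b1 : ((k % (I.n * I.n) : ℕ) : ℤ) < (I.n * I.n : ℕ) := by exact_mod_cast hlt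
  have b2 : (0 : ℤ) ≤ (k % (I.n * I.n) : ℕ) := by positivity
  rw [Nat.cast_mul] at b1
  constructor
  · simp only [matchVal, ok_ite, ok_mul, ok_var, ok_inp, ok_add, ok_ofNat, ok_mod, ok_eqb, ok_div,
      ok_zero, ok_one, ok_ltb, ev_add, ev_mul, ev_ofNat, ev_var, ev_mod, h6, h23, hl, km,
      true_and, and_true, implies_true, ok_select]
    exact fun _ _ => ⟨by constructor <;> linarith, fun _ => by constructor <;> linarith⟩
  · unfold matchRaw
    simp only [matchVal, ev_ite, ev_ltb, ev_var, ev_mul, ev_ofNat, ev_zero, h6, h23]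
    have c3 : ((k : ℤ) < 3 * ((I.n : ℤ) * I.n)) = (k < 3 * (I.n * I.n)) := by
      rw [eq_iff_iff]; exact_mod_cast Iff.rfl
    have c6 : ((k : ℤ) < 6 * ((I.n : ℤ) * I.n)) = (k < 6 * (I.n * I.n)) := by
      rw [eq_iff_iff]; exact_mod_cast Iff.rfl
    simp only [c3, c6]
    by_cases g3 : k < 3 * (I.n * I.n)
    · simp [g3]
    by_cases g6 : k < 6 * (I.n * I.n)
    · have hg1 : 3 ≤ k / (I.n * I.n) := (Nat.le_div_iff_mul_le hN).2 (by omega)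
      have hg2 : k / (I.n * I.n) < 6 := Nat.div_lt_of_lt_mul (by rw [mul_comm]; exact g6)
      obtain ⟨g, hg⟩ : ∃ g, k / (I.n * I.n) = g + 3 := ⟨k / (I.n * I.n) - 3, by omega⟩
      have hg' : g < 3 := by omega
      have s1 := ev_select (x := memOfList I.encode) (W := W) (e₀ := var 11) (e₁ := var 13)
        (e₂ := var 15) (a := fun g => (a (2 * g) : ℤ)) h6 h23 hg hg' (ha 0 (by norm_num))
        (ha 2 (by norm_num)) (ha 4 (by norm_num))
      have s2 := ev_select (x := memOfList I.encode) (W := W) (e₀ := var 12) (e₁ := var 14)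
        (e₂ := var 16) (a := fun g => (a (2 * g + 1) : ℤ)) h6 h23 hg hg' (ha 1 (by norm_num))
        (ha 3 (by norm_num)) (ha 5 (by norm_num))
      have s3 := ev_select (x := memOfList I.encode) (W := W) (e₀ := 0) (e₁ := 1)
        (e₂ := 3) (a := fun g => (tag g : ℤ)) h6 h23 hg hg' (by simp [tag]) (by simp [tag])
        (by simp [tag])
      simp only [g3, g6, if_true, if_false, lt_irrefl, one_pos, ev_eqb, ev_mod, ev_div, ev_inp,
        ev_add, ev_ofNat, ev_mul, ev_var, h6, h7, h17, h19, h23, s1, s2, s3, km, hA, hW, hg,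
        Nat.add_sub_cancel]
      have e1 : ((k % (I.n * I.n) : ℕ) : ℤ) / I.n % p = (k % (I.n * I.n) / I.n % p : ℕ) := by
        push_cast; rfl
      have e2 : ((k % (I.n * I.n) : ℕ) : ℤ) % I.n % p = (k % (I.n * I.n) % I.n % p : ℕ) := by
        push_cast; rfl
      rw [e1, e2]
      simp only [Nat.cast_inj]
      unfold matchEntry
      generalize k % (I.n * I.n) / I.n = u
      generalize k % (I.n * I.n) % I.n = w
      by_cases g1 : I.adj u w <;> by_cases g2 : u % p = a (2 * g) <;>
        by_cases g3 : w % p = a (2 * g + 1) <;>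
        by_cases g4 : [a 0, a 1, a 2, a 3, a 4, a 5].Nodup <;>
        simp only [g1, g2, g3, g4, if_true, if_false, and_self, and_true, and_false,
          mul_one, mul_zero, lt_irrefl, one_pos] <;> push_cast <;> rfl
    · simp [g3, g6, h7]

end

end WeightedGraphInst

/-! ### The table of block positions and the weights of the stars, as programs -/

namespace WeightedGraphInst

/-- The address of the sorted list. -/
def base : Expr := var 21 * cells

/-- The address of the table of positions. -/
def tableBase : Expr := (var 21 + 1) * cells

/-- The last entry of a block, which is its maximum once the list is sorted. -/
def topExpr (e : Expr) : Expr := wrk (base + (e * var 6 + (var 6 - 1)))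

def targetExpr : Expr := 100 * var 7 + inp 1

/-- The computation of the positions for all the centers. -/
def cutTable : Cmd :=
  .loop 29 (6 * var 6) (.seq (.set 30 0) (.seq (.loop 31 (3 * var 6) (.set 30
    (.ite (ltb (topExpr (3 * var 6 + var 31) + topExpr (var 31 + var 18) +
      topExpr (var 31 + var 29)) targetExpr) (var 31 + 1) (var 30))))
    (.stW (tableBase + var 29) (var 30))))

section
variable {E : Env} {s : St} {n d : ℕ} {t : ℤ} {S : List ℤ} {B : ℕ} {W : ℤ → ℤ}

theorem ev_topExpr {x v} {e : Expr} {i : ℕ} (h6 : v 6 = (n : ℤ))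
    (h21 : v 21 = (B : ℤ))
    (hW : ∀ i < 9 * (n * n), W (B * (9 * (n * n) : ℕ) + (i : ℕ)) = S.getD i 0)
    (he : e.ev x v W = i) (hi : i < 9 * n) :
    (topExpr e).ev x v W = S.getD (i * n + (n - 1)) 0 := by
  have hn : 0 < n := by omega
  have h := hW (i * n + (n - 1)) ((Nat.digit_lt hi (by omega)).trans_eq (by ring))
  rw [← h]
  simp only [topExpr, base, ev_wrk, ev_add, ev_mul, ev_var, ev_sub, ev_one, ev_cells h6, h6, h21, he]
  congr 1
  push_cast [Nat.cast_sub hn]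
  ring

theorem ok_topExpr {x v l} {e : Expr} (he : e.ok l x v W) : (topExpr e).ok l x v W := by
  simp [topExpr, base, cells, he]

/-- For each of the `6 * n` centers the recursion of `cut` is followed for `3 * n` rounds, so the
table needs `O(n ^ 2)` operations, no more than a pass of the sorting. -/
theorem tri_cutTable {c : ℕ} {W₀ : ℤ → ℤ} (hS : S.length = 9 * (n * n)) (hd : d < 6 * n)
    (hb : 9 * n < 2 ^ E.b) (hl : 2 ≤ E.l) (h6 : s.v 6 = n) (h7 : s.v 7 = c) (h18 : s.v 18 = d)
    (h21 : s.v 21 = B) (ht : 100 * c + E.x 1 = t)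
    (hW : s.W = put (B * (9 * (n * n) : ℕ)) S W₀) :
    Tri E cutTable s (6 * n * (3 * n * 4 + 10) + 3) fun s' =>
      s'.W = tab ((B + 1) * (9 * (n * n) : ℕ)) (6 * n)
        (fun e => cut n d e t (fun i => S.getD i 0) (3 * n)) (put (B * (9 * (n * n) : ℕ)) S W₀) := by
  set f : ℕ → ℤ := fun i => S.getD i 0 with hf
  have hm : ∀ j, j ∉ [29, 30, 31] → ∀ s', Same cutTable s s' → s'.v j = s.v j := fun j hj s' hs =>
    hs.v j (by simpa [cutTable, Cmd.loop, Cmd.mods, or_comm, or_assoc, or_left_comm] using hj)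
  refine (Tri.loop (τ := 3 * n * 4 + 7) (fun k s' => s'.W = tab ((B + 1) * (9 * (n * n) : ℕ)) k
    (fun e => cut n d e t f (3 * n)) (put (B * (9 * (n * n) : ℕ)) S W₀)) (6 * n)
    (by omega) ?_ (by simp [Cmd.loop, Cmd.mods]) ?_ ?_).mono le_rfl fun s' _ h => h.1
  · rw [tab_zero]; exact hW
  · intro k _ s' hs _ _
    have := hm 6 (by simp) s' hs
    simp [this, h6]
  · intro k hk s' hs hW' h29
    have e6 := (hm 6 (by simp) s' hs).trans h6
    have e7 := (hm 7 (by simp) s' hs).trans h7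
    have e18 := (hm 18 (by simp) s' hs).trans h18
    have e21 := (hm 21 (by simp) s' hs).trans h21
    -- The table lies behind the sorted list, which therefore remains readable while the table is
    -- filled.
    have hread : ∀ i < 9 * (n * n), s'.W (B * (9 * (n * n) : ℕ) + (i : ℕ)) = S.getD i 0 := by
      intro i hi
      rw [hW', tab, if_neg, put_apply (by omega)]
      have : (i : ℤ) < (9 * (n * n) : ℕ) := by exact_mod_cast hi
      rw [add_mul]
      intro h
      linarith [h.1]
    refine Tri.mono (τ₁ := ((3 * n * 4 + 3) + 1 + 1) + 2) (Q' := fun s'' =>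
      s''.W = tab ((B + 1) * (9 * (n * n) : ℕ)) (k + 1)
        (fun e => cut n d e t f (3 * n)) (put (B * (9 * (n * n) : ℕ)) S W₀)) ?_ (by omega)
      fun _ _ h => h
    refine Tri.set_seq 0 (by simp) (by simp) (by simp) ?_
    refine Tri.seq (τ₂ := 1) (Tri.accum (by norm_num) (3 * n) (fun i => (cut n d k t f i : ℤ))
      (by omega) (by simp [cut]) ?_ ?_ ?_) fun s₁ hs₁ h30 => ?_
    · intro i _; simp [e6]
    · intro i hi
      have hi' : i < 3 * n := hi
      constructor
      · simp only [ok_ite, ok_ltb, ok_add, ok_var, ok_one, targetExpr, ok_mul, ok_ofNat, ok_inp,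
          ev_one, implies_true, and_true, true_and]
        exact ⟨⟨⟨ok_topExpr (by simp), ok_topExpr (by simp)⟩, ok_topExpr (by simp)⟩, by norm_num,
          by omega⟩
      · simp only [ev_ite, ev_ltb, ev_add]
        rw [ev_topExpr (i := 3 * n + i) (by simp [e6]) (by simp [e21]) hread (by simp [e6])
            (by omega),
          ev_topExpr (i := i + d) (by simp [e6]) (by simp [e21]) hread (by simp [e18])
            (by omega),
          ev_topExpr (i := i + k) (by simp [e6]) (by simp [e21]) hread (by simp [h29])
            (by omega)]
        have ht' : targetExpr.ev E.x (Function.update (Function.update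
            (Function.update s'.v 30 0) 30 (cut n d k t f i : ℤ)) 31 i) s'.W = t := by
          simp [targetExpr, e7, ht]
        rw [ht']
        rw [cut, topSum]
        split_ifs with g <;> simp_all
    · intro i hi
      rw [Int.natAbs_natCast]
      have := cut_le n d k t f (i + 1)
      omega
    have hm₁ : ∀ j, j ≠ 30 → j ≠ 31 → s₁.v j = s'.v j := fun j a b => by
      rw [hs₁.v j (by simp [Cmd.loop, Cmd.mods, a, b])]; simp [a]
    have hW₁ : s₁.W = s'.W := hs₁.W (by simp [Cmd.loop, Cmd.noW])
    have g6 := (hm₁ 6 (by norm_num) (by norm_num)).trans e6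
    have g21 := (hm₁ 21 (by norm_num) (by norm_num)).trans e21
    have g29 := (hm₁ 29 (by norm_num) (by norm_num)).trans h29
    refine Tri.stW (by simp [tableBase, cells]) (by simp) ?_ ?_
    · simp only [ev_var, h30, Int.natAbs_natCast]
      have := cut_le n d k t f (3 * n)
      omega
    · simp only [ev_var, h30, tableBase, ev_add, ev_mul, ev_one, ev_cells g6, g21, g29]
      rw [hW₁, hW']
      exact tab_succ _ _ (fun e => (cut n d e t f (3 * n) : ℤ)) _

/-- The weight of the edge between the center `u` and the leaf `w`. -/
def starExpr (u w : Expr) : Expr :=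
  wrk (base + (.ite (eqb (w / var 6) 6) (3 * var 6 + wrk (tableBase + u))
    (.ite (eqb (w / var 6) 7) (wrk (tableBase + u) + var 18) (wrk (tableBase + u) + u)) * var 6 +
    mod w (var 6)))

theorem ev_starExpr {x v} {W₀ : ℤ → ℤ} {u w : ℕ} {eu ew : Expr} (hS : S.length = 9 * (n * n))
    (hd : d < 6 * n) (h6 : v 6 = (n : ℤ)) (h18 : v 18 = (d : ℤ)) (h21 : v 21 = (B : ℤ))
    (hW : W = tab ((B + 1) * (9 * (n * n) : ℕ)) (6 * n)
        (fun e => cut n d e t (fun i => S.getD i 0) (3 * n)) (put (B * (9 * (n * n) : ℕ)) S W₀))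
    (hu : eu.ev x v W = u) (hw : ew.ev x v W = w) (hul : u < 6 * n) :
    (starExpr eu ew).ev x v W = starWeight n d t (fun i => S.getD i 0) u w := by
  have hn : 0 < n := by omega
  set f : ℕ → ℤ := fun i => S.getD i 0 with hf
  have hcut : (wrk (tableBase + eu)).ev x v W = cut n d u t f (3 * n) := by
    simp only [ev_wrk, tableBase, ev_add, ev_mul, ev_var, ev_one, ev_cells h6, h21, hu]
    rw [hW]
    exact tab_apply hul
  have hdiv : (w : ℤ) / n = (w / n : ℕ) := by simp
  have hmod : (w : ℤ) % n = (w % n : ℕ) := by simp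
  have c6 : (((w / n : ℕ) : ℤ) = 6) = (w / n = 6) := by rw [eq_iff_iff]; exact_mod_cast Iff.rfl
  have c7 : (((w / n : ℕ) : ℤ) = 7) = (w / n = 7) := by rw [eq_iff_iff]; exact_mod_cast Iff.rfl
  have hblk : (Expr.ite (eqb (ew / var 6) 6) (3 * var 6 + wrk (tableBase + eu))
      (.ite (eqb (ew / var 6) 7) (wrk (tableBase + eu) + var 18)
        (wrk (tableBase + eu) + eu))).ev x v W = (block n d u t f (w / n) : ℕ) := by
    simp only [ev_ite, ev_eqb, ev_div, ev_add, ev_mul, ev_var, ev_ofNat, hcut, hw, h6, h18, hu,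
      hdiv, c6, c7]
    unfold block
    by_cases g6 : w / n = 6
    · simp [g6]
    by_cases g7 : w / n = 7 <;> simp [g6, g7]
  have hlt : block n d u t f (w / n) < 9 * n := by
    have := cut_le n d u t f (3 * n)
    unfold block
    split_ifs <;> omega
  have hidx := Nat.digit_lt hlt (Nat.mod_lt w hn)
  have hidx' : block n d u t f (w / n) * n + w % n < 9 * (n * n) := hidx.trans_eq (by ring)
  rw [starExpr, ev_wrk, ev_add, ev_add, ev_mul, hblk, ev_mod, hw, ev_var, h6, hmod, base, ev_mul,
    ev_var, h21, ev_cells h6]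
  have e : ((block n d u t f (w / n) : ℕ) : ℤ) * n + (w % n : ℕ) =
      (block n d u t f (w / n) * n + w % n : ℕ) := by push_cast; rfl
  rw [e]
  rw [hW, tab, if_neg, put_apply (by omega)]
  · rfl
  · have : ((block n d u t f (w / n) * n + w % n : ℕ) : ℤ) < (9 * (n * n) : ℕ) := by
      exact_mod_cast hidx'
    rw [add_mul]
    intro h
    linarith [h.1]

theorem ok_starExpr {x v l} {eu ew : Expr} (hu : eu.ok l x v W) (hw : ew.ok l x v W) :
    (starExpr eu ew).ok l x v W := by
  simp [starExpr, base, tableBase, cells, hu, hw]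

end

end WeightedGraphInst

theorem RAM.put_ofFn (base : ℤ) (N : ℕ) (f : ℕ → ℤ) (O : ℤ → ℤ) :
    RAM.put base (List.ofFn fun k : Fin N => f k) O = RAM.tab base N f O := by
  unfold RAM.put
  rw [List.length_ofFn]
  refine RAM.tab_congr O fun k hk => ?_
  rw [List.getD_eq_getElem _ _ (by simpa using hk)]
  simp

/-! ### The program that generates the star instances -/

namespace WeightedGraphInst

/-- The digit with the number `i` of the number of the instance. -/
def digit (i : ℕ) : Expr := mod (var 5 / qpow i) (var 10)

/-- The computation of the parameters of an instance. -/
def matchDigits : Cmd :=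
  .seq (.set 11 (digit 0)) <| .seq (.set 12 (digit 1)) <| .seq (.set 13 (digit 2)) <|
  .seq (.set 14 (digit 3)) <| .seq (.set 15 (digit 4)) <| .seq (.set 16 (digit 5)) <|
  .seq (.set 17 (digit 6 + 1)) <| .seq (.set 18 (var 5 / qpow 7)) <|
  .seq (.set 19 (nodup [11, 12, 13, 14, 15, 16])) <| .seq (.set 20 (1024 * var 7)) <|
  Cmd.size 20 21 22

/-- The computation of the sorted list and of the table of positions. -/
def matchPrepare : Cmd :=
  .seq matchDigits <| .seq (.loop 23 cells (.stW (var 23) matchVal)) <| .seq radixSort cutTable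

def nodes : Expr := 9 * var 6

/-- The entry with the number in variable 32 of the adjacency matrix. -/
def adjExpr : Expr :=
  1 - eqb (ltb (var 32 / nodes) (6 * var 6)) (ltb (mod (var 32) nodes) (6 * var 6))

/-- The entry with the number in variable 32 of the matrix of weights. -/
def weightExpr : Expr :=
  .ite (ltb (var 32 / nodes) (6 * var 6))
    (.ite (ltb (mod (var 32) nodes) (6 * var 6)) 0 (starExpr (var 32 / nodes) (mod (var 32) nodes)))
    (.ite (ltb (mod (var 32) nodes) (6 * var 6)) (starExpr (mod (var 32) nodes) (var 32 / nodes)) 0)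

/-- The program that writes the instance. -/
def matchGen : Cmd :=
  .seq matchPrepare <| .seq (.stO 0 nodes) <| .seq (.stO 1 targetExpr) <|
  .seq (.loop 32 (nodes * nodes) (.stO (2 + var 32) adjExpr)) <|
  .loop 32 (nodes * nodes) (.stO (2 + nodes * nodes + var 32) weightExpr)

section
variable (I : WeightedGraphInst)

theorem big_matchNum (c : ℕ) : 100000 * (I.n * I.n) ≤ I.big matchNum c ∧
    100000 * I.n ≤ I.big matchNum c ∧ 100000 * I.unit c ≤ I.big matchNum c ∧
    100000 * I.q + 500000 ≤ I.big matchNum c := by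
  have hbig : I.big matchNum c = 100000 * (2 * (I.n * I.n) + 2 + 2 * (I.num matchNum *
    I.reps matchNum) + 3 + I.num matchNum * I.n * I.len + I.unit c + I.maxAbs + I.q) := rfl
  have hnn : I.n ≤ I.n * I.n := Nat.le_mul_of_pos_left _ I.n_pos
  refine ⟨?_, ?_, ?_, ?_⟩ <;> omega

theorem matchNum_div_lt {z : ℕ} (hz : z < I.num matchNum) : z / I.q ^ 7 < 6 * I.n :=
  Nat.div_lt_of_lt_mul ((show z < 6 * I.n * I.q ^ 7 from hz).trans_eq (mul_comm _ _))

theorem matchRaw_bounds {c : ℕ} (hc : 100 ≤ c) (p : ℕ) (a : ℕ → ℕ) (k : ℕ) :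
    0 ≤ I.matchRaw c p a k ∧ I.matchRaw c p a k ≤ (1000 * I.unit c : ℕ) := by
  have h3 : 100 * I.maxAbs ≤ I.unit c := Nat.mul_le_mul_right _ hc
  have ht : ∀ g, tag g ≤ 3 := fun g => by unfold tag; split_ifs <;> norm_num
  unfold matchRaw matchEntry
  split_ifs with h1 h2 h4
  · constructor <;> positivity
  · have h5 := I.natAbs_wt_le (k % (I.n * I.n) / I.n) (k % (I.n * I.n) % I.n)
    have h6 := ht (k / (I.n * I.n) - 3)
    have h7 : (32 + tag (k / (I.n * I.n) - 3)) * I.unit c ≤ 35 * I.unit c :=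
      Nat.mul_le_mul_right _ (by omega)
    have h8 : 32 * I.unit c ≤ (32 + tag (k / (I.n * I.n) - 3)) * I.unit c :=
      Nat.mul_le_mul_right _ (by omega)
    rw [← Nat.cast_mul]
    omega
  · exact ⟨by positivity, le_rfl⟩
  · exact ⟨by positivity, le_rfl⟩

theorem length_matchList (c p : ℕ) (a : ℕ → ℕ) :
    (I.matchList c p a).length = 9 * (I.n * I.n) := by
  rw [matchList, (radix_perm _ _).length_eq, List.length_ofFn]

theorem tri_matchDigits {c z : ℕ} (hc : 1 ≤ c) (hz : z < I.num matchNum) {s : St} (h5 : s.v 5 = z)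
    (h7 : s.v 7 = I.unit c) (h10 : s.v 10 = I.q) :
    Tri (I.env matchNum c) matchDigits s (4 * (1024 * I.unit c).size + 25) fun s' =>
      s'.v 21 = (1024 * I.unit c).size ∧
      (∀ i < 6, s'.v (11 + i) = (z / I.q ^ i % I.q : ℕ)) ∧ s'.v 17 = (z / I.q ^ 6 % I.q + 1 : ℕ) ∧
      s'.v 18 = (z / I.q ^ 7 : ℕ) ∧
      s'.v 19 = if [z / I.q ^ 0 % I.q, z / I.q ^ 1 % I.q, z / I.q ^ 2 % I.q, z / I.q ^ 3 % I.q,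
        z / I.q ^ 4 % I.q, z / I.q ^ 5 % I.q].Nodup then 1 else 0 := by
  have hq : 0 < I.q := by unfold q; omega
  have hU : 0 < I.unit c := Nat.mul_pos hc I.one_le_maxAbs
  obtain ⟨hb1, hb2, hb3, hb4⟩ := I.big_matchNum c
  have lt : ∀ m : ℕ, m ≤ I.big matchNum c → (m : ℤ).natAbs < 2 ^ I.bits matchNum c := fun m hm => by
    rw [Int.natAbs_natCast]; exact I.lt_two_pow_bits hm
  have lm : ∀ a, a % I.q ≤ I.big matchNum c := fun a => by have := Nat.mod_lt a hq; omega
  have hd : ∀ (i : ℕ) (v : ℕ → ℤ) (W : ℤ → ℤ), v 5 = z → v 10 = I.q →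
      (digit i).ok I.encode.length (memOfList I.encode) v W ∧
      (digit i).ev (memOfList I.encode) v W = (z / I.q ^ i % I.q : ℕ) := fun i v W h h' => by
    simp [digit, ok_qpow, ev_qpow h', h, h']
  have hd0 := fun i W => hd i s.v W h5 h10
  have hst : ∀ (i j : ℕ) (v : ℕ → ℤ) (a : ℤ), 11 ≤ j → v 5 = z ∧ v 10 = I.q →
      Function.update v j a 5 = z ∧ Function.update v j a 10 = I.q := fun i j v a hj h => by
    rw [Function.update_of_ne (by omega), Function.update_of_ne (by omega)]; exact h
  obtain ⟨T, hT⟩ : ∃ T, T = 4 * (1024 * I.unit c).size + 5 := ⟨_, rfl⟩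
  refine Tri.mono (τ₁ := T + 2 + 2 + 2 + 2 + 2 + 2 + 2 + 2 + 2 + 2) ?_ (by omega)
    fun _ _ h => h
  refine Tri.set_seq (z / I.q ^ 0 % I.q : ℕ) (hd 0 _ _ h5 h10).1 (hd 0 _ _ h5 h10).2
    (lt _ (lm _)) ?_
  refine Tri.set_seq (z / I.q ^ 1 % I.q : ℕ) (hd 1 _ _ (by simp [h5]) (by simp [h10])).1
    (hd 1 _ _ (by simp [h5]) (by simp [h10])).2 (lt _ (lm _)) ?_
  refine Tri.set_seq (z / I.q ^ 2 % I.q : ℕ) (hd 2 _ _ (by simp [h5]) (by simp [h10])).1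
    (hd 2 _ _ (by simp [h5]) (by simp [h10])).2 (lt _ (lm _)) ?_
  refine Tri.set_seq (z / I.q ^ 3 % I.q : ℕ) (hd 3 _ _ (by simp [h5]) (by simp [h10])).1
    (hd 3 _ _ (by simp [h5]) (by simp [h10])).2 (lt _ (lm _)) ?_
  refine Tri.set_seq (z / I.q ^ 4 % I.q : ℕ) (hd 4 _ _ (by simp [h5]) (by simp [h10])).1
    (hd 4 _ _ (by simp [h5]) (by simp [h10])).2 (lt _ (lm _)) ?_
  refine Tri.set_seq (z / I.q ^ 5 % I.q : ℕ) (hd 5 _ _ (by simp [h5]) (by simp [h10])).1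
    (hd 5 _ _ (by simp [h5]) (by simp [h10])).2 (lt _ (lm _)) ?_
  refine Tri.set_seq (z / I.q ^ 6 % I.q + 1 : ℕ) ?_ ?_ (lt _ ?_) ?_
  · rw [ok_add]; exact ⟨(hd 6 _ _ (by simp [h5]) (by simp [h10])).1, by simp⟩
  · rw [ev_add, (hd 6 _ _ (by simp [h5]) (by simp [h10])).2]; simp
  · have := Nat.mod_lt (z / I.q ^ 6) hq; omega
  refine Tri.set_seq (z / I.q ^ 7 : ℕ) (by simp [ok_qpow]) ?_ (lt _ ?_) ?_
  · rw [ev_div, ev_qpow (q := I.q) (by simp [h10])]; simp [h5]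
  · have := I.matchNum_div_lt hz; omega
  refine Tri.set_seq (if [z / I.q ^ 0 % I.q, z / I.q ^ 1 % I.q, z / I.q ^ 2 % I.q,
    z / I.q ^ 3 % I.q, z / I.q ^ 4 % I.q, z / I.q ^ 5 % I.q].Nodup then 1 else 0 : ℕ) ok_nodup ?_
    (lt _ (by split_ifs <;> omega)) ?_
  · rw [ev_nodup]
    generalize z / I.q ^ 0 % I.q = a0
    generalize z / I.q ^ 1 % I.q = a1
    generalize z / I.q ^ 2 % I.q = a2
    generalize z / I.q ^ 3 % I.q = a3
    generalize z / I.q ^ 4 % I.q = a4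
    generalize z / I.q ^ 5 % I.q = a5
    push_cast
    refine if_congr ?_ rfl rfl
    -- The program compares integers, the specification natural numbers; the cast is injective.
    rw [← List.nodup_map_iff (f := ((↑) : ℕ → ℤ)) Nat.cast_injective]
    simp
  refine Tri.set_seq (1024 * I.unit c : ℕ) (by simp) (by simp [h7]) (lt _ (by omega)) ?_
  refine (Tri.size (m := 1024 * I.unit c) (by norm_num) (by norm_num) (by norm_num) (by simp)
    (I.size_lt_bits (by omega) (by omega))).mono hT.ge fun s' hs h21 => ⟨h21, ?_, ?_, ?_, ?_⟩
  · intro i hi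
    rw [hs.v (11 + i) (by simp [Cmd.size, Cmd.mods]; omega)]
    interval_cases i <;> simp
  · rw [hs.v 17 (by simp [Cmd.size, Cmd.mods])]; simp
  · rw [hs.v 18 (by simp [Cmd.size, Cmd.mods])]; simp
  · rw [hs.v 19 (by simp [Cmd.size, Cmd.mods])]; simp

end

end WeightedGraphInst

/-! ### Correctness of the program that generates the star instances -/

namespace WeightedGraphInst

section
variable (I : WeightedGraphInst)

/-- The sorted list of the instance with the number `z`. -/
noncomputable abbrev matchListOf (c z : ℕ) : List ℤ :=
  I.matchList c (z / I.q ^ 6 % I.q + 1) fun i => z / I.q ^ i % I.q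

theorem tri_matchPrepare {c z : ℕ} (hc : 100 ≤ c) (hz : z < I.num matchNum) {s : St}
    (h5 : s.v 5 = z) (h6 : s.v 6 = I.n) (h7 : s.v 7 = I.unit c) (h10 : s.v 10 = I.q)
    (hW : s.W = 0) :
    Tri (I.env matchNum c) matchPrepare s ((1024 * I.unit c).size * (126 * (I.n * I.n) + 30) +
      (180 * (I.n * I.n) + 60)) fun s' =>
      s'.v 21 = (1024 * I.unit c).size ∧ s'.v 18 = (z / I.q ^ 7 : ℕ) ∧ ∃ W₀,
      s'.W = tab (((1024 * I.unit c).size + 1) * (9 * (I.n * I.n) : ℕ)) (6 * I.n)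
        (fun e => cut I.n (z / I.q ^ 7) e (I.matchTarget c) (fun i => (I.matchListOf c z).getD i 0)
          (3 * I.n)) (put ((1024 * I.unit c).size * (9 * (I.n * I.n) : ℕ)) (I.matchListOf c z) W₀) := by
  obtain ⟨hb1, hb2, hb3, hb4⟩ := I.big_matchNum c
  have hnn : I.n ≤ I.n * I.n := Nat.le_mul_of_pos_left _ I.n_pos
  have hU : 0 < I.unit c := Nat.mul_pos (by omega) I.one_le_maxAbs
  set B := (1024 * I.unit c).size with hB
  set N := 9 * (I.n * I.n) with hN
  set R := List.ofFn fun k : Fin N => I.matchRaw c (z / I.q ^ 6 % I.q + 1)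
    (fun i => z / I.q ^ i % I.q) k with hR
  have hraw := I.matchRaw_bounds hc (z / I.q ^ 6 % I.q + 1) fun i => z / I.q ^ i % I.q
  have hlen := I.length_encode
  obtain ⟨T₁, hT₁⟩ : ∃ T, T = 4 * B + 25 := ⟨_, rfl⟩
  obtain ⟨T₂, hT₂⟩ : ∃ T, T = N * 4 + 3 := ⟨_, rfl⟩
  obtain ⟨T₃, hT₃⟩ : ∃ T, T = B * (2 * (N * 7) + 20) + 10 := ⟨_, rfl⟩
  obtain ⟨T₄, hT₄⟩ : ∃ T, T = 6 * I.n * (3 * I.n * 4 + 10) + 3 := ⟨_, rfl⟩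
  refine Tri.mono (τ₁ := T₁ + (T₂ + (T₃ + T₄ + 1) + 1) + 1) ?_ ?_ fun _ _ h => h
  · refine Tri.seq ((I.tri_matchDigits (by omega) hz h5 h7 h10).mono hT₁.ge fun _ _ h => h)
      fun s₁ hs₁ ⟨h21, ha, h17, h18, h19⟩ => ?_
    have e6 : s₁.v 6 = I.n := by
      rw [hs₁.v 6 (by simp [matchDigits, Cmd.size, Cmd.mods])]; exact h6
    have e7 : s₁.v 7 = I.unit c := by
      rw [hs₁.v 7 (by simp [matchDigits, Cmd.size, Cmd.mods])]; exact h7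
    have eW : s₁.W = 0 := by rw [hs₁.W (by simp [matchDigits, Cmd.size, Cmd.noW])]; exact hW
    refine Tri.seq ((Tri.tabW 0 N (I.matchRaw c (z / I.q ^ 6 % I.q + 1)
      fun i => z / I.q ^ i % I.q) (I.lt_two_pow_bits (by omega)) ?_ ?_ ?_ ?_).mono hT₂.ge
      fun _ _ h => h) fun s₂ hs₂ hW₂ => ?_
    · intro k W _
      exact ⟨by simp [cells], by rw [ev_cells (n := I.n) (by simp [e6])]⟩
    · intro k W _; simp
    · intro k hk
      refine I.ev_matchVal (by simp [e6]) (by simp [e7]) (fun i hi => ?_) (by simp [h17])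
        (by simp [h19]) (by simp)
      rw [Function.update_of_ne (by omega), ha i hi]
    · intro k hk
      refine I.lt_two_pow_bits ?_
      have := hraw k
      omega
    have hm₂ : ∀ j, j ≠ 23 → s₂.v j = s₁.v j := fun j hj =>
      hs₂.v j (by simp [Cmd.loop, Cmd.mods, hj])
    have e6' := (hm₂ 6 (by norm_num)).trans e6
    have e7' := (hm₂ 7 (by norm_num)).trans e7
    have h21' := (hm₂ 21 (by norm_num)).trans h21
    have h18' := (hm₂ 18 (by norm_num)).trans h18
    refine Tri.seq ((tri_radixSort (n := I.n) (B := B) (l := R) (W₀ := 0) (by simp [hR, hN]) ?_ ?_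
      ?_ e6' h21' ?_).mono hT₃.ge fun _ _ h => h) fun s₃ hs₃ ⟨W₀, hW₃⟩ => ?_
    · exact I.lt_two_pow_bits (by omega)
    · exact I.size_lt_bits (by omega) (by omega)
    · intro a ha
      obtain ⟨k, rfl⟩ := (List.mem_ofFn' _ _).1 ha
      refine I.lt_two_pow_bits ?_
      have := hraw k
      change (I.matchRaw c (z / I.q ^ 6 % I.q + 1) (fun i => z / I.q ^ i % I.q) k).natAbs ≤ _
      omega
    · rw [hW₂, eW, hR, put_ofFn]
    have hm₃ : ∀ j, j < 23 → s₃.v j = s₂.v j := fun j hj =>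
      hs₃.v j (by simp [radixSort, RAM.pass, Cmd.loop, Cmd.mods]; omega)
    have f21 := (hm₃ 21 (by norm_num)).trans h21'
    have f18 := (hm₃ 18 (by norm_num)).trans h18'
    refine (tri_cutTable (n := I.n) (d := z / I.q ^ 7) (t := I.matchTarget c) (c := I.unit c)
      (B := B) (S := I.matchListOf c z) (W₀ := W₀) (I.length_matchList _ _ _)
      (I.matchNum_div_lt hz) (I.lt_two_pow_bits (by omega)) (by simp [hlen]; positivity)
      ((hm₃ 6 (by norm_num)).trans e6') ((hm₃ 7 (by norm_num)).trans e7') f18 f21 ?_ ?_).mono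
      hT₄.ge fun s₄ hs₄ hW₄ => ?_
    · change 100 * _ + memOfList I.encode 1 = _
      rw [I.memOfList_encode_one]; rfl
    · exact hW₃
    · have hm₄ : ∀ j, j < 23 → s₄.v j = s₃.v j := fun j hj =>
        hs₄.v j (by simp [cutTable, Cmd.loop, Cmd.mods]; omega)
      exact ⟨(hm₄ 21 (by norm_num)).trans f21, (hm₄ 18 (by norm_num)).trans f18, W₀, hW₄⟩
  · rw [hT₁, hT₂, hT₃, hT₄]
    have e1 : B * (2 * (N * 7) + 20) = B * (126 * (I.n * I.n) + 20) := by rw [hN]; ring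
    have e2 : 6 * I.n * (3 * I.n * 4 + 10) = 72 * (I.n * I.n) + 60 * I.n := by ring
    have e3 : B * (126 * (I.n * I.n) + 30) = B * (126 * (I.n * I.n) + 20) + 10 * B := by ring
    omega

open Classical in
theorem generates_matchStar {c z : ℕ} (hc : 100 ≤ c) (hz : z < I.num matchNum) :
    Generates (I.env matchNum c) (I.Vars matchNum c) matchGen z (I.matchStar c z).encode
      ((1024 * I.unit c).size * (126 * (I.n * I.n) + 30) + (1000 * (I.n * I.n) + 100)) := by
  intro v hv h5 _
  obtain ⟨h1, h2, h3, h4, h6, h7, h10⟩ := id hv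
  obtain ⟨hb1, hb2, hb3, hb4⟩ := I.big_matchNum c
  have hn := I.n_pos
  set T₀ := (1024 * I.unit c).size * (126 * (I.n * I.n) + 30) with hT₀
  obtain ⟨T₁, hT₁⟩ : ∃ T, T = T₀ + (180 * (I.n * I.n) + 60) := ⟨_, rfl⟩
  obtain ⟨T₂, hT₂⟩ : ∃ T, T = (9 * I.n) * (9 * I.n) * 4 + 3 := ⟨_, rfl⟩
  refine Tri.mono (τ₁ := T₁ + (1 + (1 + (T₂ + T₂ + 1) + 1) + 1) + 1)
    (Q' := fun s' => s'.O = memOfList (I.matchStar c z).encode) ?_ ?_ fun s' hs hO =>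
      ⟨?_, ?_, hO⟩
  · refine Tri.seq ((I.tri_matchPrepare hc hz h5 h6 h7 h10 rfl).mono hT₁.ge fun _ _ h => h)
      fun s hs ⟨h21, h18, W₀, hW⟩ => ?_
    have hm : ∀ j, j ≤ 10 → s.v j = v j := fun j hj =>
      hs.v j (by simp [matchPrepare, matchDigits, Cmd.size, radixSort, RAM.pass, cutTable, Cmd.mods,
        Cmd.loop]; omega)
    have e6 : s.v 6 = I.n := (hm 6 (by norm_num)).trans h6
    have e7 : s.v 7 = I.unit c := (hm 7 (by norm_num)).trans h7
    have eO : s.O = 0 := by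
      rw [hs.O (by simp [matchPrepare, matchDigits, Cmd.size, radixSort, RAM.pass, cutTable, Cmd.noO,
        Cmd.loop])]
    refine Tri.seq (Q' := fun s₁ => s₁.O = Function.update (0 : ℤ → ℤ) 0 ((9 * I.n : ℕ) : ℤ))
      (Tri.stO (by simp) (by simp [nodes]) (by simp [nodes, e6, eO])) fun s₁ hs₁ hO₁ => ?_
    have hv₁ : s₁.v = s.v := funext fun j => hs₁.v j (by simp [Cmd.mods])
    have hW₁ : s₁.W = s.W := hs₁.W (by simp [Cmd.noW])
    refine Tri.seq (Q' := fun s₂ => s₂.O = Function.update (Function.update (0 : ℤ → ℤ) 0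
      ((9 * I.n : ℕ) : ℤ)) 1 (I.matchTarget c)) (Tri.stO (by simp) ?_ ?_) fun s₂ hs₂ hO₂ => ?_
    · have := I.length_encode
      have h0 : 0 < I.n * I.n := Nat.mul_pos hn hn
      simp [targetExpr]; omega
    · simp [targetExpr, hv₁, e7, hO₁, I.memOfList_encode_one, matchTarget]
    have hv₂ : s₂.v = s.v := (funext fun j => hs₂.v j (by simp [Cmd.mods])).trans hv₁
    have hW₂ : s₂.W = s.W := (hs₂.W (by simp [Cmd.noW])).trans hW₁
    have hlt : (9 * I.n) * (9 * I.n) < 2 ^ I.bits matchNum c := I.lt_two_pow_bits (by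
      have : (9 * I.n) * (9 * I.n) = 81 * (I.n * I.n) := by ring
      omega)
    set J := I.matchStar c z with hJ
    have hJn : J.n = 9 * I.n := rfl
    have hcount : ∀ (w : ℕ → ℤ) (W : ℤ → ℤ) (x : ℤ → ℤ), w 6 = I.n →
        (nodes * nodes).ev x w W = ((9 * I.n) * (9 * I.n) : ℕ) := fun w W x h => by
      simp [nodes, h]
    have hrow : ∀ k < (9 * I.n) * (9 * I.n), k / (9 * I.n) < 9 * I.n := fun k hk =>
      Nat.div_lt_of_lt_mul hk
    have hcol : ∀ k, k % (9 * I.n) < 9 * I.n := fun k => Nat.mod_lt _ (by omega)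
    have hdiv : ∀ k : ℕ, (k : ℤ) / (9 * I.n) = (k / (9 * I.n) : ℕ) := fun k => by push_cast; rfl
    have hmod : ∀ k : ℕ, (k : ℤ) % (9 * I.n) = (k % (9 * I.n) : ℕ) := fun k => by push_cast; rfl
    have hcast : ∀ k : ℕ, ((k : ℤ) < 6 * (I.n : ℤ)) = (k < 6 * I.n) := fun k => by
      rw [eq_iff_iff]; exact_mod_cast Iff.rfl
    refine Tri.seq ((Tri.tabO 2 ((9 * I.n) * (9 * I.n)) (fun m => if J.adj (m / J.n) (m % J.n)
      then (1 : ℤ) else 0) hlt ?_ ?_ ?_).mono hT₂.ge fun _ _ h => h) fun s₃ hs₃ hO₃ => ?_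
    · intro k _
      exact ⟨by simp [nodes], hcount _ _ _ (by simp [hv₂, e6])⟩
    · intro k _; simp
    · intro k hk
      refine ⟨by simp [adjExpr, nodes], ?_⟩
      have hA : J.adj (k / J.n) (k % J.n) ↔ _ := adj_ofArcs
      rw [hJn] at hA ⊢
      simp only [adjExpr, nodes, ev_sub, ev_one, ev_eqb, ev_ltb, ev_div, ev_mod, ev_mul, ev_ofNat,
        ev_var, Function.update_self, ne_eq, not_false_eq_true, Function.update_of_ne,
        Nat.reduceEqDiff, hv₂, e6, hdiv, hmod, hcast]
      have r1 := hrow k hk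
      have r2 := hcol k
      generalize k / (9 * I.n) = u at *
      generalize k % (9 * I.n) = w at *
      by_cases g1 : u < 6 * I.n <;> by_cases g2 : w < 6 * I.n <;> simp only [g1, g2, if_true,
        if_false] <;> rw [hA] <;> norm_num <;> omega
    have hm₃ : ∀ j, j ≠ 32 → s₃.v j = s.v j := fun j hj => by
      rw [hs₃.v j (by simp [Cmd.loop, Cmd.mods, hj]), hv₂]
    have hW₃ : s₃.W = s.W := (hs₃.W (by simp [Cmd.loop, Cmd.noW])).trans hW₂
    refine (Tri.tabO (2 + J.n * J.n) ((9 * I.n) * (9 * I.n)) (fun m => J.wt (m / J.n) (m % J.n))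
      hlt ?_ ?_ ?_).mono hT₂.ge fun s₄ _ hO₄ => ?_
    · intro k _
      exact ⟨by simp [nodes], hcount _ _ _ (by simp [hm₃, e6])⟩
    · intro k _
      refine ⟨by simp [nodes], ?_⟩
      rw [ev_add, ev_add, hcount _ _ _ (by simp [hm₃, e6]), hJn]
      simp
    · intro k hk
      refine ⟨?_, ?_⟩
      · simp [weightExpr, nodes, ok_starExpr]
      have hA : J.wt (k / J.n) (k % J.n) = _ := wt_ofArcs (hrow k hk) (hcol k)
      rw [hA, hJn]
      have r1 := hrow k hk
      have r2 := hcol k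
      set w := Function.update s₃.v 32 (k : ℤ) with hw
      have w6 : w 6 = I.n := by simp [hw, hm₃, e6]
      have w18 : w 18 = (z / I.q ^ 7 : ℕ) := by simp [hw, hm₃, h18]
      have w21 : w 21 = (1024 * I.unit c).size := by simp [hw, hm₃, h21]
      have eu : (var 32 / nodes).ev (memOfList I.encode) w s₃.W = (k / (9 * I.n) : ℕ) := by
        simp [nodes, hw, hm₃, e6]
      have ew : (mod (var 32) nodes).ev (memOfList I.encode) w s₃.W = (k % (9 * I.n) : ℕ) := by
        simp [nodes, hw, hm₃, e6]
      have S1 := fun h => ev_starExpr (I.length_matchList _ _ _) (I.matchNum_div_lt hz) w6 w18 w21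
        (hW₃.trans hW) eu ew h
      have S2 := fun h => ev_starExpr (I.length_matchList _ _ _) (I.matchNum_div_lt hz) w6 w18 w21
        (hW₃.trans hW) ew eu h
      simp only [weightExpr, ev_ite, ev_ltb, eu, ew, ev_mul, ev_ofNat, ev_var, w6, hcast, ev_zero]
      generalize k / (9 * I.n) = u at *
      generalize k % (9 * I.n) = x at *
      by_cases g1 : u < 6 * I.n <;> by_cases g2 : x < 6 * I.n
      · simp [g1, g2, not_le.2 g1, not_le.2 g2]
      · have g3 : 6 * I.n ≤ x := by omega
        simp only [g1, g2, g3, if_true, if_false, one_pos, lt_irrefl, and_self]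
        exact S1 g1
      · have g3 : 6 * I.n ≤ u := by omega
        simp only [g1, g2, g3, if_true, if_false, one_pos, lt_irrefl, and_self, false_and]
        exact S2 g2
      · simp [g1, g2]
    · rw [hO₄, hO₃, hO₂, memOfList_encode]; rfl
  · have : (9 * I.n) * (9 * I.n) = 81 * (I.n * I.n) := by ring
    omega
  · have hj : ∀ j, j ≤ 10 → s'.v j = v j := fun j hj =>
      hs.v j (by simp [matchGen, matchPrepare, matchDigits, Cmd.size, radixSort, RAM.pass, cutTable,
        Cmd.mods, Cmd.loop]; omega)
    unfold Vars
    simp only [hj 1 (by norm_num), hj 2 (by norm_num), hj 3 (by norm_num), hj 4 (by norm_num),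
      hj 6 (by norm_num), hj 7 (by norm_num), hj 10 le_rfl]
    exact hv
  · exact fun j hj => hs.v j (by simp [matchGen, matchPrepare, matchDigits, Cmd.size, radixSort,
      RAM.pass, cutTable, Cmd.mods, Cmd.loop]; omega)

end

end WeightedGraphInst

/-! ### Blocks of a sorted list, and tagged weights -/

namespace WeightedGraphInst

section
variable {n d e : ℕ} {t : ℤ} {f : ℕ → ℤ}

/-- A positive `cut` is the successor of the last position with a sum below `t`; this and the next
lemma are all that is used of it besides its range. -/
theorem topSum_lt_of_pos_cut {m : ℕ} (h : 0 < cut n d e t f m) :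
    topSum n d e f (cut n d e t f m - 1) < t := by
  induction m with
  | zero => simp [cut] at h
  | succ m ih =>
    unfold cut at h ⊢
    split_ifs at h ⊢ with g
    · simpa using g
    · exact ih h

theorem le_topSum_of_cut_le {m k : ℕ} (hk : k < m) (h : cut n d e t f m ≤ k) :
    t ≤ topSum n d e f k := by
  induction m with
  | zero => omega
  | succ m ih =>
    unfold cut at h
    split_ifs at h with g
    · omega
    · rcases Nat.lt_succ_iff_lt_or_eq.1 hk with h' | rfl
      · exact ih h' h
      · exact not_lt.1 g

/-- A sum of three entries of a sorted list also occurs in the first blocks with a large sum. -/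
theorem exists_block_sum (hf : ∀ i j, i ≤ j → j < 9 * n * n → f i ≤ f j) {i j₀ j₁ j₂ : ℕ}
    (hi : i < 3 * n) (hd : d < 6 * n) (he : e < 6 * n) (h0 : j₀ / n = 3 * n + i)
    (h1 : j₁ / n = i + d) (h2 : j₂ / n = i + e) (hsum : f j₀ + f j₁ + f j₂ = t) :
    ∃ o₀ < n, ∃ o₁ < n, ∃ o₂ < n, f ((3 * n + cut n d e t f (3 * n)) * n + o₀) +
      f ((cut n d e t f (3 * n) + d) * n + o₁) + f ((cut n d e t f (3 * n) + e) * n + o₂) = t := by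
  have hn : 0 < n := by omega
  have d0 := Nat.div_add_mod' j₀ n
  have d1 := Nat.div_add_mod' j₁ n
  have d2 := Nat.div_add_mod' j₂ n
  rw [h0] at d0
  rw [h1] at d1
  rw [h2] at d2
  have m0 := Nat.mod_lt j₀ hn
  have m1 := Nat.mod_lt j₁ hn
  have m2 := Nat.mod_lt j₂ hn
  -- In a sorted list the largest entry of a block is at most every entry of a later block.
  have blk : ∀ a b o, a < b → b < 9 * n → o < n → f (a * n + (n - 1)) ≤ f (b * n + o) := by
    intro a b o hab hb ho
    have : (a + 1) * n ≤ b * n := Nat.mul_le_mul_right _ hab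
    rw [add_mul] at this
    exact hf _ _ (by omega) (Nat.digit_lt hb ho)
  have top : ∀ b o, b < 9 * n → o < n → f (b * n + o) ≤ f (b * n + (n - 1)) := fun b o hb ho =>
    hf _ _ (by omega) (Nat.digit_lt hb (by omega))
  -- All three blocks move up with the position, hence so does the sum of their largest entries.
  have mono : ∀ k l, k ≤ l → l < 3 * n → topSum n d e f k ≤ topSum n d e f l := by
    intro k l hkl hl
    rcases hkl.eq_or_lt with rfl | hkl
    · exact le_rfl
    · exact add_le_add (add_le_add (blk _ _ _ (by omega) (by omega) (by omega))
        (blk _ _ _ (by omega) (by omega) (by omega))) (blk _ _ _ (by omega) (by omega) (by omega))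
  have hti : t ≤ topSum n d e f i := by
    have := top (3 * n + i) _ (by omega) m0
    have := top (i + d) _ (by omega) m1
    have := top (i + e) _ (by omega) m2
    rw [← hsum, ← d0, ← d1, ← d2]
    unfold topSum
    linarith
  have hcut := cut_le n d e t f (3 * n)
  -- The position just before the cut has a top sum below `t`, while that of `i` is at least `t`; so
  -- `i` cannot precede the cut.
  have hci : cut n d e t f (3 * n) ≤ i := by
    by_contra! h
    have h3 := topSum_lt_of_pos_cut (by omega : 0 < cut n d e t f (3 * n))
    have h4 := mono i (cut n d e t f (3 * n) - 1) (by omega) (by omega)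
    linarith
  rcases hci.eq_or_lt with h | h
  · exact ⟨_, m0, _, m1, _, m2, by rw [h, d0, d1, d2, hsum]⟩
  -- The top sum at the cut is at least `t` by the choice of the cut, and at most `t` because its
  -- blocks precede those of the given entries. So the largest entries themselves have sum `t`.
  · refine ⟨n - 1, by omega, n - 1, by omega, n - 1, by omega, le_antisymm ?_ ?_⟩
    · have := blk (3 * n + cut n d e t f (3 * n)) (3 * n + i) _ (by omega) (by omega) m0
      have := blk (cut n d e t f (3 * n) + d) (i + d) _ (by omega) (by omega) m1
      have := blk (cut n d e t f (3 * n) + e) (i + e) _ (by omega) (by omega) m2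
      rw [d0] at *
      rw [d1] at *
      rw [d2] at *
      linarith
    · exact le_topSum_of_cut_le (k := cut n d e t f (3 * n)) (by omega) le_rfl

/-- An entry that is preceded and followed by many entries in every sorted order. -/
theorem _root_.List.Pairwise.index_bounds {S R : List ℤ} (hS : S.Pairwise (· ≤ ·)) (hp : S.Perm R) {j : ℕ}
    (hj : j < S.length) {N : ℕ} (hlo : N ≤ R.countP fun y => decide (y < S[j]))
    (hhi : N ≤ R.countP fun y => decide (S[j] < y)) : N ≤ j ∧ j + N < S.length := by
  have hle : ∀ a b (ha : a < S.length) (hb : b < S.length), a ≤ b → S[a] ≤ S[b] := by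
    intro a b ha hb hab
    rcases hab.eq_or_lt with rfl | h
    · exact le_rfl
    · exact List.pairwise_iff_getElem.1 hS a b ha hb h
  rw [← hp.countP_eq] at hlo hhi
  -- From position `j` on nothing is smaller than `S[j]`, so all the smaller entries come before.
  have h1 : (S.drop j).countP (fun y => decide (y < S[j])) = 0 := by
    rw [List.countP_eq_zero]
    intro a ha
    obtain ⟨i, hi, rfl⟩ := List.getElem_of_mem ha
    rw [List.getElem_drop]
    simpa using hle j (j + i) hj (by simp at hi; omega) (by omega)
  have h2 : (S.take (j + 1)).countP (fun y => decide (S[j] < y)) = 0 := by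
    rw [List.countP_eq_zero]
    intro a ha
    obtain ⟨i, hi, rfl⟩ := List.getElem_of_mem ha
    rw [List.getElem_take]
    simp only [List.length_take] at hi
    simpa using hle i j (by omega) hj (by omega)
  constructor
  · generalize S[j] = x at *
    rw [← List.take_append_drop j S, List.countP_append, h1] at hlo
    have := (S.take j).countP_le_length (p := fun y => decide (y < x))
    rw [List.length_take] at this
    omega
  · generalize S[j] = x at *
    rw [← List.take_append_drop (j + 1) S, List.countP_append, h2] at hhi
    have := (S.drop (j + 1)).countP_le_length (p := fun y => decide (x < y))
    rw [List.length_drop] at this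
    omega

end

section
variable (I : WeightedGraphInst) {c p : ℕ} {a : ℕ → ℕ}

theorem matchList_sorted (hc : 100 ≤ c) : (I.matchList c p a).Pairwise (· ≤ ·) := by
  refine radix_sorted fun x hx => ?_
  obtain ⟨k, rfl⟩ := (List.mem_ofFn' _ _).1 hx
  have h := I.matchRaw_bounds hc p a k
  refine ⟨h.1, h.2.trans_lt ?_⟩
  have hU : 0 < I.unit c := Nat.mul_pos (by omega) I.one_le_maxAbs
  exact_mod_cast (by omega : 1000 * I.unit c < 1024 * I.unit c).trans (Nat.lt_size_self _)

theorem mem_matchList {x : ℤ} :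
    x ∈ I.matchList c p a ↔ ∃ k < 9 * (I.n * I.n), I.matchRaw c p a k = x := by
  rw [matchList, (radix_perm _ _).mem_iff, List.mem_ofFn']
  exact ⟨fun ⟨k, hk⟩ => ⟨k, k.2, hk⟩, fun ⟨k, hk, h⟩ => ⟨⟨k, hk⟩, h⟩⟩

/-- An entry of the middle third lies in the middle third of the sorted list. -/
theorem exists_index (hc : 100 ≤ c) {x : ℤ} (hx : x ∈ I.matchList c p a) (h0 : 0 < x)
    (h1 : x < (1000 * I.unit c : ℕ)) : ∃ j, 3 * (I.n * I.n) ≤ j ∧ j < 6 * (I.n * I.n) ∧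
      (I.matchList c p a).getD j 0 = x := by
  obtain ⟨j, hj, rfl⟩ := List.getElem_of_mem hx
  have hlen := I.length_matchList c p a
  set N := I.n * I.n with hN
  set R := List.ofFn fun k : Fin (9 * N) => I.matchRaw c p a k with hR
  have hRl : R.length = 9 * N := by simp [hR]
  have hget : ∀ i (hi : i < R.length), R[i] = I.matchRaw c p a i := fun i hi => by simp [hR]
  have hb := (I.matchList_sorted (p := p) (a := a) hc).index_bounds (radix_perm R _) hj (N := 3 * N)
    ?_ ?_
  · refine ⟨j, hb.1, ?_, List.getD_eq_getElem _ _ hj⟩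
    have := hb.2
    change j + 3 * N < (I.matchList c p a).length at this
    omega
  · refine le_trans ?_ (List.Sublist.countP_le (List.take_sublist (3 * N) R))
    rw [List.countP_eq_length.2]
    · rw [List.length_take]; omega
    · intro b hb
      obtain ⟨i, hi, rfl⟩ := List.getElem_of_mem hb
      rw [List.length_take] at hi
      rw [List.getElem_take, hget, matchRaw, if_pos (by omega)]
      simpa using h0
  · refine le_trans ?_ (List.Sublist.countP_le (List.drop_sublist (6 * N) R))
    rw [List.countP_eq_length.2]
    · rw [List.length_drop]; omega
    · intro b hb
      obtain ⟨i, hi, rfl⟩ := List.getElem_of_mem hb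
      rw [List.length_drop] at hi
      rw [List.getElem_drop, hget, matchRaw, if_neg (by omega), if_neg (by omega)]
      simpa using h1

/-- The pair `(u, v)` may serve as the edge with the number `g`. -/
def Valid (p : ℕ) (a : ℕ → ℕ) (g u v : ℕ) : Prop :=
  [a 0, a 1, a 2, a 3, a 4, a 5].Nodup ∧ I.adj u v ∧ u % p = a (2 * g) ∧ v % p = a (2 * g + 1)

theorem matchEntry_of_valid {g u v : ℕ} (h : I.Valid p a g u v) :
    I.matchEntry c p a g u v = (32 + tag g : ℕ) * (I.unit c : ℕ) + I.wt u v := if_pos h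

theorem matchEntry_of_not_valid {g u v : ℕ} (h : ¬ I.Valid p a g u v) :
    I.matchEntry c p a g u v = (1000 * I.unit c : ℕ) := if_neg h

/-- Every entry is a multiple of `unit` plus a perturbation of at most `maxAbs`, and a coefficient
other than `0` and `1000` comes from an admissible edge whose group is given by the tag. -/
theorem matchRaw_cases (k : ℕ) : ∃ α w : ℤ, I.matchRaw c p a k = α * I.unit c + w ∧
    -(I.maxAbs : ℤ) ≤ w ∧ w ≤ I.maxAbs ∧ (α = 0 ∨ α = 1000 ∨
      ∃ g < 3, α = (32 + tag g : ℕ) ∧ ∃ u v, I.Valid p a g u v ∧ I.wt u v = w) := by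
  unfold matchRaw
  split_ifs with h1 h2
  · exact ⟨0, 0, by simp, by omega, by omega, .inl rfl⟩
  · by_cases hv : I.Valid p a (k / (I.n * I.n) - 3) (k % (I.n * I.n) / I.n) (k % (I.n * I.n) % I.n)
    · rw [I.matchEntry_of_valid hv]
      have := I.natAbs_wt_le (k % (I.n * I.n) / I.n) (k % (I.n * I.n) % I.n)
      have hk : k / (I.n * I.n) < 6 :=
        Nat.div_lt_of_lt_mul (h2.trans_eq (mul_comm _ _))
      exact ⟨_, _, rfl, by omega, by omega, .inr (.inr ⟨_, by omega, rfl, _, _, hv, rfl⟩)⟩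
    · rw [I.matchEntry_of_not_valid hv]
      exact ⟨1000, 0, by simp, by omega, by omega, .inr (.inl rfl)⟩
  · exact ⟨1000, 0, by simp, by omega, by omega, .inr (.inl rfl)⟩

/-- Among the tags 0, 1, 3 the number 4 has only the representation 0 + 1 + 3 as a sum of three, up
to the order. -/
theorem tag_perm {g₀ g₁ g₂ : ℕ} (h0 : g₀ < 3) (h1 : g₁ < 3) (h2 : g₂ < 3)
    (h : tag g₀ + tag g₁ + tag g₂ = 4) : (g₀ = 0 ∧ g₁ = 1 ∧ g₂ = 2) ∨ (g₀ = 0 ∧ g₁ = 2 ∧ g₂ = 1) ∨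
      (g₀ = 1 ∧ g₁ = 0 ∧ g₂ = 2) ∨ (g₀ = 1 ∧ g₁ = 2 ∧ g₂ = 0) ∨ (g₀ = 2 ∧ g₁ = 0 ∧ g₂ = 1) ∨
      (g₀ = 2 ∧ g₁ = 1 ∧ g₂ = 0) := by
  revert h
  interval_cases g₀ <;> interval_cases g₁ <;> interval_cases g₂ <;> decide

/-- Three entries with the right sum belong to the edges of a matching. -/
theorem exists_valid_of_sum (hc : 100 ≤ c) {k₀ k₁ k₂ : ℕ} (h : I.matchRaw c p a k₀ +
    I.matchRaw c p a k₁ + I.matchRaw c p a k₂ = I.matchTarget c) :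
    ∃ u₀ v₀ u₁ v₁ u₂ v₂, I.Valid p a 0 u₀ v₀ ∧ I.Valid p a 1 u₁ v₁ ∧ I.Valid p a 2 u₂ v₂ ∧
      I.wt u₀ v₀ + I.wt u₁ v₁ + I.wt u₂ v₂ = I.target := by
  obtain ⟨α₀, w₀, e0, l0, m0, c0⟩ := I.matchRaw_cases (c := c) (p := p) (a := a) k₀
  obtain ⟨α₁, w₁, e1, l1, m1, c1⟩ := I.matchRaw_cases (c := c) (p := p) (a := a) k₁
  obtain ⟨α₂, w₂, e2, l2, m2, c2⟩ := I.matchRaw_cases (c := c) (p := p) (a := a) k₂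
  have ht := I.natAbs_target_le
  have hM := I.one_le_maxAbs
  have hU : 100 * I.maxAbs ≤ I.unit c := Nat.mul_le_mul_right _ hc
  rw [e0, e1, e2, matchTarget] at h
  have key : (α₀ + α₁ + α₂ - 100) * (I.unit c : ℤ) = I.target - w₀ - w₁ - w₂ := by linarith
  -- The three perturbations and the target amount to at most `4 * maxAbs`, which is less than one
  -- `unit`, so the coefficients have to match exactly.
  have hsum : α₀ + α₁ + α₂ = 100 := by
    have hU' : (100 : ℤ) * I.maxAbs ≤ I.unit c := by exact_mod_cast hU
    rcases lt_trichotomy (α₀ + α₁ + α₂ - 100) 0 with h' | h' | h'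
    · have : (α₀ + α₁ + α₂ - 100) * (I.unit c : ℤ) ≤ -1 * I.unit c :=
        mul_le_mul_of_nonneg_right (by omega) (by positivity)
      omega
    · omega
    · have : 1 * (I.unit c : ℤ) ≤ (α₀ + α₁ + α₂ - 100) * (I.unit c : ℤ) :=
        mul_le_mul_of_nonneg_right (by omega) (by positivity)
      omega
  rw [hsum] at key
  have tags : ∀ g, tag g = 0 ∨ tag g = 1 ∨ tag g = 3 := fun g => by unfold tag; split_ifs <;> simp
  rcases c0 with c0 | c0 | ⟨g₀, hg0, c0, u₀, v₀, V0, W0⟩ <;>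
  rcases c1 with c1 | c1 | ⟨g₁, hg1, c1, u₁, v₁, V1, W1⟩ <;>
  rcases c2 with c2 | c2 | ⟨g₂, hg2, c2, u₂, v₂, V2, W2⟩
  case inr.inr.inr.inr.inr.inr =>
    rcases tag_perm hg0 hg1 hg2 (by omega) with ⟨rfl, rfl, rfl⟩ | ⟨rfl, rfl, rfl⟩ |
      ⟨rfl, rfl, rfl⟩ | ⟨rfl, rfl, rfl⟩ | ⟨rfl, rfl, rfl⟩ | ⟨rfl, rfl, rfl⟩
    · exact ⟨_, _, _, _, _, _, V0, V1, V2, by omega⟩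
    · exact ⟨_, _, _, _, _, _, V0, V2, V1, by omega⟩
    · exact ⟨_, _, _, _, _, _, V1, V0, V2, by omega⟩
    · exact ⟨_, _, _, _, _, _, V2, V0, V1, by omega⟩
    · exact ⟨_, _, _, _, _, _, V1, V2, V0, by omega⟩
    · exact ⟨_, _, _, _, _, _, V2, V1, V0, by omega⟩
  -- With a filler among the entries the coefficients cannot sum to 100: one filler `1000` is too
  -- much, and with a filler `0` the other two give at most `2 * 35`.
  all_goals
    exfalso
    try have t0 := tags g₀
    try have t1 := tags g₁
    try have t2 := tags g₂
    omega

end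

end WeightedGraphInst

theorem Nat.exists_digits {Q : ℕ} : ∀ (m : ℕ) (a : ℕ → ℕ) (_ : ∀ i < m, a i < Q) {d D : ℕ} (_ : d < D),
    ∃ z < D * Q ^ m, z / Q ^ m = d ∧ ∀ i < m, z / Q ^ i % Q = a i
  | 0, _, _, d, _, hd => ⟨d, by simpa using hd, by simp, by simp⟩
  | m + 1, a, ha, d, D, hd => by
    obtain ⟨z, hz, h1, h2⟩ := Nat.exists_digits m (fun i => a (i + 1))
      (fun i hi => ha (i + 1) (by omega)) hd
    have h0 := ha 0 (by omega)
    have key : ∀ i, (z * Q + a 0) / Q ^ (i + 1) = z / Q ^ i := fun i => by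
      rw [pow_succ', ← Nat.div_div_eq_div_mul, Nat.digit_div h0]
    refine ⟨z * Q + a 0, (Nat.digit_lt hz h0).trans_eq (by ring), (key m).trans h1, fun i hi => ?_⟩
    cases i with
    | zero => rw [pow_zero, Nat.div_one, Nat.digit_mod h0]
    | succ i => rw [key, h2 i (by omega)]

/-! ### Correctness and size of the star instances -/

namespace WeightedGraphInst

section
variable (I : WeightedGraphInst) {c p : ℕ} {a : ℕ → ℕ}

theorem matchList_congr {a' : ℕ → ℕ} (h : ∀ i < 6, a i = a' i) :
    I.matchList c p a = I.matchList c p a' := by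
  unfold matchList
  congr 2
  funext k
  unfold matchRaw
  split_ifs with h1 h2
  · rfl
  · have hk : (k : ℕ) / (I.n * I.n) < 6 := Nat.div_lt_of_lt_mul (h2.trans_eq (mul_comm _ _))
    unfold matchEntry
    rw [h 0 (by norm_num), h 1 (by norm_num), h 2 (by norm_num), h 3 (by norm_num),
      h 4 (by norm_num), h 5 (by norm_num), h (2 * (k / (I.n * I.n) - 3)) (by omega),
      h (2 * (k / (I.n * I.n) - 3) + 1) (by omega)]
  · rfl

theorem exists_index_of_valid (hc : 100 ≤ c) {g u v : ℕ} (hg : g < 3) (h : I.Valid p a g u v) :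
    ∃ j, 3 * (I.n * I.n) ≤ j ∧ j < 6 * (I.n * I.n) ∧
      (I.matchList c p a).getD j 0 = (32 + tag g : ℕ) * (I.unit c : ℕ) + I.wt u v := by
  have hM := I.one_le_maxAbs
  have hU : 100 * I.maxAbs ≤ I.unit c := Nat.mul_le_mul_right _ hc
  have hw := I.natAbs_wt_le u v
  have h7 : (32 + tag g) * I.unit c ≤ 35 * I.unit c :=
    Nat.mul_le_mul_right _ (by unfold tag; split_ifs <;> norm_num)
  have h8 : 32 * I.unit c ≤ (32 + tag g) * I.unit c := Nat.mul_le_mul_right _ (by omega)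
  rw [← Nat.cast_mul]
  refine I.exists_index hc ?_ (by omega) (by omega)
  rw [mem_matchList]
  obtain ⟨hu, hv, -⟩ := id h.2.1
  have huv := Nat.digit_lt hu hv
  have hlt := Nat.digit_lt (show 3 + g < 6 by omega) huv
  have hge : 3 * (I.n * I.n) ≤ (3 + g) * (I.n * I.n) := Nat.mul_le_mul_right _ (by omega)
  refine ⟨(3 + g) * (I.n * I.n) + (u * I.n + v), by omega, ?_⟩
  rw [matchRaw, if_neg (by omega), if_pos hlt, Nat.digit_div huv, Nat.digit_mod huv,
    Nat.digit_div hv, Nat.digit_mod hv, Nat.add_sub_cancel_left, I.matchEntry_of_valid h,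
    Nat.cast_mul]

theorem adj_matchStar {z u v : ℕ} : (I.matchStar c z).adj u v ↔ u < 9 * I.n ∧ v < 9 * I.n ∧
    (u < 6 * I.n ∧ 6 * I.n ≤ v ∨ v < 6 * I.n ∧ 6 * I.n ≤ u) :=
  adj_ofArcs

theorem wt_matchStar {z u v : ℕ} (hu : u < 6 * I.n) (hv : v < 9 * I.n) (hv' : 6 * I.n ≤ v) :
    (I.matchStar c z).wt u v = starWeight I.n (z / I.q ^ 7) (I.matchTarget c)
      (fun i => (I.matchListOf c z).getD i 0) u v := by
  classical
  have h : (I.matchStar c z).wt u v = _ := wt_ofArcs (show u < 9 * I.n by omega) hv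
  rw [h, if_pos ⟨hu, hv'⟩]

/-- Whatever blocks the table refers to, they lie within the sorted list. So one direction of the
reduction needs nothing about `cut` but its range. -/
theorem wt_matchStar_mem {z u v : ℕ} (hz : z < I.num matchNum) (h : (I.matchStar c z).adj u v) :
    ∃ k, I.matchRaw c (z / I.q ^ 6 % I.q + 1) (fun i => z / I.q ^ i % I.q) k =
      (I.matchStar c z).wt u v := by
  wlog hu : u < 6 * I.n generalizing u v
  · rw [wt_comm]
    refine this ((adj_comm _ _ _).1 h) ?_
    have := I.adj_matchStar.1 h
    omega
  have h' := I.adj_matchStar.1 h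
  have hd := I.matchNum_div_lt hz
  rw [I.wt_matchStar hu h'.2.1 (by omega), starWeight]
  have hlen := I.length_matchList c (z / I.q ^ 6 % I.q + 1) (fun i => z / I.q ^ i % I.q)
  have hcut := cut_le I.n (z / I.q ^ 7) u (I.matchTarget c)
    (fun i => (I.matchListOf c z).getD i 0) (3 * I.n)
  have hb := Nat.digit_lt (A := 9 * I.n) (a := block I.n (z / I.q ^ 7) u (I.matchTarget c)
    (fun i => (I.matchListOf c z).getD i 0) (v / I.n))
    (by unfold block; split_ifs <;> omega) (Nat.mod_lt v I.n_pos)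
  have hmem := List.getElem_mem (hb.trans_eq ((by ring : _ = 9 * (I.n * I.n)).trans hlen.symm))
  obtain ⟨k, -, hk⟩ := I.mem_matchList.1 hmem
  exact ⟨k, hk.trans (List.getD_eq_getElem _ _ _).symm⟩

/-- Only the three weights matter, not which leaves are used or on which side the center lies: the
tags force one edge of each group, and the six end nodes have different residues. -/
theorem hasExactCopy_matching_of_matchStar (hc : 100 ≤ c) {z : ℕ} (hz : z < I.num matchNum)
    (h : (I.matchStar c z).HasExactCopy (kStar 3)) : I.HasExactCopy (kMatching 3) := by
  rw [hasExactCopy_star_iff] at h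
  obtain ⟨m, w₀, w₁, w₂, -, h0, h1, h2, hs⟩ := h
  obtain ⟨k₀, e0⟩ := I.wt_matchStar_mem hz h0
  obtain ⟨k₁, e1⟩ := I.wt_matchStar_mem hz h1
  obtain ⟨k₂, e2⟩ := I.wt_matchStar_mem hz h2
  rw [← e0, ← e1, ← e2] at hs
  obtain ⟨u₀, v₀, u₁, v₁, u₂, v₂, V0, V1, V2, hw⟩ := I.exists_valid_of_sum hc hs
  rw [hasExactCopy_matching_iff]
  refine ⟨u₀, v₀, u₁, v₁, u₂, v₂, ?_, V0.2.1, V1.2.1, V2.2.1, hw⟩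
  refine List.Nodup.of_map (· % (z / I.q ^ 6 % I.q + 1)) ?_
  have := V0.1
  simp only [List.map_cons, List.map_nil, V0.2.2.1, V0.2.2.2, V1.2.2.1, V1.2.2.2, V2.2.2.1,
    V2.2.2.2]
  exact this

/-- The tagged weights of the matching are in the middle third of the sorted list. If the first is
in block `3 * n + i`, the others are in blocks `i + d` and `i + e` with `d, e < 6 * n`; the instance
number supplies `d`, the center of the star supplies `e`. -/
theorem exists_matchStar (hc : 100 ≤ c) (h : I.HasExactCopy (kMatching 3)) :
    ∃ z < I.num matchNum, (I.matchStar c z).HasExactCopy (kStar 3) := by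
  have hn := I.n_pos
  rw [hasExactCopy_matching_iff] at h
  obtain ⟨u₀, v₀, u₁, v₁, u₂, v₂, hnd, h0, h1, h2, hs⟩ := h
  have hlt : ∀ u ∈ [u₀, v₀, u₁, v₁, u₂, v₂], u < I.n := by
    obtain ⟨_, _, -⟩ := h0
    obtain ⟨_, _, -⟩ := h1
    obtain ⟨_, _, -⟩ := h2
    simp only [List.mem_cons, List.not_mem_nil, or_false]
    rintro u (rfl | rfl | rfl | rfl | rfl | rfl) <;> assumption
  obtain ⟨p, hp, hpq, hinj⟩ := exists_mod_injOn (S := [u₀, v₀, u₁, v₁, u₂, v₂].toFinset)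
    (List.toFinset_card_le _) (n := I.n) (fun u hu => hlt u (List.mem_toFinset.1 hu))
  change p ≤ I.q at hpq
  -- The six residues are the first digits of the instance number; the seventh one is `p - 1`, so
  -- that it is below `q`.
  set a : ℕ → ℕ := fun i => if i = 6 then p - 1 else
    ([u₀, v₀, u₁, v₁, u₂, v₂].map (· % p)).getD i 0 with ha
  have hnd' : [a 0, a 1, a 2, a 3, a 4, a 5].Nodup :=
    hnd.map_on fun x hx y hy hxy => hinj (by simpa using hx) (by simpa using hy) hxy
  have haq : ∀ i < 7, a i < I.q := by
    intro i hi
    have hm : ∀ u, u % p < I.q := fun u => (Nat.mod_lt u hp).trans_le hpq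
    interval_cases i <;> simp [ha, hm]; omega
  have V0 : I.Valid p a 0 u₀ v₀ := ⟨hnd', h0, rfl, rfl⟩
  have V1 : I.Valid p a 1 u₁ v₁ := ⟨hnd', h1, rfl, rfl⟩
  have V2 : I.Valid p a 2 u₂ v₂ := ⟨hnd', h2, rfl, rfl⟩
  obtain ⟨j₀, l0, r0, e0⟩ := I.exists_index_of_valid hc (by norm_num) V0
  obtain ⟨j₁, l1, r1, e1⟩ := I.exists_index_of_valid hc (by norm_num) V1
  obtain ⟨j₂, l2, r2, e2⟩ := I.exists_index_of_valid hc (by norm_num) V2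
  have lo : ∀ j, 3 * (I.n * I.n) ≤ j → 3 * I.n ≤ j / I.n := fun j hj =>
    (Nat.le_div_iff_mul_le hn).2 (by rw [mul_assoc]; exact hj)
  have hi : ∀ j, j < 6 * (I.n * I.n) → j / I.n < 6 * I.n := fun j hj =>
    Nat.div_lt_of_lt_mul (hj.trans_eq (by ring))
  have := lo _ l0
  have := lo _ l1
  have := lo _ l2
  have := hi _ r0
  have := hi _ r1
  have := hi _ r2
  have hlen := I.length_matchList c p a
  have hsorted : ∀ i j, i ≤ j → j < 9 * I.n * I.n →
      (I.matchList c p a).getD i 0 ≤ (I.matchList c p a).getD j 0 := by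
    intro i j hij hj
    rw [mul_assoc, ← hlen] at hj
    rw [List.getD_eq_getElem _ _ hj, List.getD_eq_getElem _ _ (by omega)]
    rcases hij.eq_or_lt with rfl | hij
    · exact le_rfl
    · exact List.pairwise_iff_getElem.1 (I.matchList_sorted hc) i j _ _ hij
  set f : ℕ → ℤ := fun i => (I.matchList c p a).getD i 0 with hf
  obtain ⟨o₀, b0, o₁, b1, o₂, b2, ho⟩ := exists_block_sum (f := f) hsorted (t := I.matchTarget c)
    (i := j₀ / I.n - 3 * I.n) (d := j₁ / I.n - (j₀ / I.n - 3 * I.n))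
    (e := j₂ / I.n - (j₀ / I.n - 3 * I.n)) (j₀ := j₀) (j₁ := j₁) (j₂ := j₂) (by omega) (by omega) (by omega) (by omega)
    (by omega) (by omega) (by
      simp only [hf, e0, e1, e2, matchTarget, tag]
      push_cast
      linarith)
  set d := j₁ / I.n - (j₀ / I.n - 3 * I.n) with hd
  set e := j₂ / I.n - (j₀ / I.n - 3 * I.n) with he
  obtain ⟨z, hz, hzd, hza⟩ := Nat.exists_digits 7 a haq (show d < 6 * I.n by omega)
  refine ⟨z, hz, ?_⟩
  have hL : I.matchListOf c z = I.matchList c p a := by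
    have h6 : z / I.q ^ 6 % I.q + 1 = p := by
      rw [hza 6 (by norm_num)]
      change p - 1 + 1 = p
      omega
    rw [matchListOf, h6]
    exact I.matchList_congr fun i hi => hza i (by omega)
  rw [hasExactCopy_star_iff]
  have he6 : e < 6 * I.n := by omega
  -- One leaf from each of the three groups of `n` leaves, at the positions within the blocks.
  refine ⟨e, 6 * I.n + o₀, 7 * I.n + o₁, 8 * I.n + o₂, by omega,
    I.adj_matchStar.2 (by omega), I.adj_matchStar.2 (by omega), I.adj_matchStar.2 (by omega), ?_⟩
  rw [I.wt_matchStar he6 (by omega) (by omega), I.wt_matchStar he6 (by omega) (by omega),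
    I.wt_matchStar he6 (by omega) (by omega), hL, hzd]
  simp only [starWeight, Nat.digit_div b0, Nat.digit_div b1, Nat.digit_div b2, Nat.digit_mod b0,
    Nat.digit_mod b1, Nat.digit_mod b2]
  exact ho

/-- The lower bound comes from the target, which is at least `99 * unit`; the upper one from the
filler `1000 * unit`. -/
theorem matchStar_size (hc : 100 ≤ c) {z : ℕ} (hz : z < I.num matchNum) :
    (I.unit c).size ≤ (exactWeight (kStar 3)).size (I.matchStar c z) ∧
      (exactWeight (kStar 3)).size (I.matchStar c z) ≤ 9 * I.n * ((1000 * c).size + I.len) := by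
  have hn := I.n_pos
  have hM := I.one_le_maxAbs
  have hU : 100 * I.maxAbs ≤ I.unit c := Nat.mul_le_mul_right _ hc
  have ht := I.natAbs_target_le
  have hT : (I.matchStar c z).target = 100 * I.unit c + I.target := rfl
  constructor
  · have h1 := (I.matchStar c z).natAbs_target_le
    rw [hT] at h1
    change _ ≤ 9 * I.n * _
    exact (Nat.size_le_size (by omega)).trans (Nat.le_mul_of_pos_left _ (by omega))
  · refine Nat.mul_le_mul_left _ ((Nat.size_le_size (n := 1000 * c * I.maxAbs) ?_).trans
      (Nat.size_mul_le _ _))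
    have e : 1000 * c * I.maxAbs = 1000 * I.unit c := by unfold unit; ring
    rw [e]
    refine maxAbs_le _ (by omega) (by rw [hT]; omega) fun u v huv => ?_
    obtain ⟨k, hk⟩ := I.wt_matchStar_mem hz huv
    rw [← hk]
    have := I.matchRaw_bounds hc (z / I.q ^ 6 % I.q + 1) (fun i => z / I.q ^ i % I.q) k
    omega

end

/-- The sorting takes about `n ^ 2 * len` operations per instance, which is where `2 ≤ β` is needed.
-/
theorem solvableInTime_matching {β δ : ℝ} (hβ : 2 ≤ β) (hδ : 0 < δ)
    (h : (exactWeight (kStar 3)).SolvableInTime fun s => (s : ℝ) ^ β) :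
    (exactWeight (kMatching 3)).SolvableInTime fun s => (s : ℝ) ^ (β + 1 + δ) := by
  have hn : ∀ I : WeightedGraphInst, 1 ≤ I.n := n_pos
  have hL : ∀ I : WeightedGraphInst, 1 ≤ I.len := len_pos
  refine solvableInTime_of_reduction (Z := matchNum) (e := 6 * var 6 * qpow 7)
    (gen := matchGen) (S := fun c I => 9 * I.n * ((1000 * c).size + I.len))
    (k := fun c I => (1024 * I.unit c).size * (126 * (I.n * I.n) + 30) +
      (1000 * (I.n * I.n) + 100))
    (by linarith) hδ h (fun n q hn hq => by unfold matchNum; positivity) (fun η hη => ?_)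
    (by simp [qpow, pureIn_npow (e := var 10) rfl, Expr.pureIn]) ?_
    (fun c I z => I.matchStar c z) (fun c hc I z hz => (I.matchStar_size hc hz).1)
    (fun c hc I z hz => (I.matchStar_size hc hz).2) (fun c => ?_) (fun c => ?_)
    (fun c hc I z hz => I.generates_matchStar hc hz) fun c hc I =>
      ⟨I.exists_matchStar hc, fun ⟨z, hz, h⟩ => I.hasExactCopy_matching_of_matchStar hc hz h⟩
  · have hq := dom_q (η := η / 7) (by linarith)
    refine ((((((((Dom.fst.smul 6).mul hn hL hq).mul hn hL hq).mul hn hL hq).mul hn hL hq).mul hn hL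
      hq).mul hn hL hq).mul hn hL hq).mono hn hL (by linarith) (by linarith) |>.of_le fun I => ?_
    exact le_of_eq (by unfold num matchNum; ring)
  · intro l x v W n q h6 h10
    refine ⟨by simp [ok_qpow], ?_⟩
    rw [ev_mul, ev_qpow h10]
    simp [h6, matchNum]
  · have h1 : Dom n len 0 1 fun I => (1000 * c).size + I.len :=
      ((Dom.const _).mono hn hL le_rfl zero_le_one).add Dom.snd
    exact ((Dom.fst.smul 9).mul hn hL h1).mono hn hL (by norm_num) (by norm_num)
  · have h1 : Dom n len 0 1 fun I => (1024 * I.unit c).size := by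
      refine (((Dom.const (1024 * c).size).mono hn hL le_rfl zero_le_one).add Dom.snd).of_le
        fun I => ?_
      rw [show 1024 * I.unit c = 1024 * c * I.maxAbs by unfold unit; ring]
      exact Nat.size_mul_le _ _
    have h2 : Dom n len 2 0 fun I => I.n * I.n := (Dom.fst.mul hn hL Dom.fst).mono hn hL
      (by norm_num) (by norm_num)
    have h3 : ∀ k, Dom n len 2 0 fun _ => k := fun k =>
      (Dom.const k).mono hn hL (by norm_num) (by norm_num)
    exact ((h1.mul hn hL ((h2.smul 126).add (h3 30))).mono hn hL (by linarith) (by linarith)).add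
      (((h2.smul 1000).add (h3 100)).mono hn hL (by linarith) (by linarith))

end WeightedGraphInst

namespace KSumInst

/-! ### `3`-SUM by matchings -/

section
variable (k c : ℕ) (I : KSumInst 3)

/-- The binary length of the numbers. -/
def len : ℕ := I.maxAbs.size

theorem one_le_maxAbs : 1 ≤ I.maxAbs := le_max_left _ _

theorem len_pos : 0 < I.len := Nat.size_pos.2 I.one_le_maxAbs

theorem memOfList_encode_zero : memOfList I.encode 0 = I.n := by
  rw [memOfList_encode, tab, if_neg (by omega)]
  simp

theorem memOfList_encode_get' {m : ℕ} (hm : m < 3 * I.n) :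
    memOfList I.encode (1 + m) = I.get (m / I.n) (m % I.n) := by
  rw [memOfList_encode]
  exact tab_apply hm

theorem memOfList_encode_get {i j : ℕ} (hi : i < 3) (hj : j < I.n) :
    memOfList I.encode (1 + (i * I.n + j)) = I.get i j := by
  have := I.memOfList_encode_get' (Nat.digit_lt hi hj)
  rw [Nat.digit_div hj, Nat.digit_mod hj] at this
  exact_mod_cast this

theorem maxAbs_eq : I.maxAbs = RAM.maxAbs 1 (fun m => I.get (m / I.n) (m % I.n)) (3 * I.n) := by
  refine le_antisymm (I.maxAbs_le RAM.le_maxAbs fun i j hi hj => ?_)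
    (RAM.maxAbs_le I.one_le_maxAbs fun k _ => I.natAbs_get_le _ _)
  have h := RAM.natAbs_le_maxAbs (m := 1) (g := fun m => I.get (m / I.n) (m % I.n))
    (Nat.digit_lt hi hj)
  simpa only [Nat.digit_div hj, Nat.digit_mod hj] using h

theorem exists_side : ∃ h, I.n ≤ h * h := ⟨I.n, Nat.le_mul_of_pos_left _ I.n_pos⟩

/-- The rounded square root of the number of integers per list. -/
def side : ℕ := Nat.find I.exists_side

theorem le_side : I.n ≤ I.side * I.side := Nat.find_spec I.exists_side

theorem lt_side_iff {j : ℕ} : j < I.side ↔ j * j < I.n := by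
  refine ⟨fun h => not_le.1 (Nat.find_min I.exists_side h), fun h => ?_⟩
  by_contra! h'
  exact absurd (I.le_side.trans (Nat.mul_le_mul h' h')) (not_le.2 h)

theorem side_pos : 0 < I.side := I.lt_side_iff.2 I.n_pos

theorem side_le : I.side ≤ I.n :=
  Nat.find_min' I.exists_side (Nat.le_mul_of_pos_left _ I.n_pos)

theorem side_sq_le : I.side * I.side ≤ 4 * I.n := by
  have h0 := I.side_pos
  have h1 := I.lt_side_iff.1 (Nat.sub_lt h0 one_pos)
  obtain ⟨j, hj⟩ : ∃ j, I.side = j + 1 := ⟨I.side - 1, by omega⟩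
  rw [hj, Nat.add_sub_cancel] at h1
  rw [hj]
  have := I.n_pos
  nlinarith

theorem exists_probe : ∃ m, I.n ≤ m ^ k ∨ I.maxAbs < 2 ^ m := ⟨I.len, .inr (Nat.lt_size_self _)⟩

/-- The binary length of the numbers, unless it is large in comparison with the number of
integers per list. -/
def probe : ℕ := Nat.find (I.exists_probe k)

/-- The numbers are long. -/
def Large : Prop := I.n ≤ I.probe k ^ k

theorem probe_le_len : I.probe k ≤ I.len := Nat.find_min' _ (.inr (Nat.lt_size_self _))

variable {k}

theorem le_len_pow_of_large (h : I.Large k) : I.n ≤ I.len ^ k :=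
  h.trans (Nat.pow_le_pow_left (I.probe_le_len k) k)

theorem probe_eq_of_not_large (h : ¬ I.Large k) : I.probe k = I.len :=
  le_antisymm (I.probe_le_len k) (Nat.size_le.2 ((Nat.find_spec (I.exists_probe k)).resolve_left h))

theorem len_pow_lt_of_not_large (h : ¬ I.Large k) : I.len ^ k < I.n := by
  rw [← I.probe_eq_of_not_large h]
  exact not_le.1 h

/-- This is the test of the loop that searches for `probe`. It is only valid up to `probe`, which
the counter never exceeds. -/
theorem lt_probe_iff {j : ℕ} (hj : j ≤ I.probe k) :
    j < I.probe k ↔ j ^ k < I.n ∧ 2 ^ j ≤ I.maxAbs := by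
  constructor
  · intro h
    have := Nat.find_min (I.exists_probe k) h
    push Not at this
    exact this
  · rintro ⟨h1, h2⟩
    refine hj.lt_of_ne ?_
    rintro rfl
    rcases Nat.find_spec (I.exists_probe k) with h | h
    · exact absurd h (not_le.2 h1)
    · exact absurd h (not_lt.2 h2)

theorem probe_pos (hk : 0 < k) : 0 < I.probe k :=
  (I.lt_probe_iff (Nat.zero_le _)).2 ⟨by rw [zero_pow hk.ne']; exact I.n_pos, I.one_le_maxAbs⟩

/-- The cap at `n` limits the search for `probe` to `n` passes. A search for the exact length could
take `len` passes on numbers of that length, a quadratic time that the bound with exponent `2 - δ`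
does not permit. -/
theorem probe_le (hk : 0 < k) : I.probe k ≤ I.n :=
  Nat.find_min' _ (.inl (Nat.le_self_pow hk.ne' _))

theorem two_pow_le {j : ℕ} (hj : j ≤ I.probe k) : 2 ^ j ≤ 2 * I.maxAbs :=
  (Nat.pow_le_pow_right (by norm_num) (hj.trans (I.probe_le_len k))).trans
    (Nat.two_pow_size_le I.one_le_maxAbs)

variable (k)

open Classical in
/-- The number of generated instances. -/
noncomputable def num : ℕ := if I.Large k then 0 else 1

/-- `probe` replaces the length: they agree unless the numbers are long, and in that case no
instance is generated and no vote takes place. -/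
def reps : ℕ := (I.n * I.probe k).size

/-- As `num` is at most 1, two classes for each repetition suffice beyond the input and the initial
phase. -/
def modulus : ℕ := 3 * I.n + 1 + 2 * I.reps k + 3

/-- A multiple of the bound of the numbers. -/
def unit : ℕ := c * I.maxAbs

def big : ℕ := 100000 * (I.n * I.n + I.unit c + I.maxAbs)

def bits : ℕ := (I.big c).size

/-- The variables after the preparation. -/
def Vars (v : ℕ → ℤ) : Prop := v 1 = I.num k ∧ v 2 = I.reps k ∧ v 3 = I.modulus k ∧
  v 4 = (3 * I.n + 1 : ℕ) ∧ v 6 = I.n ∧ v 7 = I.unit c ∧ v 8 = I.side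

abbrev env : Env := ⟨memOfList I.encode, I.encode.length, I.bits c⟩

/-- The computation of the bound of the numbers and of the rounded square root. -/
def preSide : Cmd :=
  .seq (.set 6 (inp 0)) <| .seq (.set 7 1) <|
  .seq (.loop 11 (3 * var 6) (.set 7 (Expr.maxAbs (var 7) (inp (1 + var 11))))) <|
  .seq (.set 8 0) <| .while (var 6 - var 8 * var 8) (.set 8 (var 8 + 1))

/-- The computation of the capped binary length. -/
def preProbe : Cmd :=
  .seq (.set 9 0) <| .seq (.set 10 1) <|
  .while (ltb (npow (var 9) k) (var 6) * (var 7 + 1 - var 10))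
    (.seq (.set 10 (var 10 + var 10)) (.set 9 (var 9 + 1)))

/-- The preparation for the input of `3`-SUM. -/
def pre : Cmd :=
  .seq preSide <| .seq (preProbe k) <|
  .seq (.set 1 (ltb (npow (var 9) k) (var 6))) <| .seq (.set 13 (var 6 * var 9)) <|
  .seq (Cmd.size 13 2 14) <| .seq (.set 4 (3 * var 6 + 1)) <|
  .seq (.set 3 (var 4 + 2 * var 2 + 3)) <| .set 7 (lit c * var 7)

variable {k c}

theorem lt_two_pow_bits {m : ℕ} (h : m ≤ I.big c) : m < 2 ^ I.bits c :=
  h.trans_lt (Nat.lt_size_self _)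

theorem size_lt_bits {m : ℕ} (h0 : 0 < m) (h : 2 * m ≤ I.big c) : m.size < I.bits c :=
  Nat.lt_size.2 ((Nat.two_pow_size_le h0).trans h)

theorem big_bounds : 100000 * (I.n * I.n) ≤ I.big c ∧ 100000 * I.n ≤ I.big c ∧
    100000 * I.unit c ≤ I.big c ∧ 100000 * I.maxAbs ≤ I.big c ∧ 100000 ≤ I.big c := by
  have h2 : I.n ≤ I.n * I.n := Nat.le_mul_of_pos_left _ I.n_pos
  have h1 := I.one_le_maxAbs
  unfold big
  omega

theorem natAbs_inp_lt : ∀ a ∈ I.encode, a.natAbs < 2 ^ I.bits c := by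
  have hb := I.big_bounds (c := c)
  intro a ha
  refine I.lt_two_pow_bits ?_
  simp only [encode, List.mem_cons, List.mem_ofFn] at ha
  rcases ha with rfl | ⟨m, rfl⟩
  · rw [Int.natAbs_natCast]; omega
  · have := I.natAbs_get_le m.divNat m.modNat
    have e : I.get m.divNat m.modNat = I.x m.divNat m.modNat :=
      dif_pos ⟨m.divNat.2, m.modNat.2⟩
    rw [e] at this
    omega

theorem reps_le (hk : 0 < k) : I.reps k ≤ I.n * I.n + 1 := by
  refine (Nat.size_le_size (Nat.mul_le_mul_left _ (I.probe_le hk))).trans ?_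
  exact (Nat.size_le.2 Nat.lt_two_pow_self).trans (Nat.le_succ _)

theorem natAbs_natCast_lt {m : ℕ} (h : m ≤ I.big c) :
    (m : ℤ).natAbs < 2 ^ (I.env c).b := by
  rw [Int.natAbs_natCast]; exact I.lt_two_pow_bits h

theorem tri_preSide : Tri (I.env c) preSide ⟨0, 0, 0⟩ (14 * I.n + 20) fun s' =>
    s'.v 7 = I.maxAbs ∧ s'.v 6 = I.n ∧ s'.v 0 = 0 ∧ s'.v 8 = I.side := by
  have hn := I.n_pos
  have hs := I.side_le
  obtain ⟨hb1, hb2, hb3, hb4, hb5⟩ := I.big_bounds (c := c)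
  have hx0 := I.memOfList_encode_zero
  have hlen := I.length_encode
  -- The square root is found by counting upwards, which is affordable because `side` is at most
  -- `n`.
  obtain ⟨T₁, hT₁⟩ : ∃ T, T = 3 * I.n * 4 + 3 := ⟨_, rfl⟩
  obtain ⟨T₂, hT₂⟩ : ∃ T, T = I.side * 2 + 1 := ⟨_, rfl⟩
  refine Tri.mono (τ₁ := (T₁ + (T₂ + 2) + 1) + 2 + 2) (Q' := fun s' =>
    s'.v 7 = I.maxAbs ∧ s'.v 6 = I.n ∧ s'.v 0 = 0 ∧ s'.v 8 = I.side) ?_ (by omega) fun _ _ h => h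
  refine Tri.set_seq I.n (by simp [hlen]) (by simp [hx0]) (I.natAbs_natCast_lt (by omega)) ?_
  refine Tri.set_seq (1 : ℕ) (by simp) (by simp) (I.natAbs_natCast_lt (by omega)) ?_
  refine Tri.seq ((Tri.maxAbs (by norm_num) (3 * I.n) 1
      (fun m => I.get (m / I.n) (m % I.n)) ?_ ?_ ?_ ?_ ?_).mono hT₁.ge fun _ _ h => h)
      fun s₁ hs₁ h7 => ?_
  · exact I.lt_two_pow_bits (by omega)
  · simp
  · intro j a _; simp
  · intro j a hj
    have := I.memOfList_encode_get' hj
    constructor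
    · simp [hlen]; omega
    · simp [this]
  · rw [← I.maxAbs_eq]; exact I.lt_two_pow_bits (by omega)
  rw [← I.maxAbs_eq] at h7
  have h6 : s₁.v 6 = I.n := by rw [hs₁.v 6 (by simp [Cmd.loop, Cmd.mods])]; simp
  have h0 : s₁.v 0 = 0 := by rw [hs₁.v 0 (by simp [Cmd.loop, Cmd.mods])]; simp
  refine Tri.set_seq (0 : ℕ) (by simp) (by simp) (I.natAbs_natCast_lt (by omega)) ?_
  refine (Tri.while (τ := 1) (fun j s' => s'.v 8 = (j : ℕ)) I.side (by simp) ?_ ?_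
    ?_).mono hT₂.ge fun s₂ hs₂ h8 => ?_
  · intro j _ s' _ _; simp
  · intro j hj s' hs' h
    have e6 : s'.v 6 = I.n := by rw [hs'.v 6 (by simp [Cmd.mods])]; simp [h6]
    simp only [ev_sub, ev_var, ev_mul, e6, h]
    rw [I.lt_side_iff, sub_pos]
    exact_mod_cast Iff.rfl
  · intro j hj s' hs' h
    exact Tri.set (a := (j + 1 : ℕ)) (by simp) (by simp [h]) (I.natAbs_natCast_lt (by omega))
      (by simp)
  have m := fun j (hj : j ≠ 8) => hs₂.v j (by simp [Cmd.mods, hj])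
  refine ⟨?_, ?_, ?_, h8⟩
  · rw [m 7 (by norm_num)]; simp [h7]
  · rw [m 6 (by norm_num)]; simp [h6]
  · rw [m 0 (by norm_num)]; simp [h0]

theorem tri_preProbe {s : St} (hk : 0 < k) (h6 : s.v 6 = I.n) (h7 : s.v 7 = I.maxAbs) :
    Tri (I.env c) (preProbe k) s (4 * I.n + 5) fun s' => s'.v 9 = I.probe k := by
  have hp := I.probe_le hk
  obtain ⟨hb1, hb2, hb3, hb4, hb5⟩ := I.big_bounds (c := c)
  obtain ⟨T, hT⟩ : ∃ T, T = I.probe k * 4 + 1 := ⟨_, rfl⟩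
  refine Tri.mono (τ₁ := T + 2 + 2) (Q' := fun s' => s'.v 9 = I.probe k) ?_ (by omega)
    fun _ _ h => h
  refine Tri.set_seq (0 : ℕ) (by simp) (by simp) (I.natAbs_natCast_lt (by omega)) ?_
  refine Tri.set_seq (1 : ℕ) (by simp) (by simp) (I.natAbs_natCast_lt (by omega)) ?_
  refine (Tri.while (τ := 3) (fun j s' => s'.v 9 = (j : ℕ) ∧ s'.v 10 = (2 ^ j : ℕ))
    (I.probe k) (by simp) ?_ ?_ ?_).mono hT.ge fun s₃ hs₃ ⟨h9, h10⟩ => h9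
  · intro j _ s' _ _; simp [ok_npow]
  · intro j hj s' hs' ⟨g9, g10⟩
    have e6 : s'.v 6 = I.n := by rw [hs'.v 6 (by simp [Cmd.mods])]; simp [h6]
    have e7 : s'.v 7 = I.maxAbs := by rw [hs'.v 7 (by simp [Cmd.mods])]; simp [h7]
    have e9 := ev_npow (x := memOfList I.encode) (v := s'.v) (W := s'.W) (e := var 9) (q := j)
      (by simp [g9]) k
    rw [I.lt_probe_iff hj]
    simp only [ev_mul, ev_ltb, ev_sub, ev_add, ev_var, ev_one, e6, e7, g10, e9, Nat.cast_lt]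
    by_cases g : j ^ k < I.n
    · simp only [g, if_true, one_mul, true_and]
      omega
    · simp [g]
  · intro j hj s' hs' ⟨g9, g10⟩
    have := I.two_pow_le (k := k) (j := j + 1) hj
    refine Tri.set_seq (τ := 1) (2 ^ (j + 1) : ℕ) (by simp) ?_ (I.natAbs_natCast_lt (by omega))
      (Tri.set (a := (j + 1 : ℕ)) (by simp) ?_ (I.natAbs_natCast_lt (by omega)) ?_)
    · simp [g10, pow_succ]; ring
    · simp [g9]
    · simp

theorem tri_pre (hk : 0 < k) :
    Tri (I.env c) (pre k c) ⟨0, 0, 0⟩ (19 * I.n + 4 * I.reps k + 60)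
      fun s' => I.Vars k c s'.v ∧ s'.v 0 = 0 := by
  have hn := I.n_pos
  have hp := I.probe_le hk
  have hp0 := I.probe_pos hk
  have hr := I.reps_le hk
  obtain ⟨hb1, hb2, hb3, hb4, hb5⟩ := I.big_bounds (c := c)
  have hnp : I.n * I.probe k ≤ I.n * I.n := Nat.mul_le_mul_left _ hp
  have hnp0 : 0 < I.n * I.probe k := Nat.mul_pos hn hp0
  obtain ⟨T₁, hT₁⟩ : ∃ T, T = 14 * I.n + 20 := ⟨_, rfl⟩
  obtain ⟨T₂, hT₂⟩ : ∃ T, T = 4 * I.n + 5 := ⟨_, rfl⟩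
  obtain ⟨T₄, hT₄⟩ : ∃ T, T = 4 * I.reps k + 5 := ⟨_, rfl⟩
  refine Tri.mono (τ₁ := T₁ + (T₂ + ((T₄ + 5 + 1) + 2 + 2) + 1) + 1)
    (Q' := fun s' => I.Vars k c s'.v ∧ s'.v 0 = 0) ?_ (by omega) fun _ _ h => h
  refine Tri.seq (I.tri_preSide.mono hT₁.ge fun _ _ h => h) fun s₂ hs₂ ⟨h7, h6, h0, h8⟩ => ?_
  refine Tri.seq ((I.tri_preProbe hk h6 h7).mono hT₂.ge fun _ _ h => h) fun s₃ hs₃ h9 => ?_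
  have m3 : ∀ j, j ≠ 9 → j ≠ 10 → s₃.v j = s₂.v j := fun j a1 a2 =>
    hs₃.v j (by simp [preProbe, Cmd.mods, a1, a2])
  rw [← m3 8 (by norm_num) (by norm_num)] at h8
  rw [← m3 7 (by norm_num) (by norm_num)] at h7
  rw [← m3 6 (by norm_num) (by norm_num)] at h6
  rw [← m3 0 (by norm_num) (by norm_num)] at h0
  have e9 := ev_npow (x := memOfList I.encode) (v := s₃.v) (W := s₃.W) (e := var 9)
    (q := I.probe k) (by simp [h9]) k
  refine Tri.set_seq (I.num k) (by simp [ok_npow]) ?_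
    (I.natAbs_natCast_lt (by unfold num; split_ifs <;> omega)) ?_
  · simp only [ev_ltb, ev_var, h6, e9, Nat.cast_lt]
    unfold num Large
    by_cases g : I.n ≤ I.probe k ^ k
    · simp [g]
    · simp [g, not_le.1 g]
  refine Tri.set_seq (I.n * I.probe k : ℕ) (by simp) (by simp [h6, h9])
    (I.natAbs_natCast_lt (by omega)) ?_
  refine Tri.seq (τ₂ := 5) ((Tri.size (m := I.n * I.probe k) (by norm_num) (by norm_num)
    (by norm_num) (by simp) (I.size_lt_bits hnp0 (by omega))).mono hT₄.ge fun _ _ h => h)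
    fun s₄ hs₄ h2 => ?_
  have m4 : ∀ j, j ≠ 2 → j ≠ 14 → j ≠ 13 → j ≠ 1 → s₄.v j = s₃.v j := by
    intro j a1 a2 a3 a4
    rw [hs₄.v j (by simp [Cmd.size, Cmd.mods, a1, a2])]; simp [a3, a4]
  have h1' : s₄.v 1 = I.num k := by
    rw [hs₄.v 1 (by simp [Cmd.size, Cmd.mods])]; simp
  rw [← m4 8 (by norm_num) (by norm_num) (by norm_num) (by norm_num)] at h8
  rw [← m4 7 (by norm_num) (by norm_num) (by norm_num) (by norm_num)] at h7
  rw [← m4 6 (by norm_num) (by norm_num) (by norm_num) (by norm_num)] at h6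
  rw [← m4 0 (by norm_num) (by norm_num) (by norm_num) (by norm_num)] at h0
  have h2' : s₄.v 2 = I.reps k := h2
  clear h2
  refine Tri.set_seq (3 * I.n + 1 : ℕ) (by simp) (by simp [h6]) (I.natAbs_natCast_lt (by omega)) ?_
  refine Tri.set_seq (I.modulus k) (by simp) (by simp [h2', modulus])
    (I.natAbs_natCast_lt (by unfold modulus; omega)) ?_
  refine Tri.set (a := I.unit c) (by simp) (by simp [h7, unit])
    (I.natAbs_natCast_lt (by omega)) ?_
  refine ⟨⟨?_, ?_, ?_, ?_, ?_, ?_, ?_⟩, ?_⟩ <;> simp [h0, h6, h1', h2', h8]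

theorem pureIn_pre : (pre k c).pureIn = true := by
  simp [pre, preSide, preProbe, Cmd.pureIn, Cmd.size, Cmd.loop, Expr.maxAbs, Expr.pureIn, Expr.ltb,
    pureIn_npow (e := var 9) rfl]

end

end KSumInst

/-! ### The direct search and the generation of the graph, as programs -/

namespace KSumInst

/-- The direct solution for long numbers. -/
def direct : Cmd :=
  .ite (var 1) .skip <| .seq (.loop 20 (var 6) (.stW (inp (1 + var 20)) 1)) <|
    .loop 20 (var 6 * var 6) (.set 0 (.ite (wrk (0 - (inp (1 + var 6 + var 20 / var 6) +
      inp (1 + 2 * var 6 + mod (var 20) (var 6))))) 1 (var 0)))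

/-- Whether the pair of nodes in question is an arc. -/
def arcExpr (u v : Expr) : Expr :=
  eqb (mod (u / var 8) 2) 0 * eqb (v / var 8) (u / var 8 + 1) *
    ltb (mod u (var 8) * var 8 + mod v (var 8)) (var 6)

/-- The weight of an arc. -/
def valExpr (u v : Expr) : Expr :=
  inp (1 + (u / var 8 / 2 * var 6 + (mod u (var 8) * var 8 + mod v (var 8)))) +
    .ite (eqb (u / var 8 / 2) 0) 0 (.ite (eqb (u / var 8 / 2) 1) 1 3) * var 7

def order : Expr := 6 * var 8

def adjExpr : Expr :=
  .ite (arcExpr (var 20 / order) (mod (var 20) order)) 1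
    (.ite (arcExpr (mod (var 20) order) (var 20 / order)) 1 0)

def wtExpr : Expr :=
  .ite (arcExpr (var 20 / order) (mod (var 20) order)) (valExpr (var 20 / order) (mod (var 20) order))
    (.ite (arcExpr (mod (var 20) order) (var 20 / order))
      (valExpr (mod (var 20) order) (var 20 / order)) 0)

/-- The program that writes the graph. -/
def graphGen : Cmd :=
  .seq (.stO 0 order) <| .seq (.stO 1 (4 * var 7)) <|
  .seq (.loop 20 (order * order) (.stO (2 + var 20) adjExpr)) <|
  .loop 20 (order * order) (.stO (2 + order * order + var 20) wtExpr)

section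
variable (k c : ℕ) (I : KSumInst 3)

/-- The arcs, between nodes of consecutive blocks. -/
def Arc (u v : ℕ) : Prop :=
  u / I.side % 2 = 0 ∧ v / I.side = u / I.side + 1 ∧ u % I.side * I.side + v % I.side < I.n

def arcVal (u v : ℕ) : ℤ :=
  I.get (u / I.side / 2) (u % I.side * I.side + v % I.side) +
    WeightedGraphInst.tag (u / I.side / 2) * I.unit c

/-- Three bipartite graphs whose edges stand for the integers of the lists. -/
noncomputable def graph : WeightedGraphInst :=
  .ofArcs (6 * I.side) (Nat.mul_pos (by norm_num) I.side_pos) I.Arc (I.arcVal c) (4 * I.unit c)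
    fun u v h h' => by unfold Arc at h h'; omega

variable {k c}

section
variable {v : ℕ → ℤ} {W : ℤ → ℤ} {eu ew : Expr} {u w : ℕ}

open Classical in
theorem ev_arcExpr (h6 : v 6 = I.n) (h8 : v 8 = I.side)
    (hu : eu.ev (memOfList I.encode) v W = u) (hw : ew.ev (memOfList I.encode) v W = w) :
    (arcExpr eu ew).ev (memOfList I.encode) v W = if I.Arc u w then 1 else 0 := by
  simp only [arcExpr, ev_mul, ev_eqb, ev_ltb, ev_mod, ev_div, ev_add, ev_var, ev_ofNat, ev_zero,
    ev_one, hu, hw, h6, h8]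
  have c1 : ((u : ℤ) / I.side % 2 = 0) = (u / I.side % 2 = 0) := by
    rw [eq_iff_iff]; exact_mod_cast Iff.rfl
  have c2 : ((w : ℤ) / I.side = u / I.side + 1) = (w / I.side = u / I.side + 1) := by
    rw [eq_iff_iff]; exact_mod_cast Iff.rfl
  have c3 : ((u : ℤ) % I.side * I.side + w % I.side < I.n) =
      (u % I.side * I.side + w % I.side < I.n) := by
    rw [eq_iff_iff]; exact_mod_cast Iff.rfl
  simp only [c1, c2, c3]
  unfold Arc
  by_cases g1 : u / I.side % 2 = 0 <;> by_cases g2 : w / I.side = u / I.side + 1 <;>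
    by_cases g3 : u % I.side * I.side + w % I.side < I.n <;> simp [g1, g2, g3]

theorem ev_valExpr (h6 : v 6 = I.n) (h7 : v 7 = I.unit c) (h8 : v 8 = I.side)
    (hu : eu.ev (memOfList I.encode) v W = u) (hw : ew.ev (memOfList I.encode) v W = w)
    (hok : eu.ok I.encode.length (memOfList I.encode) v W)
    (hok' : ew.ok I.encode.length (memOfList I.encode) v W) (hlt : u < 6 * I.side)
    (h : I.Arc u w) : (valExpr eu ew).ok I.encode.length (memOfList I.encode) v W ∧
      (valExpr eu ew).ev (memOfList I.encode) v W = I.arcVal c u w := by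
  have h0 : u / I.side < 6 := Nat.div_lt_of_lt_mul (by rw [mul_comm]; exact hlt)
  have h1 : u / I.side / 2 < 3 := by omega
  have e1 : (1 : ℤ) + ((u : ℤ) / I.side / 2 * I.n + ((u : ℤ) % I.side * I.side + w % I.side)) =
      1 + (((u / I.side / 2 : ℕ) : ℤ) * I.n + (u % I.side * I.side + w % I.side : ℕ)) := by
    push_cast; rfl
  have e2 := I.memOfList_encode_get h1 h.2.2
  have e3 := Nat.digit_lt h1 h.2.2
  have e4 : (((u / I.side / 2 * I.n + (u % I.side * I.side + w % I.side) : ℕ)) : ℤ) <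
    (3 * I.n : ℕ) := by exact_mod_cast e3
  rw [Nat.cast_add, Nat.cast_mul] at e4
  rw [I.length_encode] at *
  constructor
  · simp only [valExpr, ok_add, ok_inp, ok_ite, ok_eqb, ok_mul, ok_var, ok_div, ok_mod, ok_ofNat,
      ok_one, ok_zero, ev_add, ev_mul, ev_div, ev_mod, ev_one, ev_var, ev_ofNat, hu, hw,
      h6, h8, e1, and_true, true_and, implies_true]
    refine ⟨⟨⟨hok, hok, hok'⟩, by positivity, ?_⟩, hok, fun _ => hok⟩
    push_cast at e4 ⊢
    linarith
  · simp only [valExpr, ev_ite, ev_eqb, ev_inp, ev_add, ev_mul, ev_div, ev_mod, ev_one, ev_var,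
      ev_ofNat, ev_zero, hu, hw, h6, h7, h8, e1, e2]
    unfold arcVal WeightedGraphInst.tag
    have d0 : ((u : ℤ) / I.side / 2 = 0) = (u / I.side / 2 = 0) := by
      rw [eq_iff_iff]; exact_mod_cast Iff.rfl
    have d1 : ((u : ℤ) / I.side / 2 = 1) = (u / I.side / 2 = 1) := by
      rw [eq_iff_iff]; exact_mod_cast Iff.rfl
    simp only [d0, d1]
    generalize u / I.side / 2 = g
    by_cases g0 : g = 0
    · simp [g0]
    by_cases g1 : g = 1 <;> simp [g0, g1]

theorem ok_arcExpr {x l} (hu : eu.ok l x v W) (hw : ew.ok l x v W) :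
    (arcExpr eu ew).ok l x v W := by
  simp [arcExpr, hu, hw]

end

open Classical in
theorem generates_graph :
    Generates (I.env c) (I.Vars k c) graphGen 0 (I.graph c).encode (1152 * I.n + 20) := by
  intro v hv h5 _
  obtain ⟨h1, h2, h3, h4, h6, h7, h8⟩ := id hv
  have hn := I.n_pos
  have hs := I.side_sq_le
  obtain ⟨hb1, hb2, hb3, hb4, hb5⟩ := I.big_bounds (c := c)
  set N := 6 * I.side * (6 * I.side) with hN
  -- Two matrices with `36 * side ^ 2 ≤ 144 * n` entries each, at four operations per entry, account
  -- for `1152 * n`.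
  have hN' : N = 36 * (I.side * I.side) := by ring
  obtain ⟨T₂, hT₂⟩ : ∃ T, T = N * 4 + 3 := ⟨_, rfl⟩
  refine Tri.mono (τ₁ := 1 + (1 + (T₂ + T₂ + 1) + 1) + 1)
    (Q' := fun s' => s'.O = memOfList (I.graph c).encode) ?_ (by omega) fun s' hs hO =>
      ⟨?_, ?_, hO⟩
  · refine Tri.seq (Q' := fun s₁ => s₁.O = Function.update (0 : ℤ → ℤ) 0 ((6 * I.side : ℕ) : ℤ))
      (Tri.stO (by simp) (by simp [order]) (by simp [order, h8])) fun s₁ hs₁ hO₁ => ?_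
    have hv₁ : s₁.v = v := funext fun j => hs₁.v j (by simp [Cmd.mods])
    refine Tri.seq (Q' := fun s₂ => s₂.O = Function.update (Function.update (0 : ℤ → ℤ) 0
      ((6 * I.side : ℕ) : ℤ)) 1 (4 * I.unit c : ℤ)) (Tri.stO (by simp) (by simp)
      (by simp [hv₁, h7, hO₁])) fun s₂ hs₂ hO₂ => ?_
    have hv₂ : s₂.v = v := (funext fun j => hs₂.v j (by simp [Cmd.mods])).trans hv₁
    have hlt : N < 2 ^ (I.env c).b := I.lt_two_pow_bits (by omega)
    set J := I.graph c with hJ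
    have hJn : J.n = 6 * I.side := rfl
    have hcount : ∀ (w : ℕ → ℤ) (W : ℤ → ℤ) (x : ℤ → ℤ), w 8 = I.side →
        (order * order).ev x w W = (N : ℕ) := fun w W x h => by
      simp [order, h, hN]
    have hrow : ∀ m < N, m / (6 * I.side) < 6 * I.side := fun m hm => Nat.div_lt_of_lt_mul hm
    have hcol : ∀ m, m % (6 * I.side) < 6 * I.side := fun m =>
      Nat.mod_lt _ (Nat.mul_pos (by norm_num) I.side_pos)
    refine Tri.seq ((Tri.tabO 2 N (fun m => if J.adj (m / J.n) (m % J.n)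
      then (1 : ℤ) else 0) hlt ?_ ?_ ?_).mono hT₂.ge fun _ _ h => h) fun s₃ hs₃ hO₃ => ?_
    · intro m _
      exact ⟨by simp [order], hcount _ _ _ (by simp [hv₂, h8])⟩
    · intro m _; simp
    · intro m hm
      refine ⟨by simp [adjExpr, order, ok_arcExpr], ?_⟩
      have hA : J.adj (m / J.n) (m % J.n) ↔ _ := WeightedGraphInst.adj_ofArcs
      rw [hJn] at hA ⊢
      have eu : (var 20 / order).ev (memOfList I.encode) (Function.update s₂.v 20 (m : ℤ)) s₂.W =
        (m / (6 * I.side) : ℕ) := by simp [order, hv₂, h8]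
      have ew : (mod (var 20) order).ev (memOfList I.encode) (Function.update s₂.v 20 (m : ℤ))
        s₂.W = (m % (6 * I.side) : ℕ) := by simp [order, hv₂, h8]
      rw [adjExpr, ev_ite, ev_ite, I.ev_arcExpr (by simp [hv₂, h6]) (by simp [hv₂, h8]) eu ew,
        I.ev_arcExpr (by simp [hv₂, h6]) (by simp [hv₂, h8]) ew eu, ev_one, ev_zero]
      have r1 := hrow m hm
      have r2 := hcol m
      generalize m / (6 * I.side) = u at *
      generalize m % (6 * I.side) = w at *
      by_cases g1 : I.Arc u w <;> by_cases g2 : I.Arc w u <;> simp only [g1, g2, if_true,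
        if_false, one_pos, lt_irrefl] <;> simp [hA, r1, r2, g1, g2]
    have hm₃ : ∀ j, j ≠ 20 → s₃.v j = v j := fun j hj => by
      rw [hs₃.v j (by simp [Cmd.loop, Cmd.mods, hj]), hv₂]
    refine (Tri.tabO (2 + J.n * J.n) N (fun m => J.wt (m / J.n) (m % J.n))
      hlt ?_ ?_ ?_).mono hT₂.ge fun s₄ _ hO₄ => ?_
    · intro m _
      exact ⟨by simp [order], hcount _ _ _ (by simp [hm₃, h8])⟩
    · intro m _
      refine ⟨by simp [order], ?_⟩
      rw [ev_add, ev_add, hcount _ _ _ (by simp [hm₃, h8]), hJn]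
      simp [hN]
    · intro m hm
      have hA : J.wt (m / J.n) (m % J.n) = _ := WeightedGraphInst.wt_ofArcs (hrow m hm) (hcol m)
      rw [hA, hJn]
      have r1 := hrow m hm
      have r2 := hcol m
      set w := Function.update s₃.v 20 (m : ℤ) with hw
      have w6 : w 6 = I.n := by simp [hw, hm₃, h6]
      have w7 : w 7 = I.unit c := by simp [hw, hm₃, h7]
      have w8 : w 8 = I.side := by simp [hw, hm₃, h8]
      have eu : (var 20 / order).ev (memOfList I.encode) w s₃.W = (m / (6 * I.side) : ℕ) := by
        simp [order, w8]; simp [hw]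
      have ew : (mod (var 20) order).ev (memOfList I.encode) w s₃.W =
          (m % (6 * I.side) : ℕ) := by
        simp [order, w8]; simp [hw]
      have ou : (var 20 / order).ok I.encode.length (memOfList I.encode) w s₃.W := by simp [order]
      have ow : (mod (var 20) order).ok I.encode.length (memOfList I.encode) w s₃.W := by
        simp [order]
      have A1 := I.ev_arcExpr w6 w8 eu ew
      have A2 := I.ev_arcExpr w6 w8 ew eu
      have S1 := I.ev_valExpr w6 w7 w8 eu ew ou ow r1
      have S2 := I.ev_valExpr w6 w7 w8 ew eu ow ou r2
      simp only [wtExpr, ok_ite, ev_ite, ok_arcExpr ou ow, ok_arcExpr ow ou, A1, A2, ok_zero,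
        ev_zero, true_and, implies_true, and_true]
      generalize m / (6 * I.side) = u at *
      generalize m % (6 * I.side) = x at *
      by_cases g1 : I.Arc u x <;> by_cases g2 : I.Arc x u <;> simp only [g1, g2, if_true,
        if_false, one_pos, lt_irrefl, forall_true_left, false_imp_iff, true_and, and_true,
        not_true_eq_false, not_false_eq_true]
      · exact S1 g1
      · exact S1 g1
      · exact S2 g2
    · rw [hO₄, hO₃, hO₂, WeightedGraphInst.memOfList_encode]; rfl
  · have hj : ∀ j, j ≤ 10 → s'.v j = v j := fun j hj =>
      hs.v j (by simp [graphGen, Cmd.mods, Cmd.loop]; omega)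
    unfold Vars
    simp only [hj 1 (by norm_num), hj 2 (by norm_num), hj 3 (by norm_num), hj 4 (by norm_num),
      hj 6 (by norm_num), hj 7 (by norm_num), hj 8 (by norm_num)]
    exact hv
  · exact fun j hj => hs.v j (by simp [graphGen, Cmd.mods, Cmd.loop]; omega)

open Classical in
-- Indirect addressing serves as a perfect hash table: the numbers of the first list mark cells of
-- the working memory, and for each pair from the other two lists the cell at the negated sum is
-- inspected.
theorem tri_direct {v : ℕ → ℤ} (hv : I.Vars k c v) (h0 : v 0 = 0) :
    Tri (I.env c) direct ⟨v, 0, 0⟩ (if I.Large k then 4 * (I.n * I.n) + 4 * I.n + 8 else 2)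
      fun s' => I.Vars k c s'.v ∧ (0 < s'.v 0 ↔ I.Large k ∧ I.HasZeroSum) := by
  obtain ⟨h1, h2, h3, h4, h6, h7, h8⟩ := id hv
  obtain ⟨hb1, hb2, hb3, hb4, hb5⟩ := I.big_bounds (c := c)
  have l₀ : 1 < 2 ^ (I.env c).b := I.lt_two_pow_bits (by omega)
  have l₁ : I.n < 2 ^ (I.env c).b := I.lt_two_pow_bits (by omega)
  have l₂ : I.n * I.n < 2 ^ (I.env c).b := I.lt_two_pow_bits (by omega)
  by_cases hL : I.Large k
  swap
  · rw [if_neg hL]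
    have h1' : v 1 = 1 := by rw [h1, num, if_neg hL]; rfl
    refine Tri.ite (τ := 1) (by simp) (fun _ => Tri.skip ⟨hv, by simp [h0, hL]⟩) fun h => ?_
    exact absurd (by simp [h1']) h
  rw [if_pos hL]
  have h1' : v 1 = 0 := by rw [h1, num, if_pos hL]; rfl
  obtain ⟨T₁, hT₁⟩ : ∃ T, T = I.n * 4 + 3 := ⟨_, rfl⟩
  obtain ⟨T₂, hT₂⟩ : ∃ T, T = I.n * I.n * 4 + 3 := ⟨_, rfl⟩
  refine Tri.mono (τ₁ := (T₁ + T₂ + 1) + 1) (Q' := fun s' => (0 < s'.v 0 ↔ I.HasZeroSum))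
    ?_ (by omega) fun s' hs h => ⟨?_, by rw [h]; simp [hL]⟩
  · refine Tri.ite (by simp) (fun h => absurd h (by simp [h1'])) fun _ => ?_
    have hx : ∀ i j : ℕ, i < 3 → j < I.n → memOfList I.encode (1 + i * I.n + j) = I.get i j := by
      intro i j hi hj
      rw [← I.memOfList_encode_get hi hj, add_assoc]
    refine Tri.seq ((Tri.loop (τ := 1) (fun j s' => s'.W = fun a => if ∃ i : ℕ, i < j ∧ I.get 0 i = a
      then 1 else 0) I.n l₁ ?_ (by simp [Cmd.mods]) ?_ ?_).mono hT₁.ge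
      fun _ _ h => h.1) fun s₁ hs₁ hW => ?_
    · funext a; simp
    · intro j _ s' hs' _ _
      have : s'.v 6 = I.n := (hs'.v 6 (by simp [Cmd.loop, Cmd.mods])).trans h6
      simp [this]
    · intro j hj s' hs' hW h20
      refine Tri.stW ?_ (by simp) (by simpa using l₀) ?_
      · simp [h20, I.length_encode]; omega
      · have e : memOfList I.encode (1 + j) = I.get 0 j := by
          have := hx 0 j (by norm_num) hj
          simpa using this
        simp only [ev_inp, ev_add, ev_one, ev_var, h20, e]
        rw [hW]
        funext a
        by_cases ha : a = I.get 0 j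
        · subst ha
          rw [Function.update_self, if_pos ⟨j, by omega, rfl⟩]
        · rw [Function.update_of_ne ha]
          refine if_congr ⟨fun ⟨i, hi, h⟩ => ⟨i, by omega, h⟩, fun ⟨i, hi, h⟩ => ⟨i, ?_, h⟩⟩ rfl rfl
          refine lt_of_le_of_ne (by omega) ?_
          rintro rfl
          exact ha h.symm
    have m₁ : ∀ j, j ≠ 20 → s₁.v j = v j := fun j hj =>
      hs₁.v j (by simp [Cmd.loop, Cmd.mods, hj])
    set P : ℕ → Prop := fun m => ∃ i < I.n,
      I.get 0 i + I.get 1 (m / I.n) + I.get 2 (m % I.n) = 0 with hP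
    refine (Tri.accum (by norm_num) (I.n * I.n) (fun j => if ∃ m < j, P m then 1 else 0)
      l₂ (by simp [m₁, h0]) ?_ ?_ ?_).mono hT₂.ge fun s₂ hs₂ h => ?_
    · intro m _; simp [m₁, h6]
    · intro m hm
      have d1 : m / I.n < I.n := Nat.div_lt_of_lt_mul hm
      have d2 := Nat.mod_lt m I.n_pos
      have x1 := hx 1 _ (by norm_num) d1
      have x2 := hx 2 _ (by norm_num) d2
      have e1 : (m : ℤ) / I.n = (m / I.n : ℕ) := by push_cast; rfl
      have e2 : (m : ℤ) % I.n = (m % I.n : ℕ) := by push_cast; rfl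
      rw [Nat.cast_one, one_mul] at x1
      rw [Nat.cast_ofNat] at x2
      constructor
      · simp only [ok_ite, ok_wrk, ok_sub, ok_zero, ok_add, ok_inp, ok_one, ok_var, ok_div, ok_mul,
          ok_ofNat, ok_mod, ev_add, ev_one, ev_var, ev_div, ev_mul, ev_ofNat, ev_mod,
          Function.update_self, ne_eq, not_false_eq_true, Function.update_of_ne,
          Nat.reduceEqDiff, OfNat.ofNat_ne_zero, m₁, h6, e1, e2, I.length_encode, true_and, and_true, implies_true]
        generalize m / I.n = y at *
        generalize m % I.n = z at *
        omega
      · simp only [ev_ite, ev_wrk, ev_sub, ev_zero, ev_inp, ev_add, ev_one, ev_var, ev_div, ev_mul,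
          ev_ofNat, ev_mod, Function.update_self, ne_eq, not_false_eq_true,
          Function.update_of_ne, Nat.reduceEqDiff, OfNat.ofNat_ne_zero, m₁, h6, e1, e2, x1, x2, hW]
        have key : (∃ i < I.n, I.get 0 i = 0 - (I.get 1 (m / I.n) + I.get 2 (m % I.n))) ↔ P m :=
          ⟨fun ⟨i, hi, h⟩ => ⟨i, hi, by omega⟩, fun ⟨i, hi, h⟩ => ⟨i, hi, by omega⟩⟩
        simp only [key]
        by_cases g : P m
        · simp only [g, if_true, one_pos]
          rw [if_pos ⟨m, by omega, g⟩]
        · simp only [g, if_false, lt_irrefl]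
          refine if_congr ⟨fun ⟨i, hi, h⟩ => ⟨i, by omega, h⟩, fun ⟨i, hi, h⟩ => ⟨i, ?_, h⟩⟩ rfl rfl
          refine lt_of_le_of_ne (by omega) ?_
          rintro rfl
          exact g h
    · intro m _
      split_ifs
      · simpa using l₀
      · simp
    · rw [h, I.hasZeroSum_iff]
      have : (∃ m < I.n * I.n, P m) ↔
          ∃ a < I.n, ∃ b < I.n, ∃ c < I.n, I.get 0 a + I.get 1 b + I.get 2 c = 0 := by
        constructor
        · rintro ⟨m, hm, i, hi, h⟩
          exact ⟨i, hi, _, Nat.div_lt_of_lt_mul hm, _, Nat.mod_lt m I.n_pos, h⟩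
        · rintro ⟨a, ha, b, hb, c, hc, h⟩
          exact ⟨b * I.n + c, Nat.digit_lt hb hc, a, ha, by
            rw [Nat.digit_div hc, Nat.digit_mod hc]; exact h⟩
      rw [← this]
      split_ifs with g <;> simp [g]
  · have hj : ∀ j, j ≠ 0 → j ≠ 20 → s'.v j = v j := fun j a1 a2 =>
      hs.v j (by simp [direct, Cmd.mods, Cmd.loop, a1, a2])
    unfold Vars
    simp only [hj 1 (by norm_num) (by norm_num), hj 2 (by norm_num) (by norm_num),
      hj 3 (by norm_num) (by norm_num), hj 4 (by norm_num) (by norm_num),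
      hj 6 (by norm_num) (by norm_num), hj 7 (by norm_num) (by norm_num),
      hj 8 (by norm_num) (by norm_num)]
    exact hv

end

end KSumInst

/-! ### Correctness and size of the graph for `3`-SUM -/

namespace KSumInst

section
variable (I : KSumInst 3) {c : ℕ}

theorem adj_graph {u v : ℕ} : (I.graph c).adj u v ↔
    u < 6 * I.side ∧ v < 6 * I.side ∧ (I.Arc u v ∨ I.Arc v u) :=
  WeightedGraphInst.adj_ofArcs

theorem wt_graph {u v : ℕ} (hu : u < 6 * I.side) (hv : v < 6 * I.side) (h : I.Arc u v) :
    (I.graph c).wt u v = I.arcVal c u v := by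
  classical
  have e : (I.graph c).wt u v = _ := WeightedGraphInst.wt_ofArcs hu hv
  rw [e, if_pos h]

theorem exists_get_of_adj {u v : ℕ} (h : (I.graph c).adj u v) : ∃ g < 3, ∃ j < I.n,
    (I.graph c).wt u v = I.get g j + WeightedGraphInst.tag g * I.unit c := by
  wlog ha : I.Arc u v generalizing u v
  · rw [WeightedGraphInst.wt_comm]
    refine this ((WeightedGraphInst.adj_comm _ _ _).1 h) ?_
    have := I.adj_graph.1 h
    tauto
  obtain ⟨hu, hv, -⟩ := I.adj_graph.1 h
  have h0 : u / I.side < 6 := Nat.div_lt_of_lt_mul (by rw [mul_comm]; exact hu)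
  exact ⟨_, by omega, _, ha.2.2, I.wt_graph hu hv ha⟩

/-- The index of a number, written to base `side`, gives the row and the column of its edge in the
bipartite graph of its list. -/
theorem adj_of_lt {g j : ℕ} (hg : g < 3) (hj : j < I.n) :
    (I.graph c).adj (2 * g * I.side + j / I.side) ((2 * g + 1) * I.side + j % I.side) ∧
    (I.graph c).wt (2 * g * I.side + j / I.side) ((2 * g + 1) * I.side + j % I.side) =
      I.get g j + WeightedGraphInst.tag g * I.unit c := by
  have d : j / I.side < I.side := Nat.div_lt_of_lt_mul (hj.trans_le I.le_side)
  have m : j % I.side < I.side := Nat.mod_lt _ I.side_pos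
  have hu := Nat.digit_lt (show 2 * g < 6 by omega) d
  have hv := Nat.digit_lt (show 2 * g + 1 < 6 by omega) m
  have ha : I.Arc (2 * g * I.side + j / I.side) ((2 * g + 1) * I.side + j % I.side) := by
    refine ⟨by rw [Nat.digit_div d]; omega, by rw [Nat.digit_div d, Nat.digit_div m], ?_⟩
    rw [Nat.digit_mod d, Nat.digit_mod m, Nat.div_add_mod']
    exact hj
  refine ⟨I.adj_graph.2 ⟨hu, hv, .inl ha⟩, ?_⟩
  rw [I.wt_graph hu hv ha, arcVal, Nat.digit_div d, Nat.digit_mod d, Nat.digit_mod m,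
    Nat.div_add_mod', Nat.mul_div_cancel_left _ two_pos]

/-- Three numbers together are less than one `unit`, so the tags have to sum to 4, which forces one
number from each list. -/
theorem hasZeroSum_of_tags (hc : 100 ≤ c) {g₀ g₁ g₂ j₀ j₁ j₂ : ℕ} (h0 : g₀ < 3) (h1 : g₁ < 3)
    (h2 : g₂ < 3) (l0 : j₀ < I.n) (l1 : j₁ < I.n) (l2 : j₂ < I.n)
    (h : (I.get g₀ j₀ + WeightedGraphInst.tag g₀ * I.unit c) +
      (I.get g₁ j₁ + WeightedGraphInst.tag g₁ * I.unit c) +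
      (I.get g₂ j₂ + WeightedGraphInst.tag g₂ * I.unit c) = 4 * I.unit c) : I.HasZeroSum := by
  have hM := I.one_le_maxAbs
  have hU : 100 * I.maxAbs ≤ I.unit c := Nat.mul_le_mul_right _ hc
  have hU' : (100 : ℤ) * I.maxAbs ≤ I.unit c := by exact_mod_cast hU
  have m0 := I.natAbs_get_le g₀ j₀
  have m1 := I.natAbs_get_le g₁ j₁
  have m2 := I.natAbs_get_le g₂ j₂
  have key : ((WeightedGraphInst.tag g₀ : ℤ) + WeightedGraphInst.tag g₁ +
      WeightedGraphInst.tag g₂ - 4) * (I.unit c : ℤ) =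
      -(I.get g₀ j₀ + I.get g₁ j₁ + I.get g₂ j₂) := by linarith
  have hsum : WeightedGraphInst.tag g₀ + WeightedGraphInst.tag g₁ + WeightedGraphInst.tag g₂ =
      4 := by
    rcases lt_trichotomy ((WeightedGraphInst.tag g₀ : ℤ) + WeightedGraphInst.tag g₁ +
      WeightedGraphInst.tag g₂ - 4) 0 with h' | h' | h'
    · have : ((WeightedGraphInst.tag g₀ : ℤ) + WeightedGraphInst.tag g₁ +
          WeightedGraphInst.tag g₂ - 4) * (I.unit c : ℤ) ≤ -1 * I.unit c :=
        mul_le_mul_of_nonneg_right (by omega) (by positivity)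
      omega
    · omega
    · have : 1 * (I.unit c : ℤ) ≤ ((WeightedGraphInst.tag g₀ : ℤ) + WeightedGraphInst.tag g₁ +
          WeightedGraphInst.tag g₂ - 4) * (I.unit c : ℤ) :=
        mul_le_mul_of_nonneg_right (by omega) (by positivity)
      omega
  have e : (WeightedGraphInst.tag g₀ : ℤ) + WeightedGraphInst.tag g₁ + WeightedGraphInst.tag g₂ - 4
      = 0 := by omega
  rw [e, zero_mul] at key
  rw [hasZeroSum_iff]
  rcases WeightedGraphInst.tag_perm h0 h1 h2 hsum with ⟨rfl, rfl, rfl⟩ | ⟨rfl, rfl, rfl⟩ |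
      ⟨rfl, rfl, rfl⟩ | ⟨rfl, rfl, rfl⟩ | ⟨rfl, rfl, rfl⟩ | ⟨rfl, rfl, rfl⟩
  · exact ⟨j₀, l0, j₁, l1, j₂, l2, by omega⟩
  · exact ⟨j₀, l0, j₂, l2, j₁, l1, by omega⟩
  · exact ⟨j₁, l1, j₀, l0, j₂, l2, by omega⟩
  · exact ⟨j₂, l2, j₀, l0, j₁, l1, by omega⟩
  · exact ⟨j₁, l1, j₂, l2, j₀, l0, by omega⟩
  · exact ⟨j₂, l2, j₁, l1, j₀, l0, by omega⟩

/-- Numbers from different lists are edges between different blocks of nodes, so any choice of one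
number per list is a matching. Conversely, the tags alone determine the lists, and disjointness of
the edges plays no role. -/
theorem hasZeroSum_iff_graph (hc : 100 ≤ c) :
    I.HasZeroSum ↔ (I.graph c).HasExactCopy (kMatching 3) := by
  have hT : (I.graph c).target = 4 * I.unit c := rfl
  rw [WeightedGraphInst.hasExactCopy_matching_iff, hT]
  constructor
  · intro h
    rw [hasZeroSum_iff] at h
    obtain ⟨a, ha, b, hb, d, hd, h⟩ := h
    obtain ⟨A0, W0⟩ := I.adj_of_lt (c := c) (show 0 < 3 by norm_num) ha
    obtain ⟨A1, W1⟩ := I.adj_of_lt (c := c) (show 1 < 3 by norm_num) hb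
    obtain ⟨A2, W2⟩ := I.adj_of_lt (c := c) (show 2 < 3 by norm_num) hd
    refine ⟨_, _, _, _, _, _, ?_, A0, A1, A2, ?_⟩
    · refine List.Nodup.of_map (· / I.side) ?_
      have dv : ∀ j < I.n, j / I.side < I.side := fun j hj =>
        Nat.div_lt_of_lt_mul (hj.trans_le I.le_side)
      have md : ∀ j, j % I.side < I.side := fun j => Nat.mod_lt _ I.side_pos
      simp only [List.map_cons, List.map_nil, Nat.digit_div (dv a ha), Nat.digit_div (dv b hb),
        Nat.digit_div (dv d hd), Nat.digit_div (md _)]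
      decide
    · rw [W0, W1, W2]
      simp only [WeightedGraphInst.tag]
      push_cast
      linarith
  · rintro ⟨u₀, v₀, u₁, v₁, u₂, v₂, -, A0, A1, A2, h⟩
    obtain ⟨g₀, h0, j₀, l0, e0⟩ := I.exists_get_of_adj A0
    obtain ⟨g₁, h1, j₁, l1, e1⟩ := I.exists_get_of_adj A1
    obtain ⟨g₂, h2, j₂, l2, e2⟩ := I.exists_get_of_adj A2
    rw [e0, e1, e2] at h
    exact I.hasZeroSum_of_tags hc h0 h1 h2 l0 l1 l2 h

theorem graph_size (hc : 100 ≤ c) :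
    (I.unit c).size ≤ (exactWeight (kMatching 3)).size (I.graph c) ∧
      (exactWeight (kMatching 3)).size (I.graph c) ≤ 6 * I.side * ((4 * c).size + I.len) := by
  have hs := I.side_pos
  have hM := I.one_le_maxAbs
  have hU : 100 * I.maxAbs ≤ I.unit c := Nat.mul_le_mul_right _ hc
  have hT : (I.graph c).target = 4 * I.unit c := rfl
  constructor
  · have h1 := (I.graph c).natAbs_target_le
    rw [hT] at h1
    change _ ≤ 6 * I.side * _
    exact (Nat.size_le_size (by omega)).trans (Nat.le_mul_of_pos_left _ (by omega))
  · refine Nat.mul_le_mul_left _ ((Nat.size_le_size (n := 4 * c * I.maxAbs) ?_).trans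
      (Nat.size_mul_le _ _))
    have e : 4 * c * I.maxAbs = 4 * I.unit c := by unfold unit; ring
    rw [e]
    refine WeightedGraphInst.maxAbs_le _ (by omega) (by rw [hT]; omega) fun u v huv => ?_
    obtain ⟨g, hg, j, hj, h⟩ := I.exists_get_of_adj huv
    rw [h]
    have := I.natAbs_get_le g j
    have h3 : WeightedGraphInst.tag g * I.unit c ≤ 3 * I.unit c :=
      Nat.mul_le_mul_right _ (by unfold WeightedGraphInst.tag; split_ifs <;> norm_num)
    rw [← Nat.cast_mul]
    omega

end

end KSumInst

/-! ### Trading powers of one parameter for powers of the other -/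

namespace Dom

variable {ι : Type*} {n L : ι → ℕ} {α β δ : ℝ} {f : ι → ℕ}

open Classical in
-- Where `n ≤ L ^ k`, a factor `n ^ δ` may be replaced by `L ^ (k * δ)`.
theorem ite_le_pow (hn : ∀ i, 1 ≤ n i) (hL : ∀ i, 1 ≤ L i) (h : Dom n L (α + δ) β f) (hδ : 0 ≤ δ)
    (k : ℕ) : Dom n L α (β + k * δ) fun i => if n i ≤ L i ^ k then f i else 0 := by
  obtain ⟨C, h0, h⟩ := h
  refine ⟨C, h0, fun i => ?_⟩
  have h1 : (0 : ℝ) < n i := by exact_mod_cast hn i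
  have h2 : (0 : ℝ) < L i := by exact_mod_cast hL i
  dsimp only
  split_ifs with g
  · refine (h i).trans (mul_le_mul_of_nonneg_left ?_ h0)
    rw [Real.rpow_add h1, Real.rpow_add h2, Real.rpow_mul h2.le, Real.rpow_natCast]
    have g' : (n i : ℝ) ≤ (L i : ℝ) ^ k := by exact_mod_cast g
    have := Real.rpow_le_rpow h1.le g' hδ
    calc (n i : ℝ) ^ α * (n i : ℝ) ^ δ * (L i : ℝ) ^ β ≤
        (n i : ℝ) ^ α * ((L i : ℝ) ^ k) ^ δ * (L i : ℝ) ^ β := by gcongr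
      _ = _ := by ring
  · rw [Nat.cast_zero]; positivity

open Classical in
-- Where `L ^ k < n`, a factor `L ^ (k * δ)` may be replaced by `n ^ δ`.
theorem ite_pow_lt (hn : ∀ i, 1 ≤ n i) (hL : ∀ i, 1 ≤ L i) {k : ℕ} (hδ : 0 ≤ δ)
    (h : Dom n L α (β + k * δ) f) :
    Dom n L (α + δ) β fun i => if L i ^ k < n i then f i else 0 := by
  obtain ⟨C, h0, h⟩ := h
  refine ⟨C, h0, fun i => ?_⟩
  have h1 : (0 : ℝ) < n i := by exact_mod_cast hn i
  have h2 : (0 : ℝ) < L i := by exact_mod_cast hL i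
  dsimp only
  split_ifs with g
  · refine (h i).trans (mul_le_mul_of_nonneg_left ?_ h0)
    rw [Real.rpow_add h1, Real.rpow_add h2, Real.rpow_mul h2.le, Real.rpow_natCast]
    have g' : (L i : ℝ) ^ k ≤ (n i : ℝ) := by exact_mod_cast g.le
    have := Real.rpow_le_rpow (by positivity) g' hδ
    calc (n i : ℝ) ^ α * ((L i : ℝ) ^ β * ((L i : ℝ) ^ k) ^ δ) ≤
        (n i : ℝ) ^ α * ((L i : ℝ) ^ β * (n i : ℝ) ^ δ) := by gcongr
      _ = _ := by ring
  · rw [Nat.cast_zero]; positivity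

end Dom

/-! ### Time of the algorithm for `3`-SUM -/

namespace KSumInst

theorem dom_side : Dom (n (k := 3)) len (1 / 2) 0 side := by
  refine ⟨2, by norm_num, fun I => ?_⟩
  rw [Real.rpow_zero, mul_one, ← Real.sqrt_eq_rpow]
  have h : ((I.side : ℝ)) * I.side ≤ 4 * I.n := by exact_mod_cast I.side_sq_le
  have h2 : (I.side : ℝ) ≤ √(4 * I.n) := Real.le_sqrt_of_sq_le (by rw [sq]; exact h)
  rwa [Real.sqrt_mul (by norm_num), show √(4 : ℝ) = 2 by
    rw [show (4 : ℝ) = 2 ^ 2 by norm_num]; exact Real.sqrt_sq (by norm_num)] at h2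

theorem dom_reps {k : ℕ} (hk : 0 < k) {η : ℝ} (hη : 0 < η) :
    Dom (n (k := 3)) len η η (reps k) := by
  have hn : ∀ I : KSumInst 3, 1 ≤ I.n := n_pos
  have hL : ∀ I : KSumInst 3, 1 ≤ I.len := len_pos
  exact ((Dom.fst.mul hn hL Dom.fst).size hn hL hη).of_le fun I =>
    Nat.size_le_size (Nat.mul_le_mul_left _ (I.probe_le hk))

theorem dom_bits (c : ℕ) {η : ℝ} (hη : 0 < η) : Dom (n (k := 3)) len η (1 + η) (bits c) := by
  have hn : ∀ I : KSumInst 3, 1 ≤ I.n := n_pos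
  have hL : ∀ I : KSumInst 3, 1 ≤ I.len := len_pos
  have hc : ∀ k, Dom n len η (1 + η) fun _ : KSumInst 3 => k := fun k =>
    (Dom.const k).mono hn hL hη.le (by linarith)
  have h5 : Dom n len η (1 + η) fun I : KSumInst 3 => (I.n * I.n).size :=
    ((Dom.fst.mul hn hL Dom.fst).size hn hL hη).mono hn hL le_rfl (by linarith)
  have h6 : Dom (n (k := 3)) len η (1 + η) len := Dom.snd.mono hn hL hη.le (by linarith)
  refine (((hc (Nat.size 100000)).add h5).add (((hc ((c + 1).size)).add h6).add (hc 1))).of_le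
    fun I => ?_
  have e : I.big c = 100000 * (I.n * I.n + (c + 1) * I.maxAbs) := by unfold big unit; ring
  unfold bits
  rw [e]
  refine (Nat.size_mul_le _ _).trans ?_
  have h7 := Nat.size_add_le (I.n * I.n) ((c + 1) * I.maxAbs)
  have h8 := Nat.size_mul_le (c + 1) I.maxAbs
  change _ ≤ _ + _ + (_ + I.maxAbs.size + 1)
  omega

open Classical in
/-- The decision procedure for `3`-SUM by one for matchings. -/
theorem decidesWithin_driver (I : KSumInst 3) {k c T : ℕ} (hk : 0 < k) (hc : 100 ≤ c) {p : Prog}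
    (hp : DecidesWithin p (I.graph c).encode ((I.graph c).HasExactCopy (kMatching 3)) T 16⁻¹) :
    DecidesWithin (driver (pre k c) direct graphGen p) I.encode I.HasZeroSum
      (driverTime (pre k c) direct graphGen p (I.num k) (I.reps k) (I.bits c)
        (19 * I.n + 4 * I.reps k + 60)
        (if I.Large k then 4 * (I.n * I.n) + 4 * I.n + 8 else 2) (1152 * I.n + 20) T)
      ((I.n * I.len : ℕ) : ℝ≥0∞)⁻¹ := by
  obtain ⟨hb1, hb2, hb3, hb4, hb5⟩ := I.big_bounds (c := c)
  have hr := I.reps_le hk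
  have hnum : I.num k ≤ 1 := by unfold num; split_ifs <;> omega
  have hnr : I.num k * I.reps k ≤ I.reps k := (Nat.mul_le_mul_right _ hnum).trans_eq (one_mul _)
  have hK : I.modulus k = 3 * I.n + 1 + 2 * I.reps k + 3 := rfl
  have hlt : I.modulus k < 2 ^ I.bits c := I.lt_two_pow_bits (by omega)
  have hlt' : I.num k < 2 ^ I.bits c := I.lt_two_pow_bits (by omega)
  have P : Plan (pre k c) direct graphGen I.encode (fun _ => (I.graph c).encode)
      (I.Large k ∧ I.HasZeroSum) (I.num k) (I.reps k) (I.bits c) (19 * I.n + 4 * I.reps k + 60)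
      (if I.Large k then 4 * (I.n * I.n) + 4 * I.n + 8 else 2) (1152 * I.n + 20) :=
    { Pre := I.Vars k c
      K := I.modulus k
      J := (3 * I.n + 1 : ℕ)
      b_pos := Nat.size_pos.2 (by omega)
      inp := I.natAbs_inp_lt
      pureIn := pureIn_pre
      le_J := by rw [I.length_encode]
      J_lt := by exact_mod_cast (by omega : 3 * I.n + 1 + 2 + 2 * (I.num k * I.reps k) < I.modulus k)
      K_lt := by rw [Int.natAbs_natCast]; exact hlt
      Z_lt := hlt'
      pre_spec := fun v hv => ⟨hv.1, hv.2.1, hv.2.2.1, hv.2.2.2.1⟩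
      pre_update := by
        rintro v i a (rfl | rfl) hv <;> simpa [Vars] using hv
      pre_run := by
        obtain ⟨k', hk', s', hrun, hV, h0⟩ := I.tri_pre (c := c) hk
        exact ⟨k', hk', s', hrun, hV, h0⟩
      ini_run := fun v hv h0 _ => I.tri_direct hv h0
      gen_run := fun z hz => by
        obtain rfl : z = 0 := by omega
        exact I.generates_graph }
  have hs : 1 ≤ I.n * I.len := Nat.mul_pos I.n_pos I.len_pos
  have herr : I.num k * voteError (I.reps k) ≤ ((I.n * I.len : ℕ) : ℝ≥0∞)⁻¹ := by
    refine voteError_mul_le hs ?_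
    unfold num
    split_ifs with h
    · simp
    · rw [one_mul, ← I.probe_eq_of_not_large h]
      exact (Nat.lt_size_self _).le
  refine (P.decidesWithin (T := T) (p := p) (Y := fun _ => (I.graph c).HasExactCopy (kMatching 3))
    le_rfl (fun z _ => hp) (herr.trans ?_)).mono ?_ le_rfl herr
  · rw [ENNReal.inv_le_one]; exact_mod_cast hs
  · rw [← I.hasZeroSum_iff_graph hc]
    unfold num
    by_cases h : I.Large k <;> simp [h]

/-- The detour through matchings saves `n ^ (ε / 2)` but costs several powers of `len`; if `len ^ k
< n`, these are paid with a part of the saving. If `n ≤ len ^ k`, the direct search costs `n ^ 2`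
times about `len`, and the missing small power of `n` is paid with the slack in the exponent of
`len`. -/
theorem solvableInTime {ε : ℝ} (hε : 0 < ε) (hε1 : ε ≤ 1)
    (h : (exactWeight (kMatching 3)).SolvableInTime fun s => (s : ℝ) ^ (4 - ε)) :
    ∃ δ : ℝ, 0 < δ ∧ (kSum 3).SolvableInTime fun s => (s : ℝ) ^ (2 - δ) := by
  classical
  have hn : ∀ I : KSumInst 3, 1 ≤ I.n := n_pos
  have hL : ∀ I : KSumInst 3, 1 ≤ I.len := len_pos
  obtain ⟨k, hk⟩ := exists_nat_ge (20 / ε)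
  have hkε : 20 ≤ k * ε := (div_le_iff₀ hε).1 hk
  have hk20 : (20 : ℝ) ≤ k := by nlinarith
  have hk0 : 0 < k := by
    have : (0 : ℝ) < k := by linarith
    exact_mod_cast this
  -- Then `k * η = 1/4` and `η ≤ ε / 80`: trading `n ^ (2 * η)` costs only `len ^ (1/2)`, and
  -- trading five powers of `len` costs only `n ^ (20 * η)`, at most `n ^ (ε / 4)`.
  obtain ⟨η, hη⟩ : ∃ η : ℝ, η = 1 / (4 * k) := ⟨_, rfl⟩
  have hkη : k * η = 1 / 4 := by rw [hη]; field_simp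
  have hη0 : 0 < η := by rw [hη]; positivity
  have hη1 : η ≤ 1 / 80 := by nlinarith
  have hηε : η ≤ ε / 80 := by nlinarith
  obtain ⟨p, cT, s₀, hcT, hp⟩ := h.exists_program (by linarith)
  set c := 100 * 2 ^ s₀ with hc
  have hc100 : 100 ≤ c := Nat.le_mul_of_pos_right _ (by positivity)
  set S : KSumInst 3 → ℕ := fun I => 6 * I.side * ((4 * c).size + I.len) with hS
  set T : KSumInst 3 → ℕ := fun I => ⌈cT * (S I : ℝ) ^ (4 - ε)⌉₊ with hT
  refine ⟨η, hη0, DecisionProblem.solvableInTime_of_dom (p := driver (pre k c) direct graphGen p)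
    (n := n) (L := len) (T := fun I => driverTime (pre k c) direct graphGen p (I.num k) (I.reps k)
      (I.bits c) (19 * I.n + 4 * I.reps k + 60)
      (if I.Large k then 4 * (I.n * I.n) + 4 * I.n + 8 else 2) (1152 * I.n + 20) (T I))
    (by linarith) (fun _ => rfl) ?_ fun I => ?_⟩
  · obtain ⟨C, hC⟩ := driverTime_le (pre k c) direct graphGen p
    have hb := dom_bits c hη0
    have hr := dom_reps hk0 hη0
    have hconst : ∀ {α β : ℝ} (m : ℕ), 0 ≤ α → 0 ≤ β → Dom n len α β fun _ : KSumInst 3 => m :=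
      fun m hα hβ => (Dom.const m).mono hn hL hα hβ
    have hn1 : Dom (n (k := 3)) len 1 η n := Dom.fst.mono hn hL le_rfl hη0.le
    have h0 : Dom n len (2 - η) (2 - η) fun I : KSumInst 3 =>
        (19 * I.n + 4 * I.reps k + 60) * I.bits c :=
      ((((hn1.smul 19).add ((hr.mono hn hL (by linarith) le_rfl).smul 4)).add
        (hconst 60 zero_le_one hη0.le)).mul hn hL hb).mono hn hL (by linarith) (by linarith)
    have h1 : Dom n len (2 - η) (2 - η) fun I : KSumInst 3 =>
        (if I.Large k then 4 * (I.n * I.n) + 4 * I.n + 8 else 2) * I.bits c := by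
      have hnn : Dom n len 2 0 fun I : KSumInst 3 => I.n * I.n :=
        (Dom.fst.mul hn hL Dom.fst).mono hn hL (by norm_num) (by norm_num)
      have h2 : Dom n len (2 - 2 * η + 2 * η) 0 fun I : KSumInst 3 =>
          4 * (I.n * I.n) + 4 * I.n + 8 :=
        (((hnn.smul 4).add ((Dom.fst.smul 4).mono hn hL (by norm_num) le_rfl)).add
          (hconst 8 (by norm_num) le_rfl)).mono hn hL (by linarith) le_rfl
      -- The exponents become `2 - 2 * η` and `1/2`; the length of the stored numbers adds `η` and
      -- `1 + η`.
      have h3 := h2.ite_le_pow hn hL (by linarith) k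
      have h4 := ((h3.add (hconst 2 (by linarith) (by nlinarith))).mul hn hL hb)
      refine (h4.mono hn hL (by linarith) (by nlinarith)).of_le fun I => Nat.mul_le_mul_right _ ?_
      by_cases hI : I.Large k
      · rw [if_pos hI, if_pos (I.le_len_pow_of_large hI)]
        omega
      · rw [if_neg hI]
        omega
    have h2 : Dom n len (2 - η) (2 - η) fun I : KSumInst 3 =>
        I.num k * (I.reps k + 1) * I.bits c * (1152 * I.n + 20 + T I + 1) := by
      have hSd : Dom n len (1 / 2) 1 S :=
        ((dom_side.smul 6).mul hn hL ((hconst _ le_rfl zero_le_one).add Dom.snd)).mono hn hL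
          (by norm_num) (by norm_num)
      have hTd : Dom n len (1 / 2 * (4 - ε)) (1 * (4 - ε)) T :=
        hSd.rpow hn hL (by norm_num) zero_le_one hcT (γ := 4 - ε) (by linarith)
      have h3 : Dom n len (2 - ε / 2) 4 fun I : KSumInst 3 => 1152 * I.n + 20 + T I + 1 :=
        ((((Dom.fst.smul 1152).mono hn hL (by linarith) (by norm_num)).add
          (hconst 20 (by linarith) (by norm_num))).add (hTd.mono hn hL (by linarith)
            (by linarith))).add (hconst 1 (by linarith) (by norm_num))
      have h4 : Dom n len η η fun I : KSumInst 3 => I.reps k + 1 :=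
        hr.add (hconst 1 hη0.le hη0.le)
      -- The exponent of `len` is rounded up to 6, of which `k * (20 * η) = 5` are traded for `n ^
      -- (20 * η)`; in total `n` has the exponent `2 - ε / 2 + 22 * η ≤ 2 - η`.
      have h5 := ((h4.mul hn hL hb).mul hn hL h3).mono hn hL (α' := 2 - ε / 2 + 2 * η)
        (β' := 1 + k * (20 * η)) (by linarith) (by nlinarith)
      refine ((h5.ite_pow_lt hn hL (by linarith)).mono hn hL (by linarith) (by linarith)).of_le
        fun I => ?_
      by_cases hI : I.Large k
      · simp [num, hI]
      · rw [if_pos (I.len_pow_lt_of_not_large hI), num, if_neg hI, one_mul]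
    have h3 : Dom (n (k := 3)) len (2 - η) (2 - η) (bits c) :=
      hb.mono hn hL (by linarith) (by linarith)
    refine (((h0.add h1).add h2).add h3).smul C |>.of_le fun I => ?_
    exact hC _ _ _ _ _ _ _ (Nat.size_pos.2 (by have := I.big_bounds (c := c); omega))
  · have hsz := I.graph_size hc100
    refine I.decidesWithin_driver hk0 hc100 (hp _ _ ?_ hsz.2)
    refine le_trans ?_ hsz.1
    refine (Nat.lt_size.2 ?_).le
    unfold unit
    exact (Nat.le_mul_of_pos_left _ (by norm_num)).trans
      (Nat.le_mul_of_pos_right c I.one_le_maxAbs)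

end KSumInst

/-! ### The cycle of implications -/

theorem DecisionProblem.SolvableInTime.mono {P : DecisionProblem} {γ γ' : ℝ} (hγ : γ ≤ γ')
    (h : P.SolvableInTime fun n => (n : ℝ) ^ γ) : P.SolvableInTime fun n => (n : ℝ) ^ γ' := by
  obtain ⟨p, T, err, hT, h⟩ := h
  refine ⟨p, T, err, hT.trans ?_, h⟩
  refine IsBigO.of_bound 1 ?_
  filter_upwards [eventually_ge_atTop 1] with s hs
  rw [one_mul, Real.norm_of_nonneg (by positivity), Real.norm_of_nonneg (by positivity)]
  exact Real.rpow_le_rpow_of_exponent_le (by exact_mod_cast hs) hγ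

theorem mainTheorem5 :
    [∃ ε : ℝ, 0 < ε ∧ (kSum 3).SolvableInTime (fun n => (n : ℝ) ^ (2 - ε)),
     ∃ ε : ℝ, 0 < ε ∧ (exactWeight (kStar 3)).SolvableInTime (fun n => (n : ℝ) ^ (3 - ε)),
     ∃ ε : ℝ, 0 < ε ∧
       (exactWeight (kMatching 3)).SolvableInTime (fun n => (n : ℝ) ^ (4 - ε))].TFAE := by
  tfae_have 1 → 2 := by
    rintro ⟨ε, hε, h⟩
    have hm : 0 < min ε 1 := lt_min hε one_pos
    have h1 := min_le_right ε 1
    -- Capping `ε` at 1 keeps the exponent large enough for the reduction; half of it is given away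
    -- for the subpolynomial overhead.
    have h' := WeightedGraphInst.solvableInTime_star (β := 2 - min ε 1) (δ := min ε 1 / 2)
      (by linarith) (by linarith) (h.mono (by linarith [min_le_left ε 1]))
    exact ⟨min ε 1 / 2, by linarith, h'.mono (by linarith)⟩
  tfae_have 2 → 3 := by
    rintro ⟨ε, hε, h⟩
    have hm : 0 < min ε 1 := lt_min hε one_pos
    have h1 := min_le_right ε 1
    have h' := WeightedGraphInst.solvableInTime_matching (β := 3 - min ε 1) (δ := min ε 1 / 2)
      (by linarith) (by linarith) (h.mono (by linarith [min_le_left ε 1]))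
    exact ⟨min ε 1 / 2, by linarith, h'.mono (by linarith)⟩
  tfae_have 3 → 1 := by
    rintro ⟨ε, hε, h⟩
    exact KSumInst.solvableInTime (lt_min hε one_pos) (min_le_right ε 1)
      (h.mono (by linarith [min_le_left ε 1]))
  tfae_finish
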